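/- **Setting.** Let $\mathbb R^{2,3}$ be $\mathbb R^5$ with $\langle X,Y\rangle=-(X^0Y^4+X^4Y^0)-X^1Y^1+X^2Y^2+X^3Y^3$, let $h$ be its Gram matrix, and let $\mathcal E^{1,2}$ be the Einstein universe, i.e. the manifold of null rays $[V]$ of $\mathbb R^{2,3}$, identified with $S^1_-\times S^2_+\subset\mathbb R^{2,3}$ and equipped with the induced Lorentz metric $g_{\mathcal E}$. Let $G=\mathrm O^\uparrow_+(2,3)$ be the group of isometries of $\mathbb R^{2,3}$ preserving orientation and time-orientation, viewed as matrices $F=(F_0,\dots,F_4)$, with Lie algebra $\mathfrak o(2,3)$; for $[V]\in\mathcal E^{1,2}$ let $\mathfrak h_{[V]}$ be the Lie algebra of the stabilizer of $[V]$ and $\mathfrak h_{[V]}^\perp$ its polar with respect to the Killing form. Put $S^{2,2}=\{V:\langle V,V\rangle=1\}$. Let $X$ be a connected oriented surface and $f:X\to\mathcal E^{1,2}$ a smooth timelike immersion (the induced metric $g=f^*g_{\mathcal E}$ is Lorentzian). For a local map $F:U\subset X\to G$ with $[F_0]=f$ write $\phi=F^{-1}dF=(\phi^i_j)$. $F$ is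 a *second order frame field* if $\phi^3_0=0$, $\phi^1_0\wedge\phi^2_0>0$ and $\phi^3_1\wedge\phi^2_0+\phi^3_2\wedge\phi^1_0=0$. Such frame fields exist locally, $F_3$ does not depend on the choice, and $\mathcal N_f=F_3:X\to S^{2,2}$ is the *conformal Gauss map*; $\langle d\mathcal N_f,d\mathcal N_f\rangle=\varrho_f\,g$ for a function $\varrho_f$. The immersion $f$ is *quasi-umbilical* if $\varrho_f=0$ and $f\wedge d\mathcal N_f\ne0$ at every point. It is then *regular* if the leaf space $\Lambda$ of the distribution $\mathrm{Ker}\,d\mathcal N_f$ is Hausdorff in the quotient topology; $\pi:X\to\Lambda$ denotes the projection. Let $f$ be quasi-umbilical. Identify $T_xX$ with its image under $df$ modulo $\mathbb R f(x)$. The *canonical orientation* of $X$ is the one for which $(V,V_*)$ is positive for all nonzero $V\in\mathrm{Im}\,d\mathcal N_f$ and null $V_*$ with $g(V,V_*)=-1$; the *helicity* $\varepsilon_f=\pm1$ is the sign of $-g(d\mathcal N_f(V_*),V_*)$. With respect to the canonical orientation, a second order frame field is *adapted* if $\phi^3_1=\phi^3_2=\varepsilon_f(\phi^1_0+\phi^2_0)$,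 $\phi^3_4=0$, $\phi^0_0-2\phi^2_1=0$ and $(\phi^1_4+\phi^2_4)\wedge(\phi^1_0+\phi^2_0)=0$. An *infinitesimal deformation* of $f$ is a smooth, not identically zero $\mathfrak o(2,3)$-valued 1-form $\delta$ on $X$ that is closed and satisfies $\delta_x(v)\in\mathfrak h_{f(x)}^\perp$ for all $x\in X$, $v\in T_xX$; $f$ is *isothermic* if it has an infinitesimal deformation. **Theorem A.** Let $f:X\to\mathcal E^{1,2}$ be a quasi-umbilical timelike immersion. 1. The conformal Gauss map $\mathcal N_f:(X,g)\to S^{2,2}$ is harmonic. 2. If $f$ is regular, then $f$ is isothermic, and its infinitesimal deformations depend on one arbitrary function of one variable, in the following precise sense. The leaf space $\Lambda$ carries a smooth structure of a $1$-dimensional manifold for which $\pi$ is a submersion, there are nowhere vanishing smooth 1-forms on $\Lambda$, and the canonical orientation and the helicity of $f$ exist. For every nowhere vanishing smooth 1-form $\zeta$ on $\Lambda$ there is exactly one adapted frame field $F:X\to G$ with $\pi^*\zeta=\pm(\phi^1_0+\phi^2_0)$. If the sign is $+$ (as can be achieved by replacing $\zeta$ by $-\zeta$), then the infinitesimal deformations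 of $f$ are exactly the 1-forms $$\delta=F\,\big((\ell\circ\pi)\,\pi^*\zeta\,(M^1_4-M^2_4)\big)\,F^{-1},\qquad M^1_4=E^1_4-E^0_1,\quad M^2_4=E^2_4+E^0_2,$$ where $E^a_b$ is the elementary matrix with entry $1$ in row $a$ and column $b$ (indices $0,\dots,4$), with $\ell:\Lambda\to\mathbb R$ an arbitrary smooth function that is not identically zero; moreover $\ell$ is uniquely determined by $\delta$. -/

import Mathlib

open scoped Manifold ContDiff

/-! ## The scalar product of signature (2,3), the Einstein universe and its conformal group -/

namespace Einstein

/-- The vector space underlying `ℝ^{2,3}`, in coordinates `(X⁰, …, X⁴)` of the standard basis. -/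
abbrev R23 : Type := Fin 5 → ℝ

/-- Real `5 × 5` matrices; `F i j` is the entry in row `i` and column `j`. -/
abbrev Mat5 : Type := Matrix (Fin 5) (Fin 5) ℝ

/-- The scalar product `⟨X,Y⟩ = -(X⁰Y⁴ + X⁴Y⁰) - X¹Y¹ + X²Y² + X³Y³`. -/
def sp (X Y : R23) : ℝ :=
  -(X 0 * Y 4 + X 4 * Y 0) - X 1 * Y 1 + X 2 * Y 2 + X 3 * Y 3

/-- The Gram matrix `h = -(E⁰₄ + E⁴₀) - E¹₁ + E²₂ + E³₃` of the scalar product. -/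
def gram : Mat5 :=
  !![0, 0, 0, 0, -1;
     0, -1, 0, 0, 0;
     0, 0, 1, 0, 0;
     0, 0, 0, 1, 0;
     -1, 0, 0, 0, 0]

theorem sp_eq (X Y : R23) : sp X Y = X ⬝ᵥ gram.mulVec Y := by
  simp [sp, gram, Matrix.mulVec, dotProduct, Fin.sum_univ_five]
  ring

/-- The standard pseudo-orthogonal basis `P₀, …, P₄`. -/
noncomputable def P : Fin 5 → R23 :=
  ![![1 / √2, 0, 0, 0, 1 / √2],
    ![0, 1, 0, 0, 0],
    ![0, 0, 1, 0, 0],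
    ![0, 0, 0, 1, 0],
    ![-(1 / √2), 0, 0, 0, 1 / √2]]

/-- The Einstein universe `S¹₋ × S²₊`: the vectors `v = v₋ + v₊`, with `v₋` in the negative definite
plane spanned by `P₀, P₁` and `v₊` in the positive definite space spanned by `P₂, P₃, P₄`, such that
`⟨v₋,v₋⟩ = -1` and `⟨v₊,v₊⟩ = 1`. Each null ray of `ℝ^{2,3}` contains exactly one such vector. -/
def einstein : Set R23 :=
  {v | sp v (P 0) ^ 2 + sp v (P 1) ^ 2 = 1 ∧
    sp v (P 2) ^ 2 + sp v (P 3) ^ 2 + sp v (P 4) ^ 2 = 1}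

/-- The hyperquadric `S^{2,2}` of unit spacelike vectors. -/
def S22 : Set R23 := {v | sp v v = 1}

/-- `X ∧ Y` is a positive bivector: the span of `X, Y` is a negative definite plane and
`det (X, Y, P₂, P₃, P₄) > 0`. -/
def IsPositiveBivector (X Y : R23) : Prop :=
  (∀ a b : ℝ, (a ≠ 0 ∨ b ≠ 0) → sp (a • X + b • Y) (a • X + b • Y) < 0) ∧
    0 < (Matrix.of ![X, Y, P 2, P 3, P 4]).det

/-- `V ∧ W` is a future-directed isotropic bivector. -/
def IsFutureDirected (V W : R23) : Prop :=
  LinearIndependent ℝ ![V, W] ∧ sp V V = 0 ∧ sp W W = 0 ∧ sp V W = 0 ∧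
    ∀ X Y : R23, IsPositiveBivector X Y → 0 < sp X V * sp Y W - sp Y V * sp X W

/-- The `k`-th column vector `F_k` of a matrix. -/
def column (F : Mat5) (k : Fin 5) : R23 := fun i => F i k

/-- The group `O↑₊(2,3)` of isometries of `ℝ^{2,3}` that preserve orientation and
time-orientation. -/
def conformalGroup : Set Mat5 :=
  {F | F.det = 1 ∧ F.transpose * gram * F = gram ∧
    IsFutureDirected (column F 0) (column F 1 + column F 2)}

section LieAlgebra

attribute [local instance] LieRing.ofAssociativeRing LieAlgebra.ofAssociativeAlgebra

/-- The Lie algebra `𝔬(2,3)` of matrices `a` with `aᵗ h + h a = 0`, with the commutator. -/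
def o23 : LieSubalgebra ℝ Mat5 := skewAdjointMatricesLieSubalgebra gram

/-- The Lie algebra `𝔥_{[V]}` of the stabilizer of the ray `[V]`. -/
def isotropyAlgebra (V : R23) : Set o23 :=
  {a | ∃ c : ℝ, (a : Mat5).mulVec V = c • V}

/-- The polar `𝔥_{[V]}^⊥` of `𝔥_{[V]}` with respect to the Killing form of `𝔬(2,3)`. -/
def isotropyPolar (V : R23) : Set Mat5 :=
  {m | ∃ a : o23, (a : Mat5) = m ∧ ∀ b ∈ isotropyAlgebra V, killingForm ℝ o23 a b = 0}

end LieAlgebra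

/-- The element `M¹₄ - M²₄` of `𝔬(2,3)`, where `M¹₄ = E¹₄ - E⁰₁` and `M²₄ = E²₄ + E⁰₂`. -/
def M14subM24 : Mat5 :=
  (Matrix.single 1 4 1 - Matrix.single 0 1 1) - (Matrix.single 2 4 1 + Matrix.single 0 2 1)

/-! ## Calculus on manifolds -/

section Manifold

variable {n : ℕ} {M : Type*} [TopologicalSpace M] [ChartedSpace (EuclideanSpace ℝ (Fin n)) M]

/-- A scalar 1-form (not necessarily smooth). -/
abbrev OneForm (n : ℕ) (M : Type*) [TopologicalSpace M]
    [ChartedSpace (EuclideanSpace ℝ (Fin n)) M] :=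
  ∀ x : M, TangentSpace (𝓡 n) x →ₗ[ℝ] ℝ

/-- A matrix-valued 1-form (not necessarily smooth). -/
abbrev MatForm (n : ℕ) (M : Type*) [TopologicalSpace M]
    [ChartedSpace (EuclideanSpace ℝ (Fin n)) M] :=
  ∀ x : M, TangentSpace (𝓡 n) x →ₗ[ℝ] Mat5

/-- The `i`-th coordinate vector field of the chart `e`, at the point with coordinates `y`. -/
noncomputable def coordVec (e : OpenPartialHomeomorph M (EuclideanSpace ℝ (Fin n)))
    (y : EuclideanSpace ℝ (Fin n)) (i : Fin n) : TangentSpace (𝓡 n) (e.symm y) :=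
  mfderiv (𝓡 n) (𝓡 n) e.symm y (EuclideanSpace.single i (1 : ℝ))

/-- Partial derivative of a vector-valued function on `ℝⁿ`. -/
noncomputable def pd {W : Type*} [NormedAddCommGroup W] [NormedSpace ℝ W] (i : Fin n)
    (u : EuclideanSpace ℝ (Fin n) → W) (y : EuclideanSpace ℝ (Fin n)) : W :=
  fderiv ℝ u y (EuclideanSpace.single i (1 : ℝ))

/-- Smoothness of a scalar 1-form: its components in every chart are smooth. -/
def IsSmoothForm (β : OneForm n M) : Prop :=
  ∀ e ∈ IsManifold.maximalAtlas (𝓡 n) ∞ M, ∀ i : Fin n,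
    ContDiffOn ℝ ∞ (fun y => β (e.symm y) (coordVec e y i)) e.target

/-- Smoothness of a matrix-valued 1-form: the components of its entries in every chart are
smooth. -/
def IsSmoothMatForm (δ : MatForm n M) : Prop :=
  ∀ e ∈ IsManifold.maximalAtlas (𝓡 n) ∞ M, ∀ (i : Fin n) (a b : Fin 5),
    ContDiffOn ℝ ∞ (fun y => δ (e.symm y) (coordVec e y i) a b) e.target

/-- Closedness of a matrix-valued 1-form `δ = ∑ δ_i dy^i`: in every chart, the components
`∂_i δ_j - ∂_j δ_i` of the exterior derivative vanish. -/
def IsClosedMatForm (δ : MatForm n M) : Prop :=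
  ∀ e ∈ IsManifold.maximalAtlas (𝓡 n) ∞ M, ∀ y ∈ e.target, ∀ (i j : Fin n) (a b : Fin 5),
    pd i (fun z => δ (e.symm z) (coordVec e z j) a b) y
      = pd j (fun z => δ (e.symm z) (coordVec e z i) a b) y

/-- A choice of orientation of every tangent space of a surface. -/
abbrev TangentOrientation (X : Type*) [TopologicalSpace X]
    [ChartedSpace (EuclideanSpace ℝ (Fin 2)) X] :=
  ∀ x : X, Orientation ℝ (TangentSpace (𝓡 2) x) (Fin 2)

end Manifold

section Surface

variable {X : Type*} [TopologicalSpace X] [ChartedSpace (EuclideanSpace ℝ (Fin 2)) X]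

/-- The differential of an `ℝ^{2,3}`-valued map. -/
noncomputable def dVec (u : X → R23) (x : X) : TangentSpace (𝓡 2) x →L[ℝ] R23 :=
  mfderiv (𝓡 2) 𝓘(ℝ, R23) u x

/-- `(v, w)` is a positive basis of `T_x X`. -/
def IsPositivePair (o : TangentOrientation X) (x : X) (v w : TangentSpace (𝓡 2) x) : Prop :=
  ∃ b : Module.Basis (Fin 2) ℝ (TangentSpace (𝓡 2) x), b 0 = v ∧ b 1 = w ∧ b.orientation = o x

/-- `o` is an orientation of the surface `X`: around every point there is a chart all of whose
coordinate frames are positive. -/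
def IsOrientation (o : TangentOrientation X) : Prop :=
  ∀ x : X, ∃ e ∈ IsManifold.maximalAtlas (𝓡 2) ∞ X, x ∈ e.source ∧
    ∀ y ∈ e.target, IsPositivePair o (e.symm y) (coordVec e y 0) (coordVec e y 1)

/-! ## Timelike immersions, frame fields and the conformal Gauss map -/

/-- The induced metric `f^*(g_ℰ)`. -/
noncomputable def inducedMetric (f : X → R23) (x : X) (v w : TangentSpace (𝓡 2) x) : ℝ :=
  sp (dVec f x v) (dVec f x w)

/-- `f` is a timelike immersion into the Einstein universe: the induced metric has
signature `(1,1)` at every point. -/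
structure IsTimelikeImmersion (f : X → R23) : Prop where
  smooth : ContMDiff (𝓡 2) 𝓘(ℝ, R23) ∞ f
  mem : ∀ x, f x ∈ einstein
  immersion : ∀ x, Function.Injective (dVec f x)
  lorentzian : ∀ x, (∃ v, inducedMetric f x v v < 0) ∧ ∃ w, 0 < inducedMetric f x w w

/-- The pullback `φ = F⁻¹ dF` of the Maurer-Cartan form; `mc F x v i j` is `φ^i_j(v)`, so that
`dF_k = ∑_j φ^j_k F_j`. -/
noncomputable def mc (F : X → Mat5) (x : X) (v : TangentSpace (𝓡 2) x) : Mat5 :=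
  (F x)⁻¹ * Matrix.of fun i j => mfderiv (𝓡 2) 𝓘(ℝ, ℝ) (fun z => F z i j) x v

/-- The 1-form `φ^i_j`. -/
noncomputable def phi (F : X → Mat5) (i j : Fin 5) (x : X) (v : TangentSpace (𝓡 2) x) : ℝ :=
  mc F x v i j

/-- A conformal frame field along `f` on the open set `U`: a smooth map `F : U → O↑₊(2,3)` with
`[F₀] = f`. -/
structure IsConformalFrame (f : X → R23) (U : Set X) (F : X → Mat5) : Prop where
  isOpen : IsOpen U
  smooth : ∀ i j, ContMDiffOn (𝓡 2) 𝓘(ℝ, ℝ) ∞ (fun x => F x i j) U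
  mem : ∀ x ∈ U, F x ∈ conformalGroup
  lift : ∀ x ∈ U, ∃ c : ℝ, 0 < c ∧ column (F x) 0 = c • f x

/-- A first order frame field: `φ³₀ = 0` and `φ¹₀ ∧ φ²₀ > 0`. -/
structure IsFirstOrderFrame (o : TangentOrientation X) (f : X → R23) (U : Set X) (F : X → Mat5) :
    Prop extends IsConformalFrame f U F where
  phi30 : ∀ x ∈ U, ∀ v, phi F 3 0 x v = 0
  positive : ∀ x ∈ U, ∀ v w, IsPositivePair o x v w →
    0 < phi F 1 0 x v * phi F 2 0 x w - phi F 1 0 x w * phi F 2 0 x v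

/-- A second order frame field: `φ³₁ ∧ φ²₀ + φ³₂ ∧ φ¹₀ = 0`. -/
structure IsSecondOrderFrame (o : TangentOrientation X) (f : X → R23) (U : Set X) (F : X → Mat5) :
    Prop extends IsFirstOrderFrame o f U F where
  second : ∀ x ∈ U, ∀ v w,
    (phi F 3 1 x v * phi F 2 0 x w - phi F 3 1 x w * phi F 2 0 x v)
      + (phi F 3 2 x v * phi F 1 0 x w - phi F 3 2 x w * phi F 1 0 x v) = 0

/-- The conformal Gauss map `𝒩_f`: its value at `x` is the vector `F₃(x)` of a second order frame
field `F` along `f` near `x` (this vector does not depend on the choice of `F`). -/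
noncomputable def conformalGaussMap (o : TangentOrientation X) (f : X → R23) (x : X) : R23 :=
  Classical.epsilon fun N : R23 =>
    ∃ (U : Set X) (F : X → Mat5), x ∈ U ∧ IsSecondOrderFrame o f U F ∧ N = column (F x) 3

/-- `f` is quasi-umbilical: at every point `x`, the quadratic form `⟨d𝒩_f, d𝒩_f⟩ = ϱ_f f^*(g_ℰ)`
vanishes, that is `ϱ_f(x) = 0`, and `f(x) ∧ d𝒩_f|_x ≠ 0`. -/
def IsQuasiUmbilical (o : TangentOrientation X) (f : X → R23) : Prop :=
  ∀ x, (∀ v w, sp (dVec (conformalGaussMap o f) x v) (dVec (conformalGaussMap o f) x w) = 0) ∧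
    ∃ v, LinearIndependent ℝ ![f x, dVec (conformalGaussMap o f) x v]

/-! ## Harmonic maps into `S^{2,2}` -/

/-- The Gram matrix of the metric induced by `f`, in the chart `e`. -/
noncomputable def metricMatrix (f : X → R23)
    (e : OpenPartialHomeomorph X (EuclideanSpace ℝ (Fin 2))) (y : EuclideanSpace ℝ (Fin 2)) :
    Matrix (Fin 2) (Fin 2) ℝ :=
  Matrix.of fun i j => inducedMetric f (e.symm y) (coordVec e y i) (coordVec e y j)

/-- The Christoffel symbols `Γ^k_{ij}` of the Levi-Civita connection of the metric induced by
`f`, in the chart `e`. -/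
noncomputable def christoffel (f : X → R23)
    (e : OpenPartialHomeomorph X (EuclideanSpace ℝ (Fin 2))) (k i j : Fin 2)
    (y : EuclideanSpace ℝ (Fin 2)) : ℝ :=
  (1 / 2) * ∑ l, (metricMatrix f e y)⁻¹ k l *
    (pd i (fun z => metricMatrix f e z j l) y + pd j (fun z => metricMatrix f e z i l) y
      - pd l (fun z => metricMatrix f e z i j) y)

/-- The orthogonal projection of `w` onto the tangent space of `S^{2,2}` at the point `p`. The
Levi-Civita connection of `S^{2,2}` is this projection of the derivative of `ℝ^{2,3}`. -/
noncomputable def tangentProj (p w : R23) : R23 := w - sp w p • p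

/-- The component `(D dN)(∂_i, ∂_j)` of the second fundamental form of a map `N : X → S^{2,2}`,
in the chart `e`, where `D` is induced by the Levi-Civita connections of `X` (with the metric
induced by `f`) and of `S^{2,2}`. -/
noncomputable def secondDerivative (f N : X → R23)
    (e : OpenPartialHomeomorph X (EuclideanSpace ℝ (Fin 2))) (i j : Fin 2)
    (y : EuclideanSpace ℝ (Fin 2)) : R23 :=
  tangentProj (N (e.symm y)) (pd i (pd j (fun z => N (e.symm z))) y)
    - ∑ k, christoffel f e k i j y • pd k (fun z => N (e.symm z)) y

/-- The tension field `tr_g (D dN)` in the chart `e`. -/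
noncomputable def tension (f N : X → R23)
    (e : OpenPartialHomeomorph X (EuclideanSpace ℝ (Fin 2))) (y : EuclideanSpace ℝ (Fin 2)) :
    R23 :=
  ∑ i, ∑ j, (metricMatrix f e y)⁻¹ i j • secondDerivative f N e i j y

/-- `N` is a harmonic map from `X`, with the metric induced by `f`, to `S^{2,2}`. -/
structure IsHarmonicMap (f N : X → R23) : Prop where
  smooth : ContMDiff (𝓡 2) 𝓘(ℝ, R23) ∞ N
  mem : ∀ x, N x ∈ S22
  tension_eq_zero : ∀ e ∈ IsManifold.maximalAtlas (𝓡 2) ∞ X, ∀ y ∈ e.target,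
    tension f N e y = 0

/-! ## Infinitesimal deformations and isothermic immersions -/

/-- An infinitesimal deformation of `f`: a smooth nonzero 1-form with values in the bundle of the
polars `𝔥_{f(x)}^⊥` which is closed as an `𝔬(2,3)`-valued 1-form. -/
structure IsInfinitesimalDeformation (f : X → R23) (δ : MatForm 2 X) : Prop where
  smooth : IsSmoothMatForm δ
  ne_zero : δ ≠ 0
  polar : ∀ x v, δ x v ∈ isotropyPolar (f x)
  closed : IsClosedMatForm δ

/-- `f` is isothermic in the sense of symmetric `R`-spaces. -/
def IsIsothermic (f : X → R23) : Prop := ∃ δ : MatForm 2 X, IsInfinitesimalDeformation f δ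

/-! ## Canonical orientation, helicity and adapted frames -/

/-- `V ∈ T_x X` lies in the image of `d𝒩_f`, where `T_x X` is identified by `df` with a subspace
of `ℝ^{2,3} / ℝ f(x)`. -/
def InImage (o : TangentOrientation X) (f : X → R23) (x : X) (V : TangentSpace (𝓡 2) x) : Prop :=
  ∃ (w : TangentSpace (𝓡 2) x) (c : ℝ),
    dVec (conformalGaussMap o f) x w = dVec f x V + c • f x

/-- `V` is a nonzero element of `Im d𝒩_f|_x` and `V'` is a null vector with `g(V,V') = -1`. -/
def IsNullPair (o : TangentOrientation X) (f : X → R23) (x : X)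
    (V V' : TangentSpace (𝓡 2) x) : Prop :=
  V ≠ 0 ∧ InImage o f x V ∧ inducedMetric f x V' V' = 0 ∧ inducedMetric f x V V' = -1

/-- `o` is the canonical orientation induced by the quasi-umbilical immersion `f`: `(V, V')` is
positive for all nonzero `V ∈ Im d𝒩_f|_x` and all null vectors `V'` with `g(V,V') = -1`. -/
def IsCanonicalOrientation (o : TangentOrientation X) (f : X → R23) : Prop :=
  IsOrientation o ∧ ∀ x V V', IsNullPair o f x V V' → IsPositivePair o x V V'

/-- `ε = ±1` is the helicity of `f`: the sign of `-g(d𝒩_f(V'), V')` for `V, V'` as above. -/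
def IsHelicity (o : TangentOrientation X) (f : X → R23) (ε : ℝ) : Prop :=
  (ε = 1 ∨ ε = -1) ∧ ∀ x V V', IsNullPair o f x V V' →
    0 < ε * -(sp (dVec (conformalGaussMap o f) x V') (dVec f x V'))

/-- An adapted frame field along a quasi-umbilical immersion with helicity `ε`: a second order
frame field such that `h = ε`, where `φ³₁ = φ³₂ = h (φ¹₀ + φ²₀)`, such that
`φ³₄ = φ⁰₀ - 2φ²₁ = 0`, and such that `(φ¹₄ + φ²₄) ∧ (φ¹₀ + φ²₀) = 0`. -/
structure IsAdaptedFrame (o : TangentOrientation X) (f : X → R23) (ε : ℝ) (U : Set X)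
    (F : X → Mat5) : Prop extends IsSecondOrderFrame o f U F where
  phi31 : ∀ x ∈ U, ∀ v, phi F 3 1 x v = ε * (phi F 1 0 x v + phi F 2 0 x v)
  phi32 : ∀ x ∈ U, ∀ v, phi F 3 2 x v = ε * (phi F 1 0 x v + phi F 2 0 x v)
  phi34 : ∀ x ∈ U, ∀ v, phi F 3 4 x v = 0
  phi00 : ∀ x ∈ U, ∀ v, phi F 0 0 x v - 2 * phi F 2 1 x v = 0
  wedge : ∀ x ∈ U, ∀ v w,
    (phi F 1 4 x v + phi F 2 4 x v) * (phi F 1 0 x w + phi F 2 0 x w)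
      - (phi F 1 4 x w + phi F 2 4 x w) * (phi F 1 0 x v + phi F 2 0 x v) = 0

/-! ## The leaf space of the distribution `Ker d𝒩_f` -/

/-- `x` and `y` are joined by a smooth curve tangent to `Ker d𝒩_f`. -/
def JoinedVertically (o : TangentOrientation X) (f : X → R23) (x y : X) : Prop :=
  ∃ γ : ℝ → X, ContMDiff 𝓘(ℝ, ℝ) (𝓡 2) ∞ γ ∧ γ 0 = x ∧ γ 1 = y ∧
    ∀ t : ℝ, dVec (conformalGaussMap o f) (γ t) (mfderiv 𝓘(ℝ, ℝ) (𝓡 2) γ t (1 : ℝ)) = 0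

/-- Two points are equivalent if they lie on the same leaf. -/
def leafSetoid (o : TangentOrientation X) (f : X → R23) : Setoid X :=
  Relation.EqvGen.setoid (JoinedVertically o f)

/-- The leaf space `Λ`, with the quotient topology. -/
abbrev LeafSpace (o : TangentOrientation X) (f : X → R23) := Quotient (leafSetoid o f)

/-- The natural projection `π : X → Λ`. -/
def leafProj (o : TangentOrientation X) (f : X → R23) : X → LeafSpace o f :=
  Quotient.mk (leafSetoid o f)

/-- A quasi-umbilical immersion is regular if its leaf space is Hausdorff. -/
def IsRegularImmersion (o : TangentOrientation X) (f : X → R23) : Prop := T2Space (LeafSpace o f)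

/-- `p` is a smooth submersion of the surface `X` onto a curve. -/
structure IsSmoothSubmersion {L : Type*} [TopologicalSpace L]
    [ChartedSpace (EuclideanSpace ℝ (Fin 1)) L] (p : X → L) : Prop where
  smooth : ContMDiff (𝓡 2) (𝓡 1) ∞ p
  surjective : Function.Surjective p
  submersion : ∀ x, Function.Surjective (mfderiv (𝓡 2) (𝓡 1) p x)

/-- The pullback `p^* ζ` of a 1-form. -/
noncomputable def pullback {L : Type*} [TopologicalSpace L]
    [ChartedSpace (EuclideanSpace ℝ (Fin 1)) L] (p : X → L) (ζ : OneForm 1 L) (x : X)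
    (v : TangentSpace (𝓡 2) x) : ℝ :=
  ζ (p x) (mfderiv (𝓡 2) (𝓡 1) p x v)

/-- `ζ` is a nowhere vanishing smooth 1-form on a curve. -/
def IsNowhereZeroForm {L : Type*} [TopologicalSpace L]
    [ChartedSpace (EuclideanSpace ℝ (Fin 1)) L] (ζ : OneForm 1 L) : Prop :=
  IsSmoothForm ζ ∧ ∀ q, ζ q ≠ 0

end Surface

end Einstein

open Einstein

/-!
# Quasi-umbilical timelike surfaces in the Einstein universe

**The Gauss map.** In a positive chart, the vector `F₃` of a second order frame field is the unit
normal of the hyperplane spanned by `f`, its first derivatives and its Laplacian, with the sign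
fixed by a determinant (`IsFirstOrderFrame.second_iff`, `IsGaussVector`). Hence it depends on `f`
alone, and it is smooth because Gram-Schmidt orthogonalization produces smooth frames
(`exists_secondOrderFrame`).

**Quasi-umbilicity.** If `⟨d𝒩, d𝒩⟩ = 0`, differentiation makes `⟨∂ᵢ∂ⱼ𝒩, ∂ₖ𝒩⟩` symmetric in `i, j`
and skew in `j, k`, so it vanishes. Together with `f ∧ d𝒩 ≠ 0` this leads to `d𝒩 = ω n` with a
nowhere vanishing 1-form `ω` and a null vector `n` tangent to the surface modulo `f`; the second
fundamental form in the direction of `𝒩` is a nonzero multiple `l ω²`, and the kernel of `ω` is a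
null direction (`exists_isGaussDirection`). Harmonicity (`tension_conformalGaussMap`) follows: `d𝒩`
is a null covector times a vector, and the derivative of its nullity determines the trace of its
Hessian (`hessian_trace`).

**Orientation and helicity.** The sign of `l` and the orientation of the null pairs `(V, V')` are
locally constant, hence constant on the connected surface (`exists_canonicalOrientation`).

**The leaf space.** Since `𝒩` has rank one, around every point some component of `𝒩` is a coordinate
of a chart onto a ball in which the leaves are the level lines of this coordinate (`exists_flowBox`).
The projection to the leaf space is open, these coordinates are its charts, and functions which are
constant along the leaves descend to smooth functions (`exists_isLeafProjection`,
`IsLeafProjection`). The vector `n` is parallel to itself along the leaves, so after normalization to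
the Euclidean unit sphere it descends too, and its pairing with `d𝒩` is a nowhere vanishing 1-form
(`exists_isNowhereZeroForm`).

**Adapted frames.** Given `ζ` on the leaf space, put `θ = ± p^*ζ` and differentiate along the leaf
space: `d𝒩 = ε θ W`, `dW = θ A`, `dA = θ B`, the sign being chosen so that `f ∧ W` is
future-directed (`IsGaussJet`). The conditions for an adapted frame with `φ¹₀ + φ²₀ = θ` amount to
`F₃ = 𝒩`, `F₁ - F₂ = W`, `⟨A, F₀⟩ = 1` and a formula for `F₄` in terms of `A`, `B` and `F₀`; the
remaining vector `F₁ + F₂` is then determined by orthogonality. This gives existence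
(`IsGaussJet.exists_isAdaptedFrame`) and uniqueness (`IsGaussJet.column_eq`) at the same time.

**Deformations.** The Killing form of `𝔬(2,3)` is a multiple of the trace form, and the polar of the
isotropy algebra of `[F₀]` consists of the bivectors `F₀ ∧ Y` with `Y` orthogonal to `F₀`
(`exists_eq_wedgeMat_of_mem_isotropyPolar`). If `δ = F₀ ∧ Y` is closed, evaluating `dδ = 0` on `F₀`,
`F₃` and `F₁ - F₂` forces `δ = r θ F₀ ∧ (F₁ - F₂)`
(`IsAdaptedChart.exists_eq_smul_wedgeMat`). Since `d(θ F₀ ∧ (F₁ - F₂)) = 0`, such a form is closed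
exactly when `dr ∧ θ = 0` (`IsAdaptedChart.pd_smul_wedgeMat`), which means that `r` descends to a
function `ℓ` on the leaf space. Finally, `F₀ ∧ (F₁ - F₂) = F (M¹₄ - M²₄) F⁻¹`
(`isometry_mul_M14subM24_mul_inv`).
-/

namespace Einstein

/-! ### Linear algebra of the scalar product -/

theorem sp_comm (X Y : R23) : sp X Y = sp Y X := by simp only [sp]; ring

@[simp] theorem sp_add_left (X Y Z : R23) : sp (X + Y) Z = sp X Z + sp Y Z := by
  simp only [sp, Pi.add_apply]; ring

@[simp] theorem sp_add_right (X Y Z : R23) : sp X (Y + Z) = sp X Y + sp X Z := by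
  simp only [sp, Pi.add_apply]; ring

@[simp] theorem sp_sub_left (X Y Z : R23) : sp (X - Y) Z = sp X Z - sp Y Z := by
  simp only [sp, Pi.sub_apply]; ring

@[simp] theorem sp_sub_right (X Y Z : R23) : sp X (Y - Z) = sp X Y - sp X Z := by
  simp only [sp, Pi.sub_apply]; ring

@[simp] theorem sp_neg_left (X Z : R23) : sp (-X) Z = -sp X Z := by
  simp only [sp, Pi.neg_apply]; ring

@[simp] theorem sp_neg_right (X Z : R23) : sp X (-Z) = -sp X Z := by
  simp only [sp, Pi.neg_apply]; ring

@[simp] theorem sp_smul_left (c : ℝ) (X Z : R23) : sp (c • X) Z = c * sp X Z := by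
  simp only [sp, Pi.smul_apply, smul_eq_mul]; ring

@[simp] theorem sp_smul_right (c : ℝ) (X Z : R23) : sp X (c • Z) = c * sp X Z := by
  simp only [sp, Pi.smul_apply, smul_eq_mul]; ring

@[simp] theorem sp_zero_left (Z : R23) : sp 0 Z = 0 := by simp [sp]

@[simp] theorem sp_zero_right (Z : R23) : sp Z 0 = 0 := by simp [sp]

/-- The determinant of the projections of two vectors to the negative definite plane spanned by
`P₀, P₁`, in the coordinates `(V⁰ + V⁴, V¹)` of that plane. On isotropic planes it is nonzero, and
its sign is the time-orientation. -/
def negDet (V W : R23) : ℝ := (V 0 + V 4) * W 1 - V 1 * (W 0 + W 4)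

@[simp] theorem negDet_add_right (X Y Z : R23) : negDet X (Y + Z) = negDet X Y + negDet X Z := by
  simp only [negDet, Pi.add_apply]; ring

@[simp] theorem negDet_sub_right (X Y Z : R23) : negDet X (Y - Z) = negDet X Y - negDet X Z := by
  simp only [negDet, Pi.sub_apply]; ring

@[simp] theorem negDet_smul_right (c : ℝ) (X Z : R23) : negDet X (c • Z) = c * negDet X Z := by
  simp only [negDet, Pi.smul_apply, smul_eq_mul]; ring

@[simp] theorem negDet_smul_left (c : ℝ) (X Z : R23) : negDet (c • X) Z = c * negDet X Z := by
  simp only [negDet, Pi.smul_apply, smul_eq_mul]; ring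

@[simp] theorem negDet_self (X : R23) : negDet X X = 0 := by simp only [negDet]; ring

/-- A vector whose projection to the plane spanned by `P₀, P₁` vanishes is spacelike or zero. -/
theorem sp_self_nonneg {v : R23} (h0 : v 0 + v 4 = 0) (h1 : v 1 = 0) : 0 ≤ sp v v := by
  have h4 : v 4 = -v 0 := by linarith
  simp only [sp, h1, h4]
  nlinarith [sq_nonneg (v 0), sq_nonneg (v 2), sq_nonneg (v 3)]

theorem eq_zero_of_sp_self_nonpos {v : R23} (h0 : v 0 + v 4 = 0) (h1 : v 1 = 0)
    (h : sp v v ≤ 0) : v = 0 := by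
  have h4 : v 4 = -v 0 := by linarith
  simp only [sp, h1, h4] at h
  have e0 : v 0 = 0 := by nlinarith [sq_nonneg (v 0), sq_nonneg (v 2), sq_nonneg (v 3)]
  have e2 : v 2 = 0 := by nlinarith [sq_nonneg (v 0), sq_nonneg (v 2), sq_nonneg (v 3)]
  have e3 : v 3 = 0 := by nlinarith [sq_nonneg (v 0), sq_nonneg (v 2), sq_nonneg (v 3)]
  ext i
  fin_cases i <;> simp_all

/-- If `V` is orthogonal to a nonzero null vector `u`, not spacelike, and has the same projection
to the plane spanned by `P₀, P₁` as a multiple of `u`, then it is that multiple. -/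
theorem exists_eq_smul_of_negDet_eq_zero {u v : R23} (hu : u ≠ 0) (huu : sp u u = 0)
    (huv : sp u v = 0) (hvv : sp v v ≤ 0) (h : negDet u v = 0) : ∃ c : ℝ, v = c • u := by
  have key : (u 0 + u 4) ^ 2 + u 1 ^ 2 ≠ 0 := by
    intro h0
    apply hu
    apply eq_zero_of_sp_self_nonpos _ _ huu.le
    · nlinarith [sq_nonneg (u 0 + u 4), sq_nonneg (u 1)]
    · nlinarith [sq_nonneg (u 0 + u 4), sq_nonneg (u 1)]
  set d := (u 0 + u 4) ^ 2 + u 1 ^ 2 with hd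
  set m := (u 0 + u 4) * (v 0 + v 4) + u 1 * v 1 with hm
  simp only [negDet] at h
  -- `d v - m u` has vanishing projection to the span of `P₀, P₁`, since the projections of `u` and
  -- `v` are proportional
  have hz : d • v - m • u = 0 := by
    apply eq_zero_of_sp_self_nonpos
    · simp only [Pi.sub_apply, Pi.smul_apply, smul_eq_mul, hd, hm]
      linear_combination (-u 1) * h
    · simp only [Pi.sub_apply, Pi.smul_apply, smul_eq_mul, hd, hm]
      linear_combination (u 0 + u 4) * h
    · simp only [sp_sub_left, sp_sub_right, sp_smul_left, sp_smul_right, sp_comm v u, huv, huu]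
      nlinarith [mul_nonneg (sq_nonneg d) (neg_nonneg.2 hvv)]
  refine ⟨m / d, ?_⟩
  have : d • v = m • u := sub_eq_zero.1 hz
  rw [div_eq_inv_mul, mul_smul, ← this, smul_smul, inv_mul_cancel₀ key, one_smul]

/-- By Cramer's rule, this combination of three vectors has vanishing projection to the plane
spanned by `P₀, P₁`, so it is spacelike or zero. -/
theorem sp_self_nonneg_of_three (A B C : R23) :
    0 ≤ sp (negDet A B • C + negDet B C • A + negDet C A • B)
      (negDet A B • C + negDet B C • A + negDet C A • B) := by
  apply sp_self_nonneg <;>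
  · simp only [negDet, Pi.add_apply, Pi.smul_apply, smul_eq_mul]
    ring

/-- No timelike vector is orthogonal to an isotropic plane. -/
theorem sp_self_nonneg_of_isotropic {V W R : R23} (hVV : sp V V = 0) (hWW : sp W W = 0)
    (hVW : sp V W = 0) (hR : sp R V = 0) (hR' : sp R W = 0) (h : negDet V W ≠ 0) :
    0 ≤ sp R R := by
  have h3 := sp_self_nonneg_of_three V W R
  simp only [sp_add_left, sp_add_right, sp_smul_left, sp_smul_right, sp_comm W V, sp_comm V R,
    sp_comm W R, hVV, hWW, hVW, hR, hR'] at h3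
  have : 0 < negDet V W ^ 2 := by positivity
  nlinarith

/-- The orthogonal complement of a negative definite plane is positive definite. -/
theorem sp_self_pos_of_timelike {A B X : R23} (hA : sp A A < 0) (hB : sp B B < 0)
    (hAB : sp A B = 0) (hXA : sp X A = 0) (hXB : sp X B = 0) (hX : X ≠ 0) : 0 < sp X X := by
  -- the projections of `A` and `B` to the span of `P₀, P₁` are independent: otherwise the
  -- combination `d B - m A` would be timelike with vanishing projection
  have hn : negDet A B ≠ 0 := by
    intro h
    set d := (A 0 + A 4) ^ 2 + A 1 ^ 2 with hd
    set m := (A 0 + A 4) * (B 0 + B 4) + A 1 * B 1 with hm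
    simp only [negDet] at h
    have hd0 : d ≠ 0 := by
      intro h0
      have h1 : A 0 + A 4 = 0 := by nlinarith [sq_nonneg (A 0 + A 4), sq_nonneg (A 1)]
      have h2 : A 1 = 0 := by nlinarith [sq_nonneg (A 0 + A 4), sq_nonneg (A 1)]
      exact absurd (sp_self_nonneg h1 h2) (not_le.2 hA)
    have h1 : 0 ≤ sp (d • B - m • A) (d • B - m • A) := by
      apply sp_self_nonneg
      · simp only [Pi.sub_apply, Pi.smul_apply, smul_eq_mul, hd, hm]
        linear_combination (-A 1) * h
      · simp only [Pi.sub_apply, Pi.smul_apply, smul_eq_mul, hd, hm]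
        linear_combination (A 0 + A 4) * h
    simp only [sp_sub_left, sp_sub_right, sp_smul_left, sp_smul_right, sp_comm B A, hAB] at h1
    have : 0 < d ^ 2 := by positivity
    nlinarith [mul_nonneg (sq_nonneg m) (neg_nonneg.2 hA.le)]
  by_contra hneg
  push Not at hneg
  -- the combination of `A, B, X` with vanishing projection is spacelike, which forces it to vanish
  have h3 := sp_self_nonneg_of_three A B X
  have e : sp (negDet A B • X + negDet B X • A + negDet X A • B)
      (negDet A B • X + negDet B X • A + negDet X A • B)
      = negDet A B ^ 2 * sp X X + negDet B X ^ 2 * sp A A + negDet X A ^ 2 * sp B B := by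
    simp only [sp_add_left, sp_add_right, sp_smul_left, sp_smul_right, sp_comm B A,
      sp_comm A X, sp_comm B X, hAB, hXA, hXB]
    ring
  have h4 : negDet A B ^ 2 * sp X X ≤ 0 := mul_nonpos_of_nonneg_of_nonpos (sq_nonneg _) hneg
  have h5 : negDet B X ^ 2 * sp A A ≤ 0 := mul_nonpos_of_nonneg_of_nonpos (sq_nonneg _) hA.le
  have h6 : negDet X A ^ 2 * sp B B ≤ 0 := mul_nonpos_of_nonneg_of_nonpos (sq_nonneg _) hB.le
  have h7 : negDet B X = 0 := by
    have : negDet B X ^ 2 * sp A A = 0 := by linarith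
    simpa [hA.ne] using this
  have h8 : negDet X A = 0 := by
    have : negDet X A ^ 2 * sp B B = 0 := by linarith
    simpa [hB.ne] using this
  have h9 : negDet A B • X + negDet B X • A + negDet X A • B = 0 := by
    apply eq_zero_of_sp_self_nonpos
    · simp only [negDet, Pi.add_apply, Pi.smul_apply, smul_eq_mul]
      ring
    · simp only [negDet, Pi.add_apply, Pi.smul_apply, smul_eq_mul]
      ring
    · rw [e]; linarith
  rw [h7, h8] at h9
  simp [hn, hX] at h9

/-- The time-orientation determinant does not change sign on the cone of nonspacelike vectors
orthogonal to a null vector. -/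
theorem negDet_pos_iff {u v w : R23} (hu : u ≠ 0) (huu : sp u u = 0) (huv : sp u v = 0)
    (huw : sp u w = 0) (hvv : sp v v = 0) (hww : sp w w = 0) (hvw : sp v w < 0) :
    0 < negDet u v ↔ 0 < negDet u w := by
  have key : ∀ {v w : R23}, sp u v = 0 → sp u w = 0 → sp v v = 0 → sp w w = 0 → sp v w < 0 →
      0 < negDet u v → 0 < negDet u w := by
    intro v w huv huw hvv hww hvw hpos
    by_contra hneg
    push Not at hneg
    have hw : negDet u w ≠ 0 := by
      intro h
      obtain ⟨c, rfl⟩ := exists_eq_smul_of_negDet_eq_zero hu huu huw hww.le h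
      simp [sp_comm v u, huv] at hvw
    have hw' : negDet u w < 0 := lt_of_le_of_ne hneg hw
    -- a timelike combination of `v` and `w` with `negDet u _ = 0` would be a multiple of `u`
    have h0 : negDet u ((-negDet u w) • v + negDet u v • w) = 0 := by
      simp only [negDet_add_right, negDet_smul_right]; ring
    have hs : sp ((-negDet u w) • v + negDet u v • w) ((-negDet u w) • v + negDet u v • w) < 0 := by
      simp only [sp_add_left, sp_add_right, sp_smul_left, sp_smul_right, hvv, hww, sp_comm w v]
      have : 0 < -negDet u w * negDet u v := mul_pos (by linarith) hpos
      nlinarith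
    obtain ⟨c, hc⟩ := exists_eq_smul_of_negDet_eq_zero hu huu (by simp [huv, huw]) hs.le h0
    rw [hc] at hs
    simp [huu] at hs
  exact ⟨key huv huw hvv hww hvw, key huw huv hww hvv (by rwa [sp_comm])⟩

theorem det_P (X Y : R23) :
    (Matrix.of ![X, Y, P 2, P 3, P 4]).det = (1 / √2) * negDet X Y := by
  simp [Matrix.det_succ_row_zero, Fin.sum_univ_succ, P, negDet, Fin.succAbove, Fin.ext_iff]
  ring

/-- An isotropic plane is future-directed if its projection to the plane spanned by `P₀, P₁` is
orientation preserving. The condition tests all positive bivectors `X ∧ Y`: such a bivector is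
deformed, through negative definite planes, into its projection to the span of `P₀, P₁`, and the
determinant of its pairing with `V ∧ W` cannot vanish on the way because no timelike vector is
orthogonal to `V` and `W`. -/
theorem isFutureDirected_of_negDet_pos {V W : R23} (hVV : sp V V = 0) (hWW : sp W W = 0)
    (hVW : sp V W = 0) (h : 0 < negDet V W) : IsFutureDirected V W := by
  refine ⟨?_, hVV, hWW, hVW, ?_⟩
  · rw [LinearIndependent.pair_iff]
    intro a b hab
    have h1 : negDet V (a • V + b • W) = 0 := by rw [hab]; simp [negDet]
    have h2 : negDet (a • V + b • W) W = 0 := by rw [hab]; simp [negDet]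
    have e1 : b * negDet V W = 0 := by rw [← h1]; simp [negDet]; ring
    have e2 : a * negDet V W = 0 := by rw [← h2]; simp [negDet]; ring
    exact ⟨by simpa [h.ne'] using e2, by simpa [h.ne'] using e1⟩
  · rintro X Y ⟨hneg, hpos⟩
    rw [det_P] at hpos
    have hXY : 0 < negDet X Y := by
      have : (0 : ℝ) < 1 / √2 := by positivity
      exact (mul_pos_iff_of_pos_left this).1 hpos
    -- `c t` shrinks the components along `P₂, P₃, P₄` by `t`, so the plane stays negative definite;
    -- `D t` is the pairing of the shrunk plane with `V ∧ W`
    let c : ℝ → R23 → R23 := fun t X => ![(X 0 + X 4) / 2 + t * ((X 0 - X 4) / 2), X 1, t * X 2,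
      t * X 3, (X 0 + X 4) / 2 - t * ((X 0 - X 4) / 2)]
    let D : ℝ → ℝ := fun t => sp (c t X) V * sp (c t Y) W - sp (c t Y) V * sp (c t X) W
    have hD0 : 0 < D 0 := by
      have : D 0 = 1 / 2 * (negDet X Y * negDet V W) := by
        simp [D, c, sp, negDet]; ring
      rw [this]; positivity
    have hcont : Continuous D := by
      simp only [D, c, sp, Matrix.cons_val]
      fun_prop
    have hne : ∀ t ∈ Set.Icc (0 : ℝ) 1, D t ≠ 0 := by
      intro t ht hDt
      have hlin : ∀ a b : ℝ, a • c t X + b • c t Y = c t (a • X + b • Y) := by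
        intro a b
        ext i
        fin_cases i <;> simp [c] <;> ring
      have hct : ∀ Z : R23, sp (c t Z) (c t Z) ≤ sp Z Z := by
        intro Z
        have e : sp (c t Z) (c t Z) = sp Z Z - (1 - t ^ 2) * ((Z 0 - Z 4) ^ 2 / 2 + Z 2 ^ 2
            + Z 3 ^ 2) := by
          simp [c, sp]; ring
        have : 0 ≤ 1 - t ^ 2 := by nlinarith [ht.1, ht.2]
        have : 0 ≤ (1 - t ^ 2) * ((Z 0 - Z 4) ^ 2 / 2 + Z 2 ^ 2 + Z 3 ^ 2) := by positivity
        linarith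
      obtain ⟨a, b, hab, h1, h2⟩ : ∃ a b : ℝ, (a ≠ 0 ∨ b ≠ 0) ∧
          sp (a • c t X + b • c t Y) V = 0 ∧ sp (a • c t X + b • c t Y) W = 0 := by
        simp only [D] at hDt
        by_cases h1 : sp (c t X) V = 0 ∧ sp (c t Y) V = 0
        · by_cases h2 : sp (c t X) W = 0
          · exact ⟨1, 0, by simp, by simp [h1.1], by simp [h2]⟩
          · refine ⟨sp (c t Y) W, -sp (c t X) W, by simp [h2], by simp [h1.1, h1.2], ?_⟩
            simp; ring
        · refine ⟨sp (c t Y) V, -sp (c t X) V, by simp only [neg_ne_zero]; tauto, ?_, ?_⟩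
          · simp; ring
          · simp; linarith
      have := sp_self_nonneg_of_isotropic hVV hWW hVW h1 h2 h.ne'
      rw [hlin] at this
      linarith [hct (a • X + b • Y), hneg a b hab]
    have hD1 : 0 < D 1 := by
      by_contra hle
      push Not at hle
      obtain ⟨t, ht, h0⟩ := intermediate_value_Icc' (zero_le_one' ℝ) hcont.continuousOn
        ⟨hle, hD0.le⟩
      exact hne t ht h0
    have hc1 : ∀ Z, c 1 Z = Z := by
      intro Z
      ext i
      fin_cases i <;> simp [c] <;> ring
    simpa only [D, hc1] using hD1

/-- The converse: `P₀ ∧ P₁` is a positive bivector, and its pairing with `V ∧ W` is a positive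
multiple of `negDet V W`. -/
theorem IsFutureDirected.negDet_pos {V W : R23} (h : IsFutureDirected V W) : 0 < negDet V W := by
  obtain ⟨-, -, -, -, h⟩ := h
  have hs : (0 : ℝ) < 1 / √2 := by positivity
  have hs2 : (1 / √2 : ℝ) * (1 / √2) = 1 / 2 := by
    rw [div_mul_div_comm, Real.mul_self_sqrt (by norm_num)]; norm_num
  have := h (P 0) (P 1) ⟨?_, ?_⟩
  · have e : sp (P 0) V * sp (P 1) W - sp (P 1) V * sp (P 0) W = (1 / √2) * negDet V W := by
      simp [sp, P, negDet]; ring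
    rw [e] at this
    exact (mul_pos_iff_of_pos_left hs).1 this
  · intro a b hab
    have e : sp (a • P 0 + b • P 1) (a • P 0 + b • P 1)
        = -(2 * ((1 / √2) * (1 / √2))) * a ^ 2 - b ^ 2 := by
      simp [sp, P]; ring
    rw [e, hs2]
    rcases hab with h | h
    · have := sq_pos_of_ne_zero h; nlinarith [sq_nonneg b]
    · have := sq_pos_of_ne_zero h; nlinarith [sq_nonneg a]
  · rw [det_P]
    have : negDet (P 0) (P 1) = 2 * (1 / √2) := by simp [negDet, P]; ring
    rw [this]
    positivity

/-! ### Frames of the group `O↑₊(2,3)` -/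

theorem gram_mul_gram : gram * gram = 1 := by
  ext i j
  fin_cases i <;> fin_cases j <;> simp [gram, Matrix.mul_apply, Fin.sum_univ_five]

theorem transpose_gram_mul_apply (F G : Mat5) (i j : Fin 5) :
    (F.transpose * gram * G) i j = sp (column F i) (column G j) := by
  rw [sp_eq, Matrix.mul_assoc]
  rfl

theorem gram_eq_transpose_mul_iff (F : Mat5) :
    F.transpose * gram * F = gram ↔ ∀ i j, sp (column F i) (column F j) = gram i j := by
  simp only [← transpose_gram_mul_apply]
  exact ⟨fun h i j => by rw [h], fun h => by ext i j; exact h i j⟩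

/-- The group `O↑₊(2,3)` in terms of the columns of its elements. By
`isFutureDirected_of_negDet_pos` the time-orientation is a single inequality. -/
theorem mem_conformalGroup_iff (F : Mat5) : F ∈ conformalGroup ↔
    F.det = 1 ∧ (∀ i j, sp (column F i) (column F j) = gram i j) ∧
      0 < negDet (column F 0) (column F 1 + column F 2) := by
  rw [← gram_eq_transpose_mul_iff]
  constructor
  · rintro ⟨h1, h2, h3⟩
    exact ⟨h1, h2, h3.negDet_pos⟩
  · rintro ⟨h1, h2, h3⟩
    refine ⟨h1, h2, isFutureDirected_of_negDet_pos ?_ ?_ ?_ h3⟩ <;>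
    · rw [gram_eq_transpose_mul_iff] at h2
      simp [h2, gram]

theorem isometry_inv {F : Mat5} (h : F.transpose * gram * F = gram) :
    F⁻¹ = gram * F.transpose * gram := by
  apply Matrix.inv_eq_left_inv
  rw [Matrix.mul_assoc, Matrix.mul_assoc, ← Matrix.mul_assoc F.transpose, h, gram_mul_gram]

theorem isometry_mul_inv {F : Mat5} (h : F.transpose * gram * F = gram) :
    F * (gram * F.transpose * gram) = 1 := by
  rw [mul_eq_one_comm, Matrix.mul_assoc, Matrix.mul_assoc, ← Matrix.mul_assoc F.transpose, h,
    gram_mul_gram]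

theorem gram_mulVec (v : R23) : gram.mulVec v = ![-v 4, -v 1, v 2, v 3, -v 0] := by
  ext i
  fin_cases i <;> simp [gram, Matrix.mulVec, dotProduct, Fin.sum_univ_five]

/-- The expansion of a vector in a pseudo-orthonormal frame. -/
theorem frame_expand {F : Mat5} (h : ∀ i j, sp (column F i) (column F j) = gram i j) (v : R23) :
    v = -sp (column F 4) v • column F 0 - sp (column F 1) v • column F 1
      + sp (column F 2) v • column F 2 + sp (column F 3) v • column F 3
      - sp (column F 0) v • column F 4 := by
  have h1 : v = F.mulVec (gram.mulVec (F.transpose.mulVec (gram.mulVec v))) := by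
    have h0 := isometry_mul_inv ((gram_eq_transpose_mul_iff F).2 h)
    rw [Matrix.mul_assoc gram] at h0
    rw [Matrix.mulVec_mulVec, Matrix.mulVec_mulVec, Matrix.mulVec_mulVec, Matrix.mul_assoc,
      Matrix.mul_assoc, h0, Matrix.one_mulVec]
  have h2 : ∀ i, (F.transpose.mulVec (gram.mulVec v)) i = sp (column F i) v := by
    intro i
    rw [sp_eq]
    rfl
  rw [gram_mulVec (F.transpose.mulVec (gram.mulVec v))] at h1
  simp only [h2] at h1
  conv_lhs => rw [h1]
  ext i
  simp only [Matrix.mulVec, dotProduct, Fin.sum_univ_five, column, Pi.add_apply, Pi.sub_apply,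
    Pi.smul_apply, smul_eq_mul, Matrix.cons_val]
  ring

theorem eq_zero_of_sp_basis {B : Mat5} (hB : B.det ≠ 0) {v : R23} (h : ∀ i, sp (B i) v = 0) :
    v = 0 := by
  have h1 : B.mulVec (gram.mulVec v) = 0 := by
    ext i
    have := h i
    rw [sp_eq] at this
    exact this
  have h2 := Matrix.eq_zero_of_mulVec_eq_zero hB h1
  have h3 : gram.mulVec (gram.mulVec v) = 0 := by rw [h2, Matrix.mulVec_zero]
  rwa [Matrix.mulVec_mulVec, gram_mul_gram, Matrix.one_mulVec] at h3

/-! ### The Killing form of `𝔬(2,3)` and the polars of the isotropy algebras -/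

/-- The skew endomorphism `X ↦ ⟨X,Y⟩ U - ⟨X,U⟩ Y` attached to the bivector `U ∧ Y`. -/
def wedgeMat (U Y : R23) : Mat5 :=
  Matrix.vecMulVec U (gram.mulVec Y) - Matrix.vecMulVec Y (gram.mulVec U)

theorem wedgeMat_mulVec (U Y X : R23) :
    (wedgeMat U Y).mulVec X = sp X Y • U - sp X U • Y := by
  rw [wedgeMat, Matrix.sub_mulVec, Matrix.vecMulVec_mulVec, Matrix.vecMulVec_mulVec, sp_eq, sp_eq,
    dotProduct_comm, dotProduct_comm (gram.mulVec U)]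
  simp

theorem wedgeMat_apply (U Y : R23) (i j : Fin 5) : wedgeMat U Y i j
    = U i * (![-Y 4, -Y 1, Y 2, Y 3, -Y 0] : R23) j
      - Y i * (![-U 4, -U 1, U 2, U 3, -U 0] : R23) j := by
  rw [wedgeMat, gram_mulVec, gram_mulVec]
  rfl

theorem mem_o23_iff (a : Mat5) : a ∈ o23 ↔ a.transpose * gram = gram * (-a) := by
  rw [o23, mem_skewAdjointMatricesLieSubalgebra, mem_skewAdjointMatricesSubmodule]
  rfl

theorem sp_mulVec_of_mem_o23 {a : Mat5} (ha : a ∈ o23) (X Y : R23) :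
    sp (a.mulVec X) Y = -sp X (a.mulVec Y) := by
  rw [mem_o23_iff] at ha
  rw [sp_eq, sp_eq, ← Matrix.vecMul_transpose, ← Matrix.dotProduct_mulVec, Matrix.mulVec_mulVec,
    Matrix.mulVec_mulVec, ha, Matrix.mul_neg, Matrix.neg_mulVec, dotProduct_neg]

theorem wedgeMat_mem_o23 (U Y : R23) : wedgeMat U Y ∈ o23 := by
  rw [mem_o23_iff]
  ext i j
  fin_cases i <;> fin_cases j <;>
    simp [wedgeMat_apply, gram, Matrix.mul_apply, Fin.sum_univ_five] <;>
    ring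

section Killing

attribute [local instance] LieRing.ofAssociativeRing LieAlgebra.ofAssociativeAlgebra

/-- The matrix in `𝔬(2,3)` whose product with the Gram matrix is skew-symmetric with the given
entries above the diagonal. -/
def skewOf (s : Fin 10 → ℝ) : Mat5 :=
  !![s 3, s 6, s 8, s 9, 0;
     s 0, 0, -s 4, -s 5, -s 6;
     -s 1, -s 4, 0, s 7, s 8;
     -s 2, -s 5, -s 7, 0, s 9;
     0, -s 0, -s 1, -s 2, -s 3]

theorem skewOf_mem (s : Fin 10 → ℝ) : skewOf s ∈ o23 := by
  rw [mem_o23_iff]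
  ext i j
  fin_cases i <;> fin_cases j <;> simp [skewOf, gram, Matrix.mul_apply, Fin.sum_univ_five]

/-- The coordinates on `𝔬(2,3)` inverse to `skewOf`. -/
def skewCoord (a : Mat5) : Fin 10 → ℝ :=
  ![a 1 0, -a 2 0, -a 3 0, a 0 0, -a 2 1, -a 3 1, a 0 1, a 2 3, a 0 2, a 0 3]

theorem skewOf_skewCoord {a : Mat5} (ha : a ∈ o23) : skewOf (skewCoord a) = a := by
  rw [mem_o23_iff] at ha
  ext i j
  have h := fun i j => congrFun (congrFun ha i) j
  simp only [gram, Matrix.mul_apply, Fin.sum_univ_five, Matrix.transpose_apply,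
    Matrix.neg_apply] at h
  have h00 := h 0 0
  have h01 := h 0 1
  have h02 := h 0 2
  have h03 := h 0 3
  have h04 := h 0 4
  have h11 := h 1 1
  have h12 := h 1 2
  have h13 := h 1 3
  have h14 := h 1 4
  have h22 := h 2 2
  have h23 := h 2 3
  have h24 := h 2 4
  have h33 := h 3 3
  have h34 := h 3 4
  have h44 := h 4 4
  simp at h00 h01 h02 h03 h04 h11 h12 h13 h14 h22 h23 h24 h33 h34 h44
  fin_cases i <;> fin_cases j <;> simp [skewOf, skewCoord] <;> linarith

/-- Linear coordinates on `𝔬(2,3)`. -/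
def skewEquiv : o23 ≃ₗ[ℝ] (Fin 10 → ℝ) where
  toFun a := skewCoord a
  map_add' a b := by
    ext i; fin_cases i <;> simp [skewCoord] <;> ring
  map_smul' c a := by
    ext i; fin_cases i <;> simp [skewCoord]
  invFun s := ⟨skewOf s, skewOf_mem s⟩
  left_inv a := Subtype.ext (skewOf_skewCoord a.2)
  right_inv s := by
    ext i; fin_cases i <;> simp [skewCoord, skewOf]

/-- The Killing form of `𝔬(2,3)` is three times the trace form, by evaluation of the trace in the
coordinates `skewEquiv`. -/
theorem killingForm_eq_trace (a b : o23) :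
    killingForm ℝ o23 a b = 3 * ((a : Mat5) * (b : Mat5)).trace := by
  rw [killingForm, LieModule.traceForm_apply_apply,
    LinearMap.trace_eq_matrix_trace ℝ (Module.Basis.ofEquivFun skewEquiv), Matrix.trace]
  have hd : ∀ k, Matrix.diag (LinearMap.toMatrix (Module.Basis.ofEquivFun skewEquiv)
      (Module.Basis.ofEquivFun skewEquiv)
      ((LieModule.toEnd ℝ o23 o23) a ∘ₗ (LieModule.toEnd ℝ o23 o23) b)) k
      = skewCoord ((a : Mat5) * ((b : Mat5) * skewOf (Pi.single k 1)
        - skewOf (Pi.single k 1) * (b : Mat5)) - ((b : Mat5) * skewOf (Pi.single k 1)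
        - skewOf (Pi.single k 1) * (b : Mat5)) * (a : Mat5)) k := by
    intro k
    rw [Matrix.diag_apply, LinearMap.toMatrix_apply, Module.Basis.coe_ofEquivFun]
    rfl
  rw [Finset.sum_congr rfl fun k _ => hd k, ← skewOf_skewCoord a.2, ← skewOf_skewCoord b.2]
  generalize skewCoord (a : Mat5) = s
  generalize skewCoord (b : Mat5) = t
  simp only [Fin.sum_univ_succ, Fin.sum_univ_zero, Matrix.trace, Matrix.diag_apply,
    Matrix.mul_apply]
  simp [skewOf, skewCoord]
  ring

theorem trace_wedgeMat_mul (U Y : R23) {b : Mat5} (hb : b ∈ o23) :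
    (wedgeMat U Y * b).trace = 2 * sp Y (b.mulVec U) := by
  have e : ∀ U Y : R23, (Matrix.vecMulVec U (gram.mulVec Y) * b).trace = sp Y (b.mulVec U) := by
    intro U Y
    rw [Matrix.trace_mul_comm, Matrix.mul_vecMulVec, Matrix.trace_vecMulVec, sp_comm, sp_eq]
  rw [wedgeMat, Matrix.sub_mul, Matrix.trace_sub, e, e, sp_comm U, sp_mulVec_of_mem_o23 hb]
  ring

/-- A bivector `V ∧ Y` with `Y` orthogonal to `V` pairs with `b ∈ 𝔬(2,3)` to a multiple of `⟨Y, b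
V⟩`, which vanishes if `b V` is a multiple of `V`. -/
theorem wedgeMat_mem_isotropyPolar {V Y : R23} (hVY : sp V Y = 0) :
    wedgeMat V Y ∈ isotropyPolar V := by
  refine ⟨⟨_, wedgeMat_mem_o23 V Y⟩, rfl, ?_⟩
  rintro b ⟨c, hc⟩
  rw [killingForm_eq_trace, trace_wedgeMat_mul V Y b.2, hc, sp_smul_right, sp_comm, hVY]
  ring

/-- The polar of the isotropy algebra of a null ray `[V]` consists of the bivectors `V ∧ Y` with
`Y` orthogonal to `V`. -/
theorem exists_eq_wedgeMat_of_mem_isotropyPolar {V : R23} (hV : V ≠ 0)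
    {m : Mat5} (hm : m ∈ isotropyPolar V) (hVV : sp V V = 0) :
    ∃ Y, sp V Y = 0 ∧ m = wedgeMat V Y := by
  obtain ⟨a, rfl, ha⟩ := hm
  have ha2 := a.2
  set m : Mat5 := (a : Mat5)
  -- the element `m` of the polar is tested against the bivectors `A ∧ B` which fix the ray `[V]`
  have key : ∀ A B : R23, (∃ c : ℝ, (wedgeMat A B).mulVec V = c • V) →
      sp B (m.mulVec A) = 0 := by
    intro A B hAB
    have := ha ⟨_, wedgeMat_mem_o23 A B⟩ hAB
    rw [killingForm_eq_trace, Matrix.trace_mul_comm, trace_wedgeMat_mul A B ha2] at this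
    linarith
  -- a vector dual to `V`, which will yield `Y = m V'`
  obtain ⟨V', hV'⟩ : ∃ V', sp V V' = -1 := by
    have h0 : V ⬝ᵥ V ≠ 0 := by rwa [Ne, dotProduct_self_eq_zero]
    refine ⟨-(V ⬝ᵥ V)⁻¹ • gram.mulVec V, ?_⟩
    rw [sp_smul_right, sp_eq, Matrix.mulVec_mulVec, gram_mul_gram, Matrix.one_mulVec]
    field_simp
  have nondeg : ∀ v : R23, (∀ X, sp X v = 0) → v = 0 := fun v hv =>
    eq_zero_of_sp_basis (B := 1) (by simp) (fun i => hv _)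
  -- bivectors of the form `V ∧ C`
  have hmV : m.mulVec V = 0 := by
    apply nondeg
    intro C
    apply key
    refine ⟨sp V C, ?_⟩
    rw [wedgeMat_mulVec, hVV]
    simp
  have hY : sp V (m.mulVec V') = 0 := by
    have := sp_mulVec_of_mem_o23 ha2 V V'
    rw [hmV, sp_zero_left] at this
    linarith
  have hself : sp V' (m.mulVec V') = 0 := by
    have := sp_mulVec_of_mem_o23 ha2 V' V'
    rw [sp_comm] at this
    linarith
  refine ⟨m.mulVec V', hY, ?_⟩
  -- bivectors `A ∧ B` of vectors orthogonal to `V` show that `m A` is a multiple of `V`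
  have hperp : ∀ A : R23, sp V A = 0 → m.mulVec A = sp A (m.mulVec V') • V := by
    intro A hA
    have hR : m.mulVec A + sp (m.mulVec A) V' • V = 0 := by
      apply nondeg
      intro X
      have e : X = (X + sp X V • V') - sp X V • V' := by abel
      have h1 : sp (X + sp X V • V') (m.mulVec A) = 0 := by
        apply key
        refine ⟨0, ?_⟩
        rw [wedgeMat_mulVec, hA]
        simp [sp_comm V X, hV']
      rw [e, sp_sub_left, sp_add_right, h1]
      simp only [sp_smul_left, sp_smul_right, sp_add_left, sp_add_right, sp_comm V' V, hV',
        sp_comm V' (m.mulVec A)]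
      ring
    rw [eq_neg_of_add_eq_zero_left hR, sp_mulVec_of_mem_o23 ha2]
    simp
  -- a vector splits into a multiple of `V'` and a vector orthogonal to `V`
  apply Matrix.ext_of_mulVec_single
  intro i
  generalize (Pi.single i 1 : R23) = X
  have e : X = (X + sp X V • V') - sp X V • V' := by abel
  have h1 := hperp (X + sp X V • V') (by simp [sp_comm V X, hV'])
  rw [wedgeMat_mulVec]
  conv_lhs => rw [e, Matrix.mulVec_sub, h1, Matrix.mulVec_smul]
  simp [hself]

end Killing

/-- Conjugation by an isometry acts on bivectors through its action on vectors. -/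
theorem isometry_mul_M14subM24_mul_inv {F : Mat5} (h : F.transpose * gram * F = gram) :
    F * M14subM24 * F⁻¹ = wedgeMat (column F 0) (column F 1 - column F 2) := by
  rw [isometry_inv h]
  have e : M14subM24 = wedgeMat (Pi.single 0 1) (Pi.single 1 1 - Pi.single 2 1) := by
    ext i j
    fin_cases i <;> fin_cases j <;>
      simp [M14subM24, wedgeMat_apply]
  have e2 : ∀ U Y : R23, F * wedgeMat U Y * (gram * F.transpose * gram)
      = wedgeMat (F.mulVec U) (F.mulVec Y) := by
    intro U Y
    have h1 : ∀ U Y : R23, F * Matrix.vecMulVec U (gram.mulVec Y) * (gram * F.transpose * gram)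
        = Matrix.vecMulVec (F.mulVec U) (gram.mulVec (F.mulVec Y)) := by
      intro U Y
      have hg : gram.transpose = gram := by
        ext i j; fin_cases i <;> fin_cases j <;> rfl
      rw [Matrix.mul_vecMulVec, Matrix.vecMulVec_mul, ← Matrix.mulVec_transpose]
      congr 1
      rw [Matrix.transpose_mul, Matrix.transpose_mul, Matrix.transpose_transpose, hg,
        Matrix.mulVec_mulVec, Matrix.mulVec_mulVec, Matrix.mul_assoc, Matrix.mul_assoc,
        gram_mul_gram, Matrix.mul_one]
    rw [wedgeMat, wedgeMat, Matrix.mul_sub, Matrix.sub_mul, h1, h1]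
  rw [e, e2, Matrix.mulVec_sub, Matrix.mulVec_single_one, Matrix.mulVec_single_one,
    Matrix.mulVec_single_one]
  rfl

/-! ### Calculus in charts -/

section Bilinear

/-- The scalar product as a continuous bilinear map. -/
noncomputable def spL : R23 →L[ℝ] R23 →L[ℝ] ℝ :=
  LinearMap.toContinuousLinearMap
    ((LinearMap.toContinuousLinearMap : (R23 →ₗ[ℝ] ℝ) ≃ₗ[ℝ] (R23 →L[ℝ] ℝ)).toLinearMap ∘ₗ
      LinearMap.mk₂ ℝ sp sp_add_left sp_smul_left sp_add_right sp_smul_right)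

theorem spL_apply (X Y : R23) : spL X Y = sp X Y := rfl

theorem contDiffOn_sp {E : Type*} [NormedAddCommGroup E] [NormedSpace ℝ E] {s : Set E}
    {u w : E → R23} (hu : ContDiffOn ℝ ∞ u s) (hw : ContDiffOn ℝ ∞ w s) :
    ContDiffOn ℝ ∞ (fun y => sp (u y) (w y)) s :=
  spL.isBoundedBilinearMap.contDiff.comp_contDiffOn (hu.prodMk hw)

theorem pd_sp {n : ℕ} {u w : EuclideanSpace ℝ (Fin n) → R23} {y : EuclideanSpace ℝ (Fin n)}
    (hu : DifferentiableAt ℝ u y) (hw : DifferentiableAt ℝ w y) (i : Fin n) :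
    pd i (fun z => sp (u z) (w z)) y = sp (pd i u y) (w y) + sp (u y) (pd i w y) := by
  have h := spL.hasFDerivAt_of_bilinear hu.hasFDerivAt hw.hasFDerivAt
  have e : (fun z => sp (u z) (w z)) = fun z => spL (u z) (w z) := rfl
  rw [pd, e, h.fderiv]
  simp [pd, spL_apply, add_comm]

theorem sp_pd_eq_neg {n : ℕ} {u w : EuclideanSpace ℝ (Fin n) → R23}
    {y : EuclideanSpace ℝ (Fin n)} (hu : DifferentiableAt ℝ u y) (hw : DifferentiableAt ℝ w y)
    {c : ℝ} (h : ∀ᶠ z in nhds y, sp (u z) (w z) = c) (i : Fin n) :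
    sp (pd i u y) (w y) = -sp (u y) (pd i w y) := by
  have h1 := pd_sp hu hw i
  have h2 : pd i (fun z => sp (u z) (w z)) y = 0 := by
    rw [pd, Filter.EventuallyEq.fderiv_eq (f := fun _ => c) h]
    simp
  linarith

theorem pd_smul {n : ℕ} {W : Type*} [NormedAddCommGroup W] [NormedSpace ℝ W]
    {c : EuclideanSpace ℝ (Fin n) → ℝ} {u : EuclideanSpace ℝ (Fin n) → W}
    {y : EuclideanSpace ℝ (Fin n)} (hc : DifferentiableAt ℝ c y) (hu : DifferentiableAt ℝ u y)
    (i : Fin n) : pd i (fun z => c z • u z) y = pd i c y • u y + c y • pd i u y := by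
  rw [pd, fderiv_fun_smul hc hu]
  simp [pd, add_comm]

theorem pd_congr {n : ℕ} {W : Type*} [NormedAddCommGroup W] [NormedSpace ℝ W]
    {u w : EuclideanSpace ℝ (Fin n) → W} {y : EuclideanSpace ℝ (Fin n)}
    (h : ∀ᶠ z in nhds y, u z = w z) (i : Fin n) : pd i u y = pd i w y := by
  rw [pd, pd, Filter.EventuallyEq.fderiv_eq h]

theorem pd_pi {n : ℕ} {ι : Type*} [Fintype ι] {u : EuclideanSpace ℝ (Fin n) → ι → ℝ}
    {y : EuclideanSpace ℝ (Fin n)} (hu : DifferentiableAt ℝ u y) (i : Fin n) (k : ι) :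
    pd i (fun z => u z k) y = pd i u y k := by
  rw [pd, pd]
  have := (hasFDerivAt_pi'.1 hu.hasFDerivAt k).fderiv
  rw [this]
  rfl

theorem contDiffOn_pd {n : ℕ} {W : Type*} [NormedAddCommGroup W] [NormedSpace ℝ W]
    {u : EuclideanSpace ℝ (Fin n) → W} {s : Set (EuclideanSpace ℝ (Fin n))} (hs : IsOpen s)
    (hu : ContDiffOn ℝ ∞ u s) (i : Fin n) : ContDiffOn ℝ ∞ (pd i u) s :=
  (hu.fderiv_of_isOpen hs (by simp)).clm_apply contDiffOn_const

theorem pd_comm {n : ℕ} {W : Type*} [NormedAddCommGroup W] [NormedSpace ℝ W]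
    {u : EuclideanSpace ℝ (Fin n) → W} {s : Set (EuclideanSpace ℝ (Fin n))} (hs : IsOpen s)
    (hu : ContDiffOn ℝ ∞ u s) {y : EuclideanSpace ℝ (Fin n)} (hy : y ∈ s) (i j : Fin n) :
    pd i (pd j u) y = pd j (pd i u) y := by
  have hd : DifferentiableAt ℝ (fderiv ℝ u) y :=
    ((hu.fderiv_of_isOpen (m := ∞) hs (by simp)).contDiffAt (hs.mem_nhds hy)).differentiableAt
      (by simp)
  have h := (hu.contDiffAt (hs.mem_nhds hy)).isSymmSndFDerivAt
    (by rw [minSmoothness_of_isRCLikeNormedField]; exact WithTop.coe_le_coe.2 le_top)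
  have e : ∀ i j : Fin n, pd i (pd j u) y = fderiv ℝ (fderiv ℝ u) y
      (EuclideanSpace.single i 1) (EuclideanSpace.single j 1) := by
    intro i j
    have h1 := (hd.hasFDerivAt.clm_apply (hasFDerivAt_const (EuclideanSpace.single j (1 : ℝ)) y))
    have h2 : pd j u = fun z => (fderiv ℝ u z) (EuclideanSpace.single j (1 : ℝ)) := rfl
    rw [h2, pd, h1.fderiv]
    simp
  rw [e, e]
  exact h _ _

theorem fderiv_eq_sum_pd {W : Type*} [NormedAddCommGroup W] [NormedSpace ℝ W]
    (u : EuclideanSpace ℝ (Fin 2) → W) (y v : EuclideanSpace ℝ (Fin 2)) :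
    fderiv ℝ u y v = v 0 • pd 0 u y + v 1 • pd 1 u y := by
  have : v = v 0 • EuclideanSpace.single 0 (1 : ℝ) + v 1 • EuclideanSpace.single 1 (1 : ℝ) := by
    ext i; fin_cases i <;> simp
  conv_lhs => rw [this]
  simp [pd]

end Bilinear

section Charts

theorem exists_symm_eq {M H : Type*} [TopologicalSpace M] [TopologicalSpace H]
    {e : OpenPartialHomeomorph M H} {x : M} (hx : x ∈ e.source) : ∃ y ∈ e.target, e.symm y = x :=
  ⟨e x, e.map_source hx, e.left_inv hx⟩

variable {n : ℕ} {M : Type*} [TopologicalSpace M] [ChartedSpace (EuclideanSpace ℝ (Fin n)) M]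
  {e : OpenPartialHomeomorph M (EuclideanSpace ℝ (Fin n))}

theorem contDiffOn_comp_symm {V : Type*} [NormedAddCommGroup V] [NormedSpace ℝ V] {u : M → V}
    {U : Set M} (hu : ContMDiffOn (𝓡 n) 𝓘(ℝ, V) ∞ u U)
    (he : e ∈ IsManifold.maximalAtlas (𝓡 n) ∞ M) :
    ContDiffOn ℝ ∞ (fun y => u (e.symm y)) (e.target ∩ e.symm ⁻¹' U) := by
  rw [← contMDiffOn_iff_contDiffOn]
  exact hu.comp ((contMDiffOn_symm_of_mem_maximalAtlas he).mono Set.inter_subset_left)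
    fun y hy => hy.2

theorem contDiffOn_comp_symm_target {V : Type*} [NormedAddCommGroup V] [NormedSpace ℝ V]
    {u : M → V} (hu : ContMDiff (𝓡 n) 𝓘(ℝ, V) ∞ u)
    (he : e ∈ IsManifold.maximalAtlas (𝓡 n) ∞ M) :
    ContDiffOn ℝ ∞ (fun y => u (e.symm y)) e.target :=
  (contDiffOn_comp_symm (hu.contMDiffOn (s := Set.univ)) he).mono fun _ hy => ⟨hy, trivial⟩

theorem mdifferentiableAt_chart_symm (he : e ∈ IsManifold.maximalAtlas (𝓡 n) ∞ M)
    {y : EuclideanSpace ℝ (Fin n)} (hy : y ∈ e.target) :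
    MDifferentiableAt (𝓡 n) (𝓡 n) e.symm y :=
  (contMDiffAt_symm_of_mem_maximalAtlas he hy).mdifferentiableAt (by simp)

theorem mdifferentiableAt_chart (he : e ∈ IsManifold.maximalAtlas (𝓡 n) ∞ M)
    {x : M} (hx : x ∈ e.source) : MDifferentiableAt (𝓡 n) (𝓡 n) e x :=
  (contMDiffAt_of_mem_maximalAtlas he hx).mdifferentiableAt (by simp)

/-- The differential of a map to a vector space evaluated on a coordinate vector field. -/
theorem mfderiv_coordVec {V : Type*} [NormedAddCommGroup V] [NormedSpace ℝ V] {u : M → V}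
    (he : e ∈ IsManifold.maximalAtlas (𝓡 n) ∞ M) {y : EuclideanSpace ℝ (Fin n)}
    (hy : y ∈ e.target) (hu : MDifferentiableAt (𝓡 n) 𝓘(ℝ, V) u (e.symm y)) (i : Fin n) :
    mfderiv (𝓡 n) 𝓘(ℝ, V) u (e.symm y) (coordVec e y i) = pd i (fun z => u (e.symm z)) y := by
  have h := mfderiv_comp y hu (mdifferentiableAt_chart_symm he hy)
  rw [coordVec, pd, ← mfderiv_eq_fderiv]
  exact (congrArg (fun L : EuclideanSpace ℝ (Fin n) →L[ℝ] V => L (EuclideanSpace.single i 1))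
    h).symm

/-- The coordinate vectors of a chart form a basis. -/
theorem exists_coordBasis (he : e ∈ IsManifold.maximalAtlas (𝓡 n) ∞ M)
    {y : EuclideanSpace ℝ (Fin n)} (hy : y ∈ e.target) :
    ∃ b : Module.Basis (Fin n) ℝ (TangentSpace (𝓡 n) (e.symm y)),
      ∀ i, b i = coordVec e y i := by
  have hs := mdifferentiableAt_chart_symm he hy
  have hx : e.symm y ∈ e.source := e.map_target hy
  have hd := mdifferentiableAt_chart he hx
  have h1 : (mfderiv (𝓡 n) (𝓡 n) e (e.symm y)).comp (mfderiv (𝓡 n) (𝓡 n) e.symm y)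
      = ContinuousLinearMap.id ℝ (EuclideanSpace ℝ (Fin n)) := by
    rw [← mfderiv_comp y hd hs]
    have : (e ∘ e.symm) =ᶠ[nhds y] id := by
      filter_upwards [e.open_target.mem_nhds hy] with z hz using e.right_inv hz
    rw [this.mfderiv_eq]
    exact mfderiv_id
  have hs' : MDifferentiableAt (𝓡 n) (𝓡 n) e.symm (e (e.symm y)) := by rwa [e.right_inv hy]
  have h2 : (mfderiv (𝓡 n) (𝓡 n) e.symm y).comp (mfderiv (𝓡 n) (𝓡 n) e (e.symm y))
      = ContinuousLinearMap.id ℝ (EuclideanSpace ℝ (Fin n)) := by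
    have h3 := mfderiv_comp (e.symm y) hs' hd
    have : (e.symm ∘ e) =ᶠ[nhds (e.symm y)] id := by
      filter_upwards [e.open_source.mem_nhds hx] with z hz using e.left_inv hz
    rw [this.mfderiv_eq] at h3
    have h4 : mfderiv (𝓡 n) (𝓡 n) e.symm (e (e.symm y)) = mfderiv (𝓡 n) (𝓡 n) e.symm y := by
      rw [e.right_inv hy]
    rw [h4] at h3
    exact h3.symm.trans mfderiv_id
  let L : EuclideanSpace ℝ (Fin n) ≃ₗ[ℝ] TangentSpace (𝓡 n) (e.symm y) :=
    LinearEquiv.ofLinearMap (mfderiv (𝓡 n) (𝓡 n) e.symm y).toLinearMap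
      (mfderiv (𝓡 n) (𝓡 n) e (e.symm y)).toLinearMap
      (LinearMap.ext fun v => congrArg
        (fun L : EuclideanSpace ℝ (Fin n) →L[ℝ] EuclideanSpace ℝ (Fin n) => L v) h2)
      (LinearMap.ext fun v => congrArg
        (fun L : EuclideanSpace ℝ (Fin n) →L[ℝ] EuclideanSpace ℝ (Fin n) => L v) h1)
  refine ⟨(EuclideanSpace.basisFun (Fin n) ℝ).toBasis.map L, fun i => ?_⟩
  simp only [Module.Basis.map_apply, OrthonormalBasis.coe_toBasis, EuclideanSpace.basisFun_apply]
  rfl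

end Charts

section Surface

variable {X : Type*} [TopologicalSpace X] [ChartedSpace (EuclideanSpace ℝ (Fin 2)) X]
  {e : OpenPartialHomeomorph X (EuclideanSpace ℝ (Fin 2))}

theorem exists_eq_coordVec (he : e ∈ IsManifold.maximalAtlas (𝓡 2) ∞ X)
    {y : EuclideanSpace ℝ (Fin 2)} (hy : y ∈ e.target) (v : TangentSpace (𝓡 2) (e.symm y)) :
    ∃ a b : ℝ, v = a • coordVec e y 0 + b • coordVec e y 1 := by
  obtain ⟨b, hb⟩ := exists_coordBasis he hy
  refine ⟨b.repr v 0, b.repr v 1, ?_⟩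
  rw [← hb, ← hb, ← Fin.sum_univ_two fun i => b.repr v i • b i, b.sum_repr]

theorem dVec_coordVec {u : X → R23} (he : e ∈ IsManifold.maximalAtlas (𝓡 2) ∞ X)
    {y : EuclideanSpace ℝ (Fin 2)} (hy : y ∈ e.target)
    (hu : MDifferentiableAt (𝓡 2) 𝓘(ℝ, R23) u (e.symm y)) (i : Fin 2) :
    dVec u (e.symm y) (coordVec e y i) = pd i (fun z => u (e.symm z)) y :=
  mfderiv_coordVec he hy hu i

theorem hasMFDerivAt_sp {u w : X → R23} {x : X} (hu : MDifferentiableAt (𝓡 2) 𝓘(ℝ, R23) u x)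
    (hw : MDifferentiableAt (𝓡 2) 𝓘(ℝ, R23) w x) (v : TangentSpace (𝓡 2) x) :
    mfderiv (𝓡 2) 𝓘(ℝ, ℝ) (fun z => sp (u z) (w z)) x v
      = sp (dVec u x v) (w x) + sp (u x) (dVec w x v) := by
  have h1 : HasFDerivAt (fun p : R23 × R23 => sp p.1 p.2)
      (spL.isBoundedBilinearMap.deriv (u x, w x)) (u x, w x) :=
    spL.isBoundedBilinearMap.hasFDerivAt (u x, w x)
  have h2 := HasMFDerivAt.comp (g := fun p : R23 × R23 => sp p.1 p.2) (f := fun z => (u z, w z)) x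
    h1.hasMFDerivAt
    (⟨hu.hasMFDerivAt.1.prodMk hw.hasMFDerivAt.1, hu.hasMFDerivAt.2.prodMk hw.hasMFDerivAt.2⟩ :
      HasMFDerivAt (𝓡 2) 𝓘(ℝ, R23 × R23) (fun z => (u z, w z)) x _)
  have e : (fun z => sp (u z) (w z)) = (fun p : R23 × R23 => sp p.1 p.2) ∘ fun z => (u z, w z) :=
    rfl
  rw [e, h2.mfderiv]
  exact add_comm _ _

theorem sp_dVec_eq_neg {u w : X → R23} {x : X} (hu : MDifferentiableAt (𝓡 2) 𝓘(ℝ, R23) u x)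
    (hw : MDifferentiableAt (𝓡 2) 𝓘(ℝ, R23) w x) {c : ℝ}
    (h : ∀ᶠ z in nhds x, sp (u z) (w z) = c) (v : TangentSpace (𝓡 2) x) :
    sp (dVec u x v) (w x) = -sp (u x) (dVec w x v) := by
  have h1 := hasMFDerivAt_sp hu hw v
  have h2 : (fun z => sp (u z) (w z)) =ᶠ[nhds x] fun _ => c := h
  rw [h2.mfderiv_eq, mfderiv_const] at h1
  have : (0 : ℝ) = sp (dVec u x v) (w x) + sp (u x) (dVec w x v) := h1
  linarith

theorem dVec_apply {u : X → R23} {x : X} (hu : MDifferentiableAt (𝓡 2) 𝓘(ℝ, R23) u x)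
    (v : TangentSpace (𝓡 2) x) (k : Fin 5) :
    mfderiv (𝓡 2) 𝓘(ℝ, ℝ) (fun z => u z k) x v = dVec u x v k := by
  have h2 := (ContinuousLinearMap.proj (R := ℝ) (φ := fun _ : Fin 5 => ℝ)
    k).hasFDerivAt.hasMFDerivAt.comp x hu.hasMFDerivAt
  exact congrArg (fun L : TangentSpace (𝓡 2) x →L[ℝ] ℝ => L v) h2.mfderiv

theorem phi_eq {F : X → Mat5} {x : X} (hF : ∀ j, MDifferentiableAt (𝓡 2) 𝓘(ℝ, R23)
    (fun z => column (F z) j) x) (h : ∀ i j, sp (column (F x) i) (column (F x) j) = gram i j)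
    (i j : Fin 5) (v : TangentSpace (𝓡 2) x) :
    phi F i j x v = (![-sp (column (F x) 4) (dVec (fun z => column (F z) j) x v),
      -sp (column (F x) 1) (dVec (fun z => column (F z) j) x v),
      sp (column (F x) 2) (dVec (fun z => column (F z) j) x v),
      sp (column (F x) 3) (dVec (fun z => column (F z) j) x v),
      -sp (column (F x) 0) (dVec (fun z => column (F z) j) x v)] : R23) i := by
  rw [phi, mc, isometry_inv ((gram_eq_transpose_mul_iff _).2 h), Matrix.mul_assoc, Matrix.mul_assoc]
  have hc : (F x).transpose * (gram * Matrix.of fun i j =>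
      mfderiv (𝓡 2) 𝓘(ℝ, ℝ) (fun z => F z i j) x v) = Matrix.of fun k j =>
        sp (column (F x) k) (dVec (fun z => column (F z) j) x v) := by
    ext k j
    rw [← Matrix.mul_assoc, transpose_gram_mul_apply]
    simp only [Matrix.of_apply]
    congr 1
    ext l
    rw [← dVec_apply (hF j)]
    rfl
  rw [hc]
  fin_cases i <;> simp [gram, Matrix.mul_apply, Fin.sum_univ_five]

theorem isPositivePair_iff {o : TangentOrientation X} {x : X} {v w : TangentSpace (𝓡 2) x}
    (h : IsPositivePair o x v w) (a b c d : ℝ) :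
    IsPositivePair o x (a • v + b • w) (c • v + d • w) ↔ 0 < a * d - b * c := by
  obtain ⟨B, rfl, rfl, hB⟩ := h
  have hdet : B.det ![a • B 0 + b • B 1, c • B 0 + d • B 1] = a * d - b * c := by
    rw [Module.Basis.det_apply, Matrix.det_fin_two]
    simp [Module.Basis.toMatrix_apply]
    ring
  constructor
  · rintro ⟨B', h0, h1, hB'⟩
    rw [← hB, eq_comm, Module.Basis.orientation_eq_iff_det_pos] at hB'
    rw [← hdet, ← h0, ← h1]
    have e : ![B' 0, B' 1] = ⇑B' := by
      ext i : 1
      fin_cases i <;> rfl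
    rwa [e]
  · intro hpos
    have hu : IsUnit (B.det ![a • B 0 + b • B 1, c • B 0 + d • B 1]) := by
      rw [hdet]; exact hpos.ne'.isUnit
    obtain ⟨h1, h2⟩ := (Module.Basis.is_basis_iff_det B).2 hu
    refine ⟨Module.Basis.mk h1 h2.ge, by simp, by simp, ?_⟩
    rw [← hB, eq_comm, Module.Basis.orientation_eq_iff_det_pos, Module.Basis.coe_mk, hdet]
    exact hpos

theorem isPositivePair_neg_iff {o : TangentOrientation X} {x : X} {v w : TangentSpace (𝓡 2) x} :
    IsPositivePair (fun x => -o x) x v w ↔ IsPositivePair o x w v := by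
  have key : ∀ (o : TangentOrientation X) (v w : TangentSpace (𝓡 2) x),
      IsPositivePair (fun x => -o x) x v w → IsPositivePair o x w v := by
    rintro o v w ⟨B, rfl, rfl, hB⟩
    refine ⟨B.reindex (Equiv.swap 0 1), by simp, by simp, ?_⟩
    have h : (B.reindex (Equiv.swap 0 1)).orientation ≠ B.orientation := by
      intro heq
      rw [eq_comm, Module.Basis.orientation_eq_iff_det_pos, Module.Basis.det_apply,
        Matrix.det_fin_two] at heq
      simp [Module.Basis.toMatrix_apply] at heq
      norm_num at heq
    rw [Module.Basis.orientation_ne_iff_eq_neg, hB] at h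
    exact h.trans (neg_neg (o x))
  refine ⟨key o v w, fun h => key (fun x => -o x) w v ?_⟩
  have e : (fun x => - -o x) = o := funext fun x => neg_neg (o x)
  rwa [e]

end Surface

/-! ### The conformal Gauss map in a chart -/

/-- For an immersion `u` of a plane domain, the vector `det(g) g^{ij} ∂_i ∂_j u`. Modulo the tangent
plane it represents the Laplacian of `u`, and it is polynomial in the derivatives of `u`. -/
noncomputable def adjLap (u : EuclideanSpace ℝ (Fin 2) → R23) (y : EuclideanSpace ℝ (Fin 2)) :
    R23 :=
  sp (pd 1 u y) (pd 1 u y) • pd 0 (pd 0 u) y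
    - (2 * sp (pd 0 u y) (pd 1 u y)) • pd 0 (pd 1 u) y
    + sp (pd 0 u y) (pd 0 u y) • pd 1 (pd 1 u) y

/-- The determinant of the induced metric. -/
noncomputable def metricDet (u : EuclideanSpace ℝ (Fin 2) → R23) (y : EuclideanSpace ℝ (Fin 2)) :
    ℝ :=
  sp (pd 0 u y) (pd 0 u y) * sp (pd 1 u y) (pd 1 u y) - sp (pd 0 u y) (pd 1 u y) ^ 2

/-- The value of the conformal Gauss map in a positive chart: the unit normal of the osculating
hyperplane spanned by `u`, its first derivatives and its Laplacian, with the sign fixed by the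
orientation (the factor `det(g) < 0` in `adjLap` is responsible for the sign of the determinant). -/
structure IsGaussVector (u : EuclideanSpace ℝ (Fin 2) → R23) (y : EuclideanSpace ℝ (Fin 2))
    (N : R23) : Prop where
  unit : sp N N = 1
  perp : sp N (u y) = 0
  perp0 : sp N (pd 0 u y) = 0
  perp1 : sp N (pd 1 u y) = 0
  perp_lap : sp N (adjLap u y) = 0
  det_neg : (Matrix.of ![u y, pd 0 u y, pd 1 u y, N, adjLap u y]).det < 0

theorem det_smul_row (a b c d : R23) (t : ℝ) (N : R23) :
    (Matrix.of ![a, b, c, t • N, d]).det = t * (Matrix.of ![a, b, c, N, d]).det := by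
  have h := Matrix.det_updateRow_smul (Matrix.of ![a, b, c, N, d]) 3 t N
  have e : ∀ M : R23, (Matrix.of ![a, b, c, N, d]).updateRow 3 M = Matrix.of ![a, b, c, M, d] := by
    intro M
    ext i j
    fin_cases i <;> simp [Matrix.updateRow_apply]
  rwa [e, e] at h

theorem eq_zero_of_sp_five {a b c d e v : R23} (hB : (Matrix.of ![a, b, c, d, e]).det ≠ 0)
    (ha : sp v a = 0) (hb : sp v b = 0) (hc : sp v c = 0) (hd : sp v d = 0) (he : sp v e = 0) :
    v = 0 := by
  apply eq_zero_of_sp_basis hB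
  intro i
  rw [sp_comm]
  fin_cases i
  exacts [ha, hb, hc, hd, he]

/-- The five conditions determine the Gauss vector up to sign, and the determinant fixes the sign.
-/
theorem IsGaussVector.unique {u : EuclideanSpace ℝ (Fin 2) → R23} {y : EuclideanSpace ℝ (Fin 2)}
    {N N' : R23} (h : IsGaussVector u y N) (h' : IsGaussVector u y N') : N = N' := by
  have h1 : N' - sp N N' • N = 0 := by
    apply eq_zero_of_sp_five h.det_neg.ne <;>
      simp [h.perp, h'.perp, h.perp0, h'.perp0, h.perp1, h'.perp1, h.unit, h.perp_lap, h'.perp_lap,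
        sp_comm N' N]
  obtain ⟨c, hc⟩ : ∃ c : ℝ, N' = c • N := ⟨_, sub_eq_zero.1 h1⟩
  have h2 := h'.unit
  rw [hc, sp_smul_left, sp_smul_right, h.unit] at h2
  have h3 := h'.det_neg
  rw [hc, det_smul_row] at h3
  have h4 : 0 < c := by
    by_contra hle
    push Not at hle
    nlinarith [h.det_neg]
  have h5 : c = 1 := by nlinarith
  rw [hc, h5, one_smul]

/-- The determinant of the osculating vectors `f, u, v, F₃, L`, expanded in a pseudo-orthonormal
frame with `F₀ ∥ f` and `u, v` orthogonal to `F₀, F₃`. It relates the orientation of the frame to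
that of the Gauss vector. -/
theorem det_frame_rows {F : Mat5} (h : ∀ i j, sp (column F i) (column F j) = gram i j) {c : ℝ}
    (hc : c ≠ 0) {f u v L : R23} (hf : column F 0 = c • f) (hu0 : sp (column F 0) u = 0)
    (hu3 : sp (column F 3) u = 0) (hv0 : sp (column F 0) v = 0) (hv3 : sp (column F 3) v = 0) :
    (Matrix.of ![f, u, v, column F 3, L]).det
      = (sp (column F 1) u * sp (column F 2) v - sp (column F 1) v * sp (column F 2) u)
        * (sp (column F 0) L / c) * F.det := by
  have e : Matrix.of ![f, u, v, column F 3, L] = Matrix.of ![![1 / c, 0, 0, 0, 0],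
      ![-sp (column F 4) u, -sp (column F 1) u, sp (column F 2) u, 0, 0],
      ![-sp (column F 4) v, -sp (column F 1) v, sp (column F 2) v, 0, 0],
      ![0, 0, 0, 1, 0],
      ![-sp (column F 4) L, -sp (column F 1) L, sp (column F 2) L, sp (column F 3) L,
        -sp (column F 0) L]] * F.transpose := by
    have hf' : f = (1 / c) • column F 0 := by rw [hf, smul_smul]; field_simp; simp
    have hu := frame_expand h u
    have hv := frame_expand h v
    have hL := frame_expand h L
    rw [hu0, hu3] at hu
    rw [hv0, hv3] at hv
    ext i j
    rw [Matrix.mul_apply, Fin.sum_univ_five]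
    fin_cases i
    · have := congrFun hf' j
      simpa [column] using this
    · have := congrFun hu j
      simp [column] at this ⊢
      linarith
    · have := congrFun hv j
      simp [column] at this ⊢
      linarith
    · simp [column]
    · have := congrFun hL j
      simp [column] at this ⊢
      linarith
  rw [e, Matrix.det_mul, Matrix.det_transpose]
  congr 1
  simp [Matrix.det_succ_row_zero, Fin.sum_univ_succ, Fin.succAbove, Fin.ext_iff]
  field_simp
  ring

theorem sp_of_frame_expand {F : Mat5} (h : ∀ i j, sp (column F i) (column F j) = gram i j)
    {u v : R23} (hu0 : sp (column F 0) u = 0) (hu3 : sp (column F 3) u = 0) :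
    sp v u = -sp (column F 4) u * sp v (column F 0) - sp (column F 1) u * sp v (column F 1)
      + sp (column F 2) u * sp v (column F 2) := by
  conv_lhs => rw [frame_expand h u, hu0, hu3]
  simp

section Surface

variable {X : Type*} [TopologicalSpace X] [ChartedSpace (EuclideanSpace ℝ (Fin 2)) X]
  {e : OpenPartialHomeomorph X (EuclideanSpace ℝ (Fin 2))} {f : X → R23}

theorem sp_self_of_mem_einstein {v : R23} (h : v ∈ einstein) : sp v v = 0 := by
  obtain ⟨h1, h2⟩ := h
  have hs2 : (1 / √2 : ℝ) * (1 / √2) = 1 / 2 := by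
    rw [div_mul_div_comm, Real.mul_self_sqrt (by norm_num)]; norm_num
  have e1 : sp v (P 0) ^ 2 + sp v (P 1) ^ 2
      = ((1 / √2) * (1 / √2)) * (v 0 + v 4) ^ 2 + v 1 ^ 2 := by simp [sp, P]; ring
  have e2 : sp v (P 2) ^ 2 + sp v (P 3) ^ 2 + sp v (P 4) ^ 2
      = ((1 / √2) * (1 / √2)) * (v 4 - v 0) ^ 2 + v 2 ^ 2 + v 3 ^ 2 := by simp [sp, P]; ring
  rw [e1, hs2] at h1
  rw [e2, hs2] at h2
  simp only [sp]
  linarith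

theorem ne_zero_of_mem_einstein {v : R23} (h : v ∈ einstein) : v ≠ 0 := by
  rintro rfl
  simpa using h.1

/-- The first and second derivatives of a timelike immersion in a chart. -/
theorem immersion_chart (hf : IsTimelikeImmersion f) (he : e ∈ IsManifold.maximalAtlas (𝓡 2) ∞ X)
    {y : EuclideanSpace ℝ (Fin 2)} (hy : y ∈ e.target) :
    (∀ i, sp (f (e.symm y)) (pd i (fun z => f (e.symm z)) y) = 0) ∧
    (∀ i j, sp (f (e.symm y)) (pd i (pd j (fun z => f (e.symm z))) y)
      = -sp (pd i (fun z => f (e.symm z)) y) (pd j (fun z => f (e.symm z)) y)) := by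
  have hs := contDiffOn_comp_symm_target hf.smooth he
  have ho := e.open_target
  have hd : ∀ y ∈ e.target, DifferentiableAt ℝ (fun z => f (e.symm z)) y := fun y hy =>
    (hs.contDiffAt (ho.mem_nhds hy)).differentiableAt (by simp)
  have h0 : ∀ y ∈ e.target, ∀ i, sp (f (e.symm y)) (pd i (fun z => f (e.symm z)) y) = 0 := by
    intro y hy i
    have := sp_pd_eq_neg (hd y hy) (hd y hy) (c := 0)
      (Filter.Eventually.of_forall fun z => sp_self_of_mem_einstein (hf.mem _)) i
    rw [sp_comm] at this
    linarith
  refine ⟨h0 y hy, fun i j => ?_⟩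
  have hj : DifferentiableAt ℝ (pd j fun z => f (e.symm z)) y :=
    ((contDiffOn_pd ho hs j).contDiffAt (ho.mem_nhds hy)).differentiableAt (by simp)
  have := sp_pd_eq_neg (hd y hy) hj (c := 0) (by
    filter_upwards [ho.mem_nhds hy] with z hz using h0 z hz j) i
  linarith

theorem sp_adjLap (hf : IsTimelikeImmersion f) (he : e ∈ IsManifold.maximalAtlas (𝓡 2) ∞ X)
    {y : EuclideanSpace ℝ (Fin 2)} (hy : y ∈ e.target) :
    sp (f (e.symm y)) (adjLap (fun z => f (e.symm z)) y)
      = -2 * metricDet (fun z => f (e.symm z)) y := by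
  have h := (immersion_chart hf he hy).2
  simp only [adjLap, metricDet, sp_add_right, sp_sub_right, sp_smul_right, h]
  ring

theorem metricDet_neg (hf : IsTimelikeImmersion f) (he : e ∈ IsManifold.maximalAtlas (𝓡 2) ∞ X)
    {y : EuclideanSpace ℝ (Fin 2)} (hy : y ∈ e.target) :
    metricDet (fun z => f (e.symm z)) y < 0 := by
  obtain ⟨⟨v, hv⟩, w, hw⟩ := hf.lorentzian (e.symm y)
  obtain ⟨a, b, rfl⟩ := exists_eq_coordVec he hy v
  obtain ⟨c, d, rfl⟩ := exists_eq_coordVec he hy w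
  have hm := (hf.smooth (e.symm y)).mdifferentiableAt (by simp)
  simp only [inducedMetric, map_add, map_smul, dVec_coordVec he hy hm, sp_add_left, sp_add_right,
    sp_smul_left, sp_smul_right, sp_comm (pd 1 (fun z => f (e.symm z)) y)
    (pd 0 (fun z => f (e.symm z)) y)] at hv hw
  simp only [metricDet]
  set g00 := sp (pd 0 (fun z => f (e.symm z)) y) (pd 0 (fun z => f (e.symm z)) y)
  set g01 := sp (pd 0 (fun z => f (e.symm z)) y) (pd 1 (fun z => f (e.symm z)) y)
  set g11 := sp (pd 1 (fun z => f (e.symm z)) y) (pd 1 (fun z => f (e.symm z)) y)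
  by_contra hneg
  push Not at hneg
  rcases lt_trichotomy g00 0 with h | h | h
  · have : g00 * (c * (c * g00 + d * g01) + d * (c * g01 + d * g11))
        = (c * g00 + d * g01) ^ 2 + d ^ 2 * (g00 * g11 - g01 ^ 2) := by ring
    nlinarith [sq_nonneg (c * g00 + d * g01), mul_nonneg (sq_nonneg d) hneg]
  · have h01 : g01 = 0 := by
      rw [h] at hneg
      nlinarith [sq_nonneg g01]
    rw [h, h01] at hv hw
    have h1 : b ^ 2 * g11 < 0 := by linarith
    have h2 : 0 < d ^ 2 * g11 := by linarith
    have h3 : 0 < g11 := by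
      by_contra hle
      push Not at hle
      nlinarith [mul_nonneg (sq_nonneg d) (neg_nonneg.2 hle)]
    nlinarith [mul_nonneg (sq_nonneg b) h3.le]
  · have : g00 * (a * (a * g00 + b * g01) + b * (a * g01 + b * g11))
        = (a * g00 + b * g01) ^ 2 + b ^ 2 * (g00 * g11 - g01 ^ 2) := by ring
    nlinarith [sq_nonneg (a * g00 + b * g01), mul_nonneg (sq_nonneg b) hneg]

theorem IsConformalFrame.gram {U : Set X} {F : X → Mat5} (hF : IsConformalFrame f U F) {x : X}
    (hx : x ∈ U) : ∀ i j, sp (column (F x) i) (column (F x) j) = gram i j :=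
  ((mem_conformalGroup_iff _).1 (hF.mem x hx)).2.1

theorem IsConformalFrame.contMDiffOn_column {U : Set X} {F : X → Mat5}
    (hF : IsConformalFrame f U F) (j : Fin 5) :
    ContMDiffOn (𝓡 2) 𝓘(ℝ, R23) ∞ (fun x => column (F x) j) U :=
  contMDiffOn_pi_space.2 fun i => hF.smooth i j

theorem IsConformalFrame.mdifferentiableAt_column {U : Set X} {F : X → Mat5}
    (hF : IsConformalFrame f U F) {x : X} (hx : x ∈ U) (j : Fin 5) :
    MDifferentiableAt (𝓡 2) 𝓘(ℝ, R23) (fun x => column (F x) j) x :=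
  ((hF.contMDiffOn_column j).contMDiffAt (hF.isOpen.mem_nhds hx)).mdifferentiableAt (by simp)

/-- The skew-symmetry of the Maurer-Cartan form. -/
theorem IsConformalFrame.sp_dVec_column {U : Set X} {F : X → Mat5}
    (hF : IsConformalFrame f U F) {x : X} (hx : x ∈ U) (i j : Fin 5) (v : TangentSpace (𝓡 2) x) :
    sp (dVec (fun z => column (F z) i) x v) (column (F x) j)
      = -sp (column (F x) i) (dVec (fun z => column (F z) j) x v) :=
  sp_dVec_eq_neg (hF.mdifferentiableAt_column hx i) (hF.mdifferentiableAt_column hx j)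
    (c := Einstein.gram i j)
    (by filter_upwards [hF.isOpen.mem_nhds hx] with z hz using hF.gram hz i j) v

/-- The forms `φⁱ₀`, `i = 1, 2, 3`, are the components of `df` in the frame. -/
theorem IsConformalFrame.sp_dVec_zero (hf : IsTimelikeImmersion f) {U : Set X} {F : X → Mat5}
    (hF : IsConformalFrame f U F) {x : X} (hx : x ∈ U) {c : ℝ} (hc : column (F x) 0 = c • f x)
    {i : Fin 5} (hi : Einstein.gram i 0 = 0) (v : TangentSpace (𝓡 2) x) :
    sp (column (F x) i) (dVec (fun z => column (F z) 0) x v)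
      = c * sp (column (F x) i) (dVec f x v) := by
  have hperp : ∀ z ∈ U, sp (column (F z) i) (f z) = 0 := by
    intro z hz
    obtain ⟨c, hc, h⟩ := hF.lift z hz
    have h1 := hF.gram hz i 0
    rw [h, sp_smul_right, hi] at h1
    simpa [hc.ne'] using h1
  have h1 := sp_dVec_eq_neg (hF.mdifferentiableAt_column hx i)
    ((hf.smooth x).mdifferentiableAt (by simp)) (c := 0)
    (by filter_upwards [hF.isOpen.mem_nhds hx] with z hz using hperp z hz) v
  have h2 := hF.sp_dVec_column hx i 0 v
  rw [hc, sp_smul_right, h1] at h2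
  linarith

theorem IsConformalFrame.phi_eq {U : Set X} {F : X → Mat5} (hF : IsConformalFrame f U F) {x : X}
    (hx : x ∈ U) (i j : Fin 5) (v : TangentSpace (𝓡 2) x) :
    phi F i j x v = (![-sp (column (F x) 4) (dVec (fun z => column (F z) j) x v),
      -sp (column (F x) 1) (dVec (fun z => column (F z) j) x v),
      sp (column (F x) 2) (dVec (fun z => column (F z) j) x v),
      sp (column (F x) 3) (dVec (fun z => column (F z) j) x v),
      -sp (column (F x) 0) (dVec (fun z => column (F z) j) x v)] : R23) i :=
  Einstein.phi_eq (hF.mdifferentiableAt_column hx) (hF.gram hx) i j v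

/-- For a first order frame, the second order condition says that `F₃` is orthogonal to the
Laplacian of `f`, and the orientation of `F₃` agrees with that of the Gauss vector. -/
theorem IsFirstOrderFrame.second_iff (hf : IsTimelikeImmersion f) {o : TangentOrientation X}
    {U : Set X} {F : X → Mat5} (hF : IsFirstOrderFrame o f U F)
    (he : e ∈ IsManifold.maximalAtlas (𝓡 2) ∞ X) {y : EuclideanSpace ℝ (Fin 2)}
    (hy : y ∈ e.target) (hx : e.symm y ∈ U)
    (hpos : IsPositivePair o (e.symm y) (coordVec e y 0) (coordVec e y 1)) :
    ((phi F 3 1 (e.symm y) (coordVec e y 0) * phi F 2 0 (e.symm y) (coordVec e y 1)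
        - phi F 3 1 (e.symm y) (coordVec e y 1) * phi F 2 0 (e.symm y) (coordVec e y 0))
      + (phi F 3 2 (e.symm y) (coordVec e y 0) * phi F 1 0 (e.symm y) (coordVec e y 1)
        - phi F 3 2 (e.symm y) (coordVec e y 1) * phi F 1 0 (e.symm y) (coordVec e y 0)) = 0 ↔
      IsGaussVector (fun z => f (e.symm z)) y (column (F (e.symm y)) 3)) := by
  obtain ⟨c, hc, hc0⟩ := hF.lift _ hx
  have hg := hF.gram hx
  have hs := contDiffOn_comp_symm_target hf.smooth he
  have ho := e.open_target
  have hm := (hf.smooth (e.symm y)).mdifferentiableAt (by simp : (∞ : WithTop ℕ∞) ≠ 0)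
  set u : EuclideanSpace ℝ (Fin 2) → R23 := fun z => f (e.symm z) with hu
  obtain ⟨hf1, hf2⟩ := immersion_chart hf he hy
  -- the components of `df`
  have hdf : ∀ i : Fin 2, dVec f (e.symm y) (coordVec e y i) = pd i u y :=
    dVec_coordVec he hy hm
  have h0u : ∀ i : Fin 2, sp (column (F (e.symm y)) 0) (pd i u y) = 0 := by
    intro i
    rw [hc0, sp_smul_left, hf1 i, mul_zero]
  have h30 : ∀ z ∈ e.target ∩ e.symm ⁻¹' U, ∀ i : Fin 2,
      sp (column (F (e.symm z)) 3) (pd i u z) = 0 := by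
    intro z hz i
    obtain ⟨c', hc', hc0'⟩ := hF.lift _ hz.2
    have h1 := hF.phi30 _ hz.2 (coordVec e z i)
    have h2 := hF.phi_eq hz.2 3 0 (coordVec e z i)
    rw [h1] at h2
    have h3 := hF.sp_dVec_zero hf hz.2 hc0' (i := 3) (by simp [Einstein.gram]) (coordVec e z i)
    rw [dVec_coordVec he hz.1 ((hf.smooth (e.symm z)).mdifferentiableAt (by simp))] at h3
    have h4 : c' * sp (column (F (e.symm z)) 3) (pd i u z) = 0 := by
      rw [← h3]; exact h2.symm
    simpa [hc'.ne'] using h4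
  have h3u := h30 y ⟨hy, hx⟩
  -- the derivatives of `F₃`
  let N : EuclideanSpace ℝ (Fin 2) → R23 := fun z => column (F (e.symm z)) 3
  have hNd : ∀ i : Fin 2, dVec (fun z => column (F z) 3) (e.symm y) (coordVec e y i) = pd i N y :=
    dVec_coordVec he hy (hF.mdifferentiableAt_column hx 3)
  have hopen : IsOpen (e.target ∩ e.symm ⁻¹' U) :=
    e.symm.continuousOn.isOpen_inter_preimage e.open_target hF.isOpen
  have hNs : DifferentiableAt ℝ N y :=
    ((contDiffOn_comp_symm (hF.contMDiffOn_column 3) he).contDiffAt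
      (hopen.mem_nhds ⟨hy, hx⟩)).differentiableAt (by simp)
  have hh : ∀ i j : Fin 2, sp (N y) (pd i (pd j u) y) = -sp (pd i N y) (pd j u y) := by
    intro i j
    have hj : DifferentiableAt ℝ (pd j u) y :=
      ((contDiffOn_pd ho hs j).contDiffAt (ho.mem_nhds hy)).differentiableAt (by simp)
    have := sp_pd_eq_neg hNs hj (c := 0) (by
      filter_upwards [hopen.mem_nhds ⟨hy, hx⟩] with z hz using h30 z hz j) i
    linarith
  have hN0 : ∀ i : Fin 2, sp (pd i N y) (column (F (e.symm y)) 0) = 0 := by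
    intro i
    rw [← hNd, hF.sp_dVec_column hx, hF.sp_dVec_zero hf hx hc0 (by simp [Einstein.gram]), hdf,
      h3u]
    simp
  have hNu : ∀ i j : Fin 2, sp (pd i N y) (pd j u y)
      = -sp (column (F (e.symm y)) 1) (pd j u y) * sp (pd i N y) (column (F (e.symm y)) 1)
        + sp (column (F (e.symm y)) 2) (pd j u y) * sp (pd i N y) (column (F (e.symm y)) 2) := by
    intro i j
    rw [sp_of_frame_expand hg (h0u j) (h3u j), hN0]
    ring
  have hguu : ∀ i j : Fin 2, sp (pd i u y) (pd j u y)
      = -sp (column (F (e.symm y)) 1) (pd i u y) * sp (column (F (e.symm y)) 1) (pd j u y)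
        + sp (column (F (e.symm y)) 2) (pd i u y) * sp (column (F (e.symm y)) 2) (pd j u y) := by
    intro i j
    rw [sp_of_frame_expand hg (h0u j) (h3u j), sp_comm (pd i u y) (column (F (e.symm y)) 0), h0u,
      sp_comm (pd i u y), sp_comm (pd i u y)]
    ring
  have hphi : ∀ i : Fin 2, phi F 1 0 (e.symm y) (coordVec e y i)
        = -(c * sp (column (F (e.symm y)) 1) (pd i u y)) ∧
      phi F 2 0 (e.symm y) (coordVec e y i) = c * sp (column (F (e.symm y)) 2) (pd i u y) ∧
      phi F 3 1 (e.symm y) (coordVec e y i) = -sp (pd i N y) (column (F (e.symm y)) 1) ∧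
      phi F 3 2 (e.symm y) (coordVec e y i) = -sp (pd i N y) (column (F (e.symm y)) 2) := by
    intro i
    refine ⟨?_, ?_, ?_, ?_⟩
    · rw [hF.phi_eq hx, ← hdf, ← hF.sp_dVec_zero hf hx hc0 (by simp [Einstein.gram])]
      rfl
    · rw [hF.phi_eq hx, ← hdf, ← hF.sp_dVec_zero hf hx hc0 (by simp [Einstein.gram])]
      rfl
    · rw [hF.phi_eq hx, ← hNd, hF.sp_dVec_column hx, neg_neg]
      rfl
    · rw [hF.phi_eq hx, ← hNd, hF.sp_dVec_column hx, neg_neg]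
      rfl
  -- orientation
  have hΔ : sp (column (F (e.symm y)) 1) (pd 0 u y) * sp (column (F (e.symm y)) 2) (pd 1 u y)
      - sp (column (F (e.symm y)) 1) (pd 1 u y) * sp (column (F (e.symm y)) 2) (pd 0 u y) < 0 := by
    have h := hF.positive _ hx _ _ hpos
    rw [(hphi 0).1, (hphi 1).1, (hphi 0).2.1, (hphi 1).2.1] at h
    have hc2 : 0 < c ^ 2 := by positivity
    by_contra hneg
    push Not at hneg
    nlinarith [mul_nonneg hc2.le hneg]
  have hdet : (Matrix.of ![u y, pd 0 u y, pd 1 u y, N y, adjLap u y]).det < 0 := by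
    have hF1 : (F (e.symm y)).det = 1 := ((mem_conformalGroup_iff _).1 (hF.mem _ hx)).1
    have := det_frame_rows hg hc.ne' hc0 (h0u 0) (h3u 0) (h0u 1) (h3u 1) (L := adjLap u y)
    rw [hF1, hc0, sp_smul_left, sp_adjLap hf he hy, mul_div_cancel_left₀ _ hc.ne'] at this
    rw [show u y = f (e.symm y) from rfl, this]
    have := metricDet_neg hf he hy
    nlinarith
  -- `⟨F₃, det(g) Δf⟩` is, up to a positive factor, the left side of the second order condition
  -- times the area form
  have h10 : sp (N y) (pd 1 (pd 0 u) y) = sp (N y) (pd 0 (pd 1 u) y) := by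
    rw [pd_comm ho hs hy]
  have hlap : sp (N y) (adjLap u y) = (sp (column (F (e.symm y)) 1) (pd 0 u y)
      * sp (column (F (e.symm y)) 2) (pd 1 u y)
      - sp (column (F (e.symm y)) 1) (pd 1 u y) * sp (column (F (e.symm y)) 2) (pd 0 u y))
      * (sp (pd 0 N y) (column (F (e.symm y)) 1) * sp (column (F (e.symm y)) 2) (pd 1 u y)
      - sp (pd 1 N y) (column (F (e.symm y)) 1) * sp (column (F (e.symm y)) 2) (pd 0 u y)
      - sp (pd 0 N y) (column (F (e.symm y)) 2) * sp (column (F (e.symm y)) 1) (pd 1 u y)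
      + sp (pd 1 N y) (column (F (e.symm y)) 2) * sp (column (F (e.symm y)) 1) (pd 0 u y)) := by
    have e1 : sp (N y) (adjLap u y) = sp (pd 1 u y) (pd 1 u y) * sp (N y) (pd 0 (pd 0 u) y)
        - sp (pd 0 u y) (pd 1 u y) * (sp (N y) (pd 0 (pd 1 u) y) + sp (N y) (pd 1 (pd 0 u) y))
        + sp (pd 0 u y) (pd 0 u y) * sp (N y) (pd 1 (pd 1 u) y) := by
      rw [h10]
      simp only [adjLap, sp_add_right, sp_sub_right, sp_smul_right]
      ring
    rw [e1, hh, hh, hh, hh, hNu, hNu, hNu, hNu, hguu, hguu, hguu]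
    ring
  rw [(hphi 0).1, (hphi 1).1, (hphi 0).2.1, (hphi 1).2.1, (hphi 0).2.2.1, (hphi 1).2.2.1,
    (hphi 0).2.2.2, (hphi 1).2.2.2]
  constructor
  · intro h
    refine ⟨by simpa [Einstein.gram] using hg 3 3, ?_, h3u 0, h3u 1, ?_, hdet⟩
    · have := hg 3 0
      rw [hc0, sp_smul_right] at this
      simpa [Einstein.gram, hc.ne'] using this
    · change sp (N y) (adjLap u y) = 0
      rw [hlap]
      apply mul_eq_zero_of_right
      have : c * (sp (pd 0 N y) (column (F (e.symm y)) 1) * sp (column (F (e.symm y)) 2) (pd 1 u y)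
        - sp (pd 1 N y) (column (F (e.symm y)) 1) * sp (column (F (e.symm y)) 2) (pd 0 u y)
        - sp (pd 0 N y) (column (F (e.symm y)) 2) * sp (column (F (e.symm y)) 1) (pd 1 u y)
        + sp (pd 1 N y) (column (F (e.symm y)) 2) * sp (column (F (e.symm y)) 1) (pd 0 u y)) = 0 := by
        linear_combination -h
      simpa [hc.ne'] using this
  · intro h
    have h1 : sp (N y) (adjLap u y) = 0 := h.perp_lap
    rw [hlap] at h1
    have h2 := (mul_eq_zero.1 h1).resolve_left hΔ.ne
    linear_combination (-c) * h2

end Surface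

/-! ### Existence of second order frame fields -/

theorem det_gram : gram.det = 1 := by
  simp [gram, Matrix.det_succ_row_zero, Fin.sum_univ_succ, Fin.succAbove, Fin.ext_iff]
  norm_num

theorem det_sq_of_isometry {F : Mat5} (h : ∀ i j, sp (column F i) (column F j) = gram i j) :
    F.det ^ 2 = 1 := by
  have := congrArg Matrix.det ((gram_eq_transpose_mul_iff F).2 h)
  rw [Matrix.det_mul, Matrix.det_mul, Matrix.det_transpose, det_gram] at this
  linarith

/-- Four vectors of a five-dimensional space have a common orthogonal vector: the matrix with these
rows and a zero row is singular. -/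
theorem exists_orthogonal_ne_zero (a b c d : R23) :
    ∃ v : R23, v ≠ 0 ∧ sp v a = 0 ∧ sp v b = 0 ∧ sp v c = 0 ∧ sp v d = 0 := by
  have hdet : (Matrix.of ![a, b, c, d, 0]).det = 0 :=
    Matrix.det_eq_zero_of_row_eq_zero 4 (fun j => rfl)
  obtain ⟨w, hw, h⟩ := Matrix.exists_mulVec_eq_zero_iff.2 hdet
  refine ⟨gram.mulVec w, ?_, ?_⟩
  · intro h0
    apply hw
    have : gram.mulVec (gram.mulVec w) = 0 := by rw [h0, Matrix.mulVec_zero]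
    rwa [Matrix.mulVec_mulVec, gram_mul_gram, Matrix.one_mulVec] at this
  · have e : ∀ x, sp (gram.mulVec w) x = x ⬝ᵥ w := by
      intro x
      rw [sp_comm, sp_eq, Matrix.mulVec_mulVec, gram_mul_gram, Matrix.one_mulVec]
    simp only [e]
    exact ⟨congrFun h 0, congrFun h 1, congrFun h 2, congrFun h 3⟩

/-- The matrix with given columns. -/
def ofColumns (a b c d e : R23) : Mat5 := (Matrix.of ![a, b, c, d, e]).transpose

theorem ofColumns_gram {a b c d e : R23} (h00 : sp a a = 0) (h01 : sp a b = 0) (h02 : sp a c = 0)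
    (h03 : sp a d = 0) (h04 : sp a e = -1) (h11 : sp b b = -1) (h12 : sp b c = 0)
    (h13 : sp b d = 0) (h14 : sp b e = 0) (h22 : sp c c = 1) (h23 : sp c d = 0) (h24 : sp c e = 0)
    (h33 : sp d d = 1) (h34 : sp d e = 0) (h44 : sp e e = 0) (i j : Fin 5) :
    sp (column (ofColumns a b c d e) i) (column (ofColumns a b c d e) j) = gram i j := by
  have c0 : column (ofColumns a b c d e) 0 = a := rfl
  have c1 : column (ofColumns a b c d e) 1 = b := rfl
  have c2 : column (ofColumns a b c d e) 2 = c := rfl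
  have c3 : column (ofColumns a b c d e) 3 = d := rfl
  have c4 : column (ofColumns a b c d e) 4 = e := rfl
  fin_cases i <;> fin_cases j <;> simp [c0, c1, c2, c3, c4, gram] <;>
    first | assumption | (rw [sp_comm]; assumption)

theorem contDiffOn_negDet {E : Type*} [NormedAddCommGroup E] [NormedSpace ℝ E] {s : Set E}
    {u w : E → R23} (hu : ContDiffOn ℝ ∞ u s) (hw : ContDiffOn ℝ ∞ w s) :
    ContDiffOn ℝ ∞ (fun y => negDet (u y) (w y)) s := by
  have hu' := contDiffOn_pi.1 hu
  have hw' := contDiffOn_pi.1 hw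
  exact (((hu' 0).add (hu' 4)).mul (hw' 1)).sub ((hu' 1).mul ((hw' 0).add (hw' 4)))

theorem contDiffOn_adjLap {u : EuclideanSpace ℝ (Fin 2) → R23}
    {s : Set (EuclideanSpace ℝ (Fin 2))} (hs : IsOpen s) (hu : ContDiffOn ℝ ∞ u s) :
    ContDiffOn ℝ ∞ (adjLap u) s := by
  have h := fun i => contDiffOn_pd hs hu i
  have h2 := fun i j => contDiffOn_pd hs (h i) j
  exact (((contDiffOn_sp (h 1) (h 1)).smul (h2 0 0)).sub
    ((contDiffOn_const.mul (contDiffOn_sp (h 0) (h 1))).smul (h2 1 0))).add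
    ((contDiffOn_sp (h 0) (h 0)).smul (h2 1 1))

/-- A smooth pseudo-orthonormal frame along a timelike immersion of a plane domain, obtained by
Gram-Schmidt orthogonalization of the osculating flag. -/
theorem exists_frame_of_immersion {u : EuclideanSpace ℝ (Fin 2) → R23}
    {Ω : Set (EuclideanSpace ℝ (Fin 2))} (hΩ : IsOpen Ω) (hu : ContDiffOn ℝ ∞ u Ω)
    (h00 : ∀ y ∈ Ω, sp (u y) (u y) = 0) (hne : ∀ y ∈ Ω, u y ≠ 0)
    (h0i : ∀ y ∈ Ω, ∀ i, sp (u y) (pd i u y) = 0)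
    (hdet : ∀ y ∈ Ω, metricDet u y < 0)
    (hlap : ∀ y ∈ Ω, sp (u y) (adjLap u y) = -2 * metricDet u y)
    {y₀ : EuclideanSpace ℝ (Fin 2)} (hy₀ : y₀ ∈ Ω) {a b : ℝ}
    (hab : sp (a • pd 0 u y₀ + b • pd 1 u y₀) (a • pd 0 u y₀ + b • pd 1 u y₀) < 0) :
    ∃ (Ω' : Set (EuclideanSpace ℝ (Fin 2))) (E : EuclideanSpace ℝ (Fin 2) → Mat5),
      IsOpen Ω' ∧ y₀ ∈ Ω' ∧ Ω' ⊆ Ω ∧ (∀ i j, ContDiffOn ℝ ∞ (fun y => E y i j) Ω') ∧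
      ∀ y ∈ Ω', E y ∈ conformalGroup ∧ column (E y) 0 = u y ∧
        sp (column (E y) 3) (pd 0 u y) = 0 ∧ sp (column (E y) 3) (pd 1 u y) = 0 ∧
        sp (column (E y) 3) (adjLap u y) = 0 ∧
        sp (column (E y) 1) (pd 0 u y) * sp (column (E y) 2) (pd 1 u y)
          - sp (column (E y) 1) (pd 1 u y) * sp (column (E y) 2) (pd 0 u y) < 0 := by
  have hd0 := contDiffOn_pd hΩ hu 0
  have hd1 := contDiffOn_pd hΩ hu 1
  -- the timelike vector field and its normalization
  let T1 := fun y => a • pd 0 u y + b • pd 1 u y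
  let T2 := fun y => (-b) • pd 0 u y + a • pd 1 u y
  have hT1 : ContDiffOn ℝ ∞ T1 Ω := (hd0.const_smul a).add (hd1.const_smul b)
  have hT2 : ContDiffOn ℝ ∞ T2 Ω := (hd0.const_smul (-b)).add (hd1.const_smul a)
  let q1 := fun y => sp (T1 y) (T1 y)
  have hq1 : ContDiffOn ℝ ∞ q1 Ω := contDiffOn_sp hT1 hT1
  let S1 := Ω ∩ q1 ⁻¹' Set.Iio 0
  have hS1 : IsOpen S1 := hq1.continuousOn.isOpen_inter_preimage hΩ isOpen_Iio
  have hab2 : 0 < a ^ 2 + b ^ 2 := by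
    by_contra hle
    have ha : a = 0 := by nlinarith [sq_nonneg a, sq_nonneg b]
    have hb : b = 0 := by nlinarith [sq_nonneg a, sq_nonneg b]
    simp [ha, hb] at hab
  let E1 := fun y => (√(-q1 y))⁻¹ • T1 y
  have hr1 : ∀ y ∈ S1, 0 < √(-q1 y) := fun y hy => Real.sqrt_pos.2 (neg_pos.2 hy.2)
  have hE1 : ContDiffOn ℝ ∞ E1 S1 :=
    (((hq1.mono Set.inter_subset_left).neg.sqrt fun y hy => (neg_pos.2 hy.2).ne').inv
      fun y hy => (hr1 y hy).ne').smul (hT1.mono Set.inter_subset_left)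
  have h11 : ∀ y ∈ S1, sp (E1 y) (E1 y) = -1 := by
    intro y hy
    have h1 := Real.mul_self_sqrt (neg_pos.2 hy.2 : 0 < -q1 y).le
    have h2 := (hr1 y hy).ne'
    simp only [E1, sp_smul_left, sp_smul_right]
    change _ * (_ * q1 y) = _
    field_simp
    linarith
  have h01 : ∀ y ∈ S1, sp (u y) (E1 y) = 0 := by
    intro y hy
    simp [E1, T1, h0i y hy.1]
  -- the spacelike unit vector field
  let T3 := fun y => T2 y + sp (T2 y) (E1 y) • E1 y
  have hT3 : ContDiffOn ℝ ∞ T3 S1 := (hT2.mono Set.inter_subset_left).add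
    ((contDiffOn_sp (hT2.mono Set.inter_subset_left) hE1).smul hE1)
  let q2 := fun y => sp (T3 y) (T3 y)
  have hq2 : ∀ y ∈ S1, 0 < q2 y := by
    intro y hy
    have e1 : q2 y = sp (T2 y) (T2 y) + sp (T2 y) (E1 y) ^ 2 := by
      simp only [q2, T3, sp_add_left, sp_add_right, sp_smul_left, sp_smul_right, h11 y hy,
        sp_comm (E1 y)]
      ring
    have e2 : sp (T2 y) (E1 y) ^ 2 * -q1 y = sp (T2 y) (T1 y) ^ 2 := by
      have h5 : (√(-q1 y))⁻¹ ^ 2 * -q1 y = 1 := by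
        rw [inv_pow, Real.sq_sqrt (neg_pos.2 hy.2).le]
        exact inv_mul_cancel₀ (neg_pos.2 hy.2).ne'
      simp only [E1, sp_smul_right]
      linear_combination sp (T2 y) (T1 y) ^ 2 * h5
    have e3 : q1 y * sp (T2 y) (T2 y) - sp (T2 y) (T1 y) ^ 2
        = (a ^ 2 + b ^ 2) ^ 2 * metricDet u y := by
      simp only [q1, T1, T2, metricDet, sp_add_left, sp_add_right, sp_smul_left, sp_smul_right,
        sp_comm (pd 1 u y) (pd 0 u y)]
      ring
    have e4 : q1 y * q2 y = (a ^ 2 + b ^ 2) ^ 2 * metricDet u y := by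
      rw [e1, ← e3, ← e2]; ring
    have h3 : q1 y * q2 y < 0 := by
      rw [e4]; exact mul_neg_of_pos_of_neg (by positivity) (hdet y hy.1)
    have h4 : q1 y < 0 := hy.2
    by_contra hle
    push Not at hle
    nlinarith [mul_nonneg (neg_nonneg.2 h4.le) (neg_nonneg.2 hle)]
  let E2 := fun y => (√(q2 y))⁻¹ • T3 y
  have hr2 : ∀ y ∈ S1, 0 < √(q2 y) := fun y hy => Real.sqrt_pos.2 (hq2 y hy)
  have hE2 : ContDiffOn ℝ ∞ E2 S1 :=
    (((contDiffOn_sp hT3 hT3).sqrt fun y hy => (hq2 y hy).ne').inv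
      fun y hy => (hr2 y hy).ne').smul hT3
  have h22 : ∀ y ∈ S1, sp (E2 y) (E2 y) = 1 := by
    intro y hy
    have h1 := Real.mul_self_sqrt (hq2 y hy).le
    have h2 := (hr2 y hy).ne'
    simp only [E2, sp_smul_left, sp_smul_right]
    change _ * (_ * q2 y) = _
    field_simp
    linarith
  have h12 : ∀ y ∈ S1, sp (E1 y) (E2 y) = 0 := by
    intro y hy
    simp [E2, T3, h11 y hy, sp_comm (E1 y) (T2 y)]
  have h02 : ∀ y ∈ S1, sp (u y) (E2 y) = 0 := by
    intro y hy
    simp [E2, T3, T2, h0i y hy.1, h01 y hy]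
  -- the second null vector field
  have hm : ∀ y ∈ S1, 0 < sp (u y) (adjLap u y) := by
    intro y hy
    rw [hlap y hy.1]
    linarith [hdet y hy.1]
  have hu1 : ContDiffOn ℝ ∞ u S1 := hu.mono Set.inter_subset_left
  have hL := (contDiffOn_adjLap hΩ hu).mono (Set.inter_subset_left : S1 ⊆ Ω)
  let L := fun y => adjLap u y + sp (adjLap u y) (E1 y) • E1 y - sp (adjLap u y) (E2 y) • E2 y
  have hLs : ContDiffOn ℝ ∞ L S1 := (hL.add ((contDiffOn_sp hL hE1).smul hE1)).sub
    ((contDiffOn_sp hL hE2).smul hE2)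
  let m := fun y => (sp (u y) (adjLap u y))⁻¹
  have hms : ContDiffOn ℝ ∞ m S1 := (contDiffOn_sp hu1 hL).inv fun y hy => (hm y hy).ne'
  let E4 := fun y => (1 / 2 * m y ^ 2 * sp (L y) (L y)) • u y - m y • L y
  have hE4 : ContDiffOn ℝ ∞ E4 S1 :=
    (((contDiffOn_const.mul (hms.pow 2)).mul (contDiffOn_sp hLs hLs)).smul hu1).sub (hms.smul hLs)
  have hL1 : ∀ y ∈ S1, sp (E1 y) (L y) = 0 := by
    intro y hy
    simp [L, h11 y hy, h12 y hy, sp_comm (E1 y) (adjLap u y)]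
  have hL2 : ∀ y ∈ S1, sp (E2 y) (L y) = 0 := by
    intro y hy
    simp [L, h22 y hy, sp_comm (E2 y) (E1 y), h12 y hy, sp_comm (E2 y) (adjLap u y)]
  have hL0 : ∀ y ∈ S1, m y * sp (u y) (L y) = 1 := by
    intro y hy
    have : sp (u y) (L y) = sp (u y) (adjLap u y) := by simp [L, h01 y hy, h02 y hy]
    rw [this]
    exact inv_mul_cancel₀ (hm y hy).ne'
  have h04 : ∀ y ∈ S1, sp (u y) (E4 y) = -1 := by
    intro y hy
    simp [E4, h00 y hy.1, hL0 y hy]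
  have h14 : ∀ y ∈ S1, sp (E1 y) (E4 y) = 0 := by
    intro y hy
    simp [E4, hL1 y hy, sp_comm (E1 y) (u y), h01 y hy]
  have h24 : ∀ y ∈ S1, sp (E2 y) (E4 y) = 0 := by
    intro y hy
    simp [E4, hL2 y hy, sp_comm (E2 y) (u y), h02 y hy]
  have h44 : ∀ y ∈ S1, sp (E4 y) (E4 y) = 0 := by
    intro y hy
    have := hL0 y hy
    simp only [E4, sp_sub_left, sp_sub_right, sp_smul_left, sp_smul_right, h00 y hy.1,
      sp_comm (L y) (u y)]
    linear_combination (-(m y ^ 2 * sp (L y) (L y))) * this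
  -- the unit normal
  have hy1 : y₀ ∈ S1 := ⟨hy₀, hab⟩
  obtain ⟨X0, hX0, hX0u, hX1, hX2, hX4⟩ :=
    exists_orthogonal_ne_zero (u y₀) (E1 y₀) (E2 y₀) (E4 y₀)
  let T5 := fun y => X0 + sp X0 (E4 y) • u y + sp X0 (u y) • E4 y + sp X0 (E1 y) • E1 y
    - sp X0 (E2 y) • E2 y
  have hX0s : ContDiffOn ℝ ∞ (fun _ : EuclideanSpace ℝ (Fin 2) => X0) S1 := contDiffOn_const
  have hT5 : ContDiffOn ℝ ∞ T5 S1 := (((hX0s.add ((contDiffOn_sp hX0s hE4).smul hu1)).add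
    ((contDiffOn_sp hX0s hu1).smul hE4)).add ((contDiffOn_sp hX0s hE1).smul hE1)).sub
    ((contDiffOn_sp hX0s hE2).smul hE2)
  have hT50 : T5 y₀ = X0 := by simp [T5, hX0u, hX1, hX2, hX4]
  let q3 := fun y => sp (T5 y) (T5 y)
  have hq3 : ContDiffOn ℝ ∞ q3 S1 := contDiffOn_sp hT5 hT5
  let S3 := S1 ∩ q3 ⁻¹' Set.Ioi 0
  have hS3 : IsOpen S3 := hq3.continuousOn.isOpen_inter_preimage hS1 isOpen_Ioi
  have hy3 : y₀ ∈ S3 := by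
    refine ⟨hy1, ?_⟩
    change 0 < sp (T5 y₀) (T5 y₀)
    rw [hT50]
    -- `E₁` and `u + E₄` span a negative definite plane
    apply sp_self_pos_of_timelike (A := E1 y₀) (B := u y₀ + E4 y₀) _ _ _ hX1 _ hX0
    · rw [h11 y₀ hy1]; norm_num
    · simp [h00 y₀ hy₀, h04 y₀ hy1, h44 y₀ hy1, sp_comm (E4 y₀) (u y₀)]
    · simp [h14 y₀ hy1, sp_comm (E1 y₀) (u y₀), h01 y₀ hy1]
    · simp [hX0u, hX4]
  let E3 := fun y => (√(q3 y))⁻¹ • T5 y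
  have hr3 : ∀ y ∈ S3, 0 < √(q3 y) := fun y hy => Real.sqrt_pos.2 hy.2
  have hsub : S3 ⊆ S1 := Set.inter_subset_left
  have hE3 : ContDiffOn ℝ ∞ E3 S3 :=
    (((hq3.mono hsub).sqrt fun y hy => (hy.2 : 0 < q3 y).ne').inv
      fun y hy => (hr3 y hy).ne').smul (hT5.mono hsub)
  have h33 : ∀ y ∈ S3, sp (E3 y) (E3 y) = 1 := by
    intro y hy
    have h1 := Real.mul_self_sqrt (hy.2 : 0 < q3 y).le
    have h2 := (hr3 y hy).ne'
    simp only [E3, sp_smul_left, sp_smul_right]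
    change _ * (_ * q3 y) = _
    field_simp
    linarith
  have h03 : ∀ y ∈ S3, sp (u y) (E3 y) = 0 := by
    intro y hy
    simp [E3, T5, h00 y hy.1.1, h01 y hy.1, h02 y hy.1, h04 y hy.1, sp_comm (u y) X0]
  have h13 : ∀ y ∈ S3, sp (E1 y) (E3 y) = 0 := by
    intro y hy
    simp [E3, T5, sp_comm (E1 y) (u y), h01 y hy.1, h11 y hy.1, h12 y hy.1, h14 y hy.1,
      sp_comm (E1 y) X0]
  have h23 : ∀ y ∈ S3, sp (E2 y) (E3 y) = 0 := by
    intro y hy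
    simp [E3, T5, sp_comm (E2 y) (u y), h02 y hy.1, sp_comm (E2 y) (E1 y), h12 y hy.1,
      h22 y hy.1, h24 y hy.1, sp_comm (E2 y) X0]
  have h34 : ∀ y ∈ S3, sp (E3 y) (E4 y) = 0 := by
    intro y hy
    simp [E3, T5, h04 y hy.1, h14 y hy.1, h24 y hy.1, h44 y hy.1]
  -- the signs
  obtain ⟨s, hs, hs0⟩ : ∃ s : ℝ, s * s = 1 ∧ 0 < negDet (u y₀) (s • (E1 y₀ + E2 y₀)) := by
    have hn : negDet (u y₀) (E1 y₀ + E2 y₀) ≠ 0 := by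
      intro h
      obtain ⟨c, hc⟩ := exists_eq_smul_of_negDet_eq_zero (hne y₀ hy₀) (h00 y₀ hy₀)
        (v := E1 y₀ + E2 y₀) (by simp [h01 y₀ hy1, h02 y₀ hy1])
        (by simp [h11 y₀ hy1, h22 y₀ hy1, h12 y₀ hy1, sp_comm (E2 y₀) (E1 y₀)]) h
      have := congrArg (sp (E1 y₀)) hc
      simp [h11 y₀ hy1, h12 y₀ hy1, sp_comm (E1 y₀) (u y₀), h01 y₀ hy1] at this
    rcases lt_or_gt_of_ne hn with h | h
    · exact ⟨-1, by norm_num, by rw [negDet_smul_right]; linarith⟩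
    · exact ⟨1, by norm_num, by rw [negDet_smul_right]; linarith⟩
  have hgram : ∀ t : ℝ, t * t = 1 → ∀ y ∈ S3, ∀ i j,
      sp (column (ofColumns (u y) (s • E1 y) (s • E2 y) (t • E3 y) (E4 y)) i)
        (column (ofColumns (u y) (s • E1 y) (s • E2 y) (t • E3 y) (E4 y)) j) = gram i j := by
    intro t ht y hy
    have hs' : ∀ r : ℝ, s * (s * r) = r := fun r => by rw [← mul_assoc, hs, one_mul]
    have ht' : ∀ r : ℝ, t * (t * r) = r := fun r => by rw [← mul_assoc, ht, one_mul]
    apply ofColumns_gram <;>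
      simp only [sp_smul_left, sp_smul_right, h00 y hy.1.1, h01 y hy.1, h02 y hy.1, h03 y hy,
        h04 y hy.1, h11 y hy.1, h12 y hy.1, h13 y hy, h14 y hy.1, h22 y hy.1, h23 y hy, h24 y hy.1,
        h33 y hy, h34 y hy, h44 y hy.1, hs', ht', mul_zero]
  obtain ⟨t, ht, ht0⟩ : ∃ t : ℝ, t * t = 1 ∧
      0 < (ofColumns (u y₀) (s • E1 y₀) (s • E2 y₀) (t • E3 y₀) (E4 y₀)).det := by
    have e : ∀ t : ℝ, (ofColumns (u y₀) (s • E1 y₀) (s • E2 y₀) (t • E3 y₀) (E4 y₀)).det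
        = t * (ofColumns (u y₀) (s • E1 y₀) (s • E2 y₀) (E3 y₀) (E4 y₀)).det := by
      intro t
      rw [ofColumns, ofColumns, Matrix.det_transpose, Matrix.det_transpose, det_smul_row]
    have hn := det_sq_of_isometry (hgram 1 (by norm_num) y₀ hy3)
    rw [one_smul] at hn
    rcases lt_or_ge 0 (ofColumns (u y₀) (s • E1 y₀) (s • E2 y₀) (E3 y₀) (E4 y₀)).det with h | h
    · exact ⟨1, by norm_num, by rw [e]; linarith⟩
    · refine ⟨-1, by norm_num, ?_⟩
      rw [e]
      have : (ofColumns (u y₀) (s • E1 y₀) (s • E2 y₀) (E3 y₀) (E4 y₀)).det ≠ 0 := by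
        intro h0
        rw [h0] at hn
        norm_num at hn
      have := lt_of_le_of_ne h this
      linarith
  let E := fun y => ofColumns (u y) (s • E1 y) (s • E2 y) (t • E3 y) (E4 y)
  have hEs : ∀ i j, ContDiffOn ℝ ∞ (fun y => E y i j) S3 := by
    intro i j
    have hu3 := contDiffOn_pi.1 (hu1.mono hsub) i
    have h1 := contDiffOn_pi.1 ((hE1.mono hsub).const_smul s) i
    have h2 := contDiffOn_pi.1 ((hE2.mono hsub).const_smul s) i
    have h3 := contDiffOn_pi.1 (hE3.const_smul t) i
    have h4 := contDiffOn_pi.1 (hE4.mono hsub) i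
    fin_cases j
    exacts [hu3, h1, h2, h3, h4]
  have hEdet : ContinuousOn (fun y => (E y).det) S3 := by
    have : ContinuousOn E S3 := continuousOn_pi.2 fun i => continuousOn_pi.2 fun j =>
      (hEs i j).continuousOn
    exact (continuous_id.matrix_det (A := fun M : Mat5 => M)).comp_continuousOn this
  have hEneg : ContinuousOn (fun y => negDet (u y) (s • (E1 y + E2 y))) S3 :=
    (contDiffOn_negDet (hu1.mono hsub)
      (((hE1.mono hsub).add (hE2.mono hsub)).const_smul s)).continuousOn
  refine ⟨(S3 ∩ (fun y => (E y).det) ⁻¹' Set.Ioi 0) ∩ (S3 ∩ (fun y => negDet (u y)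
    (s • (E1 y + E2 y))) ⁻¹' Set.Ioi 0), E,
    (hEdet.isOpen_inter_preimage hS3 isOpen_Ioi).inter
      (hEneg.isOpen_inter_preimage hS3 isOpen_Ioi), ⟨⟨hy3, ht0⟩, ⟨hy3, hs0⟩⟩,
    fun y hy => hy.1.1.1.1, fun i j => (hEs i j).mono fun y hy => hy.1.1, ?_⟩
  rintro y ⟨⟨hy, hpos : 0 < (E y).det⟩, -, hneg : 0 < negDet (u y) (s • (E1 y + E2 y))⟩
  have hg := hgram t ht y hy
  have c1 : column (E y) 1 = s • E1 y := rfl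
  have c2 : column (E y) 2 = s • E2 y := rfl
  have c3 : column (E y) 3 = t • E3 y := rfl
  have hE3T : sp (E3 y) (T1 y) = 0 ∧ sp (E3 y) (T2 y) = 0 := by
    have h1 := h13 y hy
    have h2 := h23 y hy
    simp only [E1, sp_smul_left] at h1
    have h1' := (mul_eq_zero.1 h1).resolve_left (inv_ne_zero (hr1 y hy.1).ne')
    refine ⟨by rw [sp_comm]; exact h1', ?_⟩
    have h2' : (√(q2 y))⁻¹ * sp (T3 y) (E3 y) = 0 := by rw [← sp_smul_left]; exact h2
    have h3 := (mul_eq_zero.1 h2').resolve_left (inv_ne_zero (hr2 y hy.1).ne')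
    simp only [T3, sp_add_left, sp_smul_left, h13 y hy, mul_zero, add_zero] at h3
    rw [sp_comm]; exact h3
  have hE3u : sp (E3 y) (pd 0 u y) = 0 ∧ sp (E3 y) (pd 1 u y) = 0 := by
    obtain ⟨h1, h2⟩ := hE3T
    simp only [T1, T2, sp_add_right, sp_smul_right] at h1 h2
    constructor
    · have : (a ^ 2 + b ^ 2) * sp (E3 y) (pd 0 u y) = 0 := by linear_combination a * h1 - b * h2
      exact (mul_eq_zero.1 this).resolve_left hab2.ne'
    · have : (a ^ 2 + b ^ 2) * sp (E3 y) (pd 1 u y) = 0 := by linear_combination b * h1 + a * h2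
      exact (mul_eq_zero.1 this).resolve_left hab2.ne'
  refine ⟨(mem_conformalGroup_iff _).2 ⟨?_, hg, ?_⟩, rfl, ?_, ?_, ?_, ?_⟩
  · have := det_sq_of_isometry hg
    change (E y).det ^ 2 = 1 at this
    nlinarith
  · rw [c1, c2, ← smul_add]; exact hneg
  · rw [c3, sp_smul_left, hE3u.1, mul_zero]
  · rw [c3, sp_smul_left, hE3u.2, mul_zero]
  · have h1 : sp (E3 y) (E4 y) = 0 := h34 y hy
    simp only [E4, L, sp_sub_right, sp_add_right, sp_smul_right, sp_comm (E3 y) (u y), h03 y hy,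
      sp_comm (E3 y) (E1 y), h13 y hy, sp_comm (E3 y) (E2 y), h23 y hy] at h1
    have hm0 : m y ≠ 0 := inv_ne_zero (hm y hy.1).ne'
    have h2 : m y * sp (E3 y) (adjLap u y) = 0 := by linear_combination -h1
    rw [c3, sp_smul_left, (mul_eq_zero.1 h2).resolve_left hm0, mul_zero]
  · rw [c1, c2]
    obtain ⟨μ, hμ⟩ : ∃ μ : ℝ, E2 y = (√(q2 y))⁻¹ • (T2 y + μ • T1 y) :=
      ⟨sp (T2 y) (E1 y) * (√(-q1 y))⁻¹, by simp only [E2, T3, mul_smul]; rfl⟩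
    have hE1y : E1 y = (√(-q1 y))⁻¹ • T1 y := rfl
    have e : sp (s • E1 y) (pd 0 u y) * sp (s • E2 y) (pd 1 u y)
        - sp (s • E1 y) (pd 1 u y) * sp (s • E2 y) (pd 0 u y)
        = (s * s) * ((√(-q1 y))⁻¹ * (√(q2 y))⁻¹ * (a ^ 2 + b ^ 2)) * metricDet u y := by
      rw [hμ, hE1y]
      simp only [T1, T2, metricDet, sp_add_left, sp_smul_left, sp_comm (pd 1 u y) (pd 0 u y)]
      ring
    rw [e, hs]
    have h1 := hr1 y hy.1
    have h2 := hr2 y hy.1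
    exact mul_neg_of_pos_of_neg (by positivity) (hdet y hy.1.1)

section Surface

variable {X : Type*} [TopologicalSpace X] [ChartedSpace (EuclideanSpace ℝ (Fin 2)) X]
  {f : X → R23} {o : TangentOrientation X}

/-- In a positive chart, the frame of `exists_frame_of_immersion` is a second order frame field: its
vector `F₃` is the Gauss vector. -/
theorem exists_secondOrderFrame (hf : IsTimelikeImmersion f) (ho : IsOrientation o) (x₀ : X) :
    ∃ (U : Set X) (F : X → Mat5), x₀ ∈ U ∧ IsSecondOrderFrame o f U F := by
  obtain ⟨e, he, hx₀, hpos⟩ := ho x₀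
  obtain ⟨y₀, hy₀, rfl⟩ := exists_symm_eq hx₀
  have hs := contDiffOn_comp_symm_target hf.smooth he
  obtain ⟨⟨v, hv⟩, -⟩ := hf.lorentzian (e.symm y₀)
  obtain ⟨a, b, rfl⟩ := exists_eq_coordVec he hy₀ v
  have hm := fun x => (hf.smooth x).mdifferentiableAt (by simp : (∞ : WithTop ℕ∞) ≠ 0)
  simp only [inducedMetric, map_add, map_smul, dVec_coordVec he hy₀ (hm _)] at hv
  obtain ⟨Ω, E, hΩ, hyΩ, hsub, hE, hEp⟩ := exists_frame_of_immersion e.open_target hs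
    (fun y _ => sp_self_of_mem_einstein (hf.mem _)) (fun y _ => ne_zero_of_mem_einstein (hf.mem _))
    (fun y hy => (immersion_chart hf he hy).1) (fun y hy => metricDet_neg hf he hy)
    (fun y hy => sp_adjLap hf he hy) hy₀ hv
  have hUo : IsOpen (e.source ∩ e ⁻¹' Ω) := e.isOpen_inter_preimage hΩ
  have hconf : IsConformalFrame f (e.source ∩ e ⁻¹' Ω) (fun x => E (e x)) := by
    refine ⟨hUo, fun i j => ?_, fun x hx => (hEp _ hx.2).1, fun x hx => ⟨1, one_pos, ?_⟩⟩
    · exact (contMDiffOn_iff_contDiffOn.2 (hE i j)).comp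
        ((contMDiffOn_of_mem_maximalAtlas he).mono Set.inter_subset_left) fun x hx => hx.2
    · rw [(hEp _ hx.2).2.1, e.left_inv hx.1, one_smul]
  have hdf : ∀ y ∈ Ω, ∀ i : Fin 2, dVec f (e.symm y) (coordVec e y i)
      = pd i (fun z => f (e.symm z)) y := fun y hy i => dVec_coordVec he (hsub hy) (hm _) i
  have hmem : ∀ y ∈ Ω, e.symm y ∈ e.source ∩ e ⁻¹' Ω := fun y hy =>
    ⟨e.map_target (hsub hy), by simpa [e.right_inv (hsub hy)] using hy⟩
  have hcol : ∀ y ∈ Ω, ∀ k i, (gram k 0 = 0) → sp (column (E (e (e.symm y))) k)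
      (dVec (fun x => column (E (e x)) 0) (e.symm y) (coordVec e y i))
      = sp (column (E y) k) (pd i (fun z => f (e.symm z)) y) := by
    intro y hy k i hk
    rw [hconf.sp_dVec_zero hf (hmem y hy) (c := 1) _ hk, hdf y hy, one_mul, e.right_inv (hsub hy)]
    rw [one_smul, e.right_inv (hsub hy)]
    exact (hEp _ hy).2.1
  have hfirst : IsFirstOrderFrame o f (e.source ∩ e ⁻¹' Ω) (fun x => E (e x)) := by
    refine ⟨hconf, ?_, ?_⟩
    · intro x hx v
      obtain ⟨y, hy, rfl⟩ := exists_symm_eq hx.1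
      have hyΩ : y ∈ Ω := by simpa [e.right_inv hy] using hx.2
      obtain ⟨a, b, rfl⟩ := exists_eq_coordVec he hy v
      rw [hconf.phi_eq hx]
      change sp _ _ = 0
      simp only [map_add, map_smul, sp_add_right, sp_smul_right]
      rw [hcol y hyΩ 3 0 (by simp [gram]), hcol y hyΩ 3 1 (by simp [gram])]
      rw [(hEp y hyΩ).2.2.1, (hEp y hyΩ).2.2.2.1]
      simp
    · intro x hx v w hvw
      obtain ⟨y, hy, rfl⟩ := exists_symm_eq hx.1
      have hyΩ : y ∈ Ω := by simpa [e.right_inv hy] using hx.2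
      obtain ⟨a, b, rfl⟩ := exists_eq_coordVec he hy v
      obtain ⟨c, d, rfl⟩ := exists_eq_coordVec he hy w
      rw [isPositivePair_iff (hpos y hy)] at hvw
      simp only [hconf.phi_eq hx]
      change 0 < -sp _ _ * sp _ _ - -sp _ _ * sp _ _
      simp only [map_add, map_smul, sp_add_right, sp_smul_right]
      rw [hcol y hyΩ 1 0 (by simp [gram]), hcol y hyΩ 1 1 (by simp [gram]),
        hcol y hyΩ 2 0 (by simp [gram]), hcol y hyΩ 2 1 (by simp [gram])]
      have := mul_pos hvw (neg_pos.2 (hEp y hyΩ).2.2.2.2.2)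
      linarith
  refine ⟨_, _, hmem y₀ hyΩ, hfirst, ?_⟩
  intro x hx v w
  obtain ⟨y, hy, rfl⟩ := exists_symm_eq hx.1
  have hyΩ : y ∈ Ω := by simpa [e.right_inv hy] using hx.2
  have key := (hfirst.second_iff hf he hy hx (hpos y hy)).2 (by
    have hg := ((mem_conformalGroup_iff _).1 (hEp y hyΩ).1)
    obtain ⟨-, h0, hp0, hp1, hpl, hd⟩ := hEp y hyΩ
    have hperp := hg.2.1 3 0
    rw [h0] at hperp
    rw [e.right_inv hy]
    refine ⟨by simpa [gram] using hg.2.1 3 3, by simpa [gram] using hperp, hp0, hp1, hpl, ?_⟩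
    have h0i := (immersion_chart hf he hy).1
    rw [det_frame_rows hg.2.1 one_ne_zero (by rw [h0, one_smul])
      (by rw [h0]; exact h0i 0) hp0 (by rw [h0]; exact h0i 1) hp1, hg.1, h0, sp_adjLap hf he hy]
    have := metricDet_neg hf he hy
    nlinarith)
  have hlin : ∀ i j, ∀ a b : ℝ, phi (fun x => E (e x)) i j (e.symm y)
      (a • coordVec e y 0 + b • coordVec e y 1)
      = a * phi (fun x => E (e x)) i j (e.symm y) (coordVec e y 0)
        + b * phi (fun x => E (e x)) i j (e.symm y) (coordVec e y 1) := by
    intro i j a b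
    simp only [hconf.phi_eq hx, map_add, map_smul, sp_add_right, sp_smul_right]
    fin_cases i <;> simp <;> ring
  obtain ⟨a, b, rfl⟩ := exists_eq_coordVec he hy v
  obtain ⟨c, d, rfl⟩ := exists_eq_coordVec he hy w
  simp only [hlin]
  linear_combination (a * d - b * c) * key

end Surface

section Surface

variable {X : Type*} [TopologicalSpace X] [ChartedSpace (EuclideanSpace ℝ (Fin 2)) X]
  {f : X → R23} {o : TangentOrientation X}

/-! ### The conformal Gauss map of a quasi-umbilical immersion -/

theorem IsSecondOrderFrame.isGaussVector (hf : IsTimelikeImmersion f) {U : Set X} {F : X → Mat5}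
    (hF : IsSecondOrderFrame o f U F) {e : OpenPartialHomeomorph X (EuclideanSpace ℝ (Fin 2))}
    (he : e ∈ IsManifold.maximalAtlas (𝓡 2) ∞ X) {y : EuclideanSpace ℝ (Fin 2)}
    (hy : y ∈ e.target) (hx : e.symm y ∈ U)
    (hpos : IsPositivePair o (e.symm y) (coordVec e y 0) (coordVec e y 1)) :
    IsGaussVector (fun z => f (e.symm z)) y (column (F (e.symm y)) 3) :=
  (hF.toIsFirstOrderFrame.second_iff hf he hy hx hpos).1 (hF.second _ hx _ _)

/-- The vector `F₃` of a second order frame does not depend on the frame. -/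
theorem IsSecondOrderFrame.conformalGaussMap_eq (hf : IsTimelikeImmersion f)
    (ho : IsOrientation o) {U : Set X} {F : X → Mat5} (hF : IsSecondOrderFrame o f U F) {x : X}
    (hx : x ∈ U) : conformalGaussMap o f x = column (F x) 3 := by
  obtain ⟨U', F', hx', hF', h⟩ := Classical.epsilon_spec
    (p := fun N : R23 => ∃ (U : Set X) (F : X → Mat5), x ∈ U ∧ IsSecondOrderFrame o f U F ∧
      N = column (F x) 3) ⟨_, U, F, hx, hF, rfl⟩
  obtain ⟨e, he, hxe, hpos⟩ := ho x
  obtain ⟨y, hy, rfl⟩ := exists_symm_eq hxe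
  exact h.trans ((hF'.isGaussVector hf he hy hx' (hpos y hy)).unique
    (hF.isGaussVector hf he hy hx (hpos y hy)))

/-- The Gauss map is smooth because it is locally the column `F₃` of a smooth frame. -/
theorem contMDiff_conformalGaussMap (hf : IsTimelikeImmersion f) (ho : IsOrientation o) :
    ContMDiff (𝓡 2) 𝓘(ℝ, R23) ∞ (conformalGaussMap o f) := by
  intro x
  obtain ⟨U, F, hx, hF⟩ := exists_secondOrderFrame hf ho x
  refine ((hF.contMDiffOn_column 3).contMDiffAt (hF.isOpen.mem_nhds hx)).congr_of_eventuallyEq ?_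
  filter_upwards [hF.isOpen.mem_nhds hx] with z hz using hF.conformalGaussMap_eq hf ho hz

theorem conformalGaussMap_mem (hf : IsTimelikeImmersion f) (ho : IsOrientation o) (x : X) :
    sp (conformalGaussMap o f x) (conformalGaussMap o f x) = 1 := by
  obtain ⟨U, F, hx, hF⟩ := exists_secondOrderFrame hf ho x
  rw [hF.conformalGaussMap_eq hf ho hx]
  simpa [gram] using hF.gram hx 3 3

/-- The 1-form `v ↦ f ∧ d𝒩(v)`, measured by the time-orientation determinant. For a
quasi-umbilical immersion it vanishes nowhere, and its kernel is the kernel of `d𝒩`. -/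
noncomputable def gaussForm (o : TangentOrientation X) (f : X → R23) (x : X)
    (v : TangentSpace (𝓡 2) x) : ℝ :=
  negDet (f x) (dVec (conformalGaussMap o f) x v)

theorem gaussForm_add (x : X) (v w : TangentSpace (𝓡 2) x) :
    gaussForm o f x (v + w) = gaussForm o f x v + gaussForm o f x w := by
  simp [gaussForm]

theorem gaussForm_smul (x : X) (c : ℝ) (v : TangentSpace (𝓡 2) x) :
    gaussForm o f x (c • v) = c * gaussForm o f x v := by
  simp [gaussForm]

/-- The first order structure of the conformal Gauss map of a quasi-umbilical immersion at a point:
`d𝒩 = ω n` where `ω` is the Gauss form, `n` is null and tangent to the surface modulo `f`, and the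
second fundamental form in the direction of `𝒩` is the multiple `l ω²` of the square of `ω`. -/
structure IsGaussDirection (o : TangentOrientation X) (f : X → R23) (x : X) (n : R23) (l : ℝ) :
    Prop where
  ne_zero : l ≠ 0
  dgauss : ∀ v, dVec (conformalGaussMap o f) x v = gaussForm o f x v • n
  second : ∀ v, sp n (dVec f x v) = -l * gaussForm o f x v
  null : sp n n = 0
  perp : sp n (f x) = 0
  perp_gauss : sp n (conformalGaussMap o f x) = 0
  normalized : negDet (f x) n = 1
  exists_ne : ∃ v, gaussForm o f x v ≠ 0
  tangent : ∃ (V : TangentSpace (𝓡 2) x) (c : ℝ), n = dVec f x V + c • f x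
  kernel_null : ∀ v, gaussForm o f x v = 0 → sp (dVec f x v) (dVec f x v) = 0

/-- The linear algebra of the Gauss map at a point. Here `h00`, `h01`, `h11` are the coefficients of
the second fundamental form `-⟨d𝒩, df⟩`, and the vectors `Nij` are the second derivatives of the
Gauss map. -/
theorem exists_direction {u u0 u1 N L N0 N1 : R23} {N00 N01 N11 : R23} {h00 h01 h11 : ℝ}
    (hdet : (Matrix.of ![u, u0, u1, N, L]).det ≠ 0)
    (huu : sp u u = 0) (hu : u ≠ 0) (hu0 : sp u u0 = 0) (hu1 : sp u u1 = 0) (huL : sp u L ≠ 0)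
    (hNN : sp N N = 1) (hNu : sp N u = 0) (hN0 : sp N u0 = 0) (hN1 : sp N u1 = 0)
    (hn0 : sp N0 N = 0) (hn1 : sp N1 N = 0) (hn0u : sp N0 u = 0) (hn1u : sp N1 u = 0)
    (h0 : sp N0 N0 = 0) (h01' : sp N0 N1 = 0) (h1 : sp N1 N1 = 0)
    (e00 : sp N0 u0 = -h00) (e01 : sp N0 u1 = -h01) (e10 : sp N1 u0 = -h01)
    (e11 : sp N1 u1 = -h11)
    (htr : sp u1 u1 * h00 - 2 * sp u0 u1 * h01 + sp u0 u0 * h11 = 0)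
    (f000 : sp N00 N0 = 0) (f001 : sp N00 N1 = 0) (f010 : sp N01 N0 = 0) (f011 : sp N01 N1 = 0)
    (f110 : sp N11 N0 = 0) (f111 : sp N11 N1 = 0)
    (k00 : sp N00 u = h00) (k01 : sp N01 u = h01) (k11 : sp N11 u = h11)
    (hD : negDet u N0 ≠ 0 ∨ negDet u N1 ≠ 0) :
    ∃ n l, l ≠ 0 ∧ N0 = negDet u N0 • n ∧ N1 = negDet u N1 • n ∧
      sp n u0 = -l * negDet u N0 ∧ sp n u1 = -l * negDet u N1 ∧ sp n n = 0 ∧ sp n u = 0 ∧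
      sp n N = 0 ∧ negDet u n = 1 ∧ (∃ a b c : ℝ, n = a • u0 + b • u1 + c • u) ∧
      sp u1 u1 * negDet u N0 ^ 2 - 2 * sp u0 u1 * (negDet u N0 * negDet u N1)
        + sp u0 u0 * negDet u N1 ^ 2 = 0 := by
  set D0 := negDet u N0 with hD0
  set D1 := negDet u N1 with hD1
  -- the second fundamental form does not vanish
  have hh : ¬(h00 = 0 ∧ h01 = 0 ∧ h11 = 0) := by
    rintro ⟨z00, z01, z11⟩
    have key : ∀ w : R23, sp w u = 0 → sp w u0 = 0 → sp w u1 = 0 → sp w N = 0 →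
        negDet u w = 0 := by
      intro w w1 w2 w3 w4
      have : w - (sp w L / sp u L) • u = 0 := by
        apply eq_zero_of_sp_five hdet <;>
          simp [w1, w2, w3, w4, huu, hu0, hu1, sp_comm u N, hNu, huL]
      rw [sub_eq_zero.1 this]
      simp
    rcases hD with h | h
    · exact h (key N0 hn0u (by rw [e00, z00, neg_zero]) (by rw [e01, z01, neg_zero]) hn0)
    · exact h (key N1 hn1u (by rw [e10, z01, neg_zero]) (by rw [e11, z11, neg_zero]) hn1)
  -- `f`, `N₀`, `N₁` span an isotropic subspace, which is at most two-dimensional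
  have hrank : D1 • N0 = D0 • N1 := by
    obtain ⟨c, hc⟩ := exists_eq_smul_of_negDet_eq_zero (v := D1 • N0 - D0 • N1) hu huu
      (by simp [sp_comm u, hn0u, hn1u]) (by simp [h0, h1, h01', sp_comm N1 N0])
      (by simp [← hD0, ← hD1]; ring)
    have hc0 : c = 0 := by
      by_contra hne
      apply hh
      have g : ∀ M : R23, sp M N0 = 0 → sp M N1 = 0 → sp M u = 0 := by
        intro M m0 m1
        have := congrArg (sp M) hc
        simp [m0, m1, hne] at this
        exact this
      exact ⟨k00 ▸ g N00 f000 f001, k01 ▸ g N01 f010 f011, k11 ▸ g N11 f110 f111⟩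
    rw [hc0, zero_smul] at hc
    exact sub_eq_zero.1 hc
  obtain ⟨n, hn0', hn1', hnn, hnu, hnN, hnD⟩ : ∃ n, N0 = D0 • n ∧ N1 = D1 • n ∧ sp n n = 0 ∧
      sp n u = 0 ∧ sp n N = 0 ∧ negDet u n = 1 := by
    rcases hD with h | h
    · refine ⟨D0⁻¹ • N0, ?_, ?_, by simp [h0], by simp [hn0u], by simp [hn0], ?_⟩
      · rw [smul_smul, mul_inv_cancel₀ h, one_smul]
      · rw [smul_smul, mul_comm, mul_smul, hrank, smul_smul, inv_mul_cancel₀ h, one_smul]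
      · rw [negDet_smul_right, ← hD0, inv_mul_cancel₀ h]
    · refine ⟨D1⁻¹ • N1, ?_, ?_, by simp [h1], by simp [hn1u], by simp [hn1], ?_⟩
      · rw [smul_smul, mul_comm, mul_smul, ← hrank, smul_smul, inv_mul_cancel₀ h, one_smul]
      · rw [smul_smul, mul_inv_cancel₀ h, one_smul]
      · rw [negDet_smul_right, ← hD1, inv_mul_cancel₀ h]
  have g00 : D0 * sp n u0 = -h00 := by rw [← sp_smul_left, ← hn0', e00]
  have g01 : D0 * sp n u1 = -h01 := by rw [← sp_smul_left, ← hn0', e01]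
  have g10 : D1 * sp n u0 = -h01 := by rw [← sp_smul_left, ← hn1', e10]
  have g11 : D1 * sp n u1 = -h11 := by rw [← sp_smul_left, ← hn1', e11]
  obtain ⟨l, l0, l1⟩ : ∃ l, sp n u0 = -l * D0 ∧ sp n u1 = -l * D1 := by
    rcases hD with h | h
    · refine ⟨-sp n u0 / D0, ?_, ?_⟩ <;> field_simp
      linarith
    · refine ⟨-sp n u1 / D1, ?_, ?_⟩ <;> field_simp
      linarith
  rw [l0] at g00 g10
  rw [l1] at g01 g11
  have hl : l ≠ 0 := by
    rintro rfl
    apply hh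
    refine ⟨?_, ?_, ?_⟩ <;> linarith
  refine ⟨n, l, hl, hn0', hn1', l0, l1, hnn, hnu, hnN, hnD, ?_, ?_⟩
  · -- expand `n` in the basis `u, u₀, u₁, N, L`
    have hB : IsUnit (Matrix.of ![u, u0, u1, N, L]) := by
      rw [Matrix.isUnit_iff_isUnit_det]; exact hdet.isUnit
    obtain ⟨w, hw⟩ := (Matrix.vecMul_surjective_iff_isUnit.2 hB) n
    have hw' : n = w 0 • u + w 1 • u0 + w 2 • u1 + w 3 • N + w 4 • L := by
      rw [← hw]
      ext i
      simp [Matrix.vecMul, dotProduct, Fin.sum_univ_five]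
    have h4 : w 4 = 0 := by
      have := congrArg (fun v => sp v u) hw'
      simp only [hnu, sp_add_left, sp_smul_left, huu, sp_comm u0 u, hu0, sp_comm u1 u, hu1, hNu,
        sp_comm L u] at this
      have : w 4 * sp u L = 0 := by linarith
      exact (mul_eq_zero.1 this).resolve_right huL
    have h3 : w 3 = 0 := by
      have := congrArg (fun v => sp v N) hw'
      simp only [hnN, sp_add_left, sp_smul_left, sp_comm u N, hNu, sp_comm u0 N, hN0,
        sp_comm u1 N, hN1, hNN, h4] at this
      linarith
    refine ⟨w 1, w 2, w 0, ?_⟩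
    conv_lhs => rw [hw', h3, h4]
    module
  · have : l * (sp u1 u1 * D0 ^ 2 - 2 * sp u0 u1 * (D0 * D1) + sp u0 u0 * D1 ^ 2) = 0 := by
      linear_combination htr - sp u1 u1 * g00 + 2 * sp u0 u1 * g01 - sp u0 u0 * g11
    exact (mul_eq_zero.1 this).resolve_left hl

theorem exists_isGaussDirection (hf : IsTimelikeImmersion f) (ho : IsOrientation o)
    (hq : IsQuasiUmbilical o f) (x : X) : ∃ n l, IsGaussDirection o f x n l := by
  obtain ⟨e, he, hxe, hpos⟩ := ho x
  obtain ⟨y, hy, rfl⟩ := exists_symm_eq hxe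
  have ho' := e.open_target
  have hfs := contDiffOn_comp_symm_target hf.smooth he
  have hNs := contDiffOn_comp_symm_target (contMDiff_conformalGaussMap hf ho) he
  have hfm := fun x => (hf.smooth x).mdifferentiableAt (by simp : (∞ : WithTop ℕ∞) ≠ 0)
  have hNm := fun x => (contMDiff_conformalGaussMap hf ho x).mdifferentiableAt
    (by simp : (∞ : WithTop ℕ∞) ≠ 0)
  set u : EuclideanSpace ℝ (Fin 2) → R23 := fun z => f (e.symm z) with hu
  set N : EuclideanSpace ℝ (Fin 2) → R23 := fun z => conformalGaussMap o f (e.symm z) with hN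
  have hdf : ∀ z ∈ e.target, ∀ i, dVec f (e.symm z) (coordVec e z i) = pd i u z :=
    fun z hz i => dVec_coordVec he hz (hfm _) i
  have hdN : ∀ z ∈ e.target, ∀ i,
      dVec (conformalGaussMap o f) (e.symm z) (coordVec e z i) = pd i N z :=
    fun z hz i => dVec_coordVec he hz (hNm _) i
  have hG : ∀ z ∈ e.target, IsGaussVector u z (N z) := by
    intro z hz
    obtain ⟨U, F, hx, hF⟩ := exists_secondOrderFrame hf ho (e.symm z)
    have := hF.isGaussVector hf he hz hx (hpos z hz)
    rwa [← hF.conformalGaussMap_eq hf ho hx] at this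
  have du : ∀ z ∈ e.target, DifferentiableAt ℝ u z := fun z hz =>
    (hfs.contDiffAt (ho'.mem_nhds hz)).differentiableAt (by simp)
  have dN : ∀ z ∈ e.target, DifferentiableAt ℝ N z := fun z hz =>
    (hNs.contDiffAt (ho'.mem_nhds hz)).differentiableAt (by simp)
  have dui : ∀ z ∈ e.target, ∀ i, DifferentiableAt ℝ (pd i u) z := fun z hz i =>
    ((contDiffOn_pd ho' hfs i).contDiffAt (ho'.mem_nhds hz)).differentiableAt (by simp)
  have dNi : ∀ z ∈ e.target, ∀ i, DifferentiableAt ℝ (pd i N) z := fun z hz i =>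
    ((contDiffOn_pd ho' hNs i).contDiffAt (ho'.mem_nhds hz)).differentiableAt (by simp)
  have ev : ∀ z ∈ e.target, ∀ {p : EuclideanSpace ℝ (Fin 2) → Prop}, (∀ z ∈ e.target, p z) →
      ∀ᶠ z in nhds z, p z := fun z hz p hp => by
    filter_upwards [ho'.mem_nhds hz] with w hw using hp w hw
  obtain ⟨hf1, hf2⟩ := immersion_chart hf he hy
  have hNN : ∀ z ∈ e.target, ∀ i, sp (pd i N z) (N z) = 0 := by
    intro z hz i
    have := sp_pd_eq_neg (dN z hz) (dN z hz) (c := 1) (ev z hz fun w hw => (hG w hw).unit) i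
    rw [sp_comm (N z)] at this
    linarith
  have hperp : ∀ z ∈ e.target, ∀ i, sp (N z) (pd i u z) = 0 := by
    intro z hz i
    fin_cases i
    exacts [(hG z hz).perp0, (hG z hz).perp1]
  have hNu : ∀ z ∈ e.target, ∀ i, sp (pd i N z) (u z) = 0 := by
    intro z hz i
    rw [sp_pd_eq_neg (dN z hz) (du z hz) (c := 0) (ev z hz fun w hw => (hG w hw).perp) i,
      hperp z hz, neg_zero]
  have hiso : ∀ z ∈ e.target, ∀ i j, sp (pd i N z) (pd j N z) = 0 := by
    intro z hz i j
    rw [← hdN z hz, ← hdN z hz]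
    exact (hq _).1 _ _
  have hh : ∀ i j, sp (pd i N y) (pd j u y) = -sp (N y) (pd i (pd j u) y) := fun i j =>
    sp_pd_eq_neg (dN y hy) (dui y hy j) (c := 0) (ev y hy fun w hw => hperp w hw j) i
  have hk : ∀ i j, sp (pd i (pd j N) y) (u y) = sp (N y) (pd j (pd i u) y) := fun i j => by
    rw [sp_pd_eq_neg (dNi y hy j) (du y hy) (c := 0) (ev y hy fun w hw => hNu w hw j) i, hh,
      neg_neg]
  -- the cubic form `⟨∂ᵢ∂ⱼN, ∂ₖN⟩` is symmetric in `i, j` and skew in `j, k`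
  have hskew : ∀ i j k, sp (pd i (pd j N) y) (pd k N y) = -sp (pd i (pd k N) y) (pd j N y) :=
    fun i j k => by
      rw [sp_pd_eq_neg (dNi y hy j) (dNi y hy k) (c := 0) (ev y hy fun w hw => hiso w hw j k) i,
        sp_comm]
  have hcub : ∀ i j k, sp (pd i (pd j N) y) (pd k N y) = 0 := by
    intro i j k
    have h1 := hskew i j k
    have h2 := hskew k i j
    have h3 := hskew j k i
    rw [pd_comm ho' hNs hy i k] at h1
    rw [pd_comm ho' hNs hy k j] at h2
    rw [pd_comm ho' hNs hy j i] at h3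
    linarith
  have hD : negDet (u y) (pd 0 N y) ≠ 0 ∨ negDet (u y) (pd 1 N y) ≠ 0 := by
    by_contra hcon
    push Not at hcon
    obtain ⟨v, hv⟩ := (hq (e.symm y)).2
    obtain ⟨a, b, rfl⟩ := exists_eq_coordVec he hy v
    have hne := ne_zero_of_mem_einstein (hf.mem (e.symm y))
    have huu := sp_self_of_mem_einstein (hf.mem (e.symm y))
    obtain ⟨c, hc⟩ := exists_eq_smul_of_negDet_eq_zero hne huu (v := pd 0 N y)
      (by rw [sp_comm]; exact hNu y hy 0) (hiso y hy 0 0).le hcon.1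
    obtain ⟨d, hd⟩ := exists_eq_smul_of_negDet_eq_zero hne huu (v := pd 1 N y)
      (by rw [sp_comm]; exact hNu y hy 1) (hiso y hy 1 1).le hcon.2
    rw [map_add, map_smul, map_smul, hdN y hy, hdN y hy, hc, hd] at hv
    have := LinearIndependent.pair_iff.1 hv (a * c + b * d) (-1) (by module)
    norm_num at this
  have hlap : sp (N y) (adjLap u y) = 0 := (hG y hy).perp_lap
  have hdet := metricDet_neg hf he hy
  have hlap2 := sp_adjLap hf he hy
  obtain ⟨n, l, hl, n0, n1, l0, l1, hnn, hnu, hnN, hnD, ⟨a, b, c, hn⟩, hnull⟩ :=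
    exists_direction (u := u y) (u0 := pd 0 u y) (u1 := pd 1 u y) (N := N y) (L := adjLap u y)
      (N0 := pd 0 N y) (N1 := pd 1 N y) (N00 := pd 0 (pd 0 N) y) (N01 := pd 0 (pd 1 N) y)
      (N11 := pd 1 (pd 1 N) y) (h00 := sp (N y) (pd 0 (pd 0 u) y))
      (h01 := sp (N y) (pd 0 (pd 1 u) y)) (h11 := sp (N y) (pd 1 (pd 1 u) y))
      (hG y hy).det_neg.ne (sp_self_of_mem_einstein (hf.mem _)) (ne_zero_of_mem_einstein (hf.mem _))
      (hf1 0) (hf1 1) (by rw [hlap2]; linarith) (hG y hy).unit (hG y hy).perp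
      (hG y hy).perp0 (hG y hy).perp1 (hNN y hy 0) (hNN y hy 1) (hNu y hy 0) (hNu y hy 1)
      (hiso y hy 0 0) (hiso y hy 0 1) (hiso y hy 1 1) (hh 0 0) (hh 0 1)
      (by rw [hh, pd_comm ho' hfs hy]) (hh 1 1)
      (by
        rw [adjLap] at hlap
        simp only [sp_add_right, sp_sub_right, sp_smul_right] at hlap
        linarith)
      (hcub 0 0 0) (hcub 0 0 1) (hcub 0 1 0) (hcub 0 1 1) (hcub 1 1 0) (hcub 1 1 1)
      (hk 0 0) (by rw [hk, pd_comm ho' hfs hy]) (hk 1 1) hD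
  have hom : ∀ i, gaussForm o f (e.symm y) (coordVec e y i) = negDet (u y) (pd i N y) := by
    intro i
    rw [gaussForm, hdN y hy]
  refine ⟨n, l, hl, ?_, ?_, hnn, hnu, hnN, hnD, ?_, ⟨a • coordVec e y 0 + b • coordVec e y 1, c, ?_⟩,
    ?_⟩
  · intro v
    obtain ⟨a, b, rfl⟩ := exists_eq_coordVec he hy v
    rw [gaussForm_add, gaussForm_smul, gaussForm_smul, map_add, map_smul, map_smul, hdN y hy,
      hdN y hy, hom, hom, add_smul, mul_smul, mul_smul, ← n0, ← n1]
  · intro v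
    obtain ⟨a, b, rfl⟩ := exists_eq_coordVec he hy v
    rw [gaussForm_add, gaussForm_smul, gaussForm_smul, map_add, map_smul, map_smul, hdf y hy,
      hdf y hy, hom, hom, sp_add_right, sp_smul_right, sp_smul_right, l0, l1]
    ring
  · rcases hD with h | h
    · exact ⟨coordVec e y 0, by rwa [hom]⟩
    · exact ⟨coordVec e y 1, by rwa [hom]⟩
  · rw [map_add, map_smul, map_smul, hdf y hy, hdf y hy, hn]
  · intro v
    obtain ⟨a, b, rfl⟩ := exists_eq_coordVec he hy v
    rw [gaussForm_add, gaussForm_smul, gaussForm_smul, hom, hom, map_add, map_smul, map_smul,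
      hdf y hy, hdf y hy]
    intro hv
    simp only [sp_add_left, sp_add_right, sp_smul_left, sp_smul_right,
      sp_comm (pd 1 u y) (pd 0 u y)]
    rcases hD with h | h
    · have : negDet (u y) (pd 0 N y) ^ 2 * (a * (a * sp (pd 0 u y) (pd 0 u y))
        + b * (a * sp (pd 0 u y) (pd 1 u y)) + (a * (b * sp (pd 0 u y) (pd 1 u y))
        + b * (b * sp (pd 1 u y) (pd 1 u y)))) = 0 := by
        linear_combination b ^ 2 * hnull + (sp (pd 0 u y) (pd 0 u y)
          * (a * negDet (u y) (pd 0 N y) - b * negDet (u y) (pd 1 N y))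
          + 2 * sp (pd 0 u y) (pd 1 u y) * b * negDet (u y) (pd 0 N y)) * hv
      have := (mul_eq_zero.1 this).resolve_left (pow_ne_zero 2 h)
      linarith
    · have : negDet (u y) (pd 1 N y) ^ 2 * (a * (a * sp (pd 0 u y) (pd 0 u y))
        + b * (a * sp (pd 0 u y) (pd 1 u y)) + (a * (b * sp (pd 0 u y) (pd 1 u y))
        + b * (b * sp (pd 1 u y) (pd 1 u y)))) = 0 := by
        linear_combination a ^ 2 * hnull + (sp (pd 1 u y) (pd 1 u y)
          * (b * negDet (u y) (pd 1 N y) - a * negDet (u y) (pd 0 N y))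
          + 2 * sp (pd 0 u y) (pd 1 u y) * a * negDet (u y) (pd 1 N y)) * hv
      have := (mul_eq_zero.1 this).resolve_left (pow_ne_zero 2 h)
      linarith

end Surface

section Surface

variable {X : Type*} [TopologicalSpace X] [ChartedSpace (EuclideanSpace ℝ (Fin 2)) X]
  {f : X → R23} {o : TangentOrientation X}

/-! ### Harmonicity of the conformal Gauss map -/

/-- The Gauss map and its direction in a chart. -/
theorem pd_conformalGaussMap (hf : IsTimelikeImmersion f) (ho : IsOrientation o)
    {e : OpenPartialHomeomorph X (EuclideanSpace ℝ (Fin 2))}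
    (he : e ∈ IsManifold.maximalAtlas (𝓡 2) ∞ X) {y : EuclideanSpace ℝ (Fin 2)}
    (hy : y ∈ e.target) (i : Fin 2) :
    pd i (fun z => conformalGaussMap o f (e.symm z)) y
      = dVec (conformalGaussMap o f) (e.symm y) (coordVec e y i) :=
  (dVec_coordVec he hy ((contMDiff_conformalGaussMap hf ho _).mdifferentiableAt (by simp)) i).symm

theorem metricMatrix_apply (f : X → R23) (e : OpenPartialHomeomorph X (EuclideanSpace ℝ (Fin 2)))
    (y : EuclideanSpace ℝ (Fin 2)) (i j : Fin 2) : metricMatrix f e y i j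
      = sp (dVec f (e.symm y) (coordVec e y i)) (dVec f (e.symm y) (coordVec e y j)) := rfl

theorem metricMatrix_comm (f : X → R23) (e : OpenPartialHomeomorph X (EuclideanSpace ℝ (Fin 2)))
    (y : EuclideanSpace ℝ (Fin 2)) (i j : Fin 2) :
    metricMatrix f e y i j = metricMatrix f e y j i := by
  rw [metricMatrix_apply, metricMatrix_apply, sp_comm]

theorem metricMatrix_eq (hf : IsTimelikeImmersion f)
    {e : OpenPartialHomeomorph X (EuclideanSpace ℝ (Fin 2))}
    (he : e ∈ IsManifold.maximalAtlas (𝓡 2) ∞ X) {y : EuclideanSpace ℝ (Fin 2)}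
    (hy : y ∈ e.target) (i j : Fin 2) : metricMatrix f e y i j
      = sp (pd i (fun z => f (e.symm z)) y) (pd j (fun z => f (e.symm z)) y) := by
  have hm := (hf.smooth (e.symm y)).mdifferentiableAt (by simp)
  rw [metricMatrix_apply, dVec_coordVec he hy hm, dVec_coordVec he hy hm]

theorem contDiffOn_metricMatrix (hf : IsTimelikeImmersion f)
    {e : OpenPartialHomeomorph X (EuclideanSpace ℝ (Fin 2))}
    (he : e ∈ IsManifold.maximalAtlas (𝓡 2) ∞ X) (i j : Fin 2) :
    ContDiffOn ℝ ∞ (fun y => metricMatrix f e y i j) e.target := by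
  have hs := contDiffOn_comp_symm_target hf.smooth he
  exact (contDiffOn_sp (contDiffOn_pd e.open_target hs i) (contDiffOn_pd e.open_target hs j)).congr
    fun y hy => metricMatrix_eq hf he hy i j

theorem det_metricMatrix_neg (hf : IsTimelikeImmersion f)
    {e : OpenPartialHomeomorph X (EuclideanSpace ℝ (Fin 2))}
    (he : e ∈ IsManifold.maximalAtlas (𝓡 2) ∞ X) {y : EuclideanSpace ℝ (Fin 2)}
    (hy : y ∈ e.target) : (metricMatrix f e y).det < 0 := by
  have h := metricDet_neg hf he hy
  rw [metricDet] at h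
  rw [Matrix.det_fin_two, metricMatrix_comm f e y 1 0]
  simp only [metricMatrix_eq hf he hy]
  linarith

theorem inv_fin_two (A : Matrix (Fin 2) (Fin 2) ℝ) :
    A⁻¹ 0 0 = A.det⁻¹ * A 1 1 ∧ A⁻¹ 0 1 = -(A.det⁻¹ * A 0 1) ∧ A⁻¹ 1 0 = -(A.det⁻¹ * A 1 0) ∧
      A⁻¹ 1 1 = A.det⁻¹ * A 0 0 := by
  rw [Matrix.inv_def, Matrix.adjugate_fin_two, Ring.inverse_eq_inv']
  simp

/-- The trace of the Hessian of a function `α` with `∂ᵢα = n Dᵢ`, where `D` is a null covector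
field of the metric with adjugate matrix `(a, b; b, c)`: the derivative of the equation
`a D₀² + 2 b D₀ D₁ + c D₁² = 0` determines the Hessian in the null direction, which is enough to
compute its trace. Here `aₗ, bₗ, cₗ` are the partial derivatives of `a, b, c`. -/
theorem hessian_trace_aux {a b c D0 D1 n h00 h01 h11 a0 a1 b0 b1 c0 c1 : ℝ} (hD : D0 ≠ 0)
    (hdet : a * c - b ^ 2 ≠ 0) (hQ : a * D0 ^ 2 + 2 * b * (D0 * D1) + c * D1 ^ 2 = 0)
    (h0 : (a * D0 + b * D1) * h00 + (b * D0 + c * D1) * h01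
      = -(1 / 2) * (a0 * D0 ^ 2 + 2 * b0 * (D0 * D1) + c0 * D1 ^ 2) * n)
    (h1 : (a * D0 + b * D1) * h01 + (b * D0 + c * D1) * h11
      = -(1 / 2) * (a1 * D0 ^ 2 + 2 * b1 * (D0 * D1) + c1 * D1 ^ 2) * n) :
    (a * c - b ^ 2) * (a * h00 + 2 * b * h01 + c * h11)
      = (1 / 2) * n * (a * ((a * D0 + b * D1) * c0 + (b * D0 + c * D1) * (-2 * b0 - c1))
        + 2 * b * ((a * D0 + b * D1) * c1 + (b * D0 + c * D1) * a0)
        + c * ((a * D0 + b * D1) * (-2 * b1 - a0) + (b * D0 + c * D1) * a1)) := by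
  -- `D` is proportional to `(1, τ)`, where `τ` is a root of `a + 2 b τ + c τ²`
  obtain ⟨τ, rfl⟩ : ∃ τ, D1 = τ * D0 := ⟨D1 / D0, by field_simp⟩
  have ha : a = -2 * b * τ - c * τ ^ 2 := by
    have : D0 ^ 2 * (a + 2 * b * τ + c * τ ^ 2) = 0 := by linear_combination hQ
    have := (mul_eq_zero.1 this).resolve_left (pow_ne_zero 2 hD)
    linarith
  subst ha
  have hp : b + c * τ ≠ 0 := by
    intro h
    apply hdet
    linear_combination -(b + c * τ) * h
  -- the null direction is `(-τ, 1)`, and the hypotheses give the Hessian in this direction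
  have e0 : (b + c * τ) * (-τ * h00 + h01)
      = -(1 / 2) * D0 * (a0 + 2 * b0 * τ + c0 * τ ^ 2) * n := by
    apply mul_left_cancel₀ hD
    linear_combination h0
  have e1 : (b + c * τ) * (-τ * h01 + h11)
      = -(1 / 2) * D0 * (a1 + 2 * b1 * τ + c1 * τ ^ 2) * n := by
    apply mul_left_cancel₀ hD
    linear_combination h1
  linear_combination -(b + c * τ) * (2 * b + c * τ) * e0 - (b + c * τ) * c * e1

/-- The two cases `D₀ ≠ 0` and `D₁ ≠ 0` of `hessian_trace_aux` differ by exchanging the coordinates.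
-/
theorem hessian_trace {a b c D0 D1 n h00 h01 h11 a0 a1 b0 b1 c0 c1 : ℝ} (hD : D0 ≠ 0 ∨ D1 ≠ 0)
    (hdet : a * c - b ^ 2 ≠ 0) (hQ : a * D0 ^ 2 + 2 * b * (D0 * D1) + c * D1 ^ 2 = 0)
    (h0 : (a * D0 + b * D1) * h00 + (b * D0 + c * D1) * h01
      = -(1 / 2) * (a0 * D0 ^ 2 + 2 * b0 * (D0 * D1) + c0 * D1 ^ 2) * n)
    (h1 : (a * D0 + b * D1) * h01 + (b * D0 + c * D1) * h11
      = -(1 / 2) * (a1 * D0 ^ 2 + 2 * b1 * (D0 * D1) + c1 * D1 ^ 2) * n) :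
    (a * c - b ^ 2) * (a * h00 + 2 * b * h01 + c * h11)
      = (1 / 2) * n * (a * ((a * D0 + b * D1) * c0 + (b * D0 + c * D1) * (-2 * b0 - c1))
        + 2 * b * ((a * D0 + b * D1) * c1 + (b * D0 + c * D1) * a0)
        + c * ((a * D0 + b * D1) * (-2 * b1 - a0) + (b * D0 + c * D1) * a1)) := by
  rcases hD with hD | hD
  · exact hessian_trace_aux hD hdet hQ h0 h1
  · have := hessian_trace_aux (a := c) (b := b) (c := a) (D0 := D1) (D1 := D0) (n := n) (h00 := h11)
      (h01 := h01) (h11 := h00) (a0 := c1) (a1 := c0) (b0 := b1) (b1 := b0) (c0 := a1) (c1 := a0)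
      hD (by rwa [mul_comm c a]) (by linear_combination hQ) (by linear_combination h1)
      (by linear_combination h0)
    linear_combination this

theorem pd_quadratic {n : ℕ} {a b c p q r s : EuclideanSpace ℝ (Fin n) → ℝ}
    {y : EuclideanSpace ℝ (Fin n)} (ha : DifferentiableAt ℝ a y) (hb : DifferentiableAt ℝ b y)
    (hc : DifferentiableAt ℝ c y) (hp : DifferentiableAt ℝ p y) (hq : DifferentiableAt ℝ q y)
    (hr : DifferentiableAt ℝ r y) (hs : DifferentiableAt ℝ s y) (i : Fin n) :
    pd i (fun z => a z * (p z * q z) + b z * (p z * s z + r z * q z) + c z * (r z * s z)) y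
      = pd i a y * (p y * q y) + pd i b y * (p y * s y + r y * q y) + pd i c y * (r y * s y)
        + a y * (pd i p y * q y + p y * pd i q y)
        + b y * (pd i p y * s y + p y * pd i s y + pd i r y * q y + r y * pd i q y)
        + c y * (pd i r y * s y + r y * pd i s y) := by
  have h := ((ha.hasFDerivAt.mul (hp.hasFDerivAt.mul hq.hasFDerivAt)).add
    (hb.hasFDerivAt.mul ((hp.hasFDerivAt.mul hs.hasFDerivAt).add
      (hr.hasFDerivAt.mul hq.hasFDerivAt)))).add
    (hc.hasFDerivAt.mul (hr.hasFDerivAt.mul hs.hasFDerivAt))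
  have h' := congrArg (fun L : EuclideanSpace ℝ (Fin n) →L[ℝ] ℝ => L (EuclideanSpace.single i 1))
    h.fderiv
  refine Eq.trans h' ?_
  simp [pd]
  ring

/-- A quasi-umbilical Gauss map is harmonic: the pullback of `⟨·,·⟩` vanishes and the direction of
`d𝒩` is a null covector, and both facts may be differentiated. -/
theorem tension_conformalGaussMap (hf : IsTimelikeImmersion f) (ho : IsOrientation o)
    (hG : ∀ x, ∃ n l, IsGaussDirection o f x n l)
    {e : OpenPartialHomeomorph X (EuclideanSpace ℝ (Fin 2))}
    (he : e ∈ IsManifold.maximalAtlas (𝓡 2) ∞ X) {y : EuclideanSpace ℝ (Fin 2)}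
    (hy : y ∈ e.target) : tension f (conformalGaussMap o f) e y = 0 := by
  have hot := e.open_target
  have hNs := contDiffOn_comp_symm_target (contMDiff_conformalGaussMap hf ho) he
  set N : EuclideanSpace ℝ (Fin 2) → R23 := fun z => conformalGaussMap o f (e.symm z) with hN
  have dN : ∀ z ∈ e.target, DifferentiableAt ℝ N z := fun z hz =>
    (hNs.contDiffAt (hot.mem_nhds hz)).differentiableAt (by simp)
  have dNi : ∀ z ∈ e.target, ∀ i, DifferentiableAt ℝ (pd i N) z := fun z hz i =>
    ((contDiffOn_pd hot hNs i).contDiffAt (hot.mem_nhds hz)).differentiableAt (by simp)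
  have dNik : ∀ i k, DifferentiableAt ℝ (fun z => pd i N z k) y := fun i k =>
    differentiableAt_pi.1 (dNi y hy i) k
  have dg : ∀ i j, DifferentiableAt ℝ (fun z => metricMatrix f e z i j) y := fun i j =>
    ((contDiffOn_metricMatrix hf he i j).contDiffAt (hot.mem_nhds hy)).differentiableAt (by simp)
  have hNi : ∀ z ∈ e.target, ∃ n D0 D1, (D0 ≠ 0 ∨ D1 ≠ 0) ∧ n ≠ 0 ∧ pd 0 N z = D0 • n ∧
      pd 1 N z = D1 • n ∧ sp n n = 0 ∧ sp n (N z) = 0 ∧ metricMatrix f e z 1 1 * D0 ^ 2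
        + 2 * -metricMatrix f e z 0 1 * (D0 * D1) + metricMatrix f e z 0 0 * D1 ^ 2 = 0 := by
    intro z hz
    obtain ⟨n, l, h⟩ := hG (e.symm z)
    refine ⟨n, gaussForm o f _ (coordVec e z 0), gaussForm o f _ (coordVec e z 1), ?_, ?_, ?_, ?_,
      h.null, h.perp_gauss, ?_⟩
    · obtain ⟨v, hv⟩ := h.exists_ne
      obtain ⟨a, b, rfl⟩ := exists_eq_coordVec he hz v
      by_contra! hcon
      simp [gaussForm_add, gaussForm_smul, hcon.1, hcon.2] at hv
    · rintro rfl
      simpa [negDet] using h.normalized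
    · rw [pd_conformalGaussMap hf ho he hz, h.dgauss]
    · rw [pd_conformalGaussMap hf ho he hz, h.dgauss]
    · have := h.kernel_null (gaussForm o f _ (coordVec e z 1) • coordVec e z 0
        + (-gaussForm o f _ (coordVec e z 0)) • coordVec e z 1)
        (by rw [gaussForm_add, gaussForm_smul, gaussForm_smul]; ring)
      simp only [map_add, map_smul, sp_add_left, sp_add_right, sp_smul_left, sp_smul_right] at this
      simp only [← metricMatrix_apply] at this
      rw [metricMatrix_comm f e z 1 0] at this
      linear_combination this
  have hQ : ∀ k m, ∀ᶠ z in nhds y, metricMatrix f e z 1 1 * (pd 0 N z k * pd 0 N z m)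
      + (fun z => -metricMatrix f e z 0 1) z * (pd 0 N z k * pd 1 N z m + pd 1 N z k * pd 0 N z m)
      + metricMatrix f e z 0 0 * (pd 1 N z k * pd 1 N z m) = 0 := by
    intro k m
    filter_upwards [hot.mem_nhds hy] with z hz
    obtain ⟨n, D0, D1, -, -, h0, h1, -, -, h⟩ := hNi z hz
    simp only [h0, h1, Pi.smul_apply, smul_eq_mul]
    linear_combination n k * n m * h
  obtain ⟨n, D0, D1, hD, hn, h0, h1, hnn, hnN, h⟩ := hNi y hy
  obtain ⟨k, hk⟩ : ∃ k, n k ≠ 0 := by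
    by_contra! hcon
    exact hn (funext hcon)
  -- the second derivatives of `N` are tangent to the hyperquadric
  have hproj : ∀ i j, tangentProj (conformalGaussMap o f (e.symm y)) (pd i (pd j N) y)
      = pd i (pd j N) y := by
    intro i j
    have hz : ∀ᶠ z in nhds y, sp (pd j N z) (N z) = 0 := by
      filter_upwards [hot.mem_nhds hy] with z hz
      obtain ⟨n, D0, D1, -, -, h0, h1, -, h3, -⟩ := hNi z hz
      fin_cases j
      · exact h0 ▸ by rw [sp_smul_left, h3, mul_zero]
      · exact h1 ▸ by rw [sp_smul_left, h3, mul_zero]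
    have h2 := sp_pd_eq_neg (dNi y hy j) (dN y hy) hz i
    have h3 : sp (pd j N y) (pd i N y) = 0 := by
      fin_cases i <;> fin_cases j <;> simp [h0, h1, hnn]
    change tangentProj (N y) _ = _
    rw [tangentProj, h2, h3, neg_zero, zero_smul, sub_zero]
  have hdiff : ∀ (l : Fin 2) k m, _ := fun l k m =>
    (pd_quadratic (dg 1 1) (dg 0 1).neg (dg 0 0) (dNik 0 k) (dNik 0 m) (dNik 1 k) (dNik 1 m)
      l).symm.trans ((pd_congr (hQ k m) l).trans (by simp [pd] : pd l (fun _ => (0 : ℝ)) y = 0))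
  have hneg : ∀ l, pd l (-fun z => metricMatrix f e z 0 1) y
      = -pd l (fun z => metricMatrix f e z 0 1) y := by
    intro l
    rw [pd, fderiv_neg]
    rfl
  have hcomp : ∀ i l k, pd l (fun z => pd i N z k) y = pd l (pd i N) y k := fun i l k =>
    pd_pi (dNi y hy i) l k
  simp only [hneg, hcomp, h0, h1, Pi.smul_apply, smul_eq_mul, Pi.neg_apply] at hdiff
  set a := metricMatrix f e y 1 1 with ha
  set b := metricMatrix f e y 0 1 with hb
  set c := metricMatrix f e y 0 0 with hc
  have hkey : ∀ l m, (a * D0 + -b * D1) * pd l (pd 0 N) y m + (-b * D0 + c * D1)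
      * pd l (pd 1 N) y m = -(1 / 2) * (pd l (fun z => metricMatrix f e z 1 1) y * D0 ^ 2
        + 2 * -pd l (fun z => metricMatrix f e z 0 1) y * (D0 * D1)
        + pd l (fun z => metricMatrix f e z 0 0) y * D1 ^ 2) * n m := by
    intro l m
    have hkk := hdiff l k k
    have hkm := hdiff l k m
    apply mul_left_cancel₀ (pow_ne_zero 2 hk)
    linear_combination n k * hkm - (1 / 2) * n m * hkk
  have hdet := det_metricMatrix_neg hf he hy
  obtain ⟨i00, i01, i10, i11⟩ := inv_fin_two (metricMatrix f e y)
  have hdet' : (metricMatrix f e y).det = a * c - (-b) ^ 2 := by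
    rw [Matrix.det_fin_two, metricMatrix_comm f e y 1 0]
    ring
  have hg10 : (fun z => metricMatrix f e z 1 0) = fun z => metricMatrix f e z 0 1 :=
    funext fun z => metricMatrix_comm f e z 1 0
  have hcm : pd 1 (pd 0 N) y = pd 0 (pd 1 N) y := pd_comm hot hNs hy 1 0
  ext m
  have key := hessian_trace (a0 := pd 0 (fun z => metricMatrix f e z 1 1) y)
    (b0 := -pd 0 (fun z => metricMatrix f e z 0 1) y)
    (c0 := pd 0 (fun z => metricMatrix f e z 0 0) y)
    (a1 := pd 1 (fun z => metricMatrix f e z 1 1) y)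
    (b1 := -pd 1 (fun z => metricMatrix f e z 0 1) y)
    (c1 := pd 1 (fun z => metricMatrix f e z 0 0) y) hD (hdet' ▸ hdet.ne) h (hkey 0 m)
    (by rw [← hkey 1 m, hcm])
  rw [← hdet'] at key
  simp only [tension, secondDerivative, christoffel, Fin.sum_univ_two, ← hN, hproj, i00, i01, i10,
    i11, hg10, hcm, h0, h1, metricMatrix_comm f e y 1 0, ← ha, ← hb, ← hc]
  simp only [Pi.add_apply, Pi.sub_apply, Pi.smul_apply, smul_eq_mul, Pi.zero_apply]
  have hne := hdet.ne
  set d := (metricMatrix f e y).det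
  have hdd : d⁻¹ * d = 1 := inv_mul_cancel₀ hne
  linear_combination d⁻¹ ^ 2 * key - d⁻¹ * (a * pd 0 (pd 0 N) y m - 2 * b * pd 0 (pd 1 N) y m
    + c * pd 1 (pd 1 N) y m) * hdd

theorem isHarmonicMap_conformalGaussMap (hf : IsTimelikeImmersion f) (ho : IsOrientation o)
    (hq : IsQuasiUmbilical o f) : IsHarmonicMap f (conformalGaussMap o f) where
  smooth := contMDiff_conformalGaussMap hf ho
  mem := conformalGaussMap_mem hf ho
  tension_eq_zero _ he _ hy :=
    tension_conformalGaussMap hf ho (exists_isGaussDirection hf ho hq) he hy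

end Surface

/-! ### Null pairs, canonical orientation and helicity -/

/-- On a connected space, of two complementary open conditions one holds everywhere. -/
theorem forall_or_forall_of_eventually {X : Type*} [TopologicalSpace X]
    [PreconnectedSpace X] {p q : X → Prop}
    (hp : ∀ x, p x → ∀ᶠ z in nhds x, p z) (hq : ∀ x, q x → ∀ᶠ z in nhds x, q z)
    (h : ∀ x, p x ∨ q x) (hpq : ∀ x, p x → ¬q x) : (∀ x, p x) ∨ ∀ x, q x := by
  have hc : {x | p x}ᶜ = {x | q x} := by
    ext x
    exact ⟨fun hx => (h x).resolve_left hx, fun hx hpx => hpq x hpx hx⟩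
  have hclopen : IsClopen {x | p x} := by
    refine ⟨⟨?_⟩, isOpen_iff_mem_nhds.2 hp⟩
    rw [hc]
    exact isOpen_iff_mem_nhds.2 hq
  rcases isClopen_iff.1 hclopen with h1 | h1
  · right
    intro x
    have : x ∈ {x | p x}ᶜ := by simp [h1]
    rwa [hc] at this
  · left
    intro x
    have : x ∈ {x | p x} := by simp [h1]
    exact this

section Surface

variable {X : Type*} [TopologicalSpace X] [ChartedSpace (EuclideanSpace ℝ (Fin 2)) X]
  {f : X → R23} {o : TangentOrientation X}

theorem sp_self_dVec (hf : IsTimelikeImmersion f) (x : X) (v : TangentSpace (𝓡 2) x) :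
    sp (f x) (dVec f x v) = 0 := by
  have hm := (hf.smooth x).mdifferentiableAt (by simp)
  have := sp_dVec_eq_neg hm hm (c := 0)
    (Filter.Eventually.of_forall fun z => sp_self_of_mem_einstein (hf.mem z)) v
  rw [sp_comm] at this
  linarith

variable {x : X} {n : R23} {l : ℝ}

theorem IsGaussDirection.sp_dVec (hf : IsTimelikeImmersion f) (h : IsGaussDirection o f x n l)
    {w V : TangentSpace (𝓡 2) x} {c : ℝ}
    (hV : dVec (conformalGaussMap o f) x w = dVec f x V + c • f x) (v : TangentSpace (𝓡 2) x) :
    sp (dVec f x V) (dVec f x v) = -l * gaussForm o f x w * gaussForm o f x v := by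
  have e : dVec f x V = gaussForm o f x w • n - c • f x := by rw [← h.dgauss, hV]; abel
  rw [e, sp_sub_left, sp_smul_left, sp_smul_left, h.second, sp_self_dVec hf]
  ring

/-- The image of `d𝒩` is contained in its kernel. -/
theorem IsGaussDirection.gaussForm_eq_zero (h : IsGaussDirection o f x n l)
    {V : TangentSpace (𝓡 2) x} (hV : InImage o f x V) : gaussForm o f x V = 0 := by
  obtain ⟨w, c, hw⟩ := hV
  have e : dVec f x V = gaussForm o f x w • n - c • f x := by rw [← h.dgauss, hw]; abel
  have h1 := h.second V
  rw [e, sp_sub_right, sp_smul_right, sp_smul_right, h.null, h.perp] at h1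
  have h2 : l * gaussForm o f x V = 0 := by linarith
  exact (mul_eq_zero.1 h2).resolve_left h.ne_zero

theorem IsGaussDirection.gaussForm_ne_zero (hf : IsTimelikeImmersion f)
    (h : IsGaussDirection o f x n l) {V V' : TangentSpace (𝓡 2) x} (hV : IsNullPair o f x V V') :
    gaussForm o f x V' ≠ 0 := by
  obtain ⟨-, ⟨w, c, hw⟩, -, h1⟩ := hV
  intro h0
  rw [inducedMetric, h.sp_dVec hf hw, h0, mul_zero] at h1
  norm_num at h1

/-- Null pairs exist: the vector `V` is the direction `n` of `d𝒩`, and a vector `w` outside the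
kernel of the Gauss form is corrected by a multiple of `V` to be null and rescaled. -/
theorem IsGaussDirection.exists_isNullPair (hf : IsTimelikeImmersion f)
    (h : IsGaussDirection o f x n l) : ∃ V V', IsNullPair o f x V V' := by
  obtain ⟨V, c, hV⟩ := h.tangent
  obtain ⟨w, hw⟩ := h.exists_ne
  set a := gaussForm o f x w with ha
  have hw' : dVec (conformalGaussMap o f) x (a⁻¹ • w) = dVec f x V + c • f x := by
    rw [map_smul, h.dgauss, ← ha, smul_smul, inv_mul_cancel₀ hw, one_smul, hV]
  have hin : InImage o f x V := ⟨_, _, hw'⟩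
  have hVV : sp (dVec f x V) (dVec f x V) = 0 := by
    rw [h.sp_dVec hf hw', h.gaussForm_eq_zero hin, mul_zero]
  have hVw : sp (dVec f x V) (dVec f x w) = -l * a := by
    rw [h.sp_dVec hf hw', gaussForm_smul, ← ha, inv_mul_cancel₀ hw, mul_one]
  have hla : l * a ≠ 0 := mul_ne_zero h.ne_zero hw
  refine ⟨V, (1 / (l * a)) • w + (sp (dVec f x w) (dVec f x w) / (2 * (l * a) ^ 2)) • V, ?_, hin,
    ?_, ?_⟩
  · rintro rfl
    have := h.normalized
    rw [hV] at this
    simp at this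
  · simp only [inducedMetric, map_add, map_smul, sp_add_left, sp_add_right, sp_smul_left,
      sp_smul_right, hVV, hVw, sp_comm (dVec f x w) (dVec f x V)]
    field_simp
    ring
  · simp only [inducedMetric, map_add, map_smul, sp_add_right, sp_smul_right, hVV, hVw]
    linear_combination -(one_div_mul_cancel hla)

theorem IsGaussDirection.sp_dgauss (h : IsGaussDirection o f x n l) (v : TangentSpace (𝓡 2) x) :
    sp (dVec (conformalGaussMap o f) x v) (dVec f x v) = -l * gaussForm o f x v ^ 2 := by
  rw [h.dgauss, sp_smul_left, h.second]
  ring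

/-- The number whose sign decides whether the null pairs are positive in a positive chart. -/
noncomputable def nullPairSign (o : TangentOrientation X) (f : X → R23)
    (e : OpenPartialHomeomorph X (EuclideanSpace ℝ (Fin 2))) (y : EuclideanSpace ℝ (Fin 2)) : ℝ :=
  (gaussForm o f (e.symm y) (coordVec e y 1) * metricMatrix f e y 0 0
      - gaussForm o f (e.symm y) (coordVec e y 0) * metricMatrix f e y 0 1)
    * gaussForm o f (e.symm y) (coordVec e y 0)
  + (gaussForm o f (e.symm y) (coordVec e y 1) * metricMatrix f e y 0 1
      - gaussForm o f (e.symm y) (coordVec e y 0) * metricMatrix f e y 1 1)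
    * gaussForm o f (e.symm y) (coordVec e y 1)

/-- In a chart, `a p' - b p` for a null pair `V = a ∂₀ + b ∂₁`, `V' = p ∂₀ + p' ∂₁` has the sign
opposite to `nullPairSign`. -/
theorem IsNullPair.nullPairSign_mul
    {e : OpenPartialHomeomorph X (EuclideanSpace ℝ (Fin 2))} {y : EuclideanSpace ℝ (Fin 2)}
    (hy : e ∈ IsManifold.maximalAtlas (𝓡 2) ∞ X) (hyt : y ∈ e.target)
    (h : IsGaussDirection o f (e.symm y) n l) {a b p q : ℝ}
    (hV : IsNullPair o f (e.symm y) (a • coordVec e y 0 + b • coordVec e y 1)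
      (p • coordVec e y 0 + q • coordVec e y 1)) :
    ∃ r > 0, nullPairSign o f e y * (a * q - b * p) = -r := by
  have hk := h.kernel_null (gaussForm o f _ (coordVec e y 1) • coordVec e y 0
    + (-gaussForm o f _ (coordVec e y 0)) • coordVec e y 1)
    (by rw [gaussForm_add, gaussForm_smul, gaussForm_smul]; ring)
  have h0 := h.gaussForm_eq_zero hV.2.1
  have hg := hV.2.2.2
  have hD : gaussForm o f (e.symm y) (coordVec e y 0) ≠ 0 ∨
      gaussForm o f (e.symm y) (coordVec e y 1) ≠ 0 := by
    by_contra! hcon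
    obtain ⟨v, hv⟩ := h.exists_ne
    obtain ⟨a, b, rfl⟩ := exists_eq_coordVec hy hyt v
    simp [gaussForm_add, gaussForm_smul, hcon.1, hcon.2] at hv
  rw [nullPairSign]
  rw [gaussForm_add, gaussForm_smul, gaussForm_smul] at h0
  simp only [inducedMetric, map_add, map_smul, sp_add_left, sp_add_right, sp_smul_left,
    sp_smul_right] at hk hg
  simp only [← metricMatrix_apply, metricMatrix_comm f e y 1 0] at hk hg
  set D0 := gaussForm o f (e.symm y) (coordVec e y 0)
  set D1 := gaussForm o f (e.symm y) (coordVec e y 1)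
  have hpos : 0 < D0 ^ 2 + D1 ^ 2 := by
    rcases hD with h | h <;> positivity
  refine ⟨D0 ^ 2 + D1 ^ 2, hpos, ?_⟩
  obtain ⟨ν, ha, hb⟩ : ∃ ν, a = ν * D1 ∧ b = -ν * D0 := by
    refine ⟨(a * D1 - b * D0) / (D0 ^ 2 + D1 ^ 2), ?_, ?_⟩ <;> field_simp
    · linear_combination D0 * h0
    · linear_combination D1 * h0
  rw [ha, hb] at hg ⊢
  linear_combination (D0 ^ 2 + D1 ^ 2) * hg + ν * (D0 * q - D1 * p) * hk

/-- In a positive chart the orientation of all null pairs at a point is the sign of one continuous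
function, because the area of a null pair in the chart has constant sign. -/
theorem IsNullPair.isPositivePair_iff
    {e : OpenPartialHomeomorph X (EuclideanSpace ℝ (Fin 2))} {y : EuclideanSpace ℝ (Fin 2)}
    (he : e ∈ IsManifold.maximalAtlas (𝓡 2) ∞ X) (hy : y ∈ e.target)
    (hpos : IsPositivePair o (e.symm y) (coordVec e y 0) (coordVec e y 1))
    (h : IsGaussDirection o f (e.symm y) n l) {V V' : TangentSpace (𝓡 2) (e.symm y)}
    (hV : IsNullPair o f (e.symm y) V V') :
    (IsPositivePair o (e.symm y) V V' ↔ nullPairSign o f e y < 0) ∧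
      (IsPositivePair (fun x => -o x) (e.symm y) V V' ↔ 0 < nullPairSign o f e y) := by
  obtain ⟨a, b, rfl⟩ := exists_eq_coordVec he hy V
  obtain ⟨p, q, rfl⟩ := exists_eq_coordVec he hy V'
  obtain ⟨r, hr, hs⟩ := hV.nullPairSign_mul he hy h
  rw [isPositivePair_neg_iff, Einstein.isPositivePair_iff hpos, Einstein.isPositivePair_iff hpos]
  constructor
  · constructor <;> intro h1 <;> nlinarith
  · constructor <;> intro h1 <;> nlinarith

theorem contDiffOn_gaussForm (hf : IsTimelikeImmersion f) (ho : IsOrientation o)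
    {e : OpenPartialHomeomorph X (EuclideanSpace ℝ (Fin 2))}
    (he : e ∈ IsManifold.maximalAtlas (𝓡 2) ∞ X) (i : Fin 2) :
    ContDiffOn ℝ ∞ (fun y => gaussForm o f (e.symm y) (coordVec e y i)) e.target := by
  have h := contDiffOn_negDet (contDiffOn_comp_symm_target hf.smooth he)
    (contDiffOn_pd e.open_target
      (contDiffOn_comp_symm_target (contMDiff_conformalGaussMap hf ho) he) i)
  refine h.congr fun y hy => ?_
  rw [gaussForm, pd_conformalGaussMap hf ho he hy]

theorem continuousOn_nullPairSign (hf : IsTimelikeImmersion f) (ho : IsOrientation o)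
    {e : OpenPartialHomeomorph X (EuclideanSpace ℝ (Fin 2))}
    (he : e ∈ IsManifold.maximalAtlas (𝓡 2) ∞ X) : ContinuousOn (nullPairSign o f e) e.target := by
  have h0 := (contDiffOn_gaussForm hf ho he 0).continuousOn
  have h1 := (contDiffOn_gaussForm hf ho he 1).continuousOn
  have g := fun i j => (contDiffOn_metricMatrix hf he i j).continuousOn
  exact (((h1.mul (g 0 0)).sub (h0.mul (g 0 1))).mul h0).add
    (((h1.mul (g 0 1)).sub (h0.mul (g 1 1))).mul h1)

/-- The null pairs are either positive at every point or negative at every point. -/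
theorem isPositivePair_or [ConnectedSpace X] (hf : IsTimelikeImmersion f) (ho : IsOrientation o)
    (hG : ∀ x, ∃ n l, IsGaussDirection o f x n l) :
    (∀ x V V', IsNullPair o f x V V' → IsPositivePair o x V V') ∨
      ∀ x V V', IsNullPair o f x V V' → IsPositivePair (fun x => -o x) x V V' := by
  apply forall_or_forall_of_eventually
    (p := fun x => ∀ V V', IsNullPair o f x V V' → IsPositivePair o x V V')
    (q := fun x => ∀ V V', IsNullPair o f x V V' → IsPositivePair (fun x => -o x) x V V')
  · intro x hx
    obtain ⟨e, he, hxe, hpos⟩ := ho x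
    obtain ⟨y, hy, rfl⟩ := exists_symm_eq hxe
    obtain ⟨n, l, h⟩ := hG (e.symm y)
    obtain ⟨V, V', hV⟩ := h.exists_isNullPair hf
    -- the sign of the continuous function `nullPairSign` is locally constant
    have hs := (hV.isPositivePair_iff he hy (hpos y hy) h).1.1 (hx V V' hV)
    rw [← e.eventually_nhds' _ hxe, e.right_inv hy]
    filter_upwards [e.open_target.mem_nhds hy, ((continuousOn_nullPairSign hf ho he).continuousAt
      (e.open_target.mem_nhds hy)).eventually_lt continuousAt_const hs] with z hz hzs V V' hV
    obtain ⟨n, l, h⟩ := hG (e.symm z)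
    exact (hV.isPositivePair_iff he hz (hpos z hz) h).1.2 hzs
  · intro x hx
    obtain ⟨e, he, hxe, hpos⟩ := ho x
    obtain ⟨y, hy, rfl⟩ := exists_symm_eq hxe
    obtain ⟨n, l, h⟩ := hG (e.symm y)
    obtain ⟨V, V', hV⟩ := h.exists_isNullPair hf
    have hs := (hV.isPositivePair_iff he hy (hpos y hy) h).2.1 (hx V V' hV)
    rw [← e.eventually_nhds' _ hxe, e.right_inv hy]
    filter_upwards [e.open_target.mem_nhds hy, continuousAt_const.eventually_lt
      ((continuousOn_nullPairSign hf ho he).continuousAt (e.open_target.mem_nhds hy)) hs]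
      with z hz hzs V V' hV
    obtain ⟨n, l, h⟩ := hG (e.symm z)
    exact (hV.isPositivePair_iff he hz (hpos z hz) h).2.2 hzs
  · intro x
    obtain ⟨e, he, hxe, hpos⟩ := ho x
    obtain ⟨y, hy, rfl⟩ := exists_symm_eq hxe
    obtain ⟨n, l, h⟩ := hG (e.symm y)
    obtain ⟨V, V', hV⟩ := h.exists_isNullPair hf
    have hne : nullPairSign o f e y ≠ 0 := by
      obtain ⟨a, b, rfl⟩ := exists_eq_coordVec he hy V
      obtain ⟨p, q, rfl⟩ := exists_eq_coordVec he hy V'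
      obtain ⟨r, hr, hs⟩ := hV.nullPairSign_mul he hy h
      intro h0
      rw [h0, zero_mul] at hs
      linarith
    rcases hne.lt_or_gt with hs | hs
    · exact Or.inl fun V V' hV => (hV.isPositivePair_iff he hy (hpos y hy) h).1.2 hs
    · exact Or.inr fun V V' hV => (hV.isPositivePair_iff he hy (hpos y hy) h).2.2 hs
  · intro x hp hq
    obtain ⟨e, he, hxe, hpos⟩ := ho x
    obtain ⟨y, hy, rfl⟩ := exists_symm_eq hxe
    obtain ⟨n, l, h⟩ := hG (e.symm y)
    obtain ⟨V, V', hV⟩ := h.exists_isNullPair hf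
    have h1 := (hV.isPositivePair_iff he hy (hpos y hy) h).1.1 (hp V V' hV)
    have h2 := (hV.isPositivePair_iff he hy (hpos y hy) h).2.1 (hq V V' hV)
    exact absurd h1 h2.not_gt

/-- The sign of the second fundamental form is constant. -/
theorem exists_sign [ConnectedSpace X] (hf : IsTimelikeImmersion f) (ho : IsOrientation o)
    (hG : ∀ x, ∃ n l, IsGaussDirection o f x n l) :
    ∃ ε : ℝ, (ε = 1 ∨ ε = -1) ∧ ∀ x n l, IsGaussDirection o f x n l → 0 < ε * l := by
  -- `l` is determined by `⟨d𝒩, df⟩ = -l ω²` on a vector where `ω` does not vanish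
  have huniq : ∀ {x n l n' l'}, IsGaussDirection o f x n l → IsGaussDirection o f x n' l' →
      l = l' := by
    intro x n l n' l' h h'
    obtain ⟨v, hv⟩ := h.exists_ne
    have := (h.sp_dgauss v).symm.trans (h'.sp_dgauss v)
    have := mul_right_cancel₀ (pow_ne_zero 2 hv) this
    linarith
  -- `s l > 0` is an open condition
  have hopen : ∀ s : ℝ, ∀ x, (∃ n l, IsGaussDirection o f x n l ∧ 0 < s * l) →
      ∀ᶠ z in nhds x, ∃ n l, IsGaussDirection o f z n l ∧ 0 < s * l := by
    rintro s x ⟨n, l, h, hs⟩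
    obtain ⟨e, he, hxe, -⟩ := ho x
    obtain ⟨y, hy, rfl⟩ := exists_symm_eq hxe
    obtain ⟨v, hv⟩ := h.exists_ne
    obtain ⟨a, b, rfl⟩ := exists_eq_coordVec he hy v
    have hfs := contDiffOn_comp_symm_target hf.smooth he
    have hNs := contDiffOn_comp_symm_target (contMDiff_conformalGaussMap hf ho) he
    have hdf := fun i => contDiffOn_pd e.open_target hfs i
    have hdN := fun i => contDiffOn_pd e.open_target hNs i
    have hk := (contDiffOn_sp (((hdN 0).const_smul a).add ((hdN 1).const_smul b))
      (((hdf 0).const_smul a).add ((hdf 1).const_smul b))).continuousOn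
    have hke : ∀ z ∈ e.target, sp
        (a • pd 0 (fun z => conformalGaussMap o f (e.symm z)) z
          + b • pd 1 (fun z => conformalGaussMap o f (e.symm z)) z)
        (a • pd 0 (fun z => f (e.symm z)) z + b • pd 1 (fun z => f (e.symm z)) z)
        = sp (dVec (conformalGaussMap o f) (e.symm z) (a • coordVec e z 0 + b • coordVec e z 1))
          (dVec f (e.symm z) (a • coordVec e z 0 + b • coordVec e z 1)) := by
      intro z hz
      have hm := (hf.smooth (e.symm z)).mdifferentiableAt (by simp)
      simp only [map_add, map_smul, pd_conformalGaussMap hf ho he hz, dVec_coordVec he hz hm]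
    have hv2 : 0 < gaussForm o f (e.symm y) (a • coordVec e y 0 + b • coordVec e y 1) ^ 2 := by
      positivity
    have hlt : s * sp
        (a • pd 0 (fun z => conformalGaussMap o f (e.symm z)) y
          + b • pd 1 (fun z => conformalGaussMap o f (e.symm z)) y)
        (a • pd 0 (fun z => f (e.symm z)) y + b • pd 1 (fun z => f (e.symm z)) y) < 0 := by
      rw [hke y hy, h.sp_dgauss]
      nlinarith
    rw [← e.eventually_nhds' _ hxe, e.right_inv hy]
    filter_upwards [e.open_target.mem_nhds hy,
      ((continuousOn_const.mul hk).continuousAt (e.open_target.mem_nhds hy)).eventually_lt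
        continuousAt_const hlt] with z hz hzs
    obtain ⟨n, l, h⟩ := hG (e.symm z)
    refine ⟨n, l, h, ?_⟩
    replace hzs := (congrArg (s * ·) (hke z hz)).symm.trans_lt hzs
    simp only [h.sp_dgauss] at hzs
    by_contra hcon
    have := sq_nonneg (gaussForm o f (e.symm z) (a • coordVec e z 0 + b • coordVec e z 1))
    nlinarith
  rcases forall_or_forall_of_eventually (hopen 1) (hopen (-1)) (fun x => by
      obtain ⟨n, l, h⟩ := hG x
      rcases h.ne_zero.lt_or_gt with hl | hl
      · exact Or.inr ⟨n, l, h, by linarith⟩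
      · exact Or.inl ⟨n, l, h, by linarith⟩)
    (by
      rintro x ⟨n, l, h, hl⟩ ⟨n', l', h', hl'⟩
      rw [huniq h h'] at hl
      linarith) with h | h
  · refine ⟨1, Or.inl rfl, fun x n l hn => ?_⟩
    obtain ⟨n', l', h', hl'⟩ := h x
    rwa [huniq hn h']
  · refine ⟨-1, Or.inr rfl, fun x n l hn => ?_⟩
    obtain ⟨n', l', h', hl'⟩ := h x
    rwa [huniq hn h']

/-- On a null pair, `-⟨d𝒩(V'), df(V')⟩ = l ω(V')²` has the sign of `l`. -/
theorem isHelicity_of_sign (hf : IsTimelikeImmersion f)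
    (hG : ∀ x, ∃ n l, IsGaussDirection o f x n l) {ε : ℝ} (hε : ε = 1 ∨ ε = -1)
    (h : ∀ x n l, IsGaussDirection o f x n l → 0 < ε * l) : IsHelicity o f ε := by
  refine ⟨hε, fun x V V' hV => ?_⟩
  obtain ⟨n, l, hn⟩ := hG x
  rw [hn.sp_dgauss]
  have h1 := hn.gaussForm_ne_zero hf hV
  have h2 := h x n l hn
  have : ε * -(-l * gaussForm o f x V' ^ 2) = ε * l * gaussForm o f x V' ^ 2 := by ring
  rw [this]
  positivity

end Surface

/-! ### Reversal of the orientation -/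

section Surface

variable {X : Type*} [TopologicalSpace X] [ChartedSpace (EuclideanSpace ℝ (Fin 2)) X]
  {f : X → R23} {o : TangentOrientation X}

/-- A positive chart for the opposite orientation is obtained by exchanging the coordinates of a
positive chart. -/
theorem IsOrientation.neg [IsManifold (𝓡 2) ∞ X] (ho : IsOrientation o) :
    IsOrientation fun x => -o x := by
  intro x
  obtain ⟨e, he, hxe, hpos⟩ := ho x
  let σ : EuclideanSpace ℝ (Fin 2) ≃ₗᵢ[ℝ] EuclideanSpace ℝ (Fin 2) :=
    LinearIsometryEquiv.piLpCongrLeft 2 ℝ ℝ (Equiv.swap 0 1)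
  have hσ : ∀ i, σ (EuclideanSpace.single i (1 : ℝ))
      = EuclideanSpace.single (Equiv.swap 0 1 i) (1 : ℝ) := fun i =>
    LinearIsometryEquiv.piLpCongrLeft_single _ _ _
  have hσs : ContMDiff (𝓡 2) (𝓡 2) ∞ σ := σ.contDiff.contMDiff
  have hσs' : ContMDiff (𝓡 2) (𝓡 2) ∞ σ.symm := σ.symm.contDiff.contMDiff
  let e' : OpenPartialHomeomorph X (EuclideanSpace ℝ (Fin 2)) :=
    e.transHomeomorph σ.symm.toHomeomorph
  have he' : e' ∈ IsManifold.maximalAtlas (𝓡 2) ∞ X := by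
    apply OpenPartialHomeomorph.mem_maximalAtlas_of_contMDiffOn
    · exact hσs'.comp_contMDiffOn (contMDiffOn_of_mem_maximalAtlas he)
    · exact (contMDiffOn_symm_of_mem_maximalAtlas he).comp hσs.contMDiffOn fun y hy => hy
  refine ⟨e', he', hxe, fun y hy => ?_⟩
  have hy' : σ y ∈ e.target := hy
  have hc : ∀ i, coordVec e' y i = coordVec e (σ y) (Equiv.swap 0 1 i) := by
    intro i
    have h := mfderiv_comp y (mdifferentiableAt_chart_symm he hy')
      (hσs.mdifferentiableAt (x := y) (by simp))
    have h2 : mfderiv (𝓡 2) (𝓡 2) σ y = (σ.toContinuousLinearEquiv :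
        EuclideanSpace ℝ (Fin 2) →L[ℝ] EuclideanSpace ℝ (Fin 2)) := by
      rw [mfderiv_eq_fderiv]
      exact σ.toContinuousLinearEquiv.fderiv
    rw [h2] at h
    have h3 := congrArg (fun L : EuclideanSpace ℝ (Fin 2) →L[ℝ] EuclideanSpace ℝ (Fin 2) =>
      L (EuclideanSpace.single i 1)) h
    refine h3.trans ?_
    exact congrArg (mfderiv (𝓡 2) (𝓡 2) e.symm (σ y)) (hσ i)
  rw [hc, hc]
  exact isPositivePair_neg_iff.2 (hpos _ hy')

theorem column_mul_diagonal (F : Mat5) (d : Fin 5 → ℝ) (k : Fin 5) :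
    column (F * Matrix.diagonal d) k = d k • column F k := by
  ext i
  simp [column, Matrix.mul_diagonal, mul_comm]

/-- Changing the signs of `F₂` and `F₃` turns a second order frame field into one for the opposite
orientation. -/
theorem IsSecondOrderFrame.neg {U : Set X} {F : X → Mat5} (hF : IsSecondOrderFrame o f U F) :
    IsSecondOrderFrame (fun x => -o x) f U
      (fun x => F x * Matrix.diagonal ![1, 1, -1, -1, 1]) := by
  set d : Fin 5 → ℝ := ![1, 1, -1, -1, 1] with hd
  have hcol : ∀ x k, column (F x * Matrix.diagonal d) k = d k • column (F x) k := fun x k =>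
    column_mul_diagonal _ _ _
  have hconf : IsConformalFrame f U fun x => F x * Matrix.diagonal d := by
    refine ⟨hF.isOpen, fun i j => ?_, fun x hx => ?_, fun x hx => ?_⟩
    · simp only [Matrix.mul_diagonal]
      exact (hF.smooth i j).mul contMDiffOn_const
    · obtain ⟨h1, h2, h3⟩ := (mem_conformalGroup_iff _).1 (hF.mem x hx)
      refine (mem_conformalGroup_iff _).2 ⟨?_, ?_, ?_⟩
      · rw [Matrix.det_mul, h1, Matrix.det_diagonal, Fin.prod_univ_five]
        simp [hd]
      · intro i j
        rw [hcol, hcol, sp_smul_left, sp_smul_right, h2]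
        fin_cases i <;> fin_cases j <;> simp [hd, gram]
      · have hne : column (F x) 0 ≠ 0 := by
          intro h
          rw [h] at h3
          simp [negDet] at h3
        rw [hcol, hcol, hcol]
        simp only [hd, Matrix.cons_val, one_smul]
        refine (negDet_pos_iff hne (by simp [h2, gram]) (by simp [h2, gram]) (by simp [h2, gram])
          (by simp [h2, gram]) (by simp [h2, gram]) ?_).1 h3
        simp [h2, gram]
    · obtain ⟨c, hc, h⟩ := hF.lift x hx
      exact ⟨c, hc, by rw [hcol, ← h]; simp [hd]⟩
  have hphi : ∀ x ∈ U, ∀ i j v, phi (fun x => F x * Matrix.diagonal d) i j x v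
      = d i * d j * phi F i j x v := by
    intro x hx i j v
    have hdc : dVec (fun z => column (F z * Matrix.diagonal d) j) x v
        = d j • dVec (fun z => column (F z) j) x v := by
      have : (fun z => column (F z * Matrix.diagonal d) j) = d j • fun z => column (F z) j := by
        funext z
        exact hcol z j
      rw [this, dVec, const_smul_mfderiv (hF.mdifferentiableAt_column hx j)]
      rfl
    rw [hconf.phi_eq hx, hF.phi_eq hx, hdc]
    simp only [hcol, sp_smul_left, sp_smul_right]
    fin_cases i <;> simp [hd]
  refine ⟨⟨hconf, ?_, ?_⟩, ?_⟩
  · intro x hx v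
    rw [hphi x hx, hF.phi30 x hx, mul_zero]
  · intro x hx v w hvw
    have := hF.positive x hx w v (isPositivePair_neg_iff.1 hvw)
    simp only [hphi x hx]
    simp [hd]
    linarith
  · intro x hx v w
    have := hF.second x hx v w
    simp only [hphi x hx]
    simp [hd]
    linarith

/-- Reversing the orientation reverses the Gauss map. -/
theorem conformalGaussMap_neg [IsManifold (𝓡 2) ∞ X] (hf : IsTimelikeImmersion f)
    (ho : IsOrientation o) : conformalGaussMap (fun x => -o x) f = -conformalGaussMap o f := by
  funext x
  obtain ⟨U, F, hx, hF⟩ := exists_secondOrderFrame hf ho x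
  rw [Pi.neg_apply, hF.conformalGaussMap_eq hf ho hx, hF.neg.conformalGaussMap_eq hf ho.neg hx,
    column_mul_diagonal]
  simp

theorem dVec_neg (u : X → R23) (x : X) (v : TangentSpace (𝓡 2) x) :
    dVec (-u) x v = -dVec u x v := by
  rw [dVec, mfderiv_neg]
  rfl

/-- The canonical orientation and the helicity of a quasi-umbilical immersion of a connected
surface. -/
theorem exists_canonicalOrientation [ConnectedSpace X] [IsManifold (𝓡 2) ∞ X]
    (hf : IsTimelikeImmersion f) (ho : IsOrientation o) (hq : IsQuasiUmbilical o f) :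
    ∃ (c : TangentOrientation X) (ε : ℝ), IsCanonicalOrientation c f ∧ IsHelicity c f ε ∧
      IsQuasiUmbilical c f ∧
      (conformalGaussMap c f = conformalGaussMap o f ∨
        conformalGaussMap c f = -conformalGaussMap o f) ∧
      ∀ x n l, IsGaussDirection c f x n l → 0 < ε * l := by
  have hG := exists_isGaussDirection hf ho hq
  rcases isPositivePair_or hf ho hG with h | h
  · obtain ⟨ε, hε, hs⟩ := exists_sign hf ho hG
    exact ⟨o, ε, ⟨ho, h⟩, isHelicity_of_sign hf hG hε hs, hq, Or.inl rfl, hs⟩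
  · have hN := conformalGaussMap_neg hf ho
    have hd : ∀ x v, dVec (conformalGaussMap (fun x => -o x) f) x v
        = -dVec (conformalGaussMap o f) x v := by
      intro x v
      rw [hN, dVec_neg]
    have hq' : IsQuasiUmbilical (fun x => -o x) f := by
      intro x
      obtain ⟨h1, v, hv⟩ := hq x
      refine ⟨fun v w => by rw [hd, hd, sp_neg_left, sp_neg_right, h1]; simp, -v, ?_⟩
      rwa [hd, map_neg, neg_neg]
    have hG' := exists_isGaussDirection hf ho.neg hq'
    obtain ⟨ε, hε, hs⟩ := exists_sign hf ho.neg hG'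
    refine ⟨_, ε, ⟨ho.neg, fun x V V' hV => h x V V' ?_⟩, isHelicity_of_sign hf hG' hε hs, hq',
      Or.inr hN, hs⟩
    obtain ⟨h1, ⟨w, c, hw⟩, h3⟩ := hV
    exact ⟨h1, ⟨-w, c, by rw [map_neg, ← hd, hw]⟩, h3⟩

end Surface

/-! ### The leaf space of the kernel distribution of a map of rank one -/

section Leaves

variable {X : Type*} [TopologicalSpace X] [ChartedSpace (EuclideanSpace ℝ (Fin 2)) X]
  {N : X → R23}

/-- `N` is a smooth map of a surface whose differential has rank one everywhere. -/
structure HasRankOne (N : X → R23) : Prop where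
  smooth : ContMDiff (𝓡 2) 𝓘(ℝ, R23) ∞ N
  exists_ne : ∀ x, ∃ v, dVec N x v ≠ 0
  exists_dir : ∀ x, ∃ n : R23, ∀ v, ∃ c : ℝ, dVec N x v = c • n

theorem HasRankOne.mdifferentiableAt (hN : HasRankOne N) (x : X) :
    MDifferentiableAt (𝓡 2) 𝓘(ℝ, R23) N x :=
  (hN.smooth x).mdifferentiableAt (by simp)

/-- The kernel of `dN` is the kernel of the differential of any component of `N` which is not
critical. -/
theorem HasRankOne.dVec_eq_zero (hN : HasRankOne N) {x : X} {v w : TangentSpace (𝓡 2) x} {k : Fin 5}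
    (hw : dVec N x w k ≠ 0) (hv : dVec N x v k = 0) : dVec N x v = 0 := by
  obtain ⟨n, hn⟩ := hN.exists_dir x
  obtain ⟨a, ha⟩ := hn v
  obtain ⟨b, hb⟩ := hn w
  have hk : n k ≠ 0 := by
    intro h
    rw [hb, Pi.smul_apply, h, smul_zero] at hw
    exact hw rfl
  rw [ha, Pi.smul_apply, smul_eq_mul] at hv
  rw [ha, (mul_eq_zero.1 hv).resolve_right hk, zero_smul]

/-- `x` and `y` are joined by a smooth curve tangent to the kernel of `dN`. -/
def IsJoined (N : X → R23) (x y : X) : Prop :=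
  ∃ γ : ℝ → X, ContMDiff 𝓘(ℝ, ℝ) (𝓡 2) ∞ γ ∧ γ 0 = x ∧ γ 1 = y ∧
    ∀ t : ℝ, dVec N (γ t) (mfderiv 𝓘(ℝ, ℝ) (𝓡 2) γ t (1 : ℝ)) = 0

/-- The equivalence relation of lying on the same leaf of `Ker dN`. -/
def sameLeaf (N : X → R23) : Setoid X := Relation.EqvGen.setoid (IsJoined N)

/-- The projection onto the leaf space. -/
def leafMap (N : X → R23) : X → Quotient (sameLeaf N) := Quotient.mk (sameLeaf N)

theorem sameLeaf_neg (N : X → R23) : sameLeaf (-N) = sameLeaf N := by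
  have h : IsJoined (-N) = IsJoined N := by
    funext x y
    simp only [IsJoined, dVec_neg, neg_eq_zero]
  rw [sameLeaf, sameLeaf, h]

/-- A function whose differential vanishes on `Ker dN` is constant along the curves tangent to
`Ker dN`. -/
theorem IsJoined.const {V : Type*} [NormedAddCommGroup V] [NormedSpace ℝ V] {u : X → V}
    (hu : ContMDiff (𝓡 2) 𝓘(ℝ, V) ∞ u)
    (h : ∀ x v, dVec N x v = 0 → mfderiv (𝓡 2) 𝓘(ℝ, V) u x v = 0) {γ : ℝ → X}
    (hγ : ContMDiff 𝓘(ℝ, ℝ) (𝓡 2) ∞ γ)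
    (hv : ∀ t : ℝ, dVec N (γ t) (mfderiv 𝓘(ℝ, ℝ) (𝓡 2) γ t (1 : ℝ)) = 0) (s t : ℝ) :
    u (γ s) = u (γ t) := by
  have hs : ContDiff ℝ ∞ (u ∘ γ) := (hu.comp hγ).contDiff
  refine is_const_of_deriv_eq_zero (f := u ∘ γ) (hs.differentiable (by simp)) (fun t => ?_) s t
  have h1 := mfderiv_comp t ((hu (γ t)).mdifferentiableAt (by simp))
    ((hγ t).mdifferentiableAt (by simp))
  rw [mfderiv_eq_fderiv] at h1
  rw [← fderiv_apply_one_eq_deriv]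
  exact (congrArg (fun L : ℝ →L[ℝ] V => L 1) h1).trans (h _ _ (hv t))

theorem eq_of_sameLeaf {V : Type*} [NormedAddCommGroup V] [NormedSpace ℝ V] {u : X → V}
    (hu : ContMDiff (𝓡 2) 𝓘(ℝ, V) ∞ u)
    (h : ∀ x v, dVec N x v = 0 → mfderiv (𝓡 2) 𝓘(ℝ, V) u x v = 0) {x y : X}
    (hxy : Relation.EqvGen (IsJoined N) x y) : u x = u y := by
  induction hxy with
  | rel x y hr =>
    obtain ⟨γ, hγ, rfl, rfl, hv⟩ := hr
    exact IsJoined.const hu h hγ hv 0 1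
  | refl x => rfl
  | symm x y _ ih => exact ih.symm
  | trans x y z _ _ ih ih' => exact ih.trans ih'

/-- A flow box: a chart onto a ball whose last coordinate is a component of `N`. The plaques of
`Ker dN` are the segments on which the last coordinate is constant. -/
structure FlowBox (N : X → R23) where
  /-- the component of `N` -/
  k : Fin 5
  /-- the chart -/
  chart : OpenPartialHomeomorph X (EuclideanSpace ℝ (Fin 2))
  /-- the centre of its range -/
  center : EuclideanSpace ℝ (Fin 2)
  /-- the radius of its range -/
  radius : ℝ
  mem : chart ∈ IsManifold.maximalAtlas (𝓡 2) ∞ X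
  target : chart.target = Metric.ball center radius
  coord : ∀ x ∈ chart.source, chart x 1 = N x k

namespace FlowBox

variable (B : FlowBox N)

theorem coord_symm {y : EuclideanSpace ℝ (Fin 2)} (hy : y ∈ B.chart.target) :
    N (B.chart.symm y) B.k = y 1 := by
  rw [← B.coord _ (B.chart.map_target hy), B.chart.right_inv hy]

theorem pd_symm (hN : HasRankOne N) {y : EuclideanSpace ℝ (Fin 2)} (hy : y ∈ B.chart.target)
    (i : Fin 2) : dVec N (B.chart.symm y) (coordVec B.chart y i) B.k = if i = 1 then 1 else 0 := by
  have hs := contDiffOn_comp_symm_target hN.smooth B.mem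
  have hd := (hs.contDiffAt (B.chart.open_target.mem_nhds hy)).differentiableAt (by simp)
  rw [dVec_coordVec B.mem hy (hN.mdifferentiableAt _), ← pd_pi hd]
  have h : ∀ᶠ z in nhds y, N (B.chart.symm z) B.k = (EuclideanSpace.proj (𝕜 := ℝ) 1 : _ →L[ℝ] ℝ) z := by
    filter_upwards [B.chart.open_target.mem_nhds hy] with z hz using B.coord_symm hz
  rw [pd_congr h, pd, ContinuousLinearMap.fderiv]
  fin_cases i <;> simp

theorem dVec_vertical (hN : HasRankOne N) {y : EuclideanSpace ℝ (Fin 2)}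
    (hy : y ∈ B.chart.target) : dVec N (B.chart.symm y) (coordVec B.chart y 0) = 0 := by
  refine hN.dVec_eq_zero (k := B.k) (w := coordVec B.chart y 1) ?_ ?_
  · rw [B.pd_symm hN hy]
    simp
  · rw [B.pd_symm hN hy]
    simp

/-- Two points of a flow box on which the last coordinate agrees lie on the same plaque. -/
theorem isJoined (hN : HasRankOne N) {x x' : X} (hx : x ∈ B.chart.source)
    (hx' : x' ∈ B.chart.source) (h : N x B.k = N x' B.k) : IsJoined N x x' := by
  set y := B.chart x with hy
  set d := B.chart x' - B.chart x with hd
  have hd1 : d 1 = 0 := by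
    rw [hd, PiLp.sub_apply, B.coord _ hx, B.coord _ hx', h, sub_self]
  have hd0 : d = d 0 • EuclideanSpace.single 0 (1 : ℝ) := by
    ext i
    fin_cases i
    · simp
    · simpa using hd1
  -- a segment of the plaque, parametrized by the smooth transition function so that the curve is
  -- defined on the whole line and stays in the ball
  let c : ℝ → EuclideanSpace ℝ (Fin 2) := fun t => y + Real.smoothTransition t • d
  have hc : ContDiff ℝ ∞ c :=
    contDiff_const.add (Real.smoothTransition.contDiff.smul contDiff_const)
  have hct : ∀ t, c t ∈ B.chart.target := by
    intro t
    have h1 : y ∈ B.chart.target := B.chart.map_source hx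
    have h2 : B.chart x' ∈ B.chart.target := B.chart.map_source hx'
    rw [B.target] at h1 h2 ⊢
    have := (convex_ball B.center B.radius).add_smul_sub_mem h1 h2
      ⟨Real.smoothTransition.nonneg t, Real.smoothTransition.le_one t⟩
    exact this
  have hcd : ∀ t, ∃ a : ℝ, fderiv ℝ c t 1 = a • EuclideanSpace.single 0 (1 : ℝ) := by
    intro t
    have h1 : HasFDerivAt c _ t :=
      (((Real.smoothTransition.contDiff (n := 1)).differentiable (by simp)
        t).hasFDerivAt.smul_const d).const_add y
    refine ⟨fderiv ℝ Real.smoothTransition t 1 * d 0, ?_⟩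
    rw [h1.fderiv, mul_smul, ← hd0]
    rfl
  refine ⟨fun t => B.chart.symm (c t), ?_, ?_, ?_, ?_⟩
  · exact (contMDiffOn_symm_of_mem_maximalAtlas B.mem).comp_contMDiff hc.contMDiff hct
  · simp [c, hy, B.chart.left_inv hx]
  · simp [c, hy, hd, B.chart.left_inv hx']
  · intro t
    have h1 := mfderiv_comp t (mdifferentiableAt_chart_symm B.mem (hct t))
      (hc.contMDiff.mdifferentiableAt (x := t) (by simp))
    rw [mfderiv_eq_fderiv] at h1
    obtain ⟨a, ha⟩ := hcd t
    have h2 : mfderiv 𝓘(ℝ, ℝ) (𝓡 2) (fun t => B.chart.symm (c t)) t (1 : ℝ)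
        = a • coordVec B.chart (c t) 0 := by
      refine (congrArg (fun L : ℝ →L[ℝ] EuclideanSpace ℝ (Fin 2) => L 1) h1).trans ?_
      refine (congrArg (mfderiv (𝓡 2) (𝓡 2) B.chart.symm (c t)) ha).trans ?_
      exact map_smul _ _ _
    have h3 := (dVec N (B.chart.symm (c t))).map_smul a (coordVec B.chart (c t) 0)
    rw [B.dVec_vertical hN (hct t), smul_zero] at h3
    exact (congrArg (dVec N (B.chart.symm (c t))) h2).trans h3

end FlowBox

/-- Flow boxes exist around every point: if `∂ᵢNₖ ≠ 0` in a chart, then the other coordinate of the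
chart and `Nₖ` are coordinates by the inverse function theorem. -/
theorem exists_flowBox [IsManifold (𝓡 2) ∞ X] (hN : HasRankOne N) (x : X) :
    ∃ B : FlowBox N, x ∈ B.chart.source := by
  set e := chartAt (EuclideanSpace ℝ (Fin 2)) x with he'
  have he : e ∈ IsManifold.maximalAtlas (𝓡 2) ∞ X := IsManifold.chart_mem_maximalAtlas x
  have hxe : x ∈ e.source := mem_chart_source _ x
  have hy : e x ∈ e.target := e.map_source hxe
  set y := e x with hyd
  have hxy : e.symm y = x := e.left_inv hxe
  have hs := contDiffOn_comp_symm_target hN.smooth he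
  set u : EuclideanSpace ℝ (Fin 2) → R23 := fun z => N (e.symm z) with hu
  have du : ∀ z ∈ e.target, DifferentiableAt ℝ u z := fun z hz =>
    (hs.contDiffAt (e.open_target.mem_nhds hz)).differentiableAt (by simp)
  obtain ⟨i, k, hik⟩ : ∃ i k, pd i u y k ≠ 0 := by
    by_contra! hcon
    obtain ⟨v, hv⟩ := hN.exists_ne (e.symm y)
    obtain ⟨a, b, rfl⟩ := exists_eq_coordVec he hy v
    apply hv
    have h0 : ∀ i, pd i u y = 0 := fun i => funext (hcon i)
    rw [map_add, map_smul, map_smul, dVec_coordVec he hy (hN.mdifferentiableAt _),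
      dVec_coordVec he hy (hN.mdifferentiableAt _), ← hu, h0, h0, smul_zero, smul_zero, add_zero]
  have hsk : ContDiffOn ℝ ∞ (fun z => u z k) e.target := contDiffOn_pi.1 hs k
  -- the change of coordinates, and the open set `s` on which it is locally invertible
  let Ψ : EuclideanSpace ℝ (Fin 2) → EuclideanSpace ℝ (Fin 2) := fun z => !₂[z (1 - i), u z k]
  have hΨ : ContDiffOn ℝ ∞ Ψ e.target := by
    rw [contDiffOn_euclidean]
    intro j
    fin_cases j
    · exact (EuclideanSpace.proj (𝕜 := ℝ) (1 - i) : _ →L[ℝ] ℝ).contDiff.contDiffOn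
    · exact hsk
  have dΨ : ∀ z ∈ e.target, DifferentiableAt ℝ Ψ z := fun z hz =>
    (hΨ.contDiffAt (e.open_target.mem_nhds hz)).differentiableAt (by simp)
  let s : Set (EuclideanSpace ℝ (Fin 2)) := e.target ∩ {z | pd i u z k ≠ 0}
  have hso : IsOpen s := by
    have hc : ContinuousOn (fun z => pd i u z k) e.target :=
      (contDiffOn_pi.1 (contDiffOn_pd e.open_target hs i) k).continuousOn
    exact hc.isOpen_inter_preimage e.open_target isOpen_ne
  have hequiv : ∀ z ∈ s, ∃ L : EuclideanSpace ℝ (Fin 2) ≃L[ℝ] EuclideanSpace ℝ (Fin 2),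
      HasFDerivAt Ψ (L : EuclideanSpace ℝ (Fin 2) →L[ℝ] EuclideanSpace ℝ (Fin 2)) z := by
    rintro z ⟨hz, hzk⟩
    have hd := (dΨ z hz).hasFDerivAt
    have hcomp : ∀ j v, fderiv ℝ Ψ z v j = fderiv ℝ (fun z => Ψ z j) z v := by
      intro j v
      have := ((EuclideanSpace.proj (𝕜 := ℝ) j : EuclideanSpace ℝ (Fin 2) →L[ℝ] ℝ).hasFDerivAt.comp z
        hd).fderiv
      exact (congrArg (fun L : EuclideanSpace ℝ (Fin 2) →L[ℝ] ℝ => L v) this).symm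
    have hinj : Function.Injective (fderiv ℝ Ψ z).toLinearMap := by
      rw [← LinearMap.ker_eq_bot, LinearMap.ker_eq_bot']
      intro v hv
      have h0 : v (1 - i) = 0 := by
        have h1 := hcomp 0 v
        have h2 : fderiv ℝ Ψ z v = 0 := hv
        rw [h2] at h1
        have h3 : (fun z => Ψ z 0) = (EuclideanSpace.proj (𝕜 := ℝ) (1 - i) : _ →L[ℝ] ℝ) := rfl
        rw [h3, ContinuousLinearMap.fderiv] at h1
        exact h1.symm
      have h1 : v 0 * pd 0 u z k + v 1 * pd 1 u z k = 0 := by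
        have h1 := hcomp 1 v
        have h2 : fderiv ℝ Ψ z v = 0 := hv
        rw [h2] at h1
        have h3 : (fun z => Ψ z 1) = fun z => u z k := rfl
        rw [h3, fderiv_eq_sum_pd, pd_pi (du z hz), pd_pi (du z hz)] at h1
        exact h1.symm
      have h2 : v i = 0 := by
        have hzk' : pd i u z k ≠ 0 := hzk
        fin_cases i
        · have h0' : v 1 = 0 := h0
          rw [h0', zero_mul, add_zero] at h1
          exact (mul_eq_zero.1 h1).resolve_right hzk'
        · have h0' : v 0 = 0 := h0
          rw [h0', zero_mul, zero_add] at h1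
          exact (mul_eq_zero.1 h1).resolve_right hzk'
      ext j
      fin_cases i <;> fin_cases j <;> first | exact h0 | exact h2
    refine ⟨(LinearEquiv.ofInjectiveEndo _ hinj).toContinuousLinearEquiv, ?_⟩
    convert hd using 1
    ext v
    rfl
  -- the inverse is smooth near `Ψ y`, and the range is shrunk to a ball
  have hys : y ∈ s := ⟨hy, hik⟩
  obtain ⟨L, hL⟩ := hequiv y hys
  have hcy := hΨ.contDiffAt (e.open_target.mem_nhds hy)
  let G := (hcy.toOpenPartialHomeomorph Ψ hL (by simp)).restrOpen s hso
  have hG : ∀ z, G z = Ψ z := fun z => rfl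
  have hGs : G.source ⊆ s := Set.inter_subset_right
  have hyG : y ∈ G.source := ⟨hcy.mem_toOpenPartialHomeomorph_source hL (by simp), hys⟩
  have hGsymm : ContDiffOn ℝ ∞ G.symm G.target := by
    intro a ha
    have h1 := hGs (G.map_target ha)
    obtain ⟨L, hL⟩ := hequiv _ h1
    exact (G.contDiffAt_symm ha hL
      (hΨ.contDiffAt (e.open_target.mem_nhds h1.1))).contDiffWithinAt
  let Φ := e.trans G
  have hxΦ : x ∈ Φ.source := by
    rw [OpenPartialHomeomorph.trans_source]
    exact ⟨hxe, hyG⟩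
  obtain ⟨r, hr, hball⟩ := Metric.isOpen_iff.1 Φ.open_target (Φ x) (Φ.map_source hxΦ)
  let Φ' := (Φ.symm.restrOpen (Metric.ball (Φ x) r) Metric.isOpen_ball).symm
  have hsrc : Φ'.source ⊆ Φ.source := by
    rintro z ⟨hz, -⟩
    exact hz
  have hΦe : ∀ z ∈ Φ'.source, z ∈ e.source ∧ e z ∈ G.source := by
    intro z hz
    have := hsrc hz
    rwa [OpenPartialHomeomorph.trans_source] at this
  have htgt : Φ'.target = Metric.ball (Φ x) r := Set.inter_eq_right.2 hball
  have hmem : Φ' ∈ IsManifold.maximalAtlas (𝓡 2) ∞ X := by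
    apply OpenPartialHomeomorph.mem_maximalAtlas_of_contMDiffOn
    · exact (hΨ.contMDiffOn.mono (fun z hz => hz)).comp
        ((contMDiffOn_of_mem_maximalAtlas he).mono fun z hz => (hΦe z hz).1)
        fun z hz => (hGs (hΦe z hz).2).1
    · have h1 : ∀ z ∈ Φ'.target, z ∈ G.target ∧ G.symm z ∈ e.target := by
        intro z hz
        have : z ∈ Φ.target := hball (htgt ▸ hz)
        rwa [OpenPartialHomeomorph.trans_target] at this
      exact (contMDiffOn_symm_of_mem_maximalAtlas he).comp
        (hGsymm.contMDiffOn.mono fun z hz => (h1 z hz).1) fun z hz => (h1 z hz).2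
  refine ⟨⟨k, Φ', Φ x, r, hmem, htgt, ?_⟩, hxΦ, ?_⟩
  · intro z hz
    change N (e.symm (e z)) k = N z k
    rw [e.left_inv (hΦe z hz).1]
  · change Φ x ∈ Metric.ball (Φ x) r
    exact Metric.mem_ball_self hr

end Leaves

/-! ### The smooth structure of the leaf space -/

section Leaves

variable {X : Type*} [TopologicalSpace X] [ChartedSpace (EuclideanSpace ℝ (Fin 2)) X]
  {N : X → R23}

theorem leafMap_eq_iff {x y : X} :
    leafMap N x = leafMap N y ↔ Relation.EqvGen (IsJoined N) x y :=
  Quotient.eq (r := sameLeaf N)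

theorem IsJoined.leafMap_eq {x y : X} (h : IsJoined N x y) : leafMap N x = leafMap N y :=
  leafMap_eq_iff.2 (Relation.EqvGen.rel _ _ h)

theorem continuous_leafMap : Continuous (leafMap N) := continuous_quotient_mk'

theorem surjective_leafMap : Function.Surjective (leafMap N) := Quotient.mk_surjective

/-- In a flow box, the interior of a union of leaves contains every plaque that it meets. -/
theorem FlowBox.mem_interior (B : FlowBox N) (hN : HasRankOne N) {S : Set X}
    (hS : ∀ x y, x ∈ S → IsJoined N y x → y ∈ S) {x x' : X} (hx : x ∈ B.chart.source)
    (hx' : x' ∈ B.chart.source) (h : N x B.k = N x' B.k) (hxS : x ∈ interior S) :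
    x' ∈ interior S := by
  -- translation along the plaques maps a neighbourhood of `x'` to a neighbourhood of `x`
  let τ : X → EuclideanSpace ℝ (Fin 2) := fun z => B.chart z + (B.chart x - B.chart x')
  have h0 : τ x' = B.chart x := by simp [τ]
  have hτ : ContinuousAt τ x' := (B.chart.continuousAt hx').add continuousAt_const
  have hxt : B.chart x ∈ B.chart.target := B.chart.map_source hx
  have h1 : ∀ᶠ z in nhds x', τ z ∈ B.chart.target :=
    hτ (by rw [h0]; exact B.chart.open_target.mem_nhds hxt)
  have hσ : ContinuousAt (fun z => B.chart.symm (τ z)) x' := by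
    refine ContinuousAt.comp (g := B.chart.symm) ?_ hτ
    rw [h0]
    exact B.chart.symm.continuousAt hxt
  have h2 : ∀ᶠ z in nhds x', B.chart.symm (τ z) ∈ interior S := by
    refine hσ (isOpen_interior.mem_nhds ?_)
    change B.chart.symm (τ x') ∈ interior S
    rw [h0, B.chart.left_inv hx]
    exact hxS
  rw [mem_interior_iff_mem_nhds]
  filter_upwards [h1, h2, B.chart.open_source.mem_nhds hx'] with z hz1 hz2 hz
  refine hS _ z (interior_subset hz2) (B.isJoined hN hz (B.chart.map_target hz1) ?_)
  rw [B.coord_symm hz1, ← B.coord _ hz]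
  have : B.chart x 1 = B.chart x' 1 := by rw [B.coord _ hx, B.coord _ hx', h]
  simp [τ, this]

theorem IsJoined.symm {x y : X} (h : IsJoined N x y) : IsJoined N y x := by
  obtain ⟨γ, hγ, h0, h1, hv⟩ := h
  have hr : ContMDiff 𝓘(ℝ, ℝ) 𝓘(ℝ, ℝ) ∞ (fun t : ℝ => 1 - t) :=
    (contDiff_const.sub contDiff_id).contMDiff
  refine ⟨fun t => γ (1 - t), hγ.comp hr, by simpa using h1, by simpa using h0, fun t => ?_⟩
  have h2 := mfderiv_comp t ((hγ (1 - t)).mdifferentiableAt (by simp))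
    (hr.mdifferentiableAt (x := t) (by simp))
  have h4 : HasFDerivAt (fun t : ℝ => 1 - t) (-ContinuousLinearMap.id ℝ ℝ) t :=
    (hasFDerivAt_id t).const_sub 1
  rw [mfderiv_eq_fderiv, h4.fderiv] at h2
  have h3 := congrArg (fun L : ℝ →L[ℝ] EuclideanSpace ℝ (Fin 2) => L 1) h2
  have h5 : mfderiv 𝓘(ℝ, ℝ) (𝓡 2) (fun t => γ (1 - t)) t (1 : ℝ)
      = -mfderiv 𝓘(ℝ, ℝ) (𝓡 2) γ (1 - t) (1 : ℝ) := h3.trans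
    (ContinuousLinearMap.map_neg (mfderiv 𝓘(ℝ, ℝ) (𝓡 2) γ (1 - t)) (1 : ℝ))
  have h6 := (dVec N (γ (1 - t))).map_neg (mfderiv 𝓘(ℝ, ℝ) (𝓡 2) γ (1 - t) (1 : ℝ))
  rw [hv, neg_zero] at h6
  exact (congrArg (dVec N (γ (1 - t))) h5).trans h6

/-- The interior of a union of leaves is again a union of leaves: along a curve in a leaf,
membership in the interior is locally constant by the flow boxes. -/
theorem IsJoined.mem_interior [IsManifold (𝓡 2) ∞ X] (hN : HasRankOne N) {S : Set X}
    (hS : ∀ x y, x ∈ S → IsJoined N y x → y ∈ S) {x y : X} (h : IsJoined N x y)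
    (hx : x ∈ interior S) : y ∈ interior S := by
  obtain ⟨γ, hγ, rfl, rfl, hv⟩ := h
  have hc : ∀ s t, N (γ s) = N (γ t) := IsJoined.const hN.smooth (fun _ _ h => h) hγ hv
  have hloc : IsLocallyConstant fun t => (γ t ∈ interior S) := by
    rw [IsLocallyConstant.iff_eventually_eq]
    intro t
    obtain ⟨B, hB⟩ := exists_flowBox hN (γ t)
    filter_upwards [hγ.continuous.continuousAt (B.chart.open_source.mem_nhds hB)] with s hs
    exact propext ⟨fun h => B.mem_interior hN hS hs hB (by rw [hc s t]) h,
      fun h => B.mem_interior hN hS hB hs (by rw [hc s t]) h⟩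
  exact (hloc.apply_eq_of_preconnectedSpace 0 1).mp hx

/-- The projection to the leaf space is open: the saturation of an open set is open. -/
theorem isOpenMap_leafMap [IsManifold (𝓡 2) ∞ X] (hN : HasRankOne N) :
    IsOpenMap (leafMap N) := by
  intro U hU
  rw [← isQuotientMap_quotient_mk'.isOpen_preimage]
  change IsOpen (leafMap N ⁻¹' (leafMap N '' U))
  set S := leafMap N ⁻¹' (leafMap N '' U) with hS
  have hsat : ∀ x y, x ∈ S → IsJoined N y x → y ∈ S := by
    rintro x y ⟨u, hu, hux⟩ hxy
    exact ⟨u, hu, hux.trans hxy.leafMap_eq.symm⟩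
  rw [← interior_eq_iff_isOpen]
  refine Set.Subset.antisymm interior_subset ?_
  rintro x ⟨u, hu, hux⟩
  have hui : u ∈ interior S :=
    mem_interior.2 ⟨U, fun z hz => ⟨z, hz, rfl⟩, hU, hu⟩
  have key : ∀ {a b : X}, Relation.EqvGen (IsJoined N) a b → (a ∈ interior S ↔ b ∈ interior S) := by
    intro a b hab
    induction hab with
    | rel a b h => exact ⟨h.mem_interior hN hsat, h.symm.mem_interior hN hsat⟩
    | refl a => rfl
    | symm a b _ ih => exact ih.symm
    | trans a b c _ _ ih ih' => exact ih.trans ih'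
  exact (key (leafMap_eq_iff.1 hux)).1 hui

/-- The map induced by `N` on the leaf space. -/
noncomputable def leafValue (hN : HasRankOne N) : Quotient (sameLeaf N) → R23 :=
  Quotient.lift N fun _ _ h => eq_of_sameLeaf hN.smooth (fun _ _ h => h) h

theorem leafValue_leafMap (hN : HasRankOne N) (x : X) : leafValue hN (leafMap N x) = N x := rfl

theorem continuous_leafValue (hN : HasRankOne N) : Continuous (leafValue hN) :=
  hN.smooth.continuous.quotient_lift _

theorem contDiff_single_zero :
    ContDiff ℝ ∞ fun a : ℝ => (EuclideanSpace.single 0 a : EuclideanSpace ℝ (Fin 1)) := by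
  have h : (fun a : ℝ => (EuclideanSpace.single 0 a : EuclideanSpace ℝ (Fin 1)))
      = fun a => a • EuclideanSpace.single 0 1 := by
    funext a
    ext i
    fin_cases i
    simp
  rw [h]
  exact contDiff_id.smul contDiff_const

namespace FlowBox

variable (B : FlowBox N)

/-- The transversal of a flow box through its centre. -/
noncomputable def transversal (s : EuclideanSpace ℝ (Fin 1)) : EuclideanSpace ℝ (Fin 2) :=
  B.center + EuclideanSpace.single 1 (s 0 - B.center 1)

theorem transversal_one (s : EuclideanSpace ℝ (Fin 1)) : B.transversal s 1 = s 0 := by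
  simp [transversal]

theorem contDiff_transversal : ContDiff ℝ ∞ B.transversal := by
  have h : B.transversal = fun s => B.center + (s 0 - B.center 1) • EuclideanSpace.single 1 1 := by
    funext s
    ext i
    fin_cases i <;> simp [transversal]
  rw [h]
  exact contDiff_const.add ((((EuclideanSpace.proj (𝕜 := ℝ) 0 :
    EuclideanSpace ℝ (Fin 1) →L[ℝ] ℝ).contDiff).sub contDiff_const).smul contDiff_const)

theorem transversal_mem {s : EuclideanSpace ℝ (Fin 1)} (hs : |s 0 - B.center 1| < B.radius) :
    B.transversal s ∈ B.chart.target := by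
  rw [B.target, Metric.mem_ball, dist_eq_norm]
  simpa [transversal] using hs

/-- The last coordinate of a point of the flow box lies in the range of the chart of the leaf space.
-/
theorem abs_lt {x : X} (hx : x ∈ B.chart.source) : |N x B.k - B.center 1| < B.radius := by
  have h := B.chart.map_source hx
  rw [B.target, Metric.mem_ball, dist_eq_norm] at h
  rw [← B.coord x hx]
  exact (PiLp.norm_apply_le (B.chart x - B.center) 1).trans_lt h

/-- The chart of the leaf space given by a flow box: a leaf which meets the flow box is mapped to
the last coordinate of its plaque. -/
noncomputable def leafChart [IsManifold (𝓡 2) ∞ X] (hN : HasRankOne N) :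
    OpenPartialHomeomorph (Quotient (sameLeaf N)) (EuclideanSpace ℝ (Fin 1)) where
  toFun q := EuclideanSpace.single 0 (leafValue hN q B.k)
  invFun s := leafMap N (B.chart.symm (B.transversal s))
  source := leafMap N '' B.chart.source
  target := {s | |s 0 - B.center 1| < B.radius}
  map_source' := by
    rintro _ ⟨x, hx, rfl⟩
    simpa [leafValue_leafMap] using B.abs_lt hx
  map_target' s hs := ⟨_, B.chart.map_target (B.transversal_mem hs), rfl⟩
  left_inv' := by
    rintro _ ⟨x, hx, rfl⟩
    have hs : B.transversal (EuclideanSpace.single 0 (leafValue hN (leafMap N x) B.k))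
        ∈ B.chart.target := B.transversal_mem (by simpa [leafValue_leafMap] using B.abs_lt hx)
    refine (B.isJoined hN (B.chart.map_target hs) hx ?_).leafMap_eq
    rw [B.coord_symm hs, transversal_one]
    simp [leafValue_leafMap]
  right_inv' s hs := by
    ext i
    fin_cases i
    have : N (B.chart.symm (B.transversal s)) B.k = s 0 := by
      rw [B.coord_symm (B.transversal_mem hs), transversal_one]
    simpa [leafValue_leafMap] using this
  open_source := isOpenMap_leafMap hN _ B.chart.open_source
  open_target := by
    have : Continuous fun s : EuclideanSpace ℝ (Fin 1) => |s 0 - B.center 1| := by fun_prop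
    exact isOpen_lt this continuous_const
  continuousOn_toFun := by
    have h := continuous_leafValue hN
    have : Continuous fun q => leafValue hN q B.k := (continuous_apply B.k).comp h
    exact (contDiff_single_zero.continuous.comp this).continuousOn
  continuousOn_invFun := by
    refine continuous_leafMap.comp_continuousOn (B.chart.continuousOn_symm.comp
      B.contDiff_transversal.continuous.continuousOn fun s hs => B.transversal_mem hs)

end FlowBox

/-- The charts of the flow boxes make the leaf space a curve. -/
@[reducible] noncomputable def leafChartedSpace [IsManifold (𝓡 2) ∞ X] (hN : HasRankOne N) :
    ChartedSpace (EuclideanSpace ℝ (Fin 1)) (Quotient (sameLeaf N)) where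
  atlas := Set.range fun B : FlowBox N => B.leafChart hN
  chartAt q := (exists_flowBox hN q.out).choose.leafChart hN
  mem_chart_source q := ⟨q.out, (exists_flowBox hN q.out).choose_spec, Quotient.out_eq q⟩
  chart_mem_atlas _ := ⟨_, rfl⟩

/-- The properties of the projection onto the leaf space which characterise its smooth structure:
it is a submersion whose differential has the same kernel as `dN`, and a smooth function whose
differential vanishes on `Ker dN` is the pullback of a smooth function. -/
structure IsLeafProjection {L : Type*} [TopologicalSpace L]
    [ChartedSpace (EuclideanSpace ℝ (Fin 1)) L] (N : X → R23) (p : X → L) : Prop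
    extends IsSmoothSubmersion p where
  ker : ∀ x v, mfderiv (𝓡 2) (𝓡 1) p x v = 0 ↔ dVec N x v = 0
  factor : ∀ u : X → ℝ, ContMDiff (𝓡 2) 𝓘(ℝ, ℝ) ∞ u →
    (∀ x v, dVec N x v = 0 → mfderiv (𝓡 2) 𝓘(ℝ, ℝ) u x v = 0) →
    ∃ ū : L → ℝ, ContMDiff (𝓡 1) 𝓘(ℝ, ℝ) ∞ ū ∧ ∀ x, u x = ū (p x)

theorem surjective_of_ne_zero {E : Type*} [AddCommGroup E] [Module ℝ E]
    (L : E →ₗ[ℝ] EuclideanSpace ℝ (Fin 1)) {v : E} (hv : L v ≠ 0) : Function.Surjective L := by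
  intro w
  have h0 : L v 0 ≠ 0 := by
    intro h
    apply hv
    ext i
    fin_cases i
    exact h
  refine ⟨(w 0 / L v 0) • v, ?_⟩
  rw [map_smul]
  ext i
  fin_cases i
  exact div_mul_cancel₀ _ h0

/-- The coordinate of the leaf of a point in the chart given by a flow box. -/
noncomputable def FlowBox.leafCoord (B : FlowBox N) (x : X) : EuclideanSpace ℝ (Fin 1) :=
  EuclideanSpace.single 0 (N x B.k)

theorem FlowBox.contMDiff_leafCoord (hN : HasRankOne N) (B : FlowBox N) :
    ContMDiff (𝓡 2) (𝓡 1) ∞ B.leafCoord :=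
  contDiff_single_zero.contMDiff.comp (contMDiff_pi_space.1 hN.smooth B.k)

theorem FlowBox.mfderiv_leafCoord (hN : HasRankOne N) (B : FlowBox N) (x : X)
    (v : TangentSpace (𝓡 2) x) : (mfderiv (𝓡 2) (𝓡 1) B.leafCoord x v : EuclideanSpace ℝ (Fin 1))
      = EuclideanSpace.single 0 (dVec N x v B.k) := by
  rw [← dVec_apply (hN.mdifferentiableAt x)]
  have h := ((EuclideanSpace.proj (𝕜 := ℝ) 0 :
    EuclideanSpace ℝ (Fin 1) →L[ℝ] ℝ).hasFDerivAt.hasMFDerivAt.comp x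
      ((B.contMDiff_leafCoord hN x).mdifferentiableAt (by simp)).hasMFDerivAt).mfderiv
  have h2 : (EuclideanSpace.proj (𝕜 := ℝ) 0 : EuclideanSpace ℝ (Fin 1) →L[ℝ] ℝ) ∘ B.leafCoord
      = fun z => N z B.k := by
    funext z
    simp [leafCoord]
  rw [h2] at h
  refine PiLp.ext (p := 2) (α := fun _ : Fin 1 => ℝ) fun i => ?_
  fin_cases i
  have h3 := congrArg (fun L : EuclideanSpace ℝ (Fin 2) →L[ℝ] ℝ => L v) h
  have h4 : ∀ a : ℝ, a = (EuclideanSpace.single (0 : Fin 1) a : EuclideanSpace ℝ (Fin 1)) 0 :=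
    fun a => by simp
  exact h3.symm.trans (h4 _)

theorem FlowBox.leafChart_symm_leafCoord [IsManifold (𝓡 2) ∞ X] (hN : HasRankOne N)
    (B : FlowBox N) {x : X} (hx : x ∈ B.chart.source) :
    B.leafCoord x ∈ (B.leafChart hN).target ∧
      (B.leafChart hN).symm (B.leafCoord x) = leafMap N x := by
  have h1 : leafMap N x ∈ (B.leafChart hN).source := ⟨x, hx, rfl⟩
  have h2 : (B.leafChart hN) (leafMap N x) = B.leafCoord x := rfl
  rw [← h2]
  exact ⟨(B.leafChart hN).map_source h1, (B.leafChart hN).left_inv h1⟩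

theorem FlowBox.eventuallyEq_leafMap [IsManifold (𝓡 2) ∞ X] (hN : HasRankOne N)
    (B : FlowBox N) {x : X} (hx : x ∈ B.chart.source) :
    leafMap N =ᶠ[nhds x] (B.leafChart hN).symm ∘ B.leafCoord := by
  filter_upwards [B.chart.open_source.mem_nhds hx] with z hz
    using (B.leafChart_symm_leafCoord hN hz).2.symm

/-- A leafwise constant smooth function is smooth in the charts of the leaf space. -/
theorem FlowBox.contDiffOn_transversal {V : Type*} [NormedAddCommGroup V] [NormedSpace ℝ V]
    [IsManifold (𝓡 2) ∞ X] (hN : HasRankOne N) (B : FlowBox N) {u : X → V}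
    (hu : ContMDiff (𝓡 2) 𝓘(ℝ, V) ∞ u) :
    ContDiffOn ℝ ∞ (fun s => u (B.chart.symm (B.transversal s))) (B.leafChart hN).target :=
  (contDiffOn_comp_symm_target hu B.mem).comp B.contDiff_transversal.contDiffOn
    fun _ hs => B.transversal_mem hs

/-- The transition functions between the charts of flow boxes are components of `N` along
transversals, hence smooth. -/
theorem isManifold_leafSpace [IsManifold (𝓡 2) ∞ X] (hN : HasRankOne N) :
    @IsManifold ℝ _ _ _ _ _ _ (𝓡 1) ∞ (Quotient (sameLeaf N)) _ (leafChartedSpace hN) := by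
  let := leafChartedSpace hN
  apply isManifold_of_contDiffOn
  rintro _ _ ⟨B, rfl⟩ ⟨B', rfl⟩
  simp only [modelWithCornersSelf_coe, modelWithCornersSelf_coe_symm, Function.comp_id,
    Function.id_comp, Set.preimage_id, Set.range_id, Set.inter_univ]
  have h1 : ContDiffOn ℝ ∞ (fun s => N (B.chart.symm (B.transversal s)) B'.k)
      (B.leafChart hN).target := contDiffOn_pi.1 (B.contDiffOn_transversal hN hN.smooth) B'.k
  refine (contDiff_single_zero.comp_contDiffOn h1).mono ?_
  intro s hs
  rw [OpenPartialHomeomorph.trans_source] at hs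
  exact hs.1

/-- In the charts of flow boxes, the projection to the leaf space is a component of `N`, and a
function on the leaf space is its restriction to a transversal. -/
theorem isLeafProjection_leafMap [IsManifold (𝓡 2) ∞ X] (hN : HasRankOne N)
    [ChartedSpace (EuclideanSpace ℝ (Fin 1)) (Quotient (sameLeaf N))]
    [IsManifold (𝓡 1) ∞ (Quotient (sameLeaf N))]
    (hmem : ∀ B : FlowBox N,
      B.leafChart hN ∈ IsManifold.maximalAtlas (𝓡 1) ∞ (Quotient (sameLeaf N))) :
    IsLeafProjection N (leafMap N) := by
  have hsm : ContMDiff (𝓡 2) (𝓡 1) ∞ (leafMap N) := by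
    intro x
    obtain ⟨B, hB⟩ := exists_flowBox hN x
    refine ContMDiffAt.congr_of_eventuallyEq ?_ (B.eventuallyEq_leafMap hN hB)
    exact (contMDiffAt_symm_of_mem_maximalAtlas (hmem B)
      (B.leafChart_symm_leafCoord hN hB).1).comp x (B.contMDiff_leafCoord hN x)
  have hker : ∀ x v, mfderiv (𝓡 2) (𝓡 1) (leafMap N) x v = 0 ↔ dVec N x v = 0 := by
    intro x v
    obtain ⟨B, hB⟩ := exists_flowBox hN x
    constructor
    · intro hv
      have h1 := mfderiv_comp x (mdifferentiableAt_chart (hmem B)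
        (show leafMap N x ∈ (B.leafChart hN).source from ⟨x, hB, rfl⟩))
        ((hsm x).mdifferentiableAt (by simp))
      have h2 : (B.leafChart hN) ∘ leafMap N = B.leafCoord := rfl
      rw [h2] at h1
      have h3 := congrArg (fun L : EuclideanSpace ℝ (Fin 2) →L[ℝ] EuclideanSpace ℝ (Fin 1) => L v) h1
      have h4 : (mfderiv (𝓡 2) (𝓡 1) B.leafCoord x v : EuclideanSpace ℝ (Fin 1))
          = (0 : EuclideanSpace ℝ (Fin 1)) :=
        h3.trans ((congrArg (mfderiv (𝓡 1) (𝓡 1) (B.leafChart hN) (leafMap N x)) hv).trans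
          (ContinuousLinearMap.map_zero _))
      rw [B.mfderiv_leafCoord hN] at h4
      have h5 : dVec N x v B.k = 0 := by
        have := congrArg (fun w : EuclideanSpace ℝ (Fin 1) => w 0) h4
        simpa using this
      obtain ⟨y, hy, rfl⟩ := exists_symm_eq hB
      refine hN.dVec_eq_zero (w := coordVec B.chart y 1) ?_ h5
      rw [B.pd_symm hN hy]
      simp
    · intro hv
      have h1 := mfderiv_comp x (mdifferentiableAt_chart_symm (hmem B)
        (B.leafChart_symm_leafCoord hN hB).1) ((B.contMDiff_leafCoord hN x).mdifferentiableAt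
          (by simp))
      rw [(B.eventuallyEq_leafMap hN hB).mfderiv_eq]
      refine (congrArg (fun L : EuclideanSpace ℝ (Fin 2) →L[ℝ] EuclideanSpace ℝ (Fin 1) => L v)
        h1).trans ?_
      have h3 : (mfderiv (𝓡 2) (𝓡 1) B.leafCoord x v : EuclideanSpace ℝ (Fin 1))
          = (0 : EuclideanSpace ℝ (Fin 1)) := by
        have h4 : (EuclideanSpace.single 0 ((0 : R23) B.k) : EuclideanSpace ℝ (Fin 1)) = 0 := by
          simp
        exact (B.mfderiv_leafCoord hN x v).trans ((congrArg (fun w : R23 =>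
          (EuclideanSpace.single 0 (w B.k) : EuclideanSpace ℝ (Fin 1))) hv).trans h4)
      exact (congrArg (mfderiv (𝓡 1) (𝓡 1) (B.leafChart hN).symm (B.leafCoord x)) h3).trans
        (ContinuousLinearMap.map_zero _)
  refine ⟨⟨hsm, surjective_leafMap, ?_⟩, hker, ?_⟩
  · intro x
    obtain ⟨v, hv⟩ := hN.exists_ne x
    exact surjective_of_ne_zero (mfderiv (𝓡 2) (𝓡 1) (leafMap N) x).toLinearMap (v := v)
      fun h => hv ((hker x v).1 h)
  · intro u hu hv
    let ū : Quotient (sameLeaf N) → ℝ :=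
      Quotient.lift u fun _ _ h => eq_of_sameLeaf hu hv h
    refine ⟨ū, ?_, fun x => rfl⟩
    intro q
    obtain ⟨x, rfl⟩ := surjective_leafMap q
    obtain ⟨B, hB⟩ := exists_flowBox hN x
    have hx : leafMap N x ∈ (B.leafChart hN).source := ⟨x, hB, rfl⟩
    have h1 : ContMDiffOn (𝓡 1) 𝓘(ℝ, ℝ) ∞ (fun s => u (B.chart.symm (B.transversal s)))
        (B.leafChart hN).target := (B.contDiffOn_transversal hN hu).contMDiffOn
    have h2 := (h1.comp (contMDiffOn_of_mem_maximalAtlas (hmem B))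
      fun q hq => (B.leafChart hN).map_source hq).contMDiffAt
        ((B.leafChart hN).open_source.mem_nhds hx)
    refine h2.congr_of_eventuallyEq ?_
    filter_upwards [(B.leafChart hN).open_source.mem_nhds hx] with q hq
    change ū q = ū ((B.leafChart hN).symm (B.leafChart hN q))
    rw [(B.leafChart hN).left_inv hq]

/-- The leaf space has the structure of a smooth curve. The setoid `S` allows the leaves to be
presented by another, equal equivalence relation. -/
theorem exists_isLeafProjection [IsManifold (𝓡 2) ∞ X] (hN : HasRankOne N) {S : Setoid X}
    (hS : sameLeaf N = S) : ∃ (_ : ChartedSpace (EuclideanSpace ℝ (Fin 1)) (Quotient S))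
      (_ : IsManifold (𝓡 1) ∞ (Quotient S)), IsLeafProjection N (Quotient.mk S) := by
  subst hS
  let := leafChartedSpace hN
  have := isManifold_leafSpace hN
  exact ⟨leafChartedSpace hN, this, isLeafProjection_leafMap hN fun B =>
    IsManifold.subset_maximalAtlas ⟨B, rfl⟩⟩

end Leaves

/-! ### Functions and forms which are constant along the leaves -/

section Forms

variable {n : ℕ} {M : Type*} [TopologicalSpace M] [ChartedSpace (EuclideanSpace ℝ (Fin n)) M]
  {V : Type*} [NormedAddCommGroup V] [NormedSpace ℝ V]

/-- Smoothness of a map to a vector space may be checked in one chart around every point. -/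
theorem contMDiff_of_chart {K : M → V}
    (h : ∀ x, ∃ e ∈ IsManifold.maximalAtlas (𝓡 n) ∞ M, x ∈ e.source ∧
      ContDiffAt ℝ ∞ (fun y => K (e.symm y)) (e x)) : ContMDiff (𝓡 n) 𝓘(ℝ, V) ∞ K := by
  intro x
  obtain ⟨e, he, hx, hK⟩ := h x
  have h1 := hK.contMDiffAt.comp x (contMDiffAt_of_mem_maximalAtlas he hx)
  refine h1.congr_of_eventuallyEq ?_
  filter_upwards [e.open_source.mem_nhds hx] with z hz
  simp [e.left_inv hz]

theorem exists_coordVec_ne_zero {β : OneForm n M} {e : OpenPartialHomeomorph M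
    (EuclideanSpace ℝ (Fin n))} (he : e ∈ IsManifold.maximalAtlas (𝓡 n) ∞ M)
    {y : EuclideanSpace ℝ (Fin n)} (hy : y ∈ e.target) (hβ : β (e.symm y) ≠ 0) :
    ∃ i, β (e.symm y) (coordVec e y i) ≠ 0 := by
  by_contra! hcon
  apply hβ
  obtain ⟨b, hb⟩ := exists_coordBasis he hy
  exact b.ext fun i => by rw [hb, hcon, LinearMap.zero_apply]

/-- The factor `K` in `du = β K` is smooth if the 1-form `β` vanishes nowhere. -/
theorem contMDiff_of_mfderiv_eq [IsManifold (𝓡 n) ∞ M] {β : OneForm n M} (hβ : IsSmoothForm β)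
    (hne : ∀ x, β x ≠ 0) {u K : M → V} (hu : ContMDiff (𝓡 n) 𝓘(ℝ, V) ∞ u)
    (h : ∀ x v, mfderiv (𝓡 n) 𝓘(ℝ, V) u x v = β x v • K x) : ContMDiff (𝓡 n) 𝓘(ℝ, V) ∞ K := by
  apply contMDiff_of_chart
  intro x
  have he : chartAt (EuclideanSpace ℝ (Fin n)) x ∈ IsManifold.maximalAtlas (𝓡 n) ∞ M :=
    IsManifold.chart_mem_maximalAtlas x
  have hx := mem_chart_source (EuclideanSpace ℝ (Fin n)) x
  set e := chartAt (EuclideanSpace ℝ (Fin n)) x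
  refine ⟨e, he, hx, ?_⟩
  have hy : e x ∈ e.target := e.map_source hx
  obtain ⟨i, hi⟩ := exists_coordVec_ne_zero he hy (hne _)
  have hβi := hβ e he i
  have hβy := hβi.contDiffAt (e.open_target.mem_nhds hy)
  have hui := contDiffOn_pd e.open_target (contDiffOn_comp_symm_target hu he) i
  refine ((hβy.inv hi).smul (hui.contDiffAt (e.open_target.mem_nhds hy))).congr_of_eventuallyEq ?_
  filter_upwards [e.open_target.mem_nhds hy, hβy.continuousAt.eventually_ne hi] with z hz hz'
  have h1 : pd i (fun y => u (e.symm y)) z = β (e.symm z) (coordVec e z i) • K (e.symm z) :=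
    (mfderiv_coordVec he hz ((hu _).mdifferentiableAt (by simp)) i).symm.trans (h _ _)
  rw [Pi.smul_apply', Pi.inv_apply, h1, smul_smul, inv_mul_cancel₀ hz', one_smul]

theorem linearMap_eq_zero_iff {ζ : EuclideanSpace ℝ (Fin 1) →ₗ[ℝ] ℝ} (hζ : ζ ≠ 0)
    {v : EuclideanSpace ℝ (Fin 1)} : ζ v = 0 ↔ v = 0 := by
  have h : ∀ w : EuclideanSpace ℝ (Fin 1), w = w 0 • EuclideanSpace.single 0 1 := by
    intro w
    ext i
    fin_cases i
    simp
  have h1 : ζ (EuclideanSpace.single 0 1) ≠ 0 := by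
    intro h0
    apply hζ
    ext w
    rw [h w, map_smul, h0, smul_zero, LinearMap.zero_apply]
  constructor
  · intro hv
    rw [h v, map_smul, smul_eq_mul] at hv
    rw [h v, (mul_eq_zero.1 hv).resolve_right h1, zero_smul]
  · rintro rfl
    exact map_zero _

/-- A linear map on a line is a multiple of any nonzero linear form. -/
theorem exists_eq_smul {ζ : EuclideanSpace ℝ (Fin 1) →ₗ[ℝ] ℝ} (hζ : ζ ≠ 0)
    (A : EuclideanSpace ℝ (Fin 1) →ₗ[ℝ] V) : ∃ K : V, ∀ v, A v = ζ v • K := by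
  obtain ⟨t, ht⟩ : ∃ t, ζ t ≠ 0 := by
    by_contra! hcon
    exact hζ (LinearMap.ext hcon)
  refine ⟨(ζ t)⁻¹ • A t, fun v => ?_⟩
  have h1 : v - (ζ v * (ζ t)⁻¹) • t = 0 := by
    rw [← linearMap_eq_zero_iff hζ, map_sub, map_smul, smul_eq_mul, inv_mul_cancel_right₀ ht,
      sub_self]
  conv_lhs => rw [sub_eq_zero.1 h1, map_smul, mul_smul]

/-- On a curve, every smooth function has a smooth derivative with respect to a nowhere vanishing
1-form. -/
theorem IsNowhereZeroForm.exists_deriv {L : Type*} [TopologicalSpace L]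
    [ChartedSpace (EuclideanSpace ℝ (Fin 1)) L] [IsManifold (𝓡 1) ∞ L] {ζ : OneForm 1 L}
    (hζ : IsNowhereZeroForm ζ) {a : L → V} (ha : ContMDiff (𝓡 1) 𝓘(ℝ, V) ∞ a) :
    ∃ a' : L → V, ContMDiff (𝓡 1) 𝓘(ℝ, V) ∞ a' ∧
      ∀ q v, mfderiv (𝓡 1) 𝓘(ℝ, V) a q v = ζ q v • a' q := by
  have hpt : ∀ q, ∃ K : V, ∀ v, mfderiv (𝓡 1) 𝓘(ℝ, V) a q v = ζ q v • K := fun q =>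
    exists_eq_smul (V := V) (ζ := ζ q) (hζ.2 q) (mfderiv (𝓡 1) 𝓘(ℝ, V) a q).toLinearMap
  choose a' ha' using hpt
  exact ⟨a', contMDiff_of_mfderiv_eq hζ.1 hζ.2 ha ha', ha'⟩

theorem IsNowhereZeroForm.neg {L : Type*} [TopologicalSpace L]
    [ChartedSpace (EuclideanSpace ℝ (Fin 1)) L] {ζ : OneForm 1 L} (hζ : IsNowhereZeroForm ζ) :
    IsNowhereZeroForm (-ζ) :=
  ⟨fun e he i => (hζ.1 e he i).neg, fun q => neg_ne_zero.2 (hζ.2 q)⟩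

end Forms

section Projection

variable {X : Type*} [TopologicalSpace X] [ChartedSpace (EuclideanSpace ℝ (Fin 2)) X]
  {L : Type*} [TopologicalSpace L] [ChartedSpace (EuclideanSpace ℝ (Fin 1)) L]
  {N : X → R23} {p : X → L}

/-- The factorization property of a leaf projection, for maps with values in `ℝ^{2,3}`. -/
theorem IsLeafProjection.exists_factor (hp : IsLeafProjection N p) {u : X → R23}
    (hu : ContMDiff (𝓡 2) 𝓘(ℝ, R23) ∞ u) (h : ∀ x v, dVec N x v = 0 → dVec u x v = 0) :
    ∃ ū : L → R23, ContMDiff (𝓡 1) 𝓘(ℝ, R23) ∞ ū ∧ ∀ x, u x = ū (p x) := by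
  have hk : ∀ k, ∃ ū : L → ℝ, ContMDiff (𝓡 1) 𝓘(ℝ, ℝ) ∞ ū ∧ ∀ x, u x k = ū (p x) := by
    intro k
    refine hp.factor _ (contMDiff_pi_space.1 hu k) fun x v hv => ?_
    rw [dVec_apply ((hu x).mdifferentiableAt (by simp)), h x v hv]
    rfl
  choose ū hū h using hk
  exact ⟨fun q k => ū k q, contMDiff_pi_space.2 hū, fun x => funext fun k => h k x⟩

theorem IsLeafProjection.mfderiv_comp (hp : IsLeafProjection N p) {V : Type*}
    [NormedAddCommGroup V] [NormedSpace ℝ V] {a : L → V} (ha : ContMDiff (𝓡 1) 𝓘(ℝ, V) ∞ a) (x : X)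
    (v : TangentSpace (𝓡 2) x) : mfderiv (𝓡 2) 𝓘(ℝ, V) (fun z => a (p z)) x v
      = mfderiv (𝓡 1) 𝓘(ℝ, V) a (p x) (mfderiv (𝓡 2) (𝓡 1) p x v) :=
  congrArg (fun L : EuclideanSpace ℝ (Fin 2) →L[ℝ] V => L v)
    (_root_.mfderiv_comp x ((ha _).mdifferentiableAt (by simp))
      ((hp.smooth x).mdifferentiableAt (by simp)))

theorem IsLeafProjection.pullback_eq_zero_iff (hp : IsLeafProjection N p) {ζ : OneForm 1 L}
    (hζ : IsNowhereZeroForm ζ) (x : X) (v : TangentSpace (𝓡 2) x) :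
    pullback p ζ x v = 0 ↔ dVec N x v = 0 :=
  (linearMap_eq_zero_iff (hζ.2 (p x))).trans (hp.ker x v)

/-- A smooth function which is constant along the leaves has a derivative with respect to the
pullback of a nowhere vanishing 1-form, which is again constant along the leaves. -/
theorem IsLeafProjection.exists_deriv [IsManifold (𝓡 1) ∞ L] (hp : IsLeafProjection N p)
    {ζ : OneForm 1 L} (hζ : IsNowhereZeroForm ζ) {a : L → R23}
    (ha : ContMDiff (𝓡 1) 𝓘(ℝ, R23) ∞ a) : ∃ a' : L → R23, ContMDiff (𝓡 1) 𝓘(ℝ, R23) ∞ a' ∧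
      ∀ x v, dVec (fun z => a (p z)) x v = pullback p ζ x v • a' (p x) := by
  obtain ⟨a', h1, h2⟩ := hζ.exists_deriv ha
  exact ⟨a', h1, fun x v => (hp.mfderiv_comp ha x v).trans (h2 _ _)⟩

/-- The projection of a nonzero vector to the Euclidean unit sphere. -/
noncomputable def unitize (w : R23) : R23 := (√(w ⬝ᵥ w))⁻¹ • w

theorem dotProduct_self_pos {w : R23} (hw : w ≠ 0) : 0 < w ⬝ᵥ w := by
  have h : 0 ≤ w ⬝ᵥ w := Finset.sum_nonneg fun i _ => mul_self_nonneg _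
  refine lt_of_le_of_ne h fun h0 => hw ?_
  exact dotProduct_self_eq_zero.1 h0.symm

theorem contDiffAt_unitize {w : R23} (hw : w ≠ 0) : ContDiffAt ℝ ∞ unitize w := by
  have h1 : ContDiff ℝ ∞ fun w : R23 => w ⬝ᵥ w := by
    simp only [dotProduct]
    fun_prop
  have h2 := (h1.contDiffAt (x := w)).sqrt (dotProduct_self_pos hw).ne'
  exact (h2.inv (Real.sqrt_pos.2 (dotProduct_self_pos hw)).ne').smul contDiffAt_id

/-- The projection to the sphere is constant along rays, so its differential annihilates the radial
direction. -/
theorem fderiv_unitize_self {w : R23} (hw : w ≠ 0) : fderiv ℝ unitize w w = 0 := by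
  have h1 : HasDerivAt (fun t : ℝ => (1 + t) • w) w 0 := by
    simpa using ((hasDerivAt_id (0 : ℝ)).const_add 1).smul_const w
  have h2 : HasFDerivAt unitize (fderiv ℝ unitize w) ((fun t : ℝ => (1 + t) • w) 0) := by
    simpa using ((contDiffAt_unitize hw).differentiableAt (by simp)).hasFDerivAt
  have h3 := h2.comp_hasDerivAt (0 : ℝ) h1
  have h4 : unitize ∘ (fun t : ℝ => (1 + t) • w) =ᶠ[nhds 0] fun _ => unitize w := by
    filter_upwards [lt_mem_nhds (show (-1 : ℝ) < 0 by norm_num)] with t ht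
    have hpos : 0 < 1 + t := by linarith
    have e : ((1 + t) • w) ⬝ᵥ ((1 + t) • w) = (1 + t) ^ 2 * (w ⬝ᵥ w) := by
      simp only [smul_dotProduct, dotProduct_smul, smul_eq_mul]
      ring
    simp only [Function.comp, unitize]
    rw [e, Real.sqrt_mul (by positivity), Real.sqrt_sq hpos.le, smul_smul, mul_inv, mul_assoc,
      mul_comm, mul_assoc, mul_inv_cancel₀ hpos.ne', mul_one]
  exact (h4.hasDerivAt_iff.1 h3).unique (hasDerivAt_const _ _)

theorem unitize_dotProduct_pos {w : R23} (hw : w ≠ 0) : 0 < unitize w ⬝ᵥ w := by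
  have := dotProduct_self_pos hw
  rw [unitize, smul_dotProduct, smul_eq_mul]
  positivity

end Projection

section GaussMap

variable {X : Type*} [TopologicalSpace X] [ChartedSpace (EuclideanSpace ℝ (Fin 2)) X]
  {f : X → R23} {o : TangentOrientation X}

/-- The Gauss map of a quasi-umbilical immersion has rank one, since `d𝒩 = ω n` with a nowhere
vanishing form `ω`. -/
theorem hasRankOne_conformalGaussMap (hf : IsTimelikeImmersion f) (ho : IsOrientation o)
    (hG : ∀ x, ∃ n l, IsGaussDirection o f x n l) : HasRankOne (conformalGaussMap o f) := by
  refine ⟨contMDiff_conformalGaussMap hf ho, fun x => ?_, fun x => ?_⟩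
  · obtain ⟨n, l, h⟩ := hG x
    obtain ⟨v, hv⟩ := h.exists_ne
    refine ⟨v, fun h0 => hv ?_⟩
    rw [gaussForm, h0]
    simp [negDet]
  · obtain ⟨n, l, h⟩ := hG x
    exact ⟨n, fun v => ⟨_, h.dgauss v⟩⟩

variable [IsManifold (𝓡 2) ∞ X] {L : Type*} [TopologicalSpace L]
  [ChartedSpace (EuclideanSpace ℝ (Fin 1)) L] {p : X → L}

/-- The leaf space carries a nowhere vanishing 1-form: the direction `n` of `d𝒩`, which is
normalized by `f`, is constant along the leaves up to a positive factor. -/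
theorem exists_isNowhereZeroForm (hf : IsTimelikeImmersion f) (ho : IsOrientation o)
    (hG : ∀ x, ∃ n l, IsGaussDirection o f x n l)
    (hp : IsLeafProjection (conformalGaussMap o f) p) : ∃ ζ : OneForm 1 L, IsNowhereZeroForm ζ := by
  choose n l h using hG
  have hNs := contMDiff_conformalGaussMap hf ho
  let η : OneForm 2 X := fun x =>
    { toFun := gaussForm o f x
      map_add' := gaussForm_add x
      map_smul' := fun c v => gaussForm_smul x c v }
  have hη : IsSmoothForm η := fun e he i => contDiffOn_gaussForm hf ho he i
  have hηne : ∀ x, η x ≠ 0 := by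
    intro x h0
    obtain ⟨v, hv⟩ := (h x).exists_ne
    exact hv (congrArg (fun L : TangentSpace (𝓡 2) x →ₗ[ℝ] ℝ => L v) h0)
  have hn : ContMDiff (𝓡 2) 𝓘(ℝ, R23) ∞ n :=
    contMDiff_of_mfderiv_eq hη hηne hNs fun x v => (h x).dgauss v
  have hn0 : ∀ x, n x ≠ 0 := by
    intro x h0
    have := (h x).normalized
    rw [h0] at this
    simp [negDet] at this
  -- `n` is parallel to itself along the leaves
  have hnv : ∀ x v, dVec (conformalGaussMap o f) x v = 0 → ∃ c : ℝ, dVec n x v = c • n x := by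
    intro x v hv
    obtain ⟨e, he, hx⟩ : ∃ e ∈ IsManifold.maximalAtlas (𝓡 2) ∞ X, x ∈ e.source :=
      ⟨chartAt _ x, IsManifold.chart_mem_maximalAtlas x, mem_chart_source _ x⟩
    obtain ⟨y, hy, rfl⟩ := exists_symm_eq hx
    obtain ⟨a, b, rfl⟩ := exists_eq_coordVec he hy v
    have hN' := contDiffOn_comp_symm_target hNs he
    have hn' := contDiffOn_comp_symm_target hn he
    have dn := (hn'.contDiffAt (e.open_target.mem_nhds hy)).differentiableAt (by simp)
    have dη := fun i =>
      ((hη e he i).contDiffAt (e.open_target.mem_nhds hy)).differentiableAt (by simp)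
    have hsecond : ∀ i j, pd i (pd j fun z => conformalGaussMap o f (e.symm z)) y
        = pd i (fun z => η (e.symm z) (coordVec e z j)) y • n (e.symm y)
          + η (e.symm y) (coordVec e y j) • pd i (fun z => n (e.symm z)) y := by
      intro i j
      have hev : ∀ᶠ z in nhds y, pd j (fun z => conformalGaussMap o f (e.symm z)) z
          = η (e.symm z) (coordVec e z j) • n (e.symm z) := by
        filter_upwards [e.open_target.mem_nhds hy] with z hz
        rw [pd_conformalGaussMap hf ho he hz]
        exact (h _).dgauss _
      rw [pd_congr hev, pd_smul (dη j) dn]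
    -- `d(d𝒩) = 0` reads `dω n = ω ∧ dn`, so `dn` is a multiple of `n` on the kernel of `ω`
    have hcomm := pd_comm e.open_target hN' hy 0 1
    rw [hsecond, hsecond] at hcomm
    obtain ⟨η0, hη0⟩ : ∃ r, η (e.symm y) (coordVec e y 0) = r := ⟨_, rfl⟩
    obtain ⟨η1, hη1⟩ : ∃ r, η (e.symm y) (coordVec e y 1) = r := ⟨_, rfl⟩
    rw [hη0, hη1] at hcomm
    have hab : a * η0 + b * η1 = 0 := by
      have h1 : η (e.symm y) (a • coordVec e y 0 + b • coordVec e y 1) = 0 := by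
        change negDet _ _ = 0
        rw [hv]
        simp [negDet]
      rwa [map_add, map_smul, map_smul, hη0, hη1] at h1
    have hne : η0 ≠ 0 ∨ η1 ≠ 0 := by
      by_contra! hcon
      obtain ⟨i, hi⟩ := exists_coordVec_ne_zero he hy (hηne _)
      fin_cases i
      exacts [hi (hη0.trans hcon.1), hi (hη1.trans hcon.2)]
    have hpos : 0 < η0 ^ 2 + η1 ^ 2 := by
      rcases hne with h | h <;> positivity
    obtain ⟨ν, ha, hb⟩ : ∃ ν, a = ν * η1 ∧ b = -ν * η0 := by
      refine ⟨(a * η1 - b * η0) / (η0 ^ 2 + η1 ^ 2), ?_, ?_⟩ <;> field_simp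
      · linear_combination η0 * hab
      · linear_combination η1 * hab
    have hm := (hn (e.symm y)).mdifferentiableAt (by simp : (∞ : WithTop ℕ∞) ≠ 0)
    rw [map_add, map_smul, map_smul, dVec_coordVec he hy hm, dVec_coordVec he hy hm, ha, hb]
    refine ⟨ν * (pd 1 (fun z => η (e.symm z) (coordVec e z 0)) y
      - pd 0 (fun z => η (e.symm z) (coordVec e z 1)) y), ?_⟩
    have h2 : η1 • pd 0 (fun z => n (e.symm z)) y - η0 • pd 1 (fun z => n (e.symm z)) y
        = (pd 1 (fun z => η (e.symm z) (coordVec e z 0)) y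
          - pd 0 (fun z => η (e.symm z) (coordVec e z 1)) y) • n (e.symm y) := by
      rw [sub_smul, sub_eq_sub_iff_add_eq_add, add_comm, hcomm]
    ext k
    have h3 := congrFun h2 k
    simp only [Pi.add_apply, Pi.sub_apply, Pi.smul_apply, smul_eq_mul] at h3 ⊢
    linear_combination ν * h3
  -- normalizing `n` to the Euclidean unit sphere makes it constant along the leaves
  have hu : ContMDiff (𝓡 2) 𝓘(ℝ, R23) ∞ fun x => unitize (n x) := fun x =>
    (contDiffAt_unitize (hn0 x)).contMDiffAt.comp x (hn x)
  obtain ⟨ū, hū, hun⟩ := hp.exists_factor hu fun x v hv => by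
    obtain ⟨c, hc⟩ := hnv x v hv
    have h1 := mfderiv_comp x (g := unitize)
      ((contDiffAt_unitize (hn0 x)).contMDiffAt.mdifferentiableAt (by simp))
      ((hn x).mdifferentiableAt (by simp))
    rw [mfderiv_eq_fderiv] at h1
    refine (congrArg (fun L : EuclideanSpace ℝ (Fin 2) →L[ℝ] R23 => L v) h1).trans ?_
    refine (congrArg (fderiv ℝ unitize (n x)) hc).trans ?_
    rw [map_smul, fderiv_unitize_self (hn0 x), smul_zero]
  obtain ⟨N', hN', hNN⟩ := hp.exists_factor hNs fun _ _ h => h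
  -- `𝒩` and the normalized `n` descend to the leaf space; the form is their pairing `n ⬝ d𝒩`
  let ζ : OneForm 1 L := fun q =>
    { toFun := fun v => ū q ⬝ᵥ (mfderiv (𝓡 1) 𝓘(ℝ, R23) N' q v : R23)
      map_add' := fun v w => by rw [map_add]; exact dotProduct_add _ _ _
      map_smul' := fun c v => by rw [map_smul]; exact dotProduct_smul _ _ _ }
  refine ⟨ζ, fun e he i => ?_, fun q h0 => ?_⟩
  · have h1 := contDiffOn_comp_symm_target hū he
    have h2 := contDiffOn_pd e.open_target (contDiffOn_comp_symm_target hN' he) i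
    have h3 : ContDiffOn ℝ ∞ (fun y => ū (e.symm y) ⬝ᵥ pd i (fun z => N' (e.symm z)) y)
        e.target := by
      simp only [dotProduct]
      exact ContDiffOn.sum fun k _ => (contDiffOn_pi.1 h1 k).mul (contDiffOn_pi.1 h2 k)
    refine h3.congr fun y hy => ?_
    exact congrArg (ū (e.symm y) ⬝ᵥ ·)
      (mfderiv_coordVec he hy ((hN' _).mdifferentiableAt (by simp)) i)
  · obtain ⟨x, rfl⟩ := hp.surjective q
    obtain ⟨v, hv⟩ := (h x).exists_ne
    have h1 : ζ (p x) (mfderiv (𝓡 2) (𝓡 1) p x v) = 0 :=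
      congrArg (fun L : TangentSpace (𝓡 1) (p x) →ₗ[ℝ] ℝ => L _) h0
    have h2 : (fun z => N' (p z)) = conformalGaussMap o f := funext fun z => (hNN z).symm
    have h3 := hp.mfderiv_comp hN' x v
    rw [h2] at h3
    have h4 : ū (p x) ⬝ᵥ (dVec (conformalGaussMap o f) x v) = 0 :=
      (congrArg (ū (p x) ⬝ᵥ ·) h3).trans h1
    rw [← hun, (h x).dgauss, dotProduct_smul, smul_eq_mul] at h4
    rcases mul_eq_zero.1 h4 with h5 | h5
    · exact hv h5
    · exact (unitize_dotProduct_pos (hn0 x)).ne' h5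

end GaussMap

/-! ### Moving frames and Gauss jets -/

section Algebra

theorem sp_gram_mulVec_self_pos {w : R23} (hw : w ≠ 0) : 0 < sp (gram.mulVec w) w := by
  have e : sp (gram.mulVec w) w = w ⬝ᵥ w := by
    rw [gram_mulVec]
    simp [sp, dotProduct, Fin.sum_univ_five]
    ring
  rw [e]
  exact dotProduct_self_pos hw

/-- The part of `Y` orthogonal to `F₀, F₃, F₄`. -/
noncomputable def orthPart (F0 F3 F4 Y : R23) : R23 :=
  Y + sp Y F4 • F0 + sp Y F0 • F4 - sp Y F3 • F3

/-- The null vector `Z` with `⟨W, Z⟩ = -2` in the Lorentz plane orthogonal to `F₀, F₃, F₄`, where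
`W` is a null vector of that plane; `Y` is any auxiliary vector with `⟨Y, W⟩ ≠ 0`. -/
noncomputable def nullPartner (F0 F3 F4 Y W : R23) : R23 :=
  (-2 / sp Y W) • orthPart F0 F3 F4 Y
    + (sp (orthPart F0 F3 F4 Y) (orthPart F0 F3 F4 Y) / sp Y W ^ 2) • W

theorem nullPartner_spec {F0 F3 F4 Y W : R23} (hs : sp Y W ≠ 0) (h00 : sp F0 F0 = 0)
    (h03 : sp F0 F3 = 0) (h04 : sp F0 F4 = -1) (h33 : sp F3 F3 = 1) (h34 : sp F3 F4 = 0)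
    (h44 : sp F4 F4 = 0) (h0W : sp F0 W = 0) (h3W : sp F3 W = 0) (h4W : sp F4 W = 0)
    (hWW : sp W W = 0) :
    sp F0 (nullPartner F0 F3 F4 Y W) = 0 ∧ sp F3 (nullPartner F0 F3 F4 Y W) = 0 ∧
      sp F4 (nullPartner F0 F3 F4 Y W) = 0 ∧ sp W (nullPartner F0 F3 F4 Y W) = -2 ∧
      sp (nullPartner F0 F3 F4 Y W) (nullPartner F0 F3 F4 Y W) = 0 := by
  have o0 : sp F0 (orthPart F0 F3 F4 Y) = 0 := by
    simp only [orthPart, sp_add_right, sp_sub_right, sp_smul_right, h00, h04, h03, sp_comm F0 Y]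
    ring
  have o3 : sp F3 (orthPart F0 F3 F4 Y) = 0 := by
    simp only [orthPart, sp_add_right, sp_sub_right, sp_smul_right, sp_comm F3 F0, h33, h34, h03,
      sp_comm F3 Y]
    ring
  have o4 : sp F4 (orthPart F0 F3 F4 Y) = 0 := by
    simp only [orthPart, sp_add_right, sp_sub_right, sp_smul_right, sp_comm F4 F0, sp_comm F4 F3,
      h34, h04, h44, sp_comm F4 Y]
    ring
  have oW : sp W (orthPart F0 F3 F4 Y) = sp Y W := by
    simp only [orthPart, sp_add_right, sp_sub_right, sp_smul_right, sp_comm W F0, sp_comm W F3,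
      sp_comm W F4, h0W, h3W, h4W, sp_comm W Y]
    ring
  refine ⟨?_, ?_, ?_, ?_, ?_⟩
  · rw [nullPartner, sp_add_right, sp_smul_right, sp_smul_right, o0, h0W]
    ring
  · rw [nullPartner, sp_add_right, sp_smul_right, sp_smul_right, o3, h3W]
    ring
  · rw [nullPartner, sp_add_right, sp_smul_right, sp_smul_right, o4, h4W]
    ring
  · rw [nullPartner, sp_add_right, sp_smul_right, sp_smul_right, oW, hWW, div_mul_cancel₀ _ hs]
    ring
  · simp only [nullPartner, sp_add_left, sp_add_right, sp_smul_left, sp_smul_right, oW, hWW,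
      sp_comm (orthPart F0 F3 F4 Y) W]
    field_simp
    ring

/-- A pseudo-orthonormal frame is determined by `F₀`, `F₃`, `F₄` and `F₁ - F₂`. -/
theorem frame_ext {F F' : Mat5} (h : ∀ i j, sp (column F i) (column F j) = gram i j)
    (h' : ∀ i j, sp (column F' i) (column F' j) = gram i j) (h0 : column F' 0 = column F 0)
    (h3 : column F' 3 = column F 3) (h4 : column F' 4 = column F 4)
    (hW : column F' 1 - column F' 2 = column F 1 - column F 2) : F' = F := by
  set Z := column F' 1 + column F' 2 with hZ
  have z0 : sp (column F 0) Z = 0 := by simp [hZ, ← h0, h', gram]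
  have z3 : sp (column F 3) Z = 0 := by simp [hZ, ← h3, h', gram]
  have z4 : sp (column F 4) Z = 0 := by simp [hZ, ← h4, h', gram]
  have zW : sp (column F 1) Z - sp (column F 2) Z = -2 := by
    rw [← sp_sub_left, ← hW]
    simp [hZ, h', gram]
    norm_num
  have zZ : sp Z Z = 0 := by simp [hZ, h', gram]
  have e := frame_expand h Z
  rw [z0, z3, z4] at e
  rw [e] at zZ
  simp [h, gram] at zZ
  -- `⟨F₁ - F₂, Z⟩ = -2` and `⟨Z, Z⟩ = 0` leave only `Z = F₁ + F₂`
  have e1 : sp (column F 1) Z = -1 := by linear_combination (1 / 2) * zW + (1 / 4) * zZ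
    + (1 / 4) * (sp (column F 1) Z + sp (column F 2) Z) * zW
  have e2 : sp (column F 2) Z = 1 := by linarith
  rw [e1, e2] at e
  have hZ' : column F' 1 + column F' 2 = column F 1 + column F 2 := by
    rw [← hZ, e]
    module
  have c1 : column F' 1 = column F 1 := by
    funext i
    have h1 := congrFun hZ' i
    have h2 := congrFun hW i
    simp only [Pi.add_apply, Pi.sub_apply] at h1 h2
    linarith
  have c2 : column F' 2 = column F 2 := by
    rw [c1] at hZ'
    exact add_left_cancel hZ'
  ext i j
  have hc : column F' j = column F j := by
    fin_cases j
    exacts [h0, c1, c2, h3, h4]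
  exact congrFun hc i

end Algebra

section Surface

variable {X : Type*} [TopologicalSpace X] [ChartedSpace (EuclideanSpace ℝ (Fin 2)) X]
  {f : X → R23} {o : TangentOrientation X} {ε : ℝ} {θ : ∀ x : X, TangentSpace (𝓡 2) x → ℝ}

theorem contMDiff_sp {u w : X → R23} (hu : ContMDiff (𝓡 2) 𝓘(ℝ, R23) ∞ u)
    (hw : ContMDiff (𝓡 2) 𝓘(ℝ, R23) ∞ w) :
    ContMDiff (𝓡 2) 𝓘(ℝ, ℝ) ∞ fun x => sp (u x) (w x) :=
  spL.isBoundedBilinearMap.contDiff.contMDiff.comp (hu.prodMk_space hw)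

/-- A smooth field of pseudo-orthonormal frames. -/
structure IsMovingFrame (F : X → Mat5) : Prop where
  smooth : ∀ j, ContMDiff (𝓡 2) 𝓘(ℝ, R23) ∞ fun x => column (F x) j
  gram : ∀ x i j, sp (column (F x) i) (column (F x) j) = gram i j

theorem IsConformalFrame.isMovingFrame {F : X → Mat5} (hF : IsConformalFrame f Set.univ F) :
    IsMovingFrame F :=
  ⟨fun j => contMDiffOn_univ.1 (hF.contMDiffOn_column j), fun _ => hF.gram (Set.mem_univ _)⟩

namespace IsMovingFrame

variable {F : X → Mat5}

theorem mdifferentiableAt (hF : IsMovingFrame F) (j : Fin 5) (x : X) :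
    MDifferentiableAt (𝓡 2) 𝓘(ℝ, R23) (fun z => column (F z) j) x :=
  (hF.smooth j x).mdifferentiableAt (by simp)

theorem skew (hF : IsMovingFrame F) (i j : Fin 5) (x : X) (v : TangentSpace (𝓡 2) x) :
    sp (dVec (fun z => column (F z) i) x v) (column (F x) j)
      = -sp (column (F x) i) (dVec (fun z => column (F z) j) x v) :=
  sp_dVec_eq_neg (hF.mdifferentiableAt i x) (hF.mdifferentiableAt j x) (c := Einstein.gram i j)
    (Filter.Eventually.of_forall fun z => hF.gram z i j) v

theorem phi_eq (hF : IsMovingFrame F) (i j : Fin 5) (x : X) (v : TangentSpace (𝓡 2) x) :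
    phi F i j x v = (![-sp (column (F x) 4) (dVec (fun z => column (F z) j) x v),
      -sp (column (F x) 1) (dVec (fun z => column (F z) j) x v),
      sp (column (F x) 2) (dVec (fun z => column (F z) j) x v),
      sp (column (F x) 3) (dVec (fun z => column (F z) j) x v),
      -sp (column (F x) 0) (dVec (fun z => column (F z) j) x v)] : R23) i :=
  Einstein.phi_eq (fun j => hF.mdifferentiableAt j x) (hF.gram x) i j v

theorem phi_three (hF : IsMovingFrame F) (j : Fin 5) (x : X) (v : TangentSpace (𝓡 2) x) :
    phi F 3 j x v = -sp (dVec (fun z => column (F z) 3) x v) (column (F x) j) := by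
  rw [hF.phi_eq, hF.skew, neg_neg]
  rfl

theorem dVec_sub (hF : IsMovingFrame F) (x : X) (v : TangentSpace (𝓡 2) x) :
    dVec (fun z => column (F z) 1 - column (F z) 2) x v
      = dVec (fun z => column (F z) 1) x v - dVec (fun z => column (F z) 2) x v := by
  have := (((hF.mdifferentiableAt 1 x).hasMFDerivAt).sub
    ((hF.mdifferentiableAt 2 x).hasMFDerivAt)).mfderiv
  exact congrArg (fun L : EuclideanSpace ℝ (Fin 2) →L[ℝ] R23 => L v) this

/-- The forms `φ¹ⱼ + φ²ⱼ` are the pairings of the null vector `F₁ - F₂` with `-dFⱼ`. -/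
theorem phi_one_add_phi_two (hF : IsMovingFrame F) (j : Fin 5) (x : X)
    (v : TangentSpace (𝓡 2) x) : phi F 1 j x v + phi F 2 j x v
      = -sp (column (F x) 1 - column (F x) 2) (dVec (fun z => column (F z) j) x v) := by
  rw [hF.phi_eq, hF.phi_eq, sp_sub_left]
  simp only [Matrix.cons_val]
  ring

theorem phi_one_add_phi_two' (hF : IsMovingFrame F) (j : Fin 5) (x : X)
    (v : TangentSpace (𝓡 2) x) : phi F 1 j x v + phi F 2 j x v
      = sp (dVec (fun z => column (F z) 1 - column (F z) 2) x v) (column (F x) j) := by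
  rw [hF.phi_one_add_phi_two, hF.dVec_sub, sp_sub_left, sp_sub_left, hF.skew, hF.skew]
  ring

/-- The form `φ²₁` is, up to sign, the component of `d(F₁ - F₂)` along `F₁ - F₂` itself. -/
theorem two_mul_phi (hF : IsMovingFrame F) (x : X) (v : TangentSpace (𝓡 2) x) :
    2 * phi F 2 1 x v = sp (dVec (fun z => column (F z) 1 - column (F z) 2) x v)
      (column (F x) 1 + column (F x) 2) := by
  have h1 := hF.skew 1 1 x v
  have h2 := hF.skew 2 2 x v
  have h3 := hF.skew 2 1 x v
  rw [sp_comm] at h1 h2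
  rw [hF.phi_eq, hF.dVec_sub]
  simp only [sp_add_right, sp_sub_right, sp_comm _ (column (F x) 1), sp_comm _ (column (F x) 2)]
    at h3 ⊢
  change 2 * sp _ _ = _
  linarith

end IsMovingFrame

/-- The derivatives of the conformal Gauss map along the leaf space with respect to a basic 1-form
`θ`: `d𝒩 = ε θ W`, `dW = θ A`, `dA = θ B`, where the sign of `θ` is chosen so that `f ∧ W` is
future-directed. -/
structure IsGaussJet (o : TangentOrientation X) (f : X → R23) (ε : ℝ)
    (θ : ∀ x : X, TangentSpace (𝓡 2) x → ℝ) (W A B : X → R23) : Prop where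
  smooth_W : ContMDiff (𝓡 2) 𝓘(ℝ, R23) ∞ W
  smooth_A : ContMDiff (𝓡 2) 𝓘(ℝ, R23) ∞ A
  smooth_B : ContMDiff (𝓡 2) 𝓘(ℝ, R23) ∞ B
  dN : ∀ x v, dVec (conformalGaussMap o f) x v = (ε * θ x v) • W x
  dW : ∀ x v, dVec W x v = θ x v • A x
  dA : ∀ x v, dVec A x v = θ x v • B x
  exists_ne : ∀ x, ∃ v, θ x v ≠ 0
  pos : ∀ x, 0 < negDet (f x) (W x)

namespace IsGaussJet

variable {W A B : X → R23}

/-- The vector `W` is a positive multiple of the direction `n` of `d𝒩`, and the sign condition on the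
second fundamental form makes `⟨W, df⟩` a negative multiple of `θ`. -/
theorem sp_W (hG : ∀ x, ∃ n l, IsGaussDirection o f x n l) (hε : ε = 1 ∨ ε = -1)
    (hs : ∀ x n l, IsGaussDirection o f x n l → 0 < ε * l) (h : IsGaussJet o f ε θ W A B) (x : X) :
    sp (W x) (W x) = 0 ∧ sp (W x) (f x) = 0 ∧ sp (W x) (conformalGaussMap o f x) = 0 ∧
      ∃ μ > 0, ∀ v, sp (W x) (dVec f x v) = -μ * θ x v := by
  obtain ⟨n, l, hn⟩ := hG x
  set w := negDet (f x) (W x) with hw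
  have hwpos : 0 < w := h.pos x
  have hom : ∀ v, gaussForm o f x v = ε * θ x v * w := by
    intro v
    rw [gaussForm, h.dN, negDet_smul_right]
  have hε2 : ε * ε = 1 := by rcases hε with rfl | rfl <;> norm_num
  obtain ⟨v, hv⟩ := h.exists_ne x
  have hW : W x = w • n := by
    have h1 := (h.dN x v).symm.trans (hn.dgauss v)
    rw [hom, mul_smul (ε * θ x v) w n] at h1
    have hne : ε * θ x v ≠ 0 := mul_ne_zero (by rcases hε with rfl | rfl <;> norm_num) hv
    exact smul_right_injective _ hne h1
  refine ⟨by simp [hW, hn.null], by simp [hW, hn.perp], by simp [hW, hn.perp_gauss],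
    w ^ 2 * (ε * l), mul_pos (pow_pos hwpos 2) (hs x n l hn), fun v => ?_⟩
  rw [hW, sp_smul_left, hn.second, hom]
  ring

/-- Differentiating the relations of `W` with `W`, `f` and `𝒩` gives those of `A`. -/
theorem sp_A (hf : IsTimelikeImmersion f) (ho : IsOrientation o)
    (hG : ∀ x, ∃ n l, IsGaussDirection o f x n l) (hε : ε = 1 ∨ ε = -1)
    (hs : ∀ x n l, IsGaussDirection o f x n l → 0 < ε * l) (h : IsGaussJet o f ε θ W A B) (x : X) :
    sp (A x) (W x) = 0 ∧ sp (A x) (conformalGaussMap o f x) = 0 ∧ 0 < sp (A x) (f x) := by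
  obtain ⟨v, hv⟩ := h.exists_ne x
  obtain ⟨hWW, hWf, hWN, μ, hμ, hWdf⟩ := h.sp_W hG hε hs x
  have mW := (h.smooth_W x).mdifferentiableAt (by simp : (∞ : WithTop ℕ∞) ≠ 0)
  have mf := (hf.smooth x).mdifferentiableAt (by simp : (∞ : WithTop ℕ∞) ≠ 0)
  have e1 := sp_dVec_eq_neg mW mW (c := 0)
    (Filter.Eventually.of_forall fun z => (h.sp_W hG hε hs z).1) v
  have e2 := sp_dVec_eq_neg mW mf (c := 0)
    (Filter.Eventually.of_forall fun z => (h.sp_W hG hε hs z).2.1) v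
  rw [h.dW, sp_smul_left, hWdf] at e2
  rw [h.dW, sp_smul_left, sp_smul_right, sp_comm (W x)] at e1
  have e2' : sp (A x) (f x) = μ := mul_left_cancel₀ hv (by linarith)
  refine ⟨?_, ?_, e2' ▸ hμ⟩
  · have : θ x v * sp (A x) (W x) = 0 := by linarith
    exact (mul_eq_zero.1 this).resolve_left hv
  · have mN := ((contMDiff_conformalGaussMap hf ho) x).mdifferentiableAt
      (by simp : (∞ : WithTop ℕ∞) ≠ 0)
    have e3 := sp_dVec_eq_neg mW mN (c := 0)
      (Filter.Eventually.of_forall fun z => (h.sp_W hG hε hs z).2.2.1) v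
    rw [h.dW, sp_smul_left, h.dN, sp_smul_right, hWW, mul_zero, neg_zero] at e3
    exact (mul_eq_zero.1 e3).resolve_left hv

end IsGaussJet

end Surface

/-! ### Existence of adapted frame fields -/

section Algebra

/-- The frame with `F₀ ∥ f`, `F₃ = N`, `F₁ - F₂ = W` and with `F₄` determined by `A` and the
parameter `b`. The factor of `f` gives `⟨A, F₀⟩ = 1`, so that `⟨F₀, F₄⟩ = -1`, and the coefficient
`⟨A, A⟩ / 2` makes `F₄` null. The vector `Z` is `F₁ + F₂`; it is obtained from the auxiliary vector
`h W`, which pairs with `W` to the square of its Euclidean norm. -/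
noncomputable def jetFrame (f N W A : R23) (b : ℝ) : Mat5 :=
  let F0 := (sp A f)⁻¹ • f
  let F4 := -A + (sp A A / 2) • F0 + b • W
  let Z := nullPartner F0 N F4 (gram.mulVec W) W
  ofColumns F0 ((1 / 2 : ℝ) • (Z + W)) ((1 / 2 : ℝ) • (Z - W)) N F4

theorem column_jetFrame_sub (f N W A : R23) (b : ℝ) :
    column (jetFrame f N W A b) 1 - column (jetFrame f N W A b) 2 = W := by
  change (1 / 2 : ℝ) • (_ + W) - (1 / 2 : ℝ) • (_ - W) = W
  module

theorem jetFrame_gram {f N W A : R23} (b : ℝ) (hff : sp f f = 0) (hNN : sp N N = 1)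
    (hNf : sp N f = 0) (hWW : sp W W = 0) (hWf : sp W f = 0) (hWN : sp W N = 0)
    (hAW : sp A W = 0) (hAN : sp A N = 0) (hAf : sp A f ≠ 0) (hW : W ≠ 0) (i j : Fin 5) :
    sp (column (jetFrame f N W A b) i) (column (jetFrame f N W A b) j) = gram i j := by
  have hA0 : sp A ((sp A f)⁻¹ • f) = 1 := by rw [sp_smul_right, inv_mul_cancel₀ hAf]
  have h00 : sp ((sp A f)⁻¹ • f) ((sp A f)⁻¹ • f) = 0 := by simp [hff]
  have h0N : sp ((sp A f)⁻¹ • f) N = 0 := by simp [sp_comm f N, hNf]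
  have h0W : sp ((sp A f)⁻¹ • f) W = 0 := by simp [sp_comm f W, hWf]
  set F0 := (sp A f)⁻¹ • f
  have h0A : sp F0 A = 1 := by rw [sp_comm, hA0]
  set F4 := -A + (sp A A / 2) • F0 + b • W with hF4
  have h04 : sp F0 F4 = -1 := by simp [hF4, h0A, h00, h0W]
  have h34 : sp N F4 = 0 := by simp [hF4, sp_comm N, hAN, h0N, hWN]
  have hW4 : sp F4 W = 0 := by simp [hF4, hAW, h0W, hWW]
  have h44 : sp F4 F4 = 0 := by
    simp [hF4, hA0, h0A, hAW, h0W, hWW, h00, sp_comm W A, sp_comm W F0]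
    ring
  obtain ⟨z0, z3, z4, zW, zZ⟩ := nullPartner_spec (F0 := F0) (F3 := N) (F4 := F4)
    (Y := gram.mulVec W) (W := W) (sp_gram_mulVec_self_pos hW).ne' h00 h0N h04 hNN h34 h44 h0W
    (by rw [sp_comm, hWN]) hW4 hWW
  set Z := nullPartner F0 N F4 (gram.mulVec W) W
  have zW' : sp Z W = -2 := by rw [sp_comm, zW]
  change sp (column (ofColumns F0 ((1 / 2 : ℝ) • (Z + W)) ((1 / 2 : ℝ) • (Z - W)) N F4) i)
    (column (ofColumns F0 ((1 / 2 : ℝ) • (Z + W)) ((1 / 2 : ℝ) • (Z - W)) N F4) j) = _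
  apply ofColumns_gram <;>
    simp only [sp_smul_left, sp_smul_right, sp_add_left, sp_add_right, sp_sub_left, sp_sub_right,
      h00, h0N, h04, h34, h44, h0W, hNN, hWN, zW, zW', zZ, hWW, z0, hW4, sp_comm Z N,
      sp_comm Z F4, sp_comm W F4, z3, z4] <;> norm_num

end Algebra

section Surface

variable {X : Type*} [TopologicalSpace X] [ChartedSpace (EuclideanSpace ℝ (Fin 2)) X]
  {f : X → R23} {o : TangentOrientation X} {ε : ℝ} {θ : ∀ x : X, TangentSpace (𝓡 2) x → ℝ}
  {W A B : X → R23}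

/-- For a moving frame along `f`, the components of `dF₀` orthogonal to `F₀` are those of `df`. -/
theorem IsMovingFrame.sp_dVec_zero {F : X → Mat5} (hF : IsMovingFrame F)
    (hf : IsTimelikeImmersion f) {c : X → ℝ} (hc : ∀ x, 0 < c x)
    (h0 : ∀ x, column (F x) 0 = c x • f x) {i : Fin 5} (hi : Einstein.gram i 0 = 0) (x : X)
    (v : TangentSpace (𝓡 2) x) :
    sp (column (F x) i) (dVec (fun z => column (F z) 0) x v)
      = c x * sp (column (F x) i) (dVec f x v) := by
  have h1 := hF.skew i 0 x v
  have h2 := sp_dVec_eq_neg (hF.mdifferentiableAt i x)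
    ((hf.smooth x).mdifferentiableAt (by simp : (∞ : WithTop ℕ∞) ≠ 0)) (c := 0)
    (Filter.Eventually.of_forall fun z => by
      have h3 := hF.gram z i 0
      rw [h0, sp_smul_right, hi] at h3
      exact (mul_eq_zero.1 h3).resolve_left (hc z).ne') v
  rw [h0, sp_smul_right] at h1
  linear_combination h1 - c x * h2

/-- The area form `φ¹₀ ∧ φ²₀` of a moving frame along `f` whose vector `F₁ - F₂` is the direction of
`d𝒩` is positive for the canonical orientation. -/
theorem IsMovingFrame.positive_of_canonical {F : X → Mat5} (hF : IsMovingFrame F)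
    (hf : IsTimelikeImmersion f) (ho : IsCanonicalOrientation o f)
    (hG : ∀ x, ∃ n l, IsGaussDirection o f x n l) {c : X → ℝ} (hc : ∀ x, 0 < c x)
    (h0 : ∀ x, column (F x) 0 = c x • f x) {a : ∀ x : X, TangentSpace (𝓡 2) x → ℝ}
    (hdN : ∀ x v, dVec (conformalGaussMap o f) x v
      = a x v • (column (F x) 1 - column (F x) 2)) (x : X)
    {v w : TangentSpace (𝓡 2) x} (hvw : IsPositivePair o x v w) :
    0 < phi F 1 0 x v * phi F 2 0 x w - phi F 1 0 x w * phi F 2 0 x v := by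
  have e1 : ∀ v, phi F 1 0 x v = -(c x * sp (column (F x) 1) (dVec f x v)) := fun v => by
    rw [hF.phi_eq, ← hF.sp_dVec_zero hf hc h0 (by simp [Einstein.gram])]
    rfl
  have e2 : ∀ v, phi F 2 0 x v = c x * sp (column (F x) 2) (dVec f x v) := fun v => by
    rw [hF.phi_eq, ← hF.sp_dVec_zero hf hc h0 (by simp [Einstein.gram])]
    rfl
  obtain ⟨n, l, hn⟩ := hG x
  obtain ⟨V, V', hV⟩ := hn.exists_isNullPair hf
  have hp := ho.2 x V V' hV
  obtain ⟨-, ⟨u, k, hu⟩, -, h4⟩ := hV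
  rw [hdN] at hu
  have hVd : dVec f x V = a x u • (column (F x) 1 - column (F x) 2) - k • f x :=
    eq_sub_of_add_eq hu.symm
  have hif : ∀ i : Fin 5, Einstein.gram i 0 = 0 → sp (column (F x) i) (f x) = 0 := fun i hi => by
    have h3 := hF.gram x i 0
    rw [h0, sp_smul_right, hi] at h3
    exact (mul_eq_zero.1 h3).resolve_left (hc x).ne'
  have hf1 := hif 1 (by simp [Einstein.gram])
  have hf2 := hif 2 (by simp [Einstein.gram])
  have g11 : sp (column (F x) 1) (column (F x) 1) = -1 := by simp [hF.gram, Einstein.gram]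
  have g12 : sp (column (F x) 1) (column (F x) 2) = 0 := by simp [hF.gram, Einstein.gram]
  have g21 : sp (column (F x) 2) (column (F x) 1) = 0 := by simp [hF.gram, Einstein.gram]
  have g22 : sp (column (F x) 2) (column (F x) 2) = 1 := by simp [hF.gram, Einstein.gram]
  have a1 : sp (column (F x) 1) (dVec f x V) = -a x u := by
    rw [hVd]
    simp [hf1, g11, g12]
  have a2 : sp (column (F x) 2) (dVec f x V) = -a x u := by
    rw [hVd]
    simp [hf2, g21, g22]
  rw [inducedMetric, hVd, sp_sub_left, sp_smul_left, sp_smul_left, sp_self_dVec hf, sp_sub_left]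
    at h4
  -- the sign of an area form may be tested on the positive pair `(V, V')`
  have key : phi F 1 0 x V * phi F 2 0 x V' - phi F 1 0 x V' * phi F 2 0 x V = c x ^ 2 := by
    rw [e1, e1, e2, e2, a1, a2]
    linear_combination -c x ^ 2 * h4
  obtain ⟨b, hb0, hb1, -⟩ := id hp
  have hexp : ∀ v : TangentSpace (𝓡 2) x, ∃ p q : ℝ, v = p • V + q • V' := fun v =>
    ⟨b.repr v 0, b.repr v 1, by
      rw [← hb0, ← hb1, ← Fin.sum_univ_two fun i => b.repr v i • b i, b.sum_repr]⟩
  obtain ⟨p, q, rfl⟩ := hexp v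
  obtain ⟨r, s, rfl⟩ := hexp w
  have hd := (isPositivePair_iff hp p q r s).1 hvw
  have hl1 : ∀ p q : ℝ, phi F 1 0 x (p • V + q • V') = p * phi F 1 0 x V + q * phi F 1 0 x V' := by
    intro p q
    rw [e1, e1, e1, map_add, map_smul, map_smul, sp_add_right, sp_smul_right, sp_smul_right]
    ring
  have hl2 : ∀ p q : ℝ, phi F 2 0 x (p • V + q • V') = p * phi F 2 0 x V + q * phi F 2 0 x V' := by
    intro p q
    rw [e2, e2, e2, map_add, map_smul, map_smul, sp_add_right, sp_smul_right, sp_smul_right]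
    ring
  rw [hl1, hl1, hl2, hl2]
  have : 0 < (p * s - q * r) * c x ^ 2 := mul_pos hd (pow_pos (hc x) 2)
  rw [← key] at this
  linarith

/-- A moving frame along `f` with `F₃ = 𝒩` and positive area form `φ¹₀ ∧ φ²₀` has determinant one. -/
theorem IsMovingFrame.det_eq_one {F : X → Mat5} (hF : IsMovingFrame F)
    (hf : IsTimelikeImmersion f) (ho : IsOrientation o) {c : X → ℝ} (hc : ∀ x, 0 < c x)
    (h0 : ∀ x, column (F x) 0 = c x • f x)
    (h3 : ∀ x, column (F x) 3 = conformalGaussMap o f x) (x : X)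
    (hpos : ∀ v w, IsPositivePair o x v w →
      0 < phi F 1 0 x v * phi F 2 0 x w - phi F 1 0 x w * phi F 2 0 x v) : (F x).det = 1 := by
  obtain ⟨e, he, hxe, hor⟩ := ho x
  obtain ⟨U, G, hxU, hG⟩ := exists_secondOrderFrame hf ho x
  obtain ⟨y, hy, rfl⟩ := exists_symm_eq hxe
  have hgv := hG.isGaussVector hf he hy hxU (hor y hy)
  rw [← hG.conformalGaussMap_eq hf ho hxU, ← h3] at hgv
  have hp := hpos _ _ (hor y hy)
  have mf := (hf.smooth (e.symm y)).mdifferentiableAt (by simp : (∞ : WithTop ℕ∞) ≠ 0)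
  have e1 : ∀ i, phi F 1 0 (e.symm y) (coordVec e y i)
      = -(c (e.symm y) * sp (column (F (e.symm y)) 1) (pd i (fun z => f (e.symm z)) y)) := by
    intro i
    rw [hF.phi_eq, ← dVec_coordVec he hy mf, ← hF.sp_dVec_zero hf hc h0 (by simp [Einstein.gram])]
    rfl
  have e2 : ∀ i, phi F 2 0 (e.symm y) (coordVec e y i)
      = c (e.symm y) * sp (column (F (e.symm y)) 2) (pd i (fun z => f (e.symm z)) y) := by
    intro i
    rw [hF.phi_eq, ← dVec_coordVec he hy mf, ← hF.sp_dVec_zero hf hc h0 (by simp [Einstein.gram])]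
    rfl
  rw [e1, e1, e2, e2] at hp
  have i0 := (immersion_chart hf he hy).1
  -- compare the frame with the osculating vectors, whose determinant is negative
  have hdet := det_frame_rows (hF.gram (e.symm y)) (hc (e.symm y)).ne' (h0 (e.symm y))
    (u := pd 0 (fun z => f (e.symm z)) y) (v := pd 1 (fun z => f (e.symm z)) y)
    (L := adjLap (fun z => f (e.symm z)) y) (by rw [h0, sp_smul_left, i0, mul_zero]) hgv.perp0
    (by rw [h0, sp_smul_left, i0, mul_zero]) hgv.perp1
  have hneg := hgv.det_neg
  rw [hdet, h0, sp_smul_left, mul_div_cancel_left₀ _ (hc _).ne', sp_adjLap hf he hy] at hneg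
  have hm := metricDet_neg hf he hy
  have hsq := det_sq_of_isometry (hF.gram (e.symm y))
  have hcp := hc (e.symm y)
  set D := (F (e.symm y)).det
  set m := metricDet (fun z => f (e.symm z)) y
  set k := c (e.symm y)
  set area := sp (column (F (e.symm y)) 1) (pd 0 (fun z => f (e.symm z)) y)
      * sp (column (F (e.symm y)) 2) (pd 1 (fun z => f (e.symm z)) y)
    - sp (column (F (e.symm y)) 1) (pd 1 (fun z => f (e.symm z)) y)
      * sp (column (F (e.symm y)) 2) (pd 0 (fun z => f (e.symm z)) y) with harea
  have ha : 0 < k ^ 2 * -area := by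
    rw [harea]
    linarith
  have ha' : 0 < -area := (mul_pos_iff_of_pos_left (pow_pos hcp 2)).1 ha
  have hD : 0 < D := by
    have h5 : 0 < (-area * (-2 * m)) * D := by linarith
    exact (mul_pos_iff_of_pos_left (mul_pos ha' (by linarith))).1 h5
  have h6 : (D - 1) * (D + 1) = 0 := by linear_combination hsq
  rcases mul_eq_zero.1 h6 with h7 | h7 <;> linarith

/-- A moving frame built from the Gauss jet is adapted, and its form `φ¹₀ + φ²₀` is `θ`. The
coefficient of `W` in `F₄` is dictated by the condition `φ⁰₀ = 2 φ²₁`: both forms are then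
`-⅔ ⟨F₀, B⟩ θ`. -/
theorem IsGaussJet.isAdaptedFrame (hf : IsTimelikeImmersion f) (ho : IsCanonicalOrientation o f)
    (hG : ∀ x, ∃ n l, IsGaussDirection o f x n l) (hε : ε = 1 ∨ ε = -1)
    (hs : ∀ x n l, IsGaussDirection o f x n l → 0 < ε * l) (h : IsGaussJet o f ε θ W A B)
    {F : X → Mat5} (hF : IsMovingFrame F) (h0 : ∀ x, column (F x) 0 = (sp (A x) (f x))⁻¹ • f x)
    (h3 : ∀ x, column (F x) 3 = conformalGaussMap o f x)
    (hW : ∀ x, column (F x) 1 - column (F x) 2 = W x)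
    (h4 : ∀ x, column (F x) 4 = -A x + (sp (A x) (A x) / 2) • column (F x) 0
      + (sp (column (F x) 0) (B x) / 3) • W x) :
    IsAdaptedFrame o f ε Set.univ F ∧ ∀ x v, θ x v = phi F 1 0 x v + phi F 2 0 x v := by
  have hA := h.sp_A hf ho.1 hG hε hs
  have hWs := h.sp_W hG hε hs
  have hc : ∀ x, 0 < (sp (A x) (f x))⁻¹ := fun x => inv_pos.2 (hA x).2.2
  have hA0 : ∀ x, sp (A x) (column (F x) 0) = 1 := fun x => by
    rw [h0, sp_smul_right, inv_mul_cancel₀ (hA x).2.2.ne']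
  have hWfun : (fun z => column (F z) 1 - column (F z) 2) = W := funext hW
  have h3fun : (fun z => column (F z) 3) = conformalGaussMap o f := funext h3
  have hadd : ∀ j x v, phi F 1 j x v + phi F 2 j x v = θ x v * sp (A x) (column (F x) j) := by
    intro j x v
    rw [hF.phi_one_add_phi_two', hWfun, h.dW, sp_smul_left]
  have hθ : ∀ x v, θ x v = phi F 1 0 x v + phi F 2 0 x v := fun x v => by
    rw [hadd, hA0, mul_one]
  have h3j : ∀ j x v, phi F 3 j x v = -(ε * θ x v * sp (W x) (column (F x) j)) := by
    intro j x v
    rw [hF.phi_three, h3fun, h.dN, sp_smul_left]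
  have hWc : ∀ x j, sp (W x) (column (F x) j) = Einstein.gram 1 j - Einstein.gram 2 j := by
    intro x j
    rw [← hW, sp_sub_left, hF.gram, hF.gram]
  have hpos : ∀ x v w, IsPositivePair o x v w →
      0 < phi F 1 0 x v * phi F 2 0 x w - phi F 1 0 x w * phi F 2 0 x v := fun x v w hvw =>
    hF.positive_of_canonical hf ho hG hc h0 (a := fun x v => ε * θ x v)
      (fun x v => by rw [hW, h.dN]) x hvw
  have h31 : ∀ x v, phi F 3 1 x v = ε * (phi F 1 0 x v + phi F 2 0 x v) := by
    intro x v
    rw [h3j, hWc, hθ]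
    simp [Einstein.gram]
  have h32 : ∀ x v, phi F 3 2 x v = ε * (phi F 1 0 x v + phi F 2 0 x v) := by
    intro x v
    rw [h3j, hWc, hθ]
    simp [Einstein.gram]
  refine ⟨{
    isOpen := isOpen_univ
    smooth := fun i j => (contMDiff_pi_space.1 (hF.smooth j) i).contMDiffOn
    mem := fun x _ => ?_
    lift := fun x _ => ⟨_, hc x, h0 x⟩
    phi30 := fun x _ v => ?_
    positive := fun x _ => hpos x
    second := fun x _ v w => ?_
    phi31 := fun x _ => h31 x
    phi32 := fun x _ => h32 x
    phi34 := fun x _ v => ?_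
    phi00 := fun x _ v => ?_
    wedge := fun x _ v w => ?_ }, hθ⟩
  · refine (mem_conformalGroup_iff _).2
      ⟨hF.det_eq_one hf ho.1 hc h0 h3 x (hpos x), hF.gram x, ?_⟩
    have g := hF.gram x
    refine (negDet_pos_iff (v := W x) ?_ (by simp [g, Einstein.gram])
      (by rw [sp_comm, hWc]; simp [Einstein.gram]) (by simp [g, Einstein.gram]) (hWs x).1
      (by simp [g, Einstein.gram]) (by rw [sp_add_right, hWc, hWc]; simp [Einstein.gram])).1 ?_
    · intro h00
      have := hA0 x
      rw [h00, sp_zero_right] at this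
      exact zero_ne_one this
    · rw [h0, negDet_smul_left]
      exact mul_pos (hc x) (h.pos x)
  · rw [h3j, hWc]
    simp [Einstein.gram]
  · rw [h31, h31, h32, h32]
    ring
  · rw [h3j, hWc]
    simp [Einstein.gram]
  · have e1 := hF.two_mul_phi x v
    rw [hWfun, h.dW, sp_smul_left] at e1
    have e2 : sp (A x) (column (F x) 1 + column (F x) 2)
        = -(2 / 3) * sp (column (F x) 0) (B x) := by
      have e3 : sp (column (F x) 4) (column (F x) 1 + column (F x) 2) = 0 := by
        simp [hF.gram, Einstein.gram]
      have e4 : sp (column (F x) 0) (column (F x) 1 + column (F x) 2) = 0 := by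
        simp [hF.gram, Einstein.gram]
      have e5 : sp (W x) (column (F x) 1 + column (F x) 2) = -2 := by
        rw [sp_add_right, hWc, hWc]
        simp [Einstein.gram]
        norm_num
      rw [h4, sp_add_left, sp_add_left, sp_neg_left, sp_smul_left, sp_smul_left, e4, e5] at e3
      linear_combination -e3
    have e6 : sp (A x) (dVec (fun z => column (F z) 0) x v)
        = -(θ x v * sp (B x) (column (F x) 0)) := by
      rw [← sp_smul_left, ← h.dA, sp_dVec_eq_neg ((h.smooth_A x).mdifferentiableAt (by simp))
        (hF.mdifferentiableAt 0 x) (c := 1) (Filter.Eventually.of_forall hA0), neg_neg]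
    have e7 : sp (W x) (dVec (fun z => column (F z) 0) x v) = -θ x v := by
      rw [← hW, hθ, hF.phi_one_add_phi_two, neg_neg]
    have e8 : sp (column (F x) 0) (dVec (fun z => column (F z) 0) x v) = 0 := by
      have := hF.skew 0 0 x v
      rw [sp_comm] at this
      linarith
    have e9 : phi F 0 0 x v = -sp (column (F x) 4) (dVec (fun z => column (F z) 0) x v) :=
      hF.phi_eq 0 0 x v
    rw [h4, sp_add_left, sp_add_left, sp_neg_left, sp_smul_left, sp_smul_left, e6, e7, e8,
      sp_comm (B x)] at e9
    rw [e2] at e1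
    linear_combination e9 - e1
  · rw [hadd, hadd, hadd, hadd]
    ring

/-- A Gauss jet determines an adapted frame field. -/
theorem IsGaussJet.exists_isAdaptedFrame (hf : IsTimelikeImmersion f)
    (ho : IsCanonicalOrientation o f) (hG : ∀ x, ∃ n l, IsGaussDirection o f x n l)
    (hε : ε = 1 ∨ ε = -1) (hs : ∀ x n l, IsGaussDirection o f x n l → 0 < ε * l)
    (h : IsGaussJet o f ε θ W A B) : ∃ F : X → Mat5, IsAdaptedFrame o f ε Set.univ F ∧
      ∀ x v, θ x v = phi F 1 0 x v + phi F 2 0 x v := by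
  have hA := h.sp_A hf ho.1 hG hε hs
  have hWs := h.sp_W hG hε hs
  have hW0 : ∀ x, W x ≠ 0 := fun x hx => by
    have := h.pos x
    rw [hx] at this
    simp [negDet] at this
  have hNf : ∀ x, sp (conformalGaussMap o f x) (f x) = 0 := fun x => by
    obtain ⟨U, G, hxU, hGs⟩ := exists_secondOrderFrame hf ho.1 x
    obtain ⟨c, hc, hc0⟩ := hGs.lift x hxU
    have h30 := hGs.gram hxU 3 0
    rw [hGs.conformalGaussMap_eq hf ho.1 hxU]
    rw [hc0, sp_smul_right] at h30
    exact (mul_eq_zero.1 (h30.trans (by simp [gram]))).resolve_left hc.ne'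
  let F : X → Mat5 := fun x => jetFrame (f x) (conformalGaussMap o f x) (W x) (A x)
    (sp ((sp (A x) (f x))⁻¹ • f x) (B x) / 3)
  have sA := h.smooth_A
  have sW := h.smooth_W
  have sN := contMDiff_conformalGaussMap hf ho.1
  have sμ : ContMDiff (𝓡 2) 𝓘(ℝ, ℝ) ∞ fun x => (sp (A x) (f x))⁻¹ :=
    (contMDiff_sp sA hf.smooth).inv₀ fun x => (hA x).2.2.ne'
  have s0 : ContMDiff (𝓡 2) 𝓘(ℝ, R23) ∞ fun x => (sp (A x) (f x))⁻¹ • f x := sμ.smul hf.smooth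
  have s4 : ContMDiff (𝓡 2) 𝓘(ℝ, R23) ∞ fun x => column (F x) 4 :=
    (sA.neg.add (((contMDiff_sp sA sA).div_const 2).smul s0)).add
      (((contMDiff_sp s0 h.smooth_B).div_const 3).smul sW)
  have sY : ContMDiff (𝓡 2) 𝓘(ℝ, R23) ∞ fun x => gram.mulVec (W x) :=
    (Matrix.toLin' gram).toContinuousLinearMap.contMDiff.comp sW
  have sYW := contMDiff_sp sY sW
  have hYW : ∀ x, sp (gram.mulVec (W x)) (W x) ≠ 0 := fun x => (sp_gram_mulVec_self_pos (hW0 x)).ne'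
  have sO : ContMDiff (𝓡 2) 𝓘(ℝ, R23) ∞ fun x => orthPart ((sp (A x) (f x))⁻¹ • f x)
      (conformalGaussMap o f x) (column (F x) 4) (gram.mulVec (W x)) :=
    ((sY.add ((contMDiff_sp sY s4).smul s0)).add ((contMDiff_sp sY s0).smul s4)).sub
      ((contMDiff_sp sY sN).smul sN)
  have sc : ∀ c : ℝ, ContMDiff (𝓡 2) 𝓘(ℝ, ℝ) ∞ fun _ : X => c := fun c => contMDiff_const
  have sZ : ContMDiff (𝓡 2) 𝓘(ℝ, R23) ∞ fun x => nullPartner ((sp (A x) (f x))⁻¹ • f x)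
      (conformalGaussMap o f x) (column (F x) 4) (gram.mulVec (W x)) (W x) :=
    (((sc (-2)).div₀ sYW hYW).smul sO).add
      (((contMDiff_sp sO sO).div₀ (sYW.pow 2) fun x => pow_ne_zero 2 (hYW x)).smul sW)
  have hF : IsMovingFrame F := by
    refine ⟨fun j => ?_, fun x => jetFrame_gram _ (sp_self_of_mem_einstein (hf.mem x))
      (conformalGaussMap_mem hf ho.1 x) (hNf x) (hWs x).1 (hWs x).2.1 (hWs x).2.2.1 (hA x).1
      (hA x).2.1 (hA x).2.2.ne' (hW0 x)⟩
    fin_cases j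
    exacts [s0, (sc (1 / 2)).smul (sZ.add sW),
      (sc (1 / 2)).smul (sZ.sub sW), sN, s4]
  exact ⟨F, h.isAdaptedFrame hf ho hG hε hs hF (fun x => rfl) (fun x => rfl)
    (fun x => column_jetFrame_sub _ _ _ _ _) fun x => rfl⟩

end Surface

/-! ### Uniqueness of adapted frame fields -/

section Surface

variable {X : Type*} [TopologicalSpace X] [ChartedSpace (EuclideanSpace ℝ (Fin 2)) X]
  {f : X → R23} {o : TangentOrientation X} {ε : ℝ} {θ : ∀ x : X, TangentSpace (𝓡 2) x → ℝ}
  {W A B : X → R23} {F : X → Mat5}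

theorem IsAdaptedFrame.isMovingFrame (hF : IsAdaptedFrame o f ε Set.univ F) : IsMovingFrame F :=
  hF.toIsConformalFrame.isMovingFrame

/-- The Gauss map of an adapted frame satisfies `d𝒩 = ε (φ¹₀ + φ²₀) (F₁ - F₂)`. -/
theorem IsAdaptedFrame.dVec_conformalGaussMap (hF : IsAdaptedFrame o f ε Set.univ F)
    (hf : IsTimelikeImmersion f) (ho : IsOrientation o) (x : X) (v : TangentSpace (𝓡 2) x) :
    dVec (conformalGaussMap o f) x v
      = (ε * (phi F 1 0 x v + phi F 2 0 x v)) • (column (F x) 1 - column (F x) 2) := by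
  have hm := hF.isMovingFrame
  have e : conformalGaussMap o f = fun z => column (F z) 3 :=
    funext fun z => hF.conformalGaussMap_eq hf ho (Set.mem_univ z)
  have h3 := fun j => hm.phi_three j x v
  have e0 := h3 0
  have e1 := h3 1
  have e2 := h3 2
  have e3 := hm.skew 3 3 x v
  have e4 := h3 4
  rw [hF.phi30 x trivial, sp_comm] at e0
  rw [hF.phi31 x trivial, sp_comm] at e1
  rw [hF.phi32 x trivial, sp_comm] at e2
  rw [hF.phi34 x trivial, sp_comm] at e4
  rw [sp_comm] at e3
  rw [e, frame_expand (hm.gram x) (dVec (fun z => column (F z) 3) x v),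
    show sp (column (F x) 4) (dVec (fun z => column (F z) 3) x v) = 0 by linarith,
    show sp (column (F x) 3) (dVec (fun z => column (F z) 3) x v) = 0 by linarith,
    show sp (column (F x) 0) (dVec (fun z => column (F z) 3) x v) = 0 by linarith,
    show sp (column (F x) 1) (dVec (fun z => column (F z) 3) x v) = _ by
      rw [← neg_eq_iff_eq_neg.2 e1],
    show sp (column (F x) 2) (dVec (fun z => column (F z) 3) x v) = _ by
      rw [← neg_eq_iff_eq_neg.2 e2]]
  module

/-- The plane spanned by `f` and `F₁ - F₂` is future-directed, like that spanned by `f` and `F₁ +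
F₂`. -/
theorem IsConformalFrame.negDet_sub_pos {U : Set X} (hF : IsConformalFrame f U F) {x : X}
    (hx : x ∈ U) : 0 < negDet (f x) (column (F x) 1 - column (F x) 2) := by
  obtain ⟨-, g, hpos⟩ := (mem_conformalGroup_iff _).1 (hF.mem x hx)
  obtain ⟨c, hc, h0⟩ := hF.lift x hx
  have h00 : column (F x) 0 ≠ 0 := fun h => by
    have := g 0 4
    rw [h, sp_zero_left] at this
    simp [Einstein.gram] at this
  have := (negDet_pos_iff (w := column (F x) 1 - column (F x) 2) h00 (by simp [g, Einstein.gram])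
    (by simp [g, Einstein.gram]) (by simp [g, Einstein.gram]) (by simp [g, Einstein.gram]) (by simp [g, Einstein.gram])
    (by simp [g, Einstein.gram])).1 hpos
  rw [h0, negDet_smul_left] at this
  exact (mul_pos_iff_of_pos_left hc).1 this

/-- An adapted frame field is recovered from the Gauss jet of its form `φ¹₀ + φ²₀`. -/
theorem IsGaussJet.column_eq (hf : IsTimelikeImmersion f) (ho : IsOrientation o)
    (hG : ∀ x, ∃ n l, IsGaussDirection o f x n l) (hε : ε = 1 ∨ ε = -1)
    (hs : ∀ x n l, IsGaussDirection o f x n l → 0 < ε * l) (h : IsGaussJet o f ε θ W A B)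
    (hF : IsAdaptedFrame o f ε Set.univ F)
    (hθ : ∀ x v, θ x v = phi F 1 0 x v + phi F 2 0 x v) (x : X) :
    column (F x) 0 = (sp (A x) (f x))⁻¹ • f x ∧ column (F x) 1 - column (F x) 2 = W x ∧
      column (F x) 4 = -A x + (sp (A x) (A x) / 2) • column (F x) 0
        + (sp (column (F x) 0) (B x) / 3) • W x := by
  have hm := hF.isMovingFrame
  have hε0 : ε ≠ 0 := by rcases hε with rfl | rfl <;> norm_num
  -- `W`, `F₀` and, up to the coefficient `s` of `W`, also `F₄` follow from the orthogonality
  -- relations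
  have hW : ∀ z, column (F z) 1 - column (F z) 2 = W z := by
    intro z
    obtain ⟨v, hv⟩ := h.exists_ne z
    have e1 := hF.dVec_conformalGaussMap hf ho z v
    rw [h.dN, ← hθ] at e1
    exact (smul_right_injective _ (mul_ne_zero hε0 hv) e1).symm
  have hWfun : (fun z => column (F z) 1 - column (F z) 2) = W := funext hW
  have hA0 : ∀ z, sp (A z) (column (F z) 0) = 1 := by
    intro z
    obtain ⟨v, hv⟩ := h.exists_ne z
    have e1 := hm.phi_one_add_phi_two' 0 z v
    rw [← hθ, hWfun, h.dW, sp_smul_left] at e1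
    exact mul_left_cancel₀ hv (by linarith)
  obtain ⟨v, hv⟩ := h.exists_ne x
  obtain ⟨hAW, hAN, -⟩ := h.sp_A hf ho hG hε hs x
  rw [hF.conformalGaussMap_eq hf ho (Set.mem_univ x)] at hAN
  have c0 : column (F x) 0 = (sp (A x) (f x))⁻¹ • f x := by
    obtain ⟨c, hc, h0⟩ := hF.lift x trivial
    have e1 := hA0 x
    rw [h0, sp_smul_right] at e1
    rw [h0, eq_inv_of_mul_eq_one_left e1]
  refine ⟨c0, hW x, ?_⟩
  set s := sp (column (F x) 1) (A x) with hs1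
  have hs2 : sp (column (F x) 2) (A x) = s := by
    rw [sp_comm, ← hW x, sp_sub_left] at hAW
    linarith
  have hexp : column (F x) 4 = -A x - sp (column (F x) 4) (A x) • column (F x) 0 - s • W x := by
    have e1 := frame_expand (hm.gram x) (A x)
    rw [← hs1, hs2, sp_comm (column (F x) 3), hAN, sp_comm (column (F x) 0), hA0, zero_smul,
      add_zero, one_smul] at e1
    rw [← hW x]
    funext k
    have e2 := congrFun e1 k
    simp only [Pi.add_apply, Pi.sub_apply, Pi.neg_apply, Pi.smul_apply, smul_eq_mul] at e2 ⊢
    linear_combination e2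
  have hq : sp (column (F x) 4) (A x) = -(sp (A x) (A x) / 2) := by
    have e1 : sp (column (F x) 4) (column (F x) 4) = 0 := by simp [hm.gram, gram]
    have e2 : sp (column (F x) 4) (column (F x) 0) = -1 := by simp [hm.gram, gram]
    have e3 : sp (column (F x) 4) (W x) = 0 := by simp [← hW, hm.gram, gram]
    have e4 := congrArg (fun u => sp u (A x)) hexp
    simp only [sp_sub_left, sp_neg_left, sp_smul_left] at e4
    rw [sp_comm (W x), hAW, sp_comm (column (F x) 0), hA0] at e4
    linarith
  -- the condition `φ⁰₀ = 2 φ²₁` determines `s`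
  have h3s : s = -(sp (column (F x) 0) (B x) / 3) := by
    have e1 := hm.two_mul_phi x v
    rw [hWfun, h.dW, sp_smul_left, sp_add_right, sp_comm _ (column (F x) 1),
      sp_comm _ (column (F x) 2), hs2, ← hs1] at e1
    have e6 : sp (A x) (dVec (fun z => column (F z) 0) x v)
        = -(θ x v * sp (B x) (column (F x) 0)) := by
      rw [← sp_smul_left, ← h.dA, sp_dVec_eq_neg ((h.smooth_A x).mdifferentiableAt (by simp))
        (hm.mdifferentiableAt 0 x) (c := 1) (Filter.Eventually.of_forall hA0), neg_neg]
    have e7 : sp (W x) (dVec (fun z => column (F z) 0) x v) = -θ x v := by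
      rw [← hW, hθ, hm.phi_one_add_phi_two, neg_neg]
    have e8 : sp (column (F x) 0) (dVec (fun z => column (F z) 0) x v) = 0 := by
      have := hm.skew 0 0 x v
      rw [sp_comm] at this
      linarith
    have e9 : phi F 0 0 x v = -sp (column (F x) 4) (dVec (fun z => column (F z) 0) x v) :=
      hm.phi_eq 0 0 x v
    rw [hexp, sp_sub_left, sp_sub_left, sp_neg_left, sp_smul_left, sp_smul_left, e6, e7, e8,
      sp_comm (B x)] at e9
    have e10 := hF.phi00 x trivial v
    have e11 : θ x v * (3 * s + sp (column (F x) 0) (B x)) = 0 := by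
      linear_combination -e1 + e9 - e10
    have e12 := (mul_eq_zero.1 e11).resolve_left hv
    linarith
  rw [hexp, hq, h3s]
  module

/-- The adapted frame field of a Gauss jet is unique. -/
theorem IsGaussJet.adaptedFrame_unique (hf : IsTimelikeImmersion f) (ho : IsOrientation o)
    (hG : ∀ x, ∃ n l, IsGaussDirection o f x n l) (hε : ε = 1 ∨ ε = -1)
    (hs : ∀ x n l, IsGaussDirection o f x n l → 0 < ε * l) (h : IsGaussJet o f ε θ W A B)
    {F' : X → Mat5} (hF : IsAdaptedFrame o f ε Set.univ F)
    (hθ : ∀ x v, θ x v = phi F 1 0 x v + phi F 2 0 x v) (hF' : IsAdaptedFrame o f ε Set.univ F')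
    (hθ' : ∀ x v, θ x v = phi F' 1 0 x v + phi F' 2 0 x v) : F' = F := by
  funext x
  obtain ⟨h0, hW, h4⟩ := h.column_eq hf ho hG hε hs hF hθ x
  obtain ⟨h0', hW', h4'⟩ := h.column_eq hf ho hG hε hs hF' hθ' x
  have e0 := h0'.trans h0.symm
  refine frame_ext (hF.isMovingFrame.gram x) (hF'.isMovingFrame.gram x) e0 ?_ ?_
    (hW'.trans hW.symm)
  · rw [← hF.conformalGaussMap_eq hf ho (Set.mem_univ x),
      ← hF'.conformalGaussMap_eq hf ho (Set.mem_univ x)]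
  · rw [h4', h4, e0]

/-- The sign of the form `φ¹₀ + φ²₀` of an adapted frame field is the one for which the Gauss jet is
future-directed. -/
theorem IsGaussJet.sign_eq {s : ℝ} (hf : IsTimelikeImmersion f) (ho : IsOrientation o)
    (hε : ε = 1 ∨ ε = -1) (h : IsGaussJet o f ε θ W A B) (hF : IsAdaptedFrame o f ε Set.univ F)
    (hθ : ∀ x v, phi F 1 0 x v + phi F 2 0 x v = s * θ x v) (x : X) : 0 < s := by
  have hε0 : ε ≠ 0 := by rcases hε with rfl | rfl <;> norm_num
  obtain ⟨v, hv⟩ := h.exists_ne x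
  have e1 := hF.dVec_conformalGaussMap hf ho x v
  rw [h.dN, hθ, show ε * (s * θ x v) = (ε * θ x v) * s by ring,
    mul_smul (ε * θ x v) s (_ : R23)] at e1
  have e2 := smul_right_injective _ (mul_ne_zero hε0 hv) e1
  have e3 := h.pos x
  rw [e2, negDet_smul_right] at e3
  exact (mul_pos_iff_of_pos_right (hF.negDet_sub_pos (Set.mem_univ x))).1 e3

variable {L : Type*} [TopologicalSpace L]
  [ChartedSpace (EuclideanSpace ℝ (Fin 1)) L] [IsManifold (𝓡 1) ∞ L] {p : X → L}
  {ζ : OneForm 1 L}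

/-- The derivatives of the conformal Gauss map with respect to a 1-form of the leaf space form a
Gauss jet, up to the sign of the form. -/
theorem exists_isGaussJet [ConnectedSpace X] (hf : IsTimelikeImmersion f) (ho : IsOrientation o)
    (hG : ∀ x, ∃ n l, IsGaussDirection o f x n l) (hε : ε = 1 ∨ ε = -1)
    (hp : IsLeafProjection (conformalGaussMap o f) p) (hζ : IsNowhereZeroForm ζ) :
    ∃ W A B, IsGaussJet o f ε (pullback p ζ) W A B ∨
      IsGaussJet o f ε (fun x v => -pullback p ζ x v) W A B := by
  have hN := contMDiff_conformalGaussMap hf ho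
  have hε2 : ε * ε = 1 := by rcases hε with rfl | rfl <;> norm_num
  obtain ⟨N0, hN0, hN0'⟩ := hp.exists_factor hN fun x v hv => hv
  obtain ⟨N1, hN1, hN1'⟩ := hp.exists_deriv hζ hN0
  obtain ⟨N2, hN2, hN2'⟩ := hp.exists_deriv hζ hN1
  obtain ⟨N3, hN3, hN3'⟩ := hp.exists_deriv hζ hN2
  have eN : (fun z => N0 (p z)) = conformalGaussMap o f := funext fun z => (hN0' z).symm
  rw [eN] at hN1'
  have hps := hp.smooth
  have sm : ∀ {u : L → R23}, ContMDiff (𝓡 1) 𝓘(ℝ, R23) ∞ u → ∀ c : ℝ,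
      ContMDiff (𝓡 2) 𝓘(ℝ, R23) ∞ fun x => c • u (p x) := fun hu c => by
    have hc : ContMDiff (𝓡 2) 𝓘(ℝ, ℝ) ∞ fun _ : X => c := contMDiff_const
    exact hc.smul (hu.comp hps)
  have dsm : ∀ {u : L → R23}, ContMDiff (𝓡 1) 𝓘(ℝ, R23) ∞ u → ∀ (c : ℝ) (x : X)
      (v : TangentSpace (𝓡 2) x), dVec (fun x => c • u (p x)) x v
        = c • dVec (fun z => u (p z)) x v := fun hu c x v => by
    have h1 := (((hu.comp hps) x).mdifferentiableAt (by simp : (∞ : WithTop ℕ∞) ≠ 0)).hasMFDerivAt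
    exact congrArg (fun L : EuclideanSpace ℝ (Fin 2) →L[ℝ] R23 => L v) (h1.const_smul c).mfderiv
  have hne : ∀ x, ∃ v, pullback p ζ x v ≠ 0 := fun x => by
    obtain ⟨n, l, hn⟩ := hG x
    obtain ⟨v, hv⟩ := hn.exists_ne
    refine ⟨v, fun h0 => hv ?_⟩
    rw [gaussForm, (hp.pullback_eq_zero_iff hζ x v).1 h0]
    simp [negDet]
  have hnd : ∀ x, negDet (f x) (ε • N1 (p x)) ≠ 0 := fun x h0 => by
    obtain ⟨v, hv⟩ := hne x
    obtain ⟨n, l, hn⟩ := hG x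
    apply hv
    have h1 : gaussForm o f x v = 0 := by
      rw [gaussForm, hN1', negDet_smul_right]
      rw [negDet_smul_right] at h0
      linear_combination ε * pullback p ζ x v * h0
        - pullback p ζ x v * negDet (f x) (N1 (p x)) * hε2
    rw [hp.pullback_eq_zero_iff hζ, hn.dgauss, h1, zero_smul]
  have hcont : Continuous fun x => negDet (f x) (ε • N1 (p x)) := by
    have h1 := fun i => (continuous_apply i).comp hf.smooth.continuous
    have h2 := fun i => (continuous_apply i).comp (sm hN1 ε).continuous
    exact (((h1 0).add (h1 4)).mul (h2 1)).sub ((h1 1).mul ((h2 0).add (h2 4)))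
  -- `f ∧ ε N₁` vanishes nowhere, so it is future-directed everywhere or nowhere
  have hd : (∀ x, 0 < negDet (f x) (ε • N1 (p x))) ∨ ∀ x, negDet (f x) (ε • N1 (p x)) < 0 :=
    forall_or_forall_of_eventually (fun x hx => hcont.continuousAt.eventually_const_lt hx)
      (fun x hx => hcont.continuousAt.eventually_lt_const hx) (fun x => (hnd x).lt_or_gt.symm)
      fun x hx hx' => lt_asymm hx hx'
  have e1 : ∀ x v, dVec (conformalGaussMap o f) x v
      = (ε * pullback p ζ x v) • ε • N1 (p x) := fun x v => by
    rw [hN1', smul_smul, show ε * pullback p ζ x v * ε = pullback p ζ x v by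
      linear_combination pullback p ζ x v * hε2]
  rcases hd with hd | hd
  · refine ⟨fun x => ε • N1 (p x), fun x => ε • N2 (p x), fun x => ε • N3 (p x), Or.inl
      ⟨sm hN1 ε, sm hN2 ε, sm hN3 ε, e1, fun x v => ?_, fun x v => ?_, hne, hd⟩⟩
    · rw [dsm hN1, hN2', smul_comm]
    · rw [dsm hN2, hN3', smul_comm]
  · refine ⟨fun x => (-ε) • N1 (p x), fun x => ε • N2 (p x), fun x => (-ε) • N3 (p x), Or.inr
      ⟨sm hN1 _, sm hN2 _, sm hN3 _, fun x v => ?_, fun x v => ?_, fun x v => ?_, fun x => ?_,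
        fun x => ?_⟩⟩
    · rw [e1, neg_smul, smul_neg, mul_neg, neg_smul, neg_neg]
    · rw [dsm hN1, hN2', neg_smul, neg_smul, smul_comm]
    · rw [dsm hN2, hN3', smul_comm]
      simp only [neg_smul, smul_neg, neg_neg]
    · exact (hne x).imp fun v hv => neg_ne_zero.2 hv
    · have := hd x
      rw [negDet_smul_right] at this ⊢
      linarith

/-- Exactly one of `p^*ζ` and `-p^*ζ` has a Gauss jet, which carries the frame. -/
theorem existsUnique_isAdaptedFrame [ConnectedSpace X] (hf : IsTimelikeImmersion f)
    (ho : IsCanonicalOrientation o f) (hG : ∀ x, ∃ n l, IsGaussDirection o f x n l)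
    (hε : ε = 1 ∨ ε = -1) (hs : ∀ x n l, IsGaussDirection o f x n l → 0 < ε * l)
    (hp : IsLeafProjection (conformalGaussMap o f) p) (hζ : IsNowhereZeroForm ζ) :
    ∃! F : X → Mat5, IsAdaptedFrame o f ε Set.univ F ∧
      ((∀ x v, pullback p ζ x v = phi F 1 0 x v + phi F 2 0 x v) ∨
        ∀ x v, pullback p ζ x v = -(phi F 1 0 x v + phi F 2 0 x v)) := by
  obtain ⟨x₀⟩ := (inferInstance : Nonempty X)
  obtain ⟨W, A, B, h | h⟩ := exists_isGaussJet hf ho.1 hG hε hp hζ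
  · obtain ⟨F, hF, hθ⟩ := h.exists_isAdaptedFrame hf ho hG hε hs
    refine ⟨F, ⟨hF, Or.inl hθ⟩, ?_⟩
    rintro F' ⟨hF', h' | h'⟩
    · exact h.adaptedFrame_unique hf ho.1 hG hε hs hF hθ hF' h'
    · have := h.sign_eq (s := -1) hf ho.1 hε hF' (fun x v => by rw [h']; ring) x₀
      norm_num at this
  · obtain ⟨F, hF, hθ⟩ := h.exists_isAdaptedFrame hf ho hG hε hs
    refine ⟨F, ⟨hF, Or.inr fun x v => by rw [← hθ, neg_neg]⟩, ?_⟩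
    rintro F' ⟨hF', h' | h'⟩
    · have := h.sign_eq (s := -1) hf ho.1 hε hF' (fun x v => by rw [h']; ring) x₀
      norm_num at this
    · exact h.adaptedFrame_unique hf ho.1 hG hε hs hF hθ hF' fun x v => by rw [h', neg_neg]

/-- The Gauss jet of the form `φ¹₀ + φ²₀` of an adapted frame field. -/
theorem IsAdaptedFrame.exists_isGaussJet [ConnectedSpace X] (hf : IsTimelikeImmersion f)
    (ho : IsOrientation o) (hG : ∀ x, ∃ n l, IsGaussDirection o f x n l)
    (hε : ε = 1 ∨ ε = -1) (hs : ∀ x n l, IsGaussDirection o f x n l → 0 < ε * l)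
    (hp : IsLeafProjection (conformalGaussMap o f) p) (hζ : IsNowhereZeroForm ζ)
    (hF : IsAdaptedFrame o f ε Set.univ F)
    (hθ : ∀ x v, pullback p ζ x v = phi F 1 0 x v + phi F 2 0 x v) :
    ∃ A B, IsGaussJet o f ε (pullback p ζ) (fun z => column (F z) 1 - column (F z) 2) A B := by
  obtain ⟨x₀⟩ := (inferInstance : Nonempty X)
  obtain ⟨W, A, B, h | h⟩ := Einstein.exists_isGaussJet hf ho hG hε hp hζ
  · have hW : (fun z => column (F z) 1 - column (F z) 2) = W :=
      funext fun z => (h.column_eq hf ho hG hε hs hF hθ z).2.1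
    exact ⟨A, B, hW ▸ h⟩
  · have := h.sign_eq (s := -1) hf ho hε hF (fun x v => by rw [← hθ]; ring) x₀
    norm_num at this

end Surface

/-! ### Infinitesimal deformations -/

section Local

variable {n : ℕ} {Ω : Set (EuclideanSpace ℝ (Fin n))} {y : EuclideanSpace ℝ (Fin n)}

theorem contDiffOn_mulVec {D : EuclideanSpace ℝ (Fin n) → Mat5}
    {w : EuclideanSpace ℝ (Fin n) → R23}
    (hD : ∀ a b, ContDiffOn ℝ ∞ (fun z => D z a b) Ω) (hw : ContDiffOn ℝ ∞ w Ω) :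
    ContDiffOn ℝ ∞ (fun z => (D z).mulVec (w z)) Ω :=
  contDiffOn_pi.2 fun a =>
    (ContDiffOn.sum fun b _ => (hD a b).mul (contDiffOn_pi.1 hw b) :
      ContDiffOn ℝ ∞ (fun z => ∑ b, D z a b * w z b) Ω)

theorem pd_mulVec {D : EuclideanSpace ℝ (Fin n) → Mat5} {w : EuclideanSpace ℝ (Fin n) → R23}
    (hD : ∀ a b, DifferentiableAt ℝ (fun z => D z a b) y) (hw : DifferentiableAt ℝ w y)
    (i : Fin n) : pd i (fun z => (D z).mulVec (w z)) y
      = (Matrix.of fun a b => pd i (fun z => D z a b) y).mulVec (w y)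
        + (D y).mulVec (pd i w y) := by
  have hwb : ∀ b, DifferentiableAt ℝ (fun z => w z b) y := differentiableAt_pi.1 hw
  have hd : DifferentiableAt ℝ (fun z => (D z).mulVec (w z)) y :=
    differentiableAt_pi.2 fun a =>
      (DifferentiableAt.fun_sum fun b _ => (hD a b).fun_mul (hwb b) :
        DifferentiableAt ℝ (fun z => ∑ b, D z a b * w z b) y)
  funext a
  rw [← pd_pi hd]
  have e : pd i (fun z => (D z).mulVec (w z) a) y
      = ∑ b, (pd i (fun z => D z a b) y * w y b + D y a b * pd i w y b) := by
    have h1 := HasFDerivAt.fun_sum (u := Finset.univ) (A := fun b z => D z a b * w z b)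
      fun b _ => ((hD a b).hasFDerivAt.mul (hwb b).hasFDerivAt)
    have h2 : (fun z => (D z).mulVec (w z) a) = fun z => ∑ b, D z a b * w z b := rfl
    rw [pd, h2, h1.fderiv]
    simp only [sum_apply, add_apply, smul_apply, smul_eq_mul]
    refine Finset.sum_congr rfl fun b _ => ?_
    rw [← pd_pi hw]
    simp only [pd]
    ring
  rw [e, Finset.sum_add_distrib]
  rfl

/-- Closedness of a matrix-valued 1-form, applied to a vector field. -/
theorem closed_mulVec {D : Fin n → EuclideanSpace ℝ (Fin n) → Mat5}
    {w : EuclideanSpace ℝ (Fin n) → R23}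
    (hD : ∀ j a b, DifferentiableAt ℝ (fun z => D j z a b) y) (hw : DifferentiableAt ℝ w y)
    {i j : Fin n} (h : ∀ a b, pd i (fun z => D j z a b) y = pd j (fun z => D i z a b) y) :
    pd i (fun z => (D j z).mulVec (w z)) y - (D j y).mulVec (pd i w y)
      = pd j (fun z => (D i z).mulVec (w z)) y - (D i y).mulVec (pd j w y) := by
  rw [pd_mulVec (hD j) hw, pd_mulVec (hD i) hw]
  simp only [h, add_sub_cancel_right]

end Local

section Converse

variable {Ω : Set (EuclideanSpace ℝ (Fin 2))} {F : EuclideanSpace ℝ (Fin 2) → Mat5}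
  {A : EuclideanSpace ℝ (Fin 2) → R23} {k : EuclideanSpace ℝ (Fin 2) → ℝ}
  {θ η : Fin 2 → EuclideanSpace ℝ (Fin 2) → ℝ} {ε : ℝ}
  {D : Fin 2 → EuclideanSpace ℝ (Fin 2) → Mat5}

/-- The structure equations of an adapted frame field `F` in a chart: `θ` and `η` are the components
of `φ¹₀ + φ²₀` and `(φ¹₀ - φ²₀) / 2`, and `A` is the derivative of `F₁ - F₂` with respect to `θ`. -/
structure IsAdaptedChart (ε : ℝ) (Ω : Set (EuclideanSpace ℝ (Fin 2)))
    (F : EuclideanSpace ℝ (Fin 2) → Mat5) (A : EuclideanSpace ℝ (Fin 2) → R23)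
    (k : EuclideanSpace ℝ (Fin 2) → ℝ) (θ η : Fin 2 → EuclideanSpace ℝ (Fin 2) → ℝ) : Prop where
  isOpen : IsOpen Ω
  gram : ∀ y ∈ Ω, ∀ i j, sp (column (F y) i) (column (F y) j) = Einstein.gram i j
  smooth : ∀ j, ContDiffOn ℝ ∞ (fun z => column (F z) j) Ω
  ne_zero : ε ≠ 0
  normalized : ∀ y ∈ Ω, sp (A y) (column (F y) 0) = 1
  pd_three : ∀ y ∈ Ω, ∀ i, pd i (fun z => column (F z) 3) y
    = (ε * θ i y) • (column (F y) 1 - column (F y) 2)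
  pd_sub : ∀ y ∈ Ω, ∀ i, pd i (fun z => column (F z) 1 - column (F z) 2) y = θ i y • A y
  pd_zero : ∀ y ∈ Ω, ∀ i, pd i (fun z => column (F z) 0) y = (θ i y * k y) • column (F y) 0
    + η i y • (column (F y) 1 - column (F y) 2) + (θ i y / 2) • (column (F y) 1 + column (F y) 2)

/-- A 1-form whose wedge products with two independent 1-forms vanish is zero. -/
theorem wedge_eq_zero {n₀ n₁ θ₀ θ₁ η₀ η₁ : ℝ} (hd : θ₀ * η₁ - θ₁ * η₀ ≠ 0)
    (h1 : n₀ * θ₁ = n₁ * θ₀) (h2 : n₀ * η₁ = n₁ * η₀) : n₀ = 0 ∧ n₁ = 0 :=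
  ⟨(mul_eq_zero.1 (by linear_combination θ₀ * h2 - η₀ * h1 :
      n₀ * (θ₀ * η₁ - θ₁ * η₀) = 0)).resolve_right hd,
    (mul_eq_zero.1 (by linear_combination θ₁ * h2 - η₁ * h1 :
      n₁ * (θ₀ * η₁ - θ₁ * η₀) = 0)).resolve_right hd⟩

/-- The algebraic consequences of closedness for a 1-form `δ` with values in the polars of the
isotropy algebras: evaluating `dδ = 0` on the vectors `F₀`, `F₃` and `F₁ - F₂` of an adapted frame
shows that `δ` is a multiple of `θ F₀ ∧ (F₁ - F₂)`. -/
theorem IsAdaptedChart.exists_eq_smul_wedgeMat (h : IsAdaptedChart ε Ω F A k θ η)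
    (hind : ∀ y ∈ Ω, θ 0 y * η 1 y - θ 1 y * η 0 y ≠ 0)
    (hDs : ∀ j a b, ContDiffOn ℝ ∞ (fun z => D j z a b) Ω)
    (hDc : ∀ y ∈ Ω, ∀ i j a b, pd i (fun z => D j z a b) y = pd j (fun z => D i z a b) y)
    (hD : ∀ y ∈ Ω, ∀ j, ∃ Y, sp (column (F y) 0) Y = 0 ∧ D j y = wedgeMat (column (F y) 0) Y)
    {y : EuclideanSpace ℝ (Fin 2)} (hy : y ∈ Ω) :
    ∃ l : ℝ, ∀ j, D j y
      = (l * θ j y) • wedgeMat (column (F y) 0) (column (F y) 1 - column (F y) 2) := by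
  -- `W` and `Z` are the null vectors `F₁ - F₂` and `F₁ + F₂`, with `dF₃ = ε θ W`
  choose! Y hY0 hYD using hD
  have hΩ := h.isOpen
  have hF := h.gram
  have hFs := h.smooth
  have hA := h.normalized
  let W := fun z => column (F z) 1 - column (F z) 2
  let Z := fun z => column (F z) 1 + column (F z) 2
  have hN : ∀ y ∈ Ω, ∀ i, pd i (fun z => column (F z) 3) y = (ε * θ i y) • W y := h.pd_three
  have hW : ∀ y ∈ Ω, ∀ i, pd i W y = θ i y • A y := h.pd_sub
  have h0 : ∀ y ∈ Ω, ∀ i, pd i (fun z => column (F z) 0) y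
      = (θ i y * k y) • column (F y) 0 + η i y • W y + (θ i y / 2) • Z y := h.pd_zero
  have sW : ContDiffOn ℝ ∞ W Ω := (hFs 1).sub (hFs 2)
  have sZ : ContDiffOn ℝ ∞ Z Ω := (hFs 1).add (hFs 2)
  have df : ∀ {E : Type} [NormedAddCommGroup E] [NormedSpace ℝ E]
      {u : EuclideanSpace ℝ (Fin 2) → E}, ContDiffOn ℝ ∞ u Ω → ∀ z ∈ Ω, DifferentiableAt ℝ u z :=
    fun hu z hz => (hu.contDiffAt (hΩ.mem_nhds hz)).differentiableAt (by simp)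
  have near : ∀ {P : EuclideanSpace ℝ (Fin 2) → Prop}, (∀ z ∈ Ω, P z) → ∀ z ∈ Ω,
      ∀ᶠ z in nhds z, P z := fun hP z hz => by
    filter_upwards [hΩ.mem_nhds hz] with z hz using hP z hz
  have ne0 : ∀ z ∈ Ω, column (F z) 0 ≠ 0 := fun z hz h => by
    have := hA z hz
    rw [h, sp_zero_right] at this
    exact zero_ne_one this
  have g00 : ∀ z ∈ Ω, sp (column (F z) 0) (column (F z) 0) = 0 := fun z hz => by simp [hF z hz, Einstein.gram]
  have g30 : ∀ z ∈ Ω, sp (column (F z) 3) (column (F z) 0) = 0 := fun z hz => by simp [hF z hz, Einstein.gram]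
  have gW0 : ∀ z ∈ Ω, sp (W z) (column (F z) 0) = 0 := fun z hz => by simp [W, hF z hz, Einstein.gram]
  have gZ0 : ∀ z ∈ Ω, sp (Z z) (column (F z) 0) = 0 := fun z hz => by simp [Z, hF z hz, Einstein.gram]
  have gZZ : ∀ z ∈ Ω, sp (Z z) (Z z) = 0 := fun z hz => by simp [Z, hF z hz, Einstein.gram]
  have gZW : ∀ z ∈ Ω, sp (Z z) (W z) = -2 := fun z hz => by
    simp [Z, W, hF z hz, Einstein.gram]
    norm_num
  -- the value of the form on vectors
  have hDv : ∀ z ∈ Ω, ∀ j X, (D j z).mulVec X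
      = sp X (Y z j) • column (F z) 0 - sp X (column (F z) 0) • Y z j := fun z hz j X => by
    rw [hYD z hz, wedgeMat_mulVec]
  have hDperp : ∀ z ∈ Ω, ∀ j X, sp X (column (F z) 0) = 0 →
      (D j z).mulVec X = sp X (Y z j) • column (F z) 0 := fun z hz j X hX => by
    rw [hDv z hz, hX, zero_smul, sub_zero]
  have clo : ∀ {w : EuclideanSpace ℝ (Fin 2) → R23}, ContDiffOn ℝ ∞ w Ω → ∀ z ∈ Ω,
      pd 0 (fun z => (D 1 z).mulVec (w z)) z - (D 1 z).mulVec (pd 0 w z)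
        = pd 1 (fun z => (D 0 z).mulVec (w z)) z - (D 0 z).mulVec (pd 1 w z) :=
    fun hw z hz => closed_mulVec (D := D) (fun j a b => df (hDs j a b) z hz) (df hw z hz)
      (hDc z hz 0 1)
  have pdzero : ∀ {u : EuclideanSpace ℝ (Fin 2) → R23}, (∀ z ∈ Ω, u z = 0) → ∀ z ∈ Ω, ∀ i,
      pd i u z = 0 := fun {u} hu z hz i => by
    rw [pd_congr (w := fun _ => 0) (near hu z hz), pd]
    simp
  -- evaluation on `F₀`
  have E0 : ∀ z ∈ Ω, η 0 z * sp (W z) (Y z 1) + θ 0 z / 2 * sp (Z z) (Y z 1)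
      = η 1 z * sp (W z) (Y z 0) + θ 1 z / 2 * sp (Z z) (Y z 0) := fun z hz => by
    have hv : ∀ j, ∀ z ∈ Ω, (D j z).mulVec (column (F z) 0) = 0 := fun j z hz => by
      rw [hDperp z hz j _ (g00 z hz), hY0 z hz, zero_smul]
    have h1 := clo (hFs 0) z hz
    have hp : ∀ i, sp (pd i (fun z => column (F z) 0) z) (column (F z) 0) = 0 := fun i => by
      rw [h0 z hz, sp_add_left, sp_add_left, sp_smul_left, sp_smul_left, sp_smul_left, g00 z hz,
        gW0 z hz, gZ0 z hz]
      ring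
    rw [pdzero (hv 1) z hz, pdzero (hv 0) z hz, hDperp z hz _ _ (hp 0), hDperp z hz _ _ (hp 1),
      zero_sub, zero_sub, neg_inj] at h1
    have h2 := smul_left_injective ℝ (ne0 z hz) h1
    simp only [h0 z hz, sp_add_left, sp_smul_left, hY0 z hz] at h2
    linarith
  -- pairing `∂ᵢ(δⱼ w)` with `W` and `Z` when `w` is orthogonal to `F₀`
  have pairW : ∀ {w : EuclideanSpace ℝ (Fin 2) → R23}, ContDiffOn ℝ ∞ w Ω →
      (∀ z ∈ Ω, sp (w z) (column (F z) 0) = 0) → ∀ z ∈ Ω, ∀ i j,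
      sp (pd i (fun z => (D j z).mulVec (w z)) z) (W z) = -(sp (w z) (Y z j) * θ i z) :=
    fun {w} hw hw0 z hz i j => by
      rw [sp_pd_eq_neg (c := 0) (df (contDiffOn_mulVec (hDs j) hw) z hz) (df sW z hz)
        (near (fun z hz => by rw [hDperp z hz _ _ (hw0 z hz), sp_smul_left,
          sp_comm (column (F z) 0), gW0 z hz,
          mul_zero]) z hz), hDperp z hz _ _ (hw0 z hz), hW z hz, sp_smul_left, sp_smul_right,
        sp_comm (column (F z) 0), hA z hz]
      ring
  have pairZ : ∀ {w : EuclideanSpace ℝ (Fin 2) → R23}, ContDiffOn ℝ ∞ w Ω →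
      (∀ z ∈ Ω, sp (w z) (column (F z) 0) = 0) → ∀ z ∈ Ω, ∀ i j,
      sp (pd i (fun z => (D j z).mulVec (w z)) z) (Z z) = -2 * (sp (w z) (Y z j) * η i z) :=
    fun {w} hw hw0 z hz i j => by
      have h1 := sp_pd_eq_neg (c := 0) (df (hFs 0) z hz) (df sZ z hz)
        (near (fun z hz => by rw [sp_comm, gZ0 z hz]) z hz) i
      rw [h0 z hz, sp_comm _ (Z z), sp_add_right, sp_add_right, sp_smul_right, sp_smul_right,
        sp_smul_right, gZ0 z hz, gZZ z hz, gZW z hz] at h1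
      rw [sp_pd_eq_neg (c := 0) (df (contDiffOn_mulVec (hDs j) hw) z hz) (df sZ z hz)
        (near (fun z hz => by rw [hDperp z hz _ _ (hw0 z hz), sp_smul_left,
          sp_comm (column (F z) 0), gZ0 z hz,
          mul_zero]) z hz), hDperp z hz _ _ (hw0 z hz), sp_smul_left]
      linear_combination -sp (w z) (Y z j) * h1
  -- evaluation on `F₃`
  have E3 : ∀ z ∈ Ω, (∀ j, sp (column (F z) 3) (Y z j) = 0) := fun z hz => by
    have h1 := clo (hFs 3) z hz
    have hp : ∀ i, sp (pd i (fun z => column (F z) 3) z) (column (F z) 0) = 0 := fun i => by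
      rw [hN z hz, sp_smul_left, gW0 z hz, mul_zero]
    rw [hDperp z hz _ _ (hp 0), hDperp z hz _ _ (hp 1)] at h1
    have h2 := congrArg (fun u => sp u (W z)) h1
    have h3 := congrArg (fun u => sp u (Z z)) h1
    simp only [sp_sub_left, sp_smul_left, sp_comm (column (F z) 0), gW0 z hz, gZ0 z hz, mul_zero,
      sub_zero, pairW (hFs 3) g30 z hz, pairZ (hFs 3) g30 z hz] at h2 h3
    obtain ⟨n0, n1⟩ := wedge_eq_zero (n₀ := sp (column (F z) 3) (Y z 0))
      (n₁ := sp (column (F z) 3) (Y z 1)) (hind z hz) (by linarith) (by linarith)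
    intro j
    fin_cases j
    exacts [n0, n1]
  have E3' : ∀ z ∈ Ω, sp (W z) (Y z 0) * θ 1 z = sp (W z) (Y z 1) * θ 0 z := fun z hz => by
    have hv : ∀ j, ∀ z ∈ Ω, (D j z).mulVec (column (F z) 3) = 0 := fun j z hz => by
      rw [hDperp z hz j _ (g30 z hz), E3 z hz, zero_smul]
    have h1 := clo (hFs 3) z hz
    have hp : ∀ i, sp (pd i (fun z => column (F z) 3) z) (column (F z) 0) = 0 := fun i => by
      rw [hN z hz, sp_smul_left, gW0 z hz, mul_zero]
    rw [pdzero (hv 1) z hz, pdzero (hv 0) z hz, hDperp z hz _ _ (hp 0), hDperp z hz _ _ (hp 1),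
      zero_sub, zero_sub, neg_inj] at h1
    have h2 := smul_left_injective ℝ (ne0 z hz) h1
    simp only [hN z hz, sp_smul_left] at h2
    refine mul_left_cancel₀ h.ne_zero ?_
    linear_combination -h2
  -- evaluation on `F₁ - F₂`
  have EW : 2 * (η 0 y * sp (W y) (Y y 1) - η 1 y * sp (W y) (Y y 0))
      = θ 0 y * sp (Z y) (Y y 1) - θ 1 y * sp (Z y) (Y y 0) := by
    have h1 := congrArg (fun u => sp u (Z y)) (clo sW y hy)
    simp only [sp_sub_left, pairZ sW gW0 y hy, hDv y hy, hW y hy, sp_smul_left,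
      sp_comm (column (F y) 0), gZ0 y hy, hA y hy, sp_comm (Y y _) (Z y)] at h1
    linarith
  have hE0 := E0 y hy
  obtain ⟨w0, w1⟩ := wedge_eq_zero (n₀ := sp (W y) (Y y 0)) (n₁ := sp (W y) (Y y 1)) (hind y hy)
    (E3' y hy) (by linarith)
  have hz : sp (Z y) (Y y 0) * θ 1 y = sp (Z y) (Y y 1) * θ 0 y := by
    rw [w0, w1] at EW
    linarith
  have hwj : ∀ j, sp (W y) (Y y j) = 0 := by
    intro j
    fin_cases j
    exacts [w0, w1]
  obtain ⟨l, hl⟩ : ∃ l : ℝ, ∀ j, sp (Z y) (Y y j) = l * θ j y := by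
    by_cases hθ : θ 0 y = 0
    · have hθ1 : θ 1 y ≠ 0 := fun h => hind y hy (by rw [hθ, h]; ring)
      refine ⟨sp (Z y) (Y y 1) / θ 1 y, fun j => ?_⟩
      fin_cases j
      · refine mul_right_cancel₀ hθ1 (hz.trans ?_)
        change _ = sp (Z y) (Y y 1) / θ 1 y * θ 0 y * θ 1 y
        rw [hθ]
        ring
      · exact (div_mul_cancel₀ _ hθ1).symm
    · refine ⟨sp (Z y) (Y y 0) / θ 0 y, fun j => ?_⟩
      fin_cases j
      · exact (div_mul_cancel₀ _ hθ).symm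
      · refine mul_right_cancel₀ hθ (hz.symm.trans ?_)
        change _ = sp (Z y) (Y y 0) / θ 0 y * θ 1 y * θ 0 y
        field_simp
  refine ⟨-(l / 2), fun j => ?_⟩
  have h1 : sp (column (F y) 1) (Y y j) - sp (column (F y) 2) (Y y j) = 0 := by
    rw [← sp_sub_left]
    exact hwj j
  have h2 : sp (column (F y) 1) (Y y j) + sp (column (F y) 2) (Y y j) = l * θ j y := by
    rw [← sp_add_left]
    exact hl j
  -- hence `Yⱼ` is a multiple `-(l / 2) θⱼ` of `W` modulo `F₀`, which `wedgeMat` does not see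
  have hYexp : Y y j = -sp (column (F y) 4) (Y y j) • column (F y) 0
      + (-(l / 2) * θ j y) • (column (F y) 1 - column (F y) 2) := by
    rw [frame_expand (hF y hy) (Y y j), E3 y hy, hY0 y hy,
      show sp (column (F y) 1) (Y y j) = l / 2 * θ j y by linarith,
      show sp (column (F y) 2) (Y y j) = l / 2 * θ j y by linarith]
    simp [hF y hy, Einstein.gram]
    module
  rw [hYD y hy]
  ext a b
  have hk := fun k => congrFun hYexp k
  simp only [Pi.add_apply, Pi.smul_apply, smul_eq_mul] at hk
  rw [Matrix.smul_apply, smul_eq_mul, wedgeMat_apply, wedgeMat_apply]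
  fin_cases b <;> simp [hk] <;> ring

end Converse

/-! ### The exterior derivative of the deformations -/

section Local

variable {Ω : Set (EuclideanSpace ℝ (Fin 2))} {F : EuclideanSpace ℝ (Fin 2) → Mat5}
  {A : EuclideanSpace ℝ (Fin 2) → R23} {k : EuclideanSpace ℝ (Fin 2) → ℝ}
  {θ η : Fin 2 → EuclideanSpace ℝ (Fin 2) → ℝ} {ε : ℝ} {y : EuclideanSpace ℝ (Fin 2)}

namespace IsAdaptedChart

theorem differentiableAt (h : IsAdaptedChart ε Ω F A k θ η) {E : Type*} [NormedAddCommGroup E]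
    [NormedSpace ℝ E] {u : EuclideanSpace ℝ (Fin 2) → E} (hu : ContDiffOn ℝ ∞ u Ω) (hy : y ∈ Ω) :
    DifferentiableAt ℝ u y :=
  (hu.contDiffAt (h.isOpen.mem_nhds hy)).differentiableAt (by simp)

theorem sub_ne_zero (h : IsAdaptedChart ε Ω F A k θ η) (hy : y ∈ Ω) :
    column (F y) 1 - column (F y) 2 ≠ 0 := fun h0 => by
  have h1 : sp (column (F y) 1 - column (F y) 2) (column (F y) 1) = -1 := by
    simp [h.gram y hy, Einstein.gram]
  rw [h0, sp_zero_left] at h1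
  norm_num at h1

theorem θ_eq (h : IsAdaptedChart ε Ω F A k θ η) (hy : y ∈ Ω) (i : Fin 2) :
    θ i y = sp (pd i (fun z => column (F z) 1 - column (F z) 2) y) (column (F y) 0) := by
  rw [h.pd_sub y hy, sp_smul_left, h.normalized y hy, mul_one]

theorem smooth_sub (h : IsAdaptedChart ε Ω F A k θ η) :
    ContDiffOn ℝ ∞ (fun z => column (F z) 1 - column (F z) 2) Ω := (h.smooth 1).sub (h.smooth 2)

theorem smooth_θ (h : IsAdaptedChart ε Ω F A k θ η) (i : Fin 2) : ContDiffOn ℝ ∞ (θ i) Ω :=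
  (contDiffOn_sp (contDiffOn_pd h.isOpen h.smooth_sub i) (h.smooth 0)).congr
    fun _ hy => h.θ_eq hy i

/-- The form `θ` is closed, because `d𝒩 = ε θ (F₁ - F₂)` and `d(F₁ - F₂)` is a multiple of `θ`. -/
theorem pd_θ_comm (h : IsAdaptedChart ε Ω F A k θ η) (hy : y ∈ Ω) (i j : Fin 2) :
    pd i (θ j) y = pd j (θ i) y := by
  have key : ∀ i j, pd i (pd j fun z => column (F z) 3) y
      = (ε * pd i (θ j) y) • (column (F y) 1 - column (F y) 2) + (ε * θ j y * θ i y) • A y := by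
    intro i j
    have e1 : pd i (pd j fun z => column (F z) 3) y
        = pd i (fun z => (ε * θ j z) • (column (F z) 1 - column (F z) 2)) y := by
      refine pd_congr ?_ i
      filter_upwards [h.isOpen.mem_nhds hy] with z hz using h.pd_three z hz j
    have e2 : pd i (fun z => ε * θ j z) y = ε * pd i (θ j) y := by
      rw [pd, fderiv_const_mul (h.differentiableAt (h.smooth_θ j) hy)]
      rfl
    rw [e1, pd_smul ((h.differentiableAt (h.smooth_θ j) hy).const_mul ε)
      (h.differentiableAt h.smooth_sub hy), e2, h.pd_sub y hy, smul_smul]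
  have h1 := pd_comm h.isOpen (h.smooth 3) hy i j
  rw [key, key, mul_right_comm ε (θ i y)] at h1
  exact mul_left_cancel₀ h.ne_zero (smul_left_injective ℝ (h.sub_ne_zero hy) (add_right_cancel h1))

/-- The derivative of `F₀ ∧ (F₁ - F₂)` is a multiple of `θ`. -/
theorem exists_pd_wedgeMat (h : IsAdaptedChart ε Ω F A k θ η) (hy : y ∈ Ω) (w : R23) :
    ∃ K : R23, ∀ i, pd i (fun z => (wedgeMat (column (F z) 0)
      (column (F z) 1 - column (F z) 2)).mulVec w) y = θ i y • K := by
  set W := column (F y) 1 - column (F y) 2 with hW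
  set Z := column (F y) 1 + column (F y) 2 with hZ
  refine ⟨sp w W • (k y • column (F y) 0 + (1 / 2 : ℝ) • Z) + sp w (A y) • column (F y) 0
    - sp w (k y • column (F y) 0 + (1 / 2 : ℝ) • Z) • W - sp w (column (F y) 0) • A y,
    fun i => ?_⟩
  have d0 := h.differentiableAt (h.smooth 0) hy
  have dW := h.differentiableAt h.smooth_sub hy
  have dc : ∀ {u : EuclideanSpace ℝ (Fin 2) → R23}, DifferentiableAt ℝ u y →
      DifferentiableAt ℝ (fun z => sp w (u z)) y ∧
        pd i (fun z => sp w (u z)) y = sp w (pd i u y) := fun {u} hu => by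
    have e1 := pd_sp (differentiableAt_const (𝕜 := ℝ) (x := y) w) hu i
    have e2 : pd i (fun _ : EuclideanSpace ℝ (Fin 2) => w) y = 0 := by simp [pd]
    rw [e2, sp_zero_left, zero_add] at e1
    exact ⟨((spL w).differentiableAt.comp y hu :), e1⟩
  have e1 : (fun z => (wedgeMat (column (F z) 0) (column (F z) 1 - column (F z) 2)).mulVec w)
      = fun z => sp w (column (F z) 1 - column (F z) 2) • column (F z) 0
        - sp w (column (F z) 0) • (column (F z) 1 - column (F z) 2) :=
    funext fun z => wedgeMat_mulVec _ _ _
  have e2 : pd i (fun z => sp w (column (F z) 1 - column (F z) 2) • column (F z) 0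
        - sp w (column (F z) 0) • (column (F z) 1 - column (F z) 2)) y
      = pd i (fun z => sp w (column (F z) 1 - column (F z) 2) • column (F z) 0) y
        - pd i (fun z => sp w (column (F z) 0) • (column (F z) 1 - column (F z) 2)) y := by
    rw [pd, fderiv_fun_sub ((dc dW).1.fun_smul d0) ((dc d0).1.fun_smul dW)]
    rfl
  rw [e1, e2, pd_smul (dc dW).1 d0, pd_smul (dc d0).1 dW, (dc dW).2, (dc d0).2, h.pd_sub y hy,
    h.pd_zero y hy, ← hW, ← hZ]
  funext c
  simp only [Pi.add_apply, Pi.sub_apply, Pi.smul_apply, smul_eq_mul, sp_add_right, sp_smul_right]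
  ring

theorem smooth_wedgeMat (h : IsAdaptedChart ε Ω F A k θ η) (w : R23) :
    ContDiffOn ℝ ∞ (fun z => (wedgeMat (column (F z) 0)
      (column (F z) 1 - column (F z) 2)).mulVec w) Ω := by
  have e1 : ContDiffOn ℝ ∞ (fun z => sp w (column (F z) 1 - column (F z) 2) • column (F z) 0
      - sp w (column (F z) 0) • (column (F z) 1 - column (F z) 2)) Ω :=
    ((contDiffOn_sp contDiffOn_const h.smooth_sub).smul (h.smooth 0)).sub
      ((contDiffOn_sp contDiffOn_const (h.smooth 0)).smul h.smooth_sub)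
  simpa only [wedgeMat_mulVec] using e1

/-- The exterior derivative of `g θ F₀ ∧ (F₁ - F₂)` is `dg ∧ θ F₀ ∧ (F₁ - F₂)`. -/
theorem pd_smul_wedgeMat (h : IsAdaptedChart ε Ω F A k θ η) {g : EuclideanSpace ℝ (Fin 2) → ℝ}
    (hy : y ∈ Ω) (hg : DifferentiableAt ℝ g y) (w : R23) (i j : Fin 2) :
    pd i (fun z => ((g z * θ j z) • wedgeMat (column (F z) 0)
        (column (F z) 1 - column (F z) 2)).mulVec w) y
      - pd j (fun z => ((g z * θ i z) • wedgeMat (column (F z) 0)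
        (column (F z) 1 - column (F z) 2)).mulVec w) y
      = (pd i g y * θ j y - pd j g y * θ i y) • (wedgeMat (column (F y) 0)
        (column (F y) 1 - column (F y) 2)).mulVec w := by
  obtain ⟨K, hK⟩ := h.exists_pd_wedgeMat hy w
  have dm := h.differentiableAt (h.smooth_wedgeMat w) hy
  have e2 : ∀ i j, pd i (fun z => ((g z * θ j z) • wedgeMat (column (F z) 0)
        (column (F z) 1 - column (F z) 2)).mulVec w) y
      = (pd i g y * θ j y + g y * pd i (θ j) y) • (wedgeMat (column (F y) 0)
        (column (F y) 1 - column (F y) 2)).mulVec w + (g y * θ j y * θ i y) • K := by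
    intro i j
    have dθ := h.differentiableAt (h.smooth_θ j) hy
    have e3 : pd i (fun z => g z * θ j z) y = pd i g y * θ j y + g y * pd i (θ j) y := by
      rw [pd, fderiv_fun_mul hg dθ]
      simp only [add_apply, smul_apply, smul_eq_mul, pd]
      ring
    simp only [Matrix.smul_mulVec]
    rw [pd_smul (hg.fun_mul dθ) dm, e3, hK, smul_smul]
  rw [e2, e2, h.pd_θ_comm hy j i]
  funext c
  simp only [Pi.add_apply, Pi.sub_apply, Pi.smul_apply, smul_eq_mul]
  ring

end IsAdaptedChart

end Local

section Surface

variable {X : Type*} [TopologicalSpace X] [ChartedSpace (EuclideanSpace ℝ (Fin 2)) X]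
  {f : X → R23} {o : TangentOrientation X} {ε : ℝ} {θ : ∀ x : X, TangentSpace (𝓡 2) x → ℝ}
  {A B : X → R23} {F : X → Mat5}

/-- An adapted frame field satisfies the structure equations in every chart. -/
theorem IsAdaptedFrame.isAdaptedChart (hf : IsTimelikeImmersion f) (ho : IsOrientation o)
    (hε : ε = 1 ∨ ε = -1) (hF : IsAdaptedFrame o f ε Set.univ F)
    (hθ : ∀ x v, θ x v = phi F 1 0 x v + phi F 2 0 x v)
    (h : IsGaussJet o f ε θ (fun z => column (F z) 1 - column (F z) 2) A B)
    {e : OpenPartialHomeomorph X (EuclideanSpace ℝ (Fin 2))}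
    (he : e ∈ IsManifold.maximalAtlas (𝓡 2) ∞ X) :
    IsAdaptedChart ε e.target (fun z => F (e.symm z)) (fun z => A (e.symm z))
      (fun z => sp (A (e.symm z)) (column (F (e.symm z)) 1 + column (F (e.symm z)) 2))
      (fun i z => θ (e.symm z) (coordVec e z i))
      (fun i z => (phi F 1 0 (e.symm z) (coordVec e z i)
        - phi F 2 0 (e.symm z) (coordVec e z i)) / 2) := by
  have hm := hF.isMovingFrame
  have hε0 : ε ≠ 0 := by rcases hε with rfl | rfl <;> norm_num
  have eN : conformalGaussMap o f = fun z => column (F z) 3 :=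
    funext fun z => hF.conformalGaussMap_eq hf ho (Set.mem_univ z)
  have dsub : ∀ x, MDifferentiableAt (𝓡 2) 𝓘(ℝ, R23)
      (fun z => column (F z) 1 - column (F z) 2) x := fun x =>
    (h.smooth_W x).mdifferentiableAt (by simp)
  refine ⟨e.open_target, fun y _ => hm.gram _, fun j => contDiffOn_comp_symm_target (hm.smooth j) he,
    hε0, fun y _ => ?_, fun y hy i => ?_, fun y hy i => ?_, fun y hy i => ?_⟩
  · obtain ⟨v, hv⟩ := h.exists_ne (e.symm y)
    have e1 := hm.phi_one_add_phi_two' 0 (e.symm y) v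
    rw [← hθ, h.dW, sp_smul_left] at e1
    exact mul_left_cancel₀ hv (by linarith)
  · rw [← dVec_coordVec he hy (hm.mdifferentiableAt 3 _), ← eN, h.dN]
  · rw [← dVec_coordVec he hy (dsub _), h.dW]
  · rw [← dVec_coordVec he hy (hm.mdifferentiableAt 0 _)]
    set x := e.symm y
    set v := coordVec e y i
    have p0 := hm.phi_eq 0 0 x v
    have p1 := hm.phi_eq 1 0 x v
    have p2 := hm.phi_eq 2 0 x v
    have p3 := hm.phi_eq 3 0 x v
    have e8 : sp (column (F x) 0) (dVec (fun z => column (F z) 0) x v) = 0 := by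
      have := hm.skew 0 0 x v
      rw [sp_comm] at this
      linarith
    have e1 := hm.two_mul_phi x v
    rw [h.dW, sp_smul_left] at e1
    have e2 := hF.phi00 x trivial v
    rw [hF.phi30 x trivial] at p3
    simp only [Matrix.cons_val] at p0 p1 p2 p3
    rw [hθ] at e1 ⊢
    rw [frame_expand (hm.gram x) (dVec (fun z => column (F z) 0) x v), ← p3, ← p2, ← p0, e8,
      show sp (column (F x) 1) (dVec (fun z => column (F z) 0) x v) = -phi F 1 0 x v by linarith,
      show phi F 0 0 x v = (phi F 1 0 x v + phi F 2 0 x v)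
        * sp (A x) (column (F x) 1 + column (F x) 2) by linarith]
    module

theorem IsAdaptedFrame.mul_M14subM24_mul_inv (hF : IsAdaptedFrame o f ε Set.univ F) (x : X)
    (r : ℝ) : F x * (r • M14subM24) * (F x)⁻¹
      = r • wedgeMat (column (F x) 0) (column (F x) 1 - column (F x) 2) := by
  rw [Matrix.mul_smul, Matrix.smul_mul, isometry_mul_M14subM24_mul_inv
    ((gram_eq_transpose_mul_iff _).2 (hF.isMovingFrame.gram x))]

theorem mulVec_single_apply (M : Mat5) (a b : Fin 5) : M.mulVec (Pi.single b 1) a = M a b := by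
  simp

theorem wedgeMat_smul_left (c : ℝ) (U Y : R23) : wedgeMat (c • U) Y = wedgeMat U (c • Y) := by
  ext i j
  rw [wedgeMat_apply, wedgeMat_apply]
  fin_cases j <;> simp <;> ring

theorem smul_wedgeMat (c : ℝ) (U Y : R23) : c • wedgeMat U Y = wedgeMat U (c • Y) := by
  ext i j
  rw [Matrix.smul_apply, wedgeMat_apply, wedgeMat_apply]
  fin_cases j <;> simp <;> ring

theorem IsMovingFrame.wedgeMat_ne_zero (hF : IsMovingFrame F) (x : X) :
    wedgeMat (column (F x) 0) (column (F x) 1 - column (F x) 2) ≠ 0 := fun h0 => by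
  have h1 := congrArg (fun M : Mat5 => sp (M.mulVec (column (F x) 4)) (column (F x) 1)) h0
  simp [wedgeMat_mulVec, hF.gram, Einstein.gram] at h1

variable {L : Type*} [TopologicalSpace L]
  [ChartedSpace (EuclideanSpace ℝ (Fin 1)) L] {p : X → L} {ζ : OneForm 1 L}

/-- The 1-form `(ℓ ∘ p) p^*ζ F₀ ∧ (F₁ - F₂)`. -/
noncomputable def deformation (F : X → Mat5) (p : X → L) (ζ : OneForm 1 L) (l : L → ℝ) :
    MatForm 2 X := fun x =>
  (l (p x) • (ζ (p x) ∘ₗ (mfderiv (𝓡 2) (𝓡 1) p x).toLinearMap)).smulRight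
    (wedgeMat (column (F x) 0) (column (F x) 1 - column (F x) 2))

theorem deformation_apply (l : L → ℝ) (x : X) (v : TangentSpace (𝓡 2) x) :
    deformation F p ζ l x v = (l (p x) * pullback p ζ x v)
      • wedgeMat (column (F x) 0) (column (F x) 1 - column (F x) 2) := rfl

/-- The form is closed because `dℓ` is a multiple of `p^*ζ`. -/
theorem isInfinitesimalDeformation_deformation [IsManifold (𝓡 1) ∞ L]
    (hf : IsTimelikeImmersion f) (ho : IsOrientation o)
    (hε : ε = 1 ∨ ε = -1) (hF : IsAdaptedFrame o f ε Set.univ F)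
    (hp : IsLeafProjection (conformalGaussMap o f) p) (hζ : IsNowhereZeroForm ζ)
    (hθ : ∀ x v, pullback p ζ x v = phi F 1 0 x v + phi F 2 0 x v)
    (h : IsGaussJet o f ε (pullback p ζ) (fun z => column (F z) 1 - column (F z) 2) A B)
    {l : L → ℝ} (hl : ContMDiff (𝓡 1) 𝓘(ℝ, ℝ) ∞ l) (hl0 : l ≠ 0) :
    IsInfinitesimalDeformation f (deformation F p ζ l) := by
  have hlp := hl.comp hp.smooth
  refine ⟨fun e he i a b => ?_, fun h0 => ?_, fun x v => ?_, fun e he y hy i j a b => ?_⟩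
  · have hc := hF.isAdaptedChart hf ho hε hθ h he
    have e1 := contDiffOn_pi.1 (((contDiffOn_comp_symm_target hlp he).mul (hc.smooth_θ i)).smul
      (hc.smooth_wedgeMat (Pi.single b 1))) a
    refine e1.congr fun y _ => ?_
    rw [← mulVec_single_apply (deformation F p ζ l (e.symm y) (coordVec e y i)), deformation_apply,
      Matrix.smul_mulVec]
    rfl
  · obtain ⟨q, hq⟩ := Function.ne_iff.1 hl0
    obtain ⟨x, rfl⟩ := hp.surjective q
    obtain ⟨v, hv⟩ := h.exists_ne x
    have e1 := deformation_apply (F := F) (p := p) (ζ := ζ) l x v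
    rw [h0] at e1
    exact smul_ne_zero (mul_ne_zero hq hv) (hF.isMovingFrame.wedgeMat_ne_zero x) e1.symm
  · obtain ⟨c, hc, h0⟩ := hF.lift x trivial
    rw [deformation_apply, h0, wedgeMat_smul_left, smul_wedgeMat]
    apply wedgeMat_mem_isotropyPolar
    have e1 : sp (column (F x) 0) (column (F x) 1 - column (F x) 2) = 0 := by
      simp [hF.isMovingFrame.gram, gram]
    rw [h0, sp_smul_left] at e1
    simp only [sp_smul_right, e1, mul_zero]
  · have hc := hF.isAdaptedChart hf ho hε hθ h he
    obtain ⟨l', -, hl'⟩ := hζ.exists_deriv hl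
    have hg : ∀ i, pd i (fun z => l (p (e.symm z))) y
        = pullback p ζ (e.symm y) (coordVec e y i) * l' (p (e.symm y)) := fun i => by
      have e1 := mfderiv_coordVec (u := fun x => l (p x)) he hy
        ((hlp (e.symm y)).mdifferentiableAt (by simp)) i
      rw [← e1]
      exact (hp.mfderiv_comp hl _ _).trans (hl' _ _)
    have sg := hc.differentiableAt (contDiffOn_comp_symm_target hlp he) hy
    have e2 := hc.pd_smul_wedgeMat hy sg (Pi.single b 1) i j
    have e3 : ∀ j : Fin 2, DifferentiableAt ℝ (fun z => ((l (p (e.symm z))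
        * pullback p ζ (e.symm z) (coordVec e z j)) • wedgeMat (column (F (e.symm z)) 0)
        (column (F (e.symm z)) 1 - column (F (e.symm z)) 2)).mulVec (Pi.single b 1)) y := fun j => by
      simp only [Matrix.smul_mulVec]
      exact (sg.fun_mul (hc.differentiableAt (hc.smooth_θ j) hy)).fun_smul
        (hc.differentiableAt (hc.smooth_wedgeMat _) hy)
    have e4 := congrFun e2 a
    have e5 : pd i (l ∘ p ∘ e.symm) y * pullback p ζ (e.symm y) (coordVec e y j)
        - pd j (l ∘ p ∘ e.symm) y * pullback p ζ (e.symm y) (coordVec e y i) = 0 := by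
      have h1 := hg i
      have h2 := hg j
      change pd i (l ∘ p ∘ e.symm) y = _ at h1
      change pd j (l ∘ p ∘ e.symm) y = _ at h2
      rw [h1, h2]
      ring
    have e6 : pd i (fun z => ((l (p (e.symm z))
        * pullback p ζ (e.symm z) (coordVec e z j)) • wedgeMat (column (F (e.symm z)) 0)
        (column (F (e.symm z)) 1 - column (F (e.symm z)) 2)).mulVec (Pi.single b 1)) y a
      - pd j (fun z => ((l (p (e.symm z))
        * pullback p ζ (e.symm z) (coordVec e z i)) • wedgeMat (column (F (e.symm z)) 0)
        (column (F (e.symm z)) 1 - column (F (e.symm z)) 2)).mulVec (Pi.single b 1)) y a = 0 := by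
      refine e4.trans ?_
      rw [Pi.smul_apply, smul_eq_mul]
      exact mul_eq_zero_of_left e5 _
    rw [← pd_pi (e3 j), ← pd_pi (e3 i)] at e6
    simp only [mulVec_single_apply] at e6
    exact sub_eq_zero.1 e6

/-- Every infinitesimal deformation is a multiple of `θ F₀ ∧ (F₁ - F₂)`, and the factor is constant
along the leaves. -/
theorem IsInfinitesimalDeformation.exists_eq {δ : MatForm 2 X} (hδ : IsInfinitesimalDeformation f δ)
    (hf : IsTimelikeImmersion f) (ho : IsOrientation o)
    (hε : ε = 1 ∨ ε = -1) (hF : IsAdaptedFrame o f ε Set.univ F)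
    (hp : IsLeafProjection (conformalGaussMap o f) p) (hζ : IsNowhereZeroForm ζ)
    (hθ : ∀ x v, pullback p ζ x v = phi F 1 0 x v + phi F 2 0 x v)
    (h : IsGaussJet o f ε (pullback p ζ) (fun z => column (F z) 1 - column (F z) 2) A B) :
    ∃ l : L → ℝ, ContMDiff (𝓡 1) 𝓘(ℝ, ℝ) ∞ l ∧ ∀ x v, δ x v = (l (p x) * pullback p ζ x v)
      • wedgeMat (column (F x) 0) (column (F x) 1 - column (F x) 2) := by
  have hm := hF.isMovingFrame
  -- the pointwise factor `r`, from the closedness of `δ` in a chart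
  have hpt : ∀ x, ∃ r : ℝ, ∀ v, δ x v = (r * pullback p ζ x v)
      • wedgeMat (column (F x) 0) (column (F x) 1 - column (F x) 2) := by
    intro x
    obtain ⟨e, he, hx, hpos⟩ := ho x
    obtain ⟨y, hy, rfl⟩ := exists_symm_eq hx
    have hc := hF.isAdaptedChart hf ho hε hθ h he
    -- `θ ∧ η = -φ¹₀ ∧ φ²₀` vanishes nowhere
    have hind : ∀ z ∈ e.target, pullback p ζ (e.symm z) (coordVec e z 0)
          * ((phi F 1 0 (e.symm z) (coordVec e z 1) - phi F 2 0 (e.symm z) (coordVec e z 1)) / 2)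
        - pullback p ζ (e.symm z) (coordVec e z 1)
          * ((phi F 1 0 (e.symm z) (coordVec e z 0) - phi F 2 0 (e.symm z) (coordVec e z 0)) / 2)
        ≠ 0 := fun z hz => by
      have h1 := hF.positive (e.symm z) trivial _ _ (hpos z hz)
      rw [hθ, hθ]
      refine ne_of_lt ?_
      linarith
    have hpol : ∀ z ∈ e.target, ∀ j, ∃ Y, sp (column (F (e.symm z)) 0) Y = 0 ∧
        δ (e.symm z) (coordVec e z j) = wedgeMat (column (F (e.symm z)) 0) Y := fun z hz j => by
      obtain ⟨c, hc, h0⟩ := hF.lift (e.symm z) trivial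
      obtain ⟨Y, hY, hY'⟩ := exists_eq_wedgeMat_of_mem_isotropyPolar
        (ne_zero_of_mem_einstein (hf.mem (e.symm z))) (hδ.polar (e.symm z) (coordVec e z j))
        (sp_self_of_mem_einstein (hf.mem (e.symm z)))
      refine ⟨c⁻¹ • Y, ?_, ?_⟩
      · rw [h0, sp_smul_left, sp_smul_right, hY, mul_zero, mul_zero]
      · rw [hY', h0, wedgeMat_smul_left, smul_smul, mul_inv_cancel₀ hc.ne', one_smul]
    obtain ⟨r, hr⟩ := hc.exists_eq_smul_wedgeMat
      (D := fun j z => δ (e.symm z) (coordVec e z j)) hind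
      (fun j a b => hδ.smooth e he j a b) (fun z hz i j a b => hδ.closed e he z hz i j a b) hpol hy
    refine ⟨r, fun v => ?_⟩
    obtain ⟨a, b, rfl⟩ := exists_eq_coordVec he hy v
    have e1 : pullback p ζ (e.symm y) (a • coordVec e y 0 + b • coordVec e y 1)
        = a * pullback p ζ (e.symm y) (coordVec e y 0)
          + b * pullback p ζ (e.symm y) (coordVec e y 1) := by
      simp only [pullback, map_add, map_smul, smul_eq_mul]
    rw [map_add, map_smul, map_smul, hr, hr, e1]
    module
  choose r hr using hpt
  have hval : ∀ x v, sp ((δ x v).mulVec (column (F x) 4)) (column (F x) 1)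
      = -(r x * pullback p ζ x v) := fun x v => by
    rw [hr, Matrix.smul_mulVec, wedgeMat_mulVec]
    simp [hm.gram, gram]
  -- `r` is a quotient of smooth functions, by evaluation on a coordinate vector where `p^*ζ ≠ 0`
  have hrs : ContMDiff (𝓡 2) 𝓘(ℝ, ℝ) ∞ r := by
    apply contMDiff_of_chart
    intro x
    obtain ⟨e, he, hx, hpos⟩ := ho x
    refine ⟨e, he, hx, ?_⟩
    obtain ⟨y, hy, rfl⟩ := exists_symm_eq hx
    rw [e.right_inv hy]
    have hc := hF.isAdaptedChart hf ho hε hθ h he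
    obtain ⟨j, hj⟩ : ∃ j, pullback p ζ (e.symm y) (coordVec e y j) ≠ 0 := by
      by_contra! hcon
      obtain ⟨v, hv⟩ := h.exists_ne (e.symm y)
      obtain ⟨a, b, rfl⟩ := exists_eq_coordVec he hy v
      apply hv
      have h0 := hcon 0
      have h1 := hcon 1
      simp only [pullback] at h0 h1
      simp only [pullback, map_add, map_smul, h0, h1, smul_zero, add_zero]
    have sθ := (hc.smooth_θ j).contDiffAt (e.open_target.mem_nhds hy)
    have sv := (contDiffOn_sp (contDiffOn_mulVec (fun a b => hδ.smooth e he j a b) (hc.smooth 4))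
      (hc.smooth 1)).contDiffAt (e.open_target.mem_nhds hy)
    refine (sv.neg.div sθ hj).congr_of_eventuallyEq ?_
    filter_upwards [sθ.continuousAt.eventually_ne hj] with z hz
    change _ = -sp ((δ (e.symm z) (coordVec e z j)).mulVec _) _ / _
    rw [hval, neg_neg]
    exact (mul_div_cancel_right₀ _ hz).symm
  -- closedness of `δ` now says `dr ∧ p^*ζ = 0`
  have hvert : ∀ x v, dVec (conformalGaussMap o f) x v = 0 → mfderiv (𝓡 2) 𝓘(ℝ, ℝ) r x v = 0 := by
    intro x v hv
    obtain ⟨e, he, hx, hpos⟩ := ho x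
    obtain ⟨y, hy, rfl⟩ := exists_symm_eq hx
    have hc := hF.isAdaptedChart hf ho hε hθ h he
    have sr := (hrs (e.symm y)).mdifferentiableAt (by simp : (∞ : WithTop ℕ∞) ≠ 0)
    have sg := hc.differentiableAt (contDiffOn_comp_symm_target hrs he) hy
    have key : pd 0 (fun z => r (e.symm z)) y * pullback p ζ (e.symm y) (coordVec e y 1)
        - pd 1 (fun z => r (e.symm z)) y * pullback p ζ (e.symm y) (coordVec e y 0) = 0 := by
      have e1 := hc.pd_smul_wedgeMat hy sg (column (F (e.symm y)) 4) 0 1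
      have e2 := closed_mulVec (D := fun j z => δ (e.symm z) (coordVec e z j))
        (w := fun _ => column (F (e.symm y)) 4) (y := y)
        (fun j a b => hc.differentiableAt (hδ.smooth e he j a b) hy)
        (differentiableAt_const _) (i := 0) (j := 1) (hδ.closed e he y hy 0 1)
      have e3 : ∀ i : Fin 2, pd i (fun _ : EuclideanSpace ℝ (Fin 2) => column (F (e.symm y)) 4) y
          = 0 := fun i => by simp [pd]
      rw [e3, e3, Matrix.mulVec_zero, Matrix.mulVec_zero, sub_zero, sub_zero] at e2
      simp only [hr] at e2
      rw [e2, sub_self] at e1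
      have e4 := congrArg (fun u => sp u (column (F (e.symm y)) 1)) e1
      simp [wedgeMat_mulVec, hm.gram, gram] at e4
      linarith
    have h0 := (hp.pullback_eq_zero_iff hζ _ v).2 hv
    obtain ⟨a, b, rfl⟩ := exists_eq_coordVec he hy v
    have e1 : pullback p ζ (e.symm y) (a • coordVec e y 0 + b • coordVec e y 1)
        = a * pullback p ζ (e.symm y) (coordVec e y 0)
          + b * pullback p ζ (e.symm y) (coordVec e y 1) := by
      simp only [pullback, map_add, map_smul, smul_eq_mul]
    rw [e1] at h0
    have e2 : mfderiv (𝓡 2) 𝓘(ℝ, ℝ) r (e.symm y) (a • coordVec e y 0 + b • coordVec e y 1)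
        = a * pd 0 (fun z => r (e.symm z)) y + b * pd 1 (fun z => r (e.symm z)) y := by
      rw [map_add, map_smul, map_smul]
      exact congrArg₂ (fun s t : ℝ => a * s + b * t) (mfderiv_coordVec he hy sr 0)
        (mfderiv_coordVec he hy sr 1)
    rw [e2]
    obtain ⟨w, hw⟩ := h.exists_ne (e.symm y)
    obtain ⟨c, d, rfl⟩ := exists_eq_coordVec he hy w
    have e3 : pullback p ζ (e.symm y) (c • coordVec e y 0 + d • coordVec e y 1)
        = c * pullback p ζ (e.symm y) (coordVec e y 0)
          + d * pullback p ζ (e.symm y) (coordVec e y 1) := by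
      simp only [pullback, map_add, map_smul, smul_eq_mul]
    rw [e3] at hw
    refine (mul_eq_zero.1 ?_).resolve_right hw
    linear_combination (c * pd 0 (fun z => r (e.symm z)) y + d * pd 1 (fun z => r (e.symm z)) y) * h0
      + (a * d - b * c) * key
  obtain ⟨l, hl, hlr⟩ := hp.factor r hrs hvert
  exact ⟨l, hl, fun x v => by rw [hr, hlr]⟩

end Surface

/-! ### The correspondence with functions on the leaf space -/

section Surface

variable {X : Type*} [TopologicalSpace X] [ChartedSpace (EuclideanSpace ℝ (Fin 2)) X]
  [ConnectedSpace X] {f : X → R23} {o : TangentOrientation X} {ε : ℝ} {F : X → Mat5}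
  {L : Type*} [TopologicalSpace L] [ChartedSpace (EuclideanSpace ℝ (Fin 1)) L]
  [IsManifold (𝓡 1) ∞ L] {p : X → L} {ζ : OneForm 1 L}

/-- The infinitesimal deformations correspond to the nonzero smooth functions on the leaf space. -/
theorem IsAdaptedFrame.deformations (hf : IsTimelikeImmersion f) (ho : IsOrientation o)
    (hG : ∀ x, ∃ n l, IsGaussDirection o f x n l) (hε : ε = 1 ∨ ε = -1)
    (hs : ∀ x n l, IsGaussDirection o f x n l → 0 < ε * l)
    (hp : IsLeafProjection (conformalGaussMap o f) p) (hζ : IsNowhereZeroForm ζ)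
    (hF : IsAdaptedFrame o f ε Set.univ F)
    (hθ : ∀ x v, pullback p ζ x v = phi F 1 0 x v + phi F 2 0 x v) :
    (∀ l : L → ℝ, ContMDiff (𝓡 1) 𝓘(ℝ, ℝ) ∞ l → l ≠ 0 →
      ∃ δ : MatForm 2 X, IsInfinitesimalDeformation f δ ∧ ∀ x v, δ x v
        = F x * ((l (p x) * pullback p ζ x v) • M14subM24) * (F x)⁻¹) ∧
    ∀ δ : MatForm 2 X, IsInfinitesimalDeformation f δ →
      ∃! l : L → ℝ, ContMDiff (𝓡 1) 𝓘(ℝ, ℝ) ∞ l ∧ l ≠ 0 ∧ ∀ x v, δ x v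
        = F x * ((l (p x) * pullback p ζ x v) • M14subM24) * (F x)⁻¹ := by
  obtain ⟨A, B, h⟩ := hF.exists_isGaussJet hf ho hG hε hs hp hζ hθ
  have hM := hF.mul_M14subM24_mul_inv
  refine ⟨fun l hl hl0 => ⟨deformation F p ζ l,
    isInfinitesimalDeformation_deformation hf ho hε hF hp hζ hθ h hl hl0, fun x v => ?_⟩,
    fun δ hδ => ?_⟩
  · rw [hM, deformation_apply]
  · obtain ⟨l, hl, hδl⟩ := hδ.exists_eq hf ho hε hF hp hζ hθ h
    refine ⟨l, ⟨hl, ?_, fun x v => by rw [hM, hδl]⟩, ?_⟩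
    · rintro rfl
      refine hδ.ne_zero ?_
      funext x
      refine LinearMap.ext fun v => ?_
      rw [hδl, Pi.zero_apply, zero_mul, zero_smul]
      rfl
    · rintro l' ⟨-, -, hl'⟩
      funext q
      obtain ⟨x, rfl⟩ := hp.surjective q
      obtain ⟨v, hv⟩ := h.exists_ne x
      have e1 := (hl' x v).symm.trans (hδl x v)
      rw [hM] at e1
      exact mul_right_cancel₀ hv
        (smul_left_injective ℝ (hF.isMovingFrame.wedgeMat_ne_zero x) e1)

/-- The constant function `1` on the leaf space gives an infinitesimal deformation. -/
theorem isIsothermic_of_isLeafProjection (hf : IsTimelikeImmersion f)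
    (ho : IsCanonicalOrientation o f) (hG : ∀ x, ∃ n l, IsGaussDirection o f x n l)
    (hε : ε = 1 ∨ ε = -1) (hs : ∀ x n l, IsGaussDirection o f x n l → 0 < ε * l)
    (hp : IsLeafProjection (conformalGaussMap o f) p) (hζ : IsNowhereZeroForm ζ) :
    IsIsothermic f := by
  obtain ⟨x₀⟩ := (inferInstance : Nonempty X)
  have key : ∀ ζ : OneForm 1 L, IsNowhereZeroForm ζ → ∀ F, IsAdaptedFrame o f ε Set.univ F →
      (∀ x v, pullback p ζ x v = phi F 1 0 x v + phi F 2 0 x v) → IsIsothermic f :=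
    fun ζ hζ F hF hθ => by
      obtain ⟨δ, hδ, -⟩ := (hF.deformations hf ho.1 hG hε hs hp hζ hθ).1 (fun _ => 1)
        contMDiff_const fun h0 => one_ne_zero (congrFun h0 (p x₀))
      exact ⟨δ, hδ⟩
  obtain ⟨F, ⟨hF, hθ | hθ⟩, -⟩ := existsUnique_isAdaptedFrame hf ho hG hε hs hp hζ
  · exact key ζ hζ F hF hθ
  · exact key (-ζ) hζ.neg F hF fun x v => by
      rw [← neg_eq_iff_eq_neg.2 (hθ x v)]
      rfl

end Surface

end Einstein

theorem theoremA {X : Type*} [TopologicalSpace X] [T2Space X] [SecondCountableTopology X]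
    [ConnectedSpace X] [ChartedSpace (EuclideanSpace ℝ (Fin 2)) X] [IsManifold (𝓡 2) ∞ X]
    (o : TangentOrientation X) (ho : IsOrientation o)
    (f : X → R23) (hf : IsTimelikeImmersion f) (hq : IsQuasiUmbilical o f) :
    -- the conformal Gauss map is harmonic
    IsHarmonicMap f (conformalGaussMap o f) ∧
    (IsRegularImmersion o f →
      -- a regular quasi-umbilical immersion is isothermic
      IsIsothermic f ∧
      -- the leaf space is a smooth curve, and its projection is a submersion
      ∃ (_ : ChartedSpace (EuclideanSpace ℝ (Fin 1)) (LeafSpace o f))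
        (_ : IsManifold (𝓡 1) ∞ (LeafSpace o f)),
        IsSmoothSubmersion (leafProj o f) ∧
        (∃ ζ : OneForm 1 (LeafSpace o f), IsNowhereZeroForm ζ) ∧
        -- the canonical orientation and the helicity
        ∃ (c : TangentOrientation X) (ε : ℝ), IsCanonicalOrientation c f ∧ IsHelicity c f ε ∧
          ∀ ζ : OneForm 1 (LeafSpace o f), IsNowhereZeroForm ζ →
            -- the adapted frame field determined by `ζ` up to sign
            (∃! F : X → Mat5, IsAdaptedFrame c f ε Set.univ F ∧
              ((∀ x v, pullback (leafProj o f) ζ x v = phi F 1 0 x v + phi F 2 0 x v) ∨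
                ∀ x v, pullback (leafProj o f) ζ x v = -(phi F 1 0 x v + phi F 2 0 x v))) ∧
            ∀ F : X → Mat5, IsAdaptedFrame c f ε Set.univ F →
              (∀ x v, pullback (leafProj o f) ζ x v = phi F 1 0 x v + phi F 2 0 x v) →
              -- the infinitesimal deformations correspond bijectively to the nonzero smooth
              -- functions on the leaf space
              (∀ ℓ : LeafSpace o f → ℝ, ContMDiff (𝓡 1) 𝓘(ℝ, ℝ) ∞ ℓ → ℓ ≠ 0 →
                ∃ δ : MatForm 2 X, IsInfinitesimalDeformation f δ ∧
                  ∀ x v, δ x v = F x *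
                    ((ℓ (leafProj o f x) * pullback (leafProj o f) ζ x v) • M14subM24) *
                      (F x)⁻¹) ∧
              ∀ δ : MatForm 2 X, IsInfinitesimalDeformation f δ →
                ∃! ℓ : LeafSpace o f → ℝ, ContMDiff (𝓡 1) 𝓘(ℝ, ℝ) ∞ ℓ ∧ ℓ ≠ 0 ∧
                  ∀ x v, δ x v = F x *
                    ((ℓ (leafProj o f x) * pullback (leafProj o f) ζ x v) • M14subM24) *
                      (F x)⁻¹) := by
  refine ⟨isHarmonicMap_conformalGaussMap hf ho hq, fun _ => ?_⟩
  obtain ⟨c, ε, hc, hε, hqc, hN, hs⟩ := exists_canonicalOrientation hf ho hq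
  have hG := exists_isGaussDirection hf hc.1 hqc
  have hS : sameLeaf (conformalGaussMap c f) = leafSetoid o f := by
    rcases hN with h | h
    · rw [h]
      rfl
    · rw [h, sameLeaf_neg]
      rfl
  obtain ⟨hL, hL', hp⟩ :=
    exists_isLeafProjection (hasRankOne_conformalGaussMap hf hc.1 hG) hS
  change IsLeafProjection (conformalGaussMap c f) (leafProj o f) at hp
  obtain ⟨ζ₀, hζ₀⟩ := exists_isNowhereZeroForm hf hc.1 hG hp
  exact ⟨isIsothermic_of_isLeafProjection hf hc hG hε.1 hs hp hζ₀, hL, hL', hp.toIsSmoothSubmersion,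
    ⟨ζ₀, hζ₀⟩, c, ε, hc, hε, fun ζ hζ => ⟨existsUnique_isAdaptedFrame hf hc hG hε.1 hs hp hζ,
      fun F hF hθ => hF.deformations hf hc.1 hG hε.1 hs hp hζ hθ⟩⟩
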